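/- Let $n,\ell\ge 1$ be integers. Let $\mathfrak o$ be a complete discrete valuation ring with maximal ideal $\mathfrak p$ and finite residue field $k$ of odd characteristic and cardinality $q>n$. Let $\mathbf G$ be either $\mathbf{GL}_n$, or the unitary group $\mathbf{GU}_n=\{x : x^\circ x=I\}$, where $\mathfrak O$ is the ring of integers of an unramified quadratic extension of the fraction field of $\mathfrak o$, $\nu$ is its non-trivial Galois automorphism and $(a_{ij})^\circ=(a_{ji}^\nu)$; thus $\mathbf{GL}_n(\mathfrak o)$ is the usual group and $\mathbf{GU}_n(\mathfrak o)\subset \mathrm{GL}_n(\mathfrak O)$. Put $\varepsilon=1$ for $\mathbf{GL}_n$ and $\varepsilon=-1$ for $\mathbf{GU}_n$. Let $\mathsf K^m$ be the kernel of $\mathbf G(\mathfrak o)\to \mathbf G(\mathfrak o/\mathfrak p^m)$. The level of a continuous irreducible complex representation of $\mathbf G(\mathfrak o)$ is the least integer $\ell\ge 0$ such that it is trivial on $\mathsf K^{\ell+1}$. Let $\mathfrak g$ be the Lie algebra of $\mathbf G$, so that $\mathfrak g(k)$ is $\mathrm M_n(k)$ for $\mathbf{GL}_n$, and $\{x: x+x^\circ=0\}\subset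 \mathrm M_n(k_2)$ for $\mathbf{GU}_n$, where $k_2$ is the residue field of $\mathfrak O$. Fix a uniformiser $\pi$ of $\mathfrak o$ and a non-trivial additive character $\psi$ of $k$; every character of $(\mathfrak g(k),+)$ is $\varphi_x(y)=\psi(\mathrm{Tr}(xy))$ for a unique $x\in\mathfrak g(k)$. A representation of level $\ell\ge 1$, and its character, is regular if every linear character of $\mathsf K^\ell$ occurring in it is the pullback of some $\varphi_x$ along $\mathsf K^\ell/\mathsf K^{\ell+1}\simeq\mathfrak g(k)$, $1+\pi^\ell y\mapsto y \bmod \pi$, where the characteristic polynomial of $x$ equals its minimal polynomial (this does not depend on the choice of $\pi$ and $\psi$). An $n$-type is an $n\times n$ matrix $\tau=(\tau_{d,e})_{1\le d,e\le n}$ of non-negative integers with $\sum_{d,e} d\,e\,\tau_{d,e}=n$. Put $$v_\varepsilon(x)=x^{n^2}\prod_{1\le d\le n}\left(1-\varepsilon^d x^{-d}\right),\qquad u^\tau_\varepsilon(x)=x^n\prod_{1\le d,e\le n}\left(1-\varepsilon^d x^{-d}\right)^{\tau_{d,e}}.$$ Then the set of degrees of the regular characters of $\mathbf G(\mathfrak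 o)$ of level $\ell$ is exactly $$\left\{\, q^{\binom n2(\ell-1)}\,\frac{v_\varepsilon(q)}{u^\tau_\varepsilon(q)} \;:\; \tau \text{ an } n\text{-type}\right\}.$$ In particular the degrees satisfy Ennola duality, as polynomials in $q$. Fix $n$ and $\ell$. Call $f\in\mathbb Z[x]$ a degree polynomial for $\mathbf{GL}_n$ (respectively $\mathbf{GU}_n$) if $f(q)$ is the degree of a regular character of level $\ell$ of $\mathbf{GL}_n(\mathfrak o)$ (respectively $\mathbf{GU}_n(\mathfrak o)$) for every $\mathfrak o$ as above (respectively every $\mathfrak o$ and $\mathfrak O$ as above), where $q>n$ is the cardinality of the residue field of $\mathfrak o$. Then, for each such $\mathfrak o$ (and $\mathfrak O$), every degree of a regular character of level $\ell$ is the value at $q$ of a degree polynomial; and for every $f\in\mathbb Z[x]$, $f(x)$ is a degree polynomial for $\mathbf{GL}_n$ if and only if $(-1)^{\deg f}f(-x)$ is a degree polynomial for $\mathbf{GU}_n$. -/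

import Mathlib

open Polynomial IsLocalRing

universe u v

namespace RegChar

noncomputable section

/-! ### The groups and their Lie algebras over the residue field -/

/-- The conjugate transpose `x°` of a square matrix, with `(i, j)` entry `σ (x j i)`. -/
def conjTr {A : Type*} [CommRing A] {n : ℕ} (σ : A →+* A) (x : Matrix (Fin n) (Fin n) A) :
    Matrix (Fin n) (Fin n) A :=
  (x.map σ).transpose

theorem conjTr_mul {A : Type*} [CommRing A] {n : ℕ} (σ : A →+* A)
    (x y : Matrix (Fin n) (Fin n) A) : conjTr σ (x * y) = conjTr σ y * conjTr σ x := by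
  simp [conjTr, Matrix.map_mul, Matrix.transpose_mul]

theorem conjTr_one {A : Type*} [CommRing A] {n : ℕ} (σ : A →+* A) :
    conjTr σ (1 : Matrix (Fin n) (Fin n) A) = 1 := by
  simp [conjTr]

/-- The group `{x ∈ GL_n(A) : x° x = 1}`. -/
def unitary {A : Type*} [CommRing A] (σ : A →+* A) (n : ℕ) : Subgroup (GL (Fin n) A) where
  carrier := {g | conjTr σ (g : Matrix (Fin n) (Fin n) A) * g = 1}
  one_mem' := by simp [conjTr_one]
  mul_mem' := by
    intro a b ha hb
    have ha' : conjTr σ (a : Matrix (Fin n) (Fin n) A) * a = 1 := ha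
    have hb' : conjTr σ (b : Matrix (Fin n) (Fin n) A) * b = 1 := hb
    change conjTr σ (a * b : Matrix (Fin n) (Fin n) A) * (a * b) = 1
    rw [conjTr_mul, Matrix.mul_assoc, ← Matrix.mul_assoc _ (a : Matrix (Fin n) (Fin n) A),
      ha', Matrix.one_mul, hb']
  inv_mem' := by
    intro a ha
    have h : conjTr σ (a : Matrix (Fin n) (Fin n) A) =
        ((a⁻¹ : GL (Fin n) A) : Matrix (Fin n) (Fin n) A) :=
      Units.eq_inv_of_mul_eq_one_right ha
    change conjTr σ ((a⁻¹ : GL (Fin n) A) : Matrix (Fin n) (Fin n) A) * _ = 1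
    rw [← h, ← conjTr_mul, h, Units.mul_inv, conjTr_one]

/-- The anti-hermitian matrices `{x ∈ M_n(A) : x + x° = 0}`. -/
def antiHermitian {A : Type*} [CommRing A] (σ : A →+* A) (n : ℕ) :
    Set (Matrix (Fin n) (Fin n) A) :=
  {x | x + conjTr σ x = 0}

/-- The automorphism of the residue field of `O` induced by an automorphism of `O`. -/
def residueAut {o O : Type*} [CommRing o] [CommRing O] [IsLocalRing O] [Algebra o O]
    (ν : O ≃ₐ[o] O) : ResidueField O →+* ResidueField O :=
  (ResidueField.mapEquiv ν.toRingEquiv : ResidueField O ≃+* ResidueField O)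

/-- `O` is the ring of integers of an unramified quadratic extension of the fraction field of the
complete discrete valuation ring `o` (to be used when `O` is a discrete valuation ring). -/
structure IsUnramifiedQuadratic (o O : Type*) [CommRing o] [IsLocalRing o] [CommRing O]
    [IsLocalRing O] [Algebra o O] : Prop where
  finite : Module.Finite o O
  finrank_eq : Module.finrank o O = 2
  unramified : (maximalIdeal o).map (algebraMap o O) = maximalIdeal O

/-! ### Regular representations

In this section `R` is `o` or `O`, the group `𝐆(o)` is a group `G` with an embedding `ι` into
`GL_n(R)`, and `L` is the Lie algebra `𝔤(k)`, contained in the matrices over the residue field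
of `R`. -/

/-- The principal congruence subgroup: the kernel of reduction modulo the `m`-th power of the
maximal ideal. -/
def congruenceSubgroup {R G : Type*} [CommRing R] [IsLocalRing R] [Group G] {n : ℕ}
    (ι : G →* GL (Fin n) R) (m : ℕ) : Subgroup G :=
  ((Matrix.GeneralLinearGroup.map (n := Fin n)
    (Ideal.Quotient.mk (maximalIdeal R ^ m))).comp ι).ker

/-- A matrix over a field is regular if its characteristic polynomial is its minimal polynomial. -/
def IsRegularMatrix {κ : Type*} [Field κ] {n : ℕ} (x : Matrix (Fin n) (Fin n) κ) : Prop :=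
  x.charpoly = minpoly κ x

/-- The linear character `θ` of the `ℓ`-th congruence subgroup is the pullback, along
`1 + π ^ ℓ y ↦ y mod π`, of a character `φ_x : y ↦ ψ (Tr (x y))` of `𝔤(k)` with `x ∈ 𝔤(k)` regular.
Here `π` is a uniformiser of `o` and `ψ` is an additive character of the residue field of `R` which
is non-trivial on the residue field of `o`; replacing `π` and `ψ` by other choices multiplies `x` by
a non-zero element of the residue field of `o`, so that regularity does not depend on them. -/
def IsRegularCharacter (o : Type*) {R G : Type*} [CommRing o] [CommRing R] [IsLocalRing R]
    [Algebra o R] [Group G] {n : ℕ} (ι : G →* GL (Fin n) R)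
    (L : Set (Matrix (Fin n) (Fin n) (ResidueField R))) (ℓ : ℕ)
    (θ : congruenceSubgroup ι ℓ →* ℂˣ) : Prop :=
  ∃ π : o, Irreducible π ∧
  ∃ ψ : AddChar (ResidueField R) ℂ, (∃ a : o, ψ (residue R (algebraMap o R a)) ≠ 1) ∧
  ∃ x ∈ L, IsRegularMatrix x ∧
    ∀ (g : congruenceSubgroup ι ℓ) (y : Matrix (Fin n) (Fin n) R),
      (ι (g : G) : Matrix (Fin n) (Fin n) R) = 1 + algebraMap o R π ^ ℓ • y →
        (θ g : ℂ) = ψ (Matrix.trace (x * y.map (residue R)))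

/-- The complex representation `ρ` is irreducible, has level `ℓ` (that is, `ℓ` is the least natural
number such that `ρ` is trivial on the `(ℓ + 1)`-st congruence subgroup) and is regular: all the
linear characters of the `ℓ`-th congruence subgroup that occur in `ρ` are regular.

Being trivial on an open subgroup, such a `ρ` is automatically continuous. -/
structure IsRegularOfLevel (o : Type*) {R G V : Type*} [CommRing o] [CommRing R] [IsLocalRing R]
    [Algebra o R] [Group G] {n : ℕ} (ι : G →* GL (Fin n) R)
    (L : Set (Matrix (Fin n) (Fin n) (ResidueField R))) (ℓ : ℕ)
    [AddCommGroup V] [Module ℂ V] (ρ : Representation ℂ G V) : Prop where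
  irreducible : ρ.IsIrreducible
  level : IsLeast {r : ℕ | ∀ g ∈ congruenceSubgroup ι (r + 1), ρ g = 1} ℓ
  regular : ∀ θ : congruenceSubgroup ι ℓ →* ℂˣ,
    (∃ w : V, w ≠ 0 ∧ ∀ g : congruenceSubgroup ι ℓ, ρ (g : G) w = (θ g : ℂ) • w) →
      IsRegularCharacter o ι L ℓ θ

/-- The degrees of the regular characters of level `ℓ` of `G`. -/
def regularDegrees (o : Type*) {R G : Type*} [CommRing o] [CommRing R] [IsLocalRing R]
    [Algebra o R] [Group G] {n : ℕ} (ι : G →* GL (Fin n) R)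
    (L : Set (Matrix (Fin n) (Fin n) (ResidueField R))) (ℓ : ℕ) : Set ℕ :=
  {d | ∃ ρ : Representation ℂ G (Fin d → ℂ), IsRegularOfLevel o ι L ℓ ρ}

/-- The degrees of the regular characters of level `ℓ` of `GL_n(o)`. -/
def degreesGL (o : Type*) [CommRing o] [IsLocalRing o] (n ℓ : ℕ) : Set ℕ :=
  regularDegrees o (MonoidHom.id (GL (Fin n) o)) Set.univ ℓ

/-- The degrees of the regular characters of level `ℓ` of `GU_n(o)`, the unitary group of the
extension `O` of `o`, where `ν` is the non-trivial automorphism of `O` over `o`. -/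
def degreesGU {o O : Type*} [CommRing o] [CommRing O] [IsLocalRing O] [Algebra o O]
    (ν : O ≃ₐ[o] O) (n ℓ : ℕ) : Set ℕ :=
  regularDegrees o (unitary (ν : O →+* O) n).subtype (antiHermitian (residueAut ν) n) ℓ

/-! ### Types and the degree formula -/

/-- `τ` is an `n`-type: `∑ d e τ_{d,e} = n`, the sum being over `d, e ∈ {1, …, n}`
(the index `i : Fin n` stands for `i + 1`). -/
def IsType {n : ℕ} (τ : Matrix (Fin n) (Fin n) ℕ) : Prop :=
  ∑ d : Fin n, ∑ e : Fin n, ((d : ℕ) + 1) * ((e : ℕ) + 1) * τ d e = n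

/-- `v_ε(x) = x^(n²) ∏_{1 ≤ d ≤ n} (1 - ε^d x^(-d))`. -/
def vEval (n : ℕ) (ε : ℤ) (x : ℚ) : ℚ :=
  x ^ (n ^ 2) * ∏ d : Fin n, (1 - (ε : ℚ) ^ ((d : ℕ) + 1) * (x ^ ((d : ℕ) + 1))⁻¹)

/-- `u_ε^τ(x) = x^n ∏_{1 ≤ d, e ≤ n} (1 - ε^d x^(-d))^{τ_{d,e}}`. -/
def uEval {n : ℕ} (ε : ℤ) (τ : Matrix (Fin n) (Fin n) ℕ) (x : ℚ) : ℚ :=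
  x ^ n * ∏ d : Fin n, ∏ e : Fin n,
    (1 - (ε : ℚ) ^ ((d : ℕ) + 1) * (x ^ ((d : ℕ) + 1))⁻¹) ^ τ d e

/-- The numbers `q^(C(n,2) (ℓ - 1)) v_ε(q) / u_ε^τ(q)`, for `n`-types `τ`. -/
def degreeFormula (n ℓ : ℕ) (ε : ℤ) (q : ℕ) : Set ℚ :=
  {r | ∃ τ : Matrix (Fin n) (Fin n) ℕ, IsType τ ∧
    r = (q : ℚ) ^ (n.choose 2 * (ℓ - 1)) * vEval n ε q / uEval ε τ q}

/-! ### Ennola duality -/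

/-- The polynomials `f ∈ ℤ[x]` such that `f(q)` is the degree of a regular character of level `ℓ`
of `GL_n(o)`, for every complete discrete valuation ring `o` whose residue field is finite of odd
characteristic and of cardinality `q > n`. -/
def degreePolynomialsGL (n ℓ : ℕ) : Set ℤ[X] :=
  {f | ∀ (o : Type u) [CommRing o] [IsDomain o] [IsDiscreteValuationRing o]
    [IsAdicComplete (maximalIdeal o) o] [Finite (ResidueField o)],
    ringChar (ResidueField o) ≠ 2 → n < Nat.card (ResidueField o) →
      ∃ d ∈ degreesGL o n ℓ, (d : ℤ) = f.eval (Nat.card (ResidueField o) : ℤ)}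

/-- The polynomials `f ∈ ℤ[x]` such that `f(q)` is the degree of a regular character of level `ℓ`
of `GU_n(o)`, for every complete discrete valuation ring `o` whose residue field is finite of odd
characteristic and of cardinality `q > n`, and for every unramified quadratic extension. -/
def degreePolynomialsGU (n ℓ : ℕ) : Set ℤ[X] :=
  {f | ∀ (o : Type u) [CommRing o] [IsDomain o] [IsDiscreteValuationRing o]
    [IsAdicComplete (maximalIdeal o) o] [Finite (ResidueField o)]
    (O : Type v) [CommRing O] [IsDomain O] [IsDiscreteValuationRing O] [Algebra o O]
    (ν : O ≃ₐ[o] O),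
    ringChar (ResidueField o) ≠ 2 → n < Nat.card (ResidueField o) →
    IsUnramifiedQuadratic o O → ν ≠ AlgEquiv.refl →
      ∃ d ∈ degreesGU ν n ℓ, (d : ℤ) = f.eval (Nat.card (ResidueField o) : ℤ)}

/-- The polynomial `(-1)^(deg f) f(-x)`. -/
def ennola (f : ℤ[X]) : ℤ[X] := C ((-1) ^ f.natDegree) * f.comp (-X)

end

end RegChar

/-!
The degrees of the regular representations are computed by Clifford theory on the congruence
subgroups `K^m`. For `2 m ≥ ℓ + 1` the quotient `K^m / K^(ℓ+1)` is abelian, and the trace pairing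
identifies its characters with Lie algebra elements modulo `𝔭^(ℓ+1-m)`. If the reduction of such an
element `x` is cyclic, so is `x`; its commutant is then the commutative algebra generated by `x`,
and the stabilizer of the character attached to `x` is the product of the centralizer of a lift of
`x` with a congruence subgroup. For `GU` the lift has to be unitary (`exists_unitary_lift`), and
`q > n` is used here. The Cayley transform treats `GL` and `GU` alike: all that is needed of the
two groups is collected in `IsCayleyPair` and `IsRegularSetting`.

When `ℓ + 1` is even, a character of the abelian congruence subgroup extends to its stabilizer, so
a representation containing it contains a stable line. When `ℓ + 1` is odd, one layer of the
filtration remains on which the commutator defines an alternating form; its radical is given by the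
centralizer of `x`, and a Heisenberg argument (`finrank_sq_eq_card_of_heisenberg`,
`IsOddDatum.finrank_sq`) computes the dimension over the stabilizer. Both cases give
`(dim)² = [G : S]² |𝔤/𝔷|^(ℓ-1)`, where `G` and `S` are the group over the residue field and the
centralizer in it of the reduction of `x`, and `𝔤/𝔷` is the quotient of the Lie algebra by
the Lie algebra centralizer, of order `q^(n(n-1))`.
Every cyclic `x` is the parameter of some representation (`exists_mem_regularDegrees`).

It remains to compute `|G|` and `|S|`. The orders of the groups are `v_ε(q)`
(`card_GL_eq_vEval`, `card_unitary_eq_vEval`). For a cyclic `x` with characteristic polynomial `f`,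
`S` is the unit group of `k[X]/f` for `GL`, and for `GU` it is the conic
`a² - η b² = 1` over `k[X]/f`, with `η` a non-square of `k`. The unit group of `GL` is treated as
the split form of the same conic. By the Chinese remainder theorem and the rational parametrisation
of the conic (`card_conic_add`), its order is `u_ε^τ(q)`, where `τ_{d,e}` counts
the irreducible factors of degree `d` and multiplicity `e`
(`IsSign.exists_card_conic_eq_uEval`). Conversely each type `τ` occurs: as `q > n`, there are enough
irreducible polynomials of each degree (`exists_monic_of_isType`), and every monic polynomial is the
characteristic polynomial of a cyclic matrix of the required symmetry
(`exists_selfAdjoint_charpoly_eq`).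

For the Ennola duality, the quotients `v_ε / u_ε^τ` are polynomials: after cancelling powers of the
variable this is the divisibility behind Gaussian binomial coefficients (`prodPoly_mul_dvd`,
`uPoly_dvd_vPoly`). The substitution `x ↦ -x` exchanges the two signs and is multiplicative. A
degree polynomial takes, for infinitely many primes `p`, the value of one of the finitely many
formula polynomials at `p` (use the power series rings over the fields with `p` elements), so it
is equal to one of them.
-/


namespace RegChar

/-! ### Commuting operators on a Heisenberg representation -/

/-- Burnside's theorem: on a finite-dimensional simple module over a `ℂ`-algebra, every `ℂ`-linear
endomorphism is the action of an element of the algebra. -/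
theorem lsmul_surjective_of_isSimpleModule {A W : Type*} [Ring A] [Algebra ℂ A] [AddCommGroup W]
    [Module ℂ W] [Module A W] [IsScalarTower ℂ A W] [IsSimpleModule A W] [FiniteDimensional ℂ W] :
    Function.Surjective (Algebra.lsmul ℂ ℂ W : A →ₐ[ℂ] Module.End ℂ W) := by
  intro T
  have hsch := IsSimpleModule.algebraMap_end_bijective_of_isAlgClosed (A := A) (V := W) ℂ
  let f : Module.End (Module.End A W) W :=
    { toFun := T
      map_add' := T.map_add
      map_smul' := by
        intro φ w
        obtain ⟨c, rfl⟩ := hsch.2 φ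
        simp }
  obtain ⟨s, hs⟩ := Module.Finite.fg_top (R := ℂ) (M := W)
  obtain ⟨r, hr⟩ := jacobson_density f s
  refine ⟨r, LinearMap.ext_on (hs : Submodule.span ℂ (s : Set W) = ⊤) fun m hm => ?_⟩
  exact (hr m hm).symm

/-- If two invertible operators commute up to the scalar `c`, then `c` is a root of unity of order
dividing the dimension of any subspace stable under the operators and their inverses. -/
theorem pow_finrank_eq_one_of_commute_up_to {W : Type*} [AddCommGroup W] [Module ℂ W]
    [FiniteDimensional ℂ W] {S S' T T' : Module.End ℂ W} {c : ℂ} (hS : S * S' = 1)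
    (hT : T * T' = 1) (hST : S * T = c • (T * S)) (p : Submodule ℂ W)
    (pS : ∀ w ∈ p, S w ∈ p) (pT : ∀ w ∈ p, T w ∈ p) (pS' : ∀ w ∈ p, S' w ∈ p)
    (pT' : ∀ w ∈ p, T' w ∈ p) : c ^ Module.finrank ℂ p = 1 := by
  have key : ∀ {X Y : Module.End ℂ W} (hX : ∀ w ∈ p, X w ∈ p) (hY : ∀ w ∈ p, Y w ∈ p),
      X * Y = 1 → LinearMap.det (X.restrict hX) ≠ 0 := by
    intro X Y hX hY h
    have : X.restrict hX * Y.restrict hY = 1 := by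
      ext w; simpa using congrArg (fun f => f (w : W)) h
    intro h0
    have h1 := congrArg LinearMap.det this
    rw [map_mul, h0, zero_mul, map_one] at h1
    exact zero_ne_one h1
  have h1 : S.restrict pS * T.restrict pT = c • (T.restrict pT * S.restrict pS) := by
    ext w; simpa using congrArg (fun f => f (w : W)) hST
  have h2 := congrArg LinearMap.det h1
  rw [LinearMap.det_smul, map_mul, map_mul] at h2
  have ha := key pS pS' hS
  have hb := key pT pT' hT
  have : (LinearMap.det (S.restrict pS) * LinearMap.det (T.restrict pT)) *
      (c ^ Module.finrank ℂ p - 1) = 0 := by linear_combination -h2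
  rcases mul_eq_zero.1 this with h | h
  · exact absurd h (mul_ne_zero ha hb)
  · linear_combination h

/-- Two commuting-up-to-a-scalar operators that commute with an involution of trace one commute:
the scalar is killed by the two consecutive dimensions of the eigenspaces of the involution. -/
theorem scalar_eq_one_of_involution_trace_one {W : Type*} [AddCommGroup W] [Module ℂ W]
    [FiniteDimensional ℂ W] {S S' T T' J : Module.End ℂ W} {c : ℂ} (hS : S * S' = 1)
    (hS' : S' * S = 1)
    (hT : T * T' = 1) (hT' : T' * T = 1) (hST : S * T = c • (T * S)) (hJ : J * J = 1)
    (htr : LinearMap.trace ℂ W J = 1)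
    (hJS : J * S = S * J) (hJT : J * T = T * J) : c = 1 := by
  have hJS' : J * S' = S' * J := by
    calc J * S' = (S' * S) * J * S' := by rw [hS', one_mul]
      _ = S' * (J * S) * S' := by rw [hJS]; simp only [mul_assoc]
      _ = S' * J := by rw [mul_assoc, mul_assoc, hS, mul_one]
  have hJT' : J * T' = T' * J := by
    calc J * T' = (T' * T) * J * T' := by rw [hT', one_mul]
      _ = T' * (J * T) * T' := by rw [hJT]; simp only [mul_assoc]
      _ = T' * J := by rw [mul_assoc, mul_assoc, hT, mul_one]
  let p : ℂ → Submodule ℂ W := fun ε => LinearMap.ker (J - ε • 1)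
  have hmem : ∀ ε w, w ∈ p ε ↔ J w = ε • w := by
    intro ε w; simp [p, sub_eq_zero]
  have hst : ∀ ε (X : Module.End ℂ W), J * X = X * J → ∀ w ∈ p ε, X w ∈ p ε := by
    intro ε X hX w hw
    rw [hmem] at hw ⊢
    have := congrArg (fun f => f w) hX
    simp only [Module.End.mul_apply] at this
    rw [this, hw, map_smul]
  have hp := fun ε => pow_finrank_eq_one_of_commute_up_to hS hT hST (p ε) (hst ε S hJS)
    (hst ε T hJT) (hst ε S' hJS') (hst ε T' hJT')
  have htrp : ∀ ε : ℂ, ε * ε = 1 →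
      (Module.finrank ℂ (p ε) : ℂ) = (Module.finrank ℂ W + ε) / 2 := by
    intro ε hε
    have hJJ : ∀ w, J (J w) = w := fun w => congrArg (fun f => f w) hJ
    have : LinearMap.IsProj (p ε) ((1 / 2 : ℂ) • (1 + ε • J)) := by
      constructor
      · intro w
        rw [hmem]
        simp only [LinearMap.smul_apply, LinearMap.add_apply, Module.End.one_apply, map_smul,
          map_add, hJJ, smul_add, smul_smul]
        rw [add_comm]
        congr 1
        · congr 1; ring
        · congr 1; linear_combination -(1/2 : ℂ) * hε
      · intro w hw
        rw [hmem] at hw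
        simp only [LinearMap.smul_apply, LinearMap.add_apply, Module.End.one_apply, hw, smul_smul,
          hε, one_smul]
        rw [← two_smul ℂ w, smul_smul]; norm_num
    have h2 := this.trace
    rw [← h2, map_smul, map_add, map_smul, htr, LinearMap.trace_one]
    simp only [smul_eq_mul]; ring
  have h1 := htrp 1 (by ring)
  have h2 := htrp (-1) (by ring)
  have h3 : Module.finrank ℂ (p 1) = Module.finrank ℂ (p (-1)) + 1 := by
    have : (Module.finrank ℂ (p 1) : ℂ) = ((Module.finrank ℂ (p (-1)) + 1 : ℕ) : ℂ) := by
      push_cast; rw [h1, h2]; ring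
    exact_mod_cast this
  have h4 := hp 1
  rw [h3, pow_succ, hp (-1), one_mul] at h4
  exact h4

/-- A twisted group algebra of a nondegenerate alternating cocycle is the full endomorphism algebra of
any of its simple modules `W`, and commuting automorphisms permuting its basis are implemented by
commuting elements, since these preserve the eigenspaces of the parity operator `∑ u v`. -/
theorem exists_commuting_implementers {A W 𝔳 : Type*} [Ring A] [Algebra ℂ A] [AddCommGroup W]
    [Module ℂ W] [Module A W] [IsScalarTower ℂ A W] [IsSimpleModule A W] [FiniteDimensional ℂ W]
    [AddCommGroup 𝔳] [Finite 𝔳] (uA : 𝔳 → A) (γ : 𝔳 → 𝔳 → ℂ) (huA0 : uA 0 = 1)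
    (huA_mul : ∀ a b, uA a * uA b = γ a b • uA (a + b))
    (hγl : ∀ a a' b, γ (a + a') b = γ a b * γ a' b)
    (hγr : ∀ a b b', γ a (b + b') = γ a b * γ a b')
    (hγa : ∀ a, γ a a = 1) (hnd : ∀ a, a ≠ 0 → ∃ b, γ a b ≠ 1)
    (hhalf : ∀ a : 𝔳, ∃ b, b + b = a)
    (hsp : Submodule.span ℂ (Set.range uA) = ⊤)
    {I : Type*} (α : I → A ≃ₐ[ℂ] A) (s : I → 𝔳 ≃ 𝔳) (hs : ∀ i a, α i (uA a) = uA (s i a))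
    (hαcomm : ∀ i j x, α i (α j x) = α j (α i x)) :
    Module.finrank ℂ W ^ 2 = Nat.card 𝔳 ∧ ∃ t t' : I → A, (∀ i, t i * t' i = 1) ∧
      (∀ i, t' i * t i = 1) ∧ (∀ i x, α i x * t i = t i * x) ∧ ∀ i j, t i * t j = t j * t i := by
  classical
  have := Fintype.ofFinite 𝔳
  -- formal properties of the cocycle
  have hz : ∀ b, γ 0 b = 1 := by
    intro b
    have h1 := hγr 0 0 b
    have h2 := hγl 0 0 b
    have h3 : γ 0 b = 0 ∨ γ 0 b = 1 := by
      rw [add_zero] at h2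
      rcases eq_or_ne (γ 0 b) 0 with h | h
      · exact Or.inl h
      · right; exact mul_left_cancel₀ h (by rw [← h2, mul_one])
    rcases h3 with h | h
    · exfalso
      have h4 := hγr 0 b (-b)
      rw [add_neg_cancel, h, zero_mul, hγa] at h4
      exact one_ne_zero h4
    · exact h
  have hzr : ∀ a, γ a 0 = 1 := by
    intro a
    have h2 := hγr a 0 0
    have h4 := hγl a (-a) 0
    rw [add_neg_cancel, hz] at h4
    have hne : γ a 0 ≠ 0 := fun h => by rw [h, zero_mul] at h4; exact one_ne_zero h4
    rw [add_zero] at h2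
    exact mul_left_cancel₀ hne (by rw [← h2, mul_one])
  have hskew : ∀ a b, γ a b * γ b a = 1 := by
    intro a b
    have h := hγa (a + b)
    rw [hγl, hγr, hγr, hγa, hγa, one_mul, mul_one] at h
    exact h
  have hne : ∀ a b, γ a b ≠ 0 := fun a b h => by
    have := hskew a b; rw [h, zero_mul] at this; exact zero_ne_one this
  have hneg : ∀ a b, γ a (-b) = γ b a := by
    intro a b
    have h := hγr a b (-b)
    rw [add_neg_cancel, hzr] at h
    exact mul_left_cancel₀ (hne a b) (by rw [← h, hskew])
  have hnegl : ∀ a b, γ (-a) b = γ b a := by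
    intro a b
    have h := hγl a (-a) b
    rw [add_neg_cancel, hz] at h
    exact mul_left_cancel₀ (hne a b) (by rw [← h, hskew])
  set r : A →ₐ[ℂ] Module.End ℂ W := Algebra.lsmul ℂ ℂ W with hr
  have hrsurj : Function.Surjective r := lsmul_surjective_of_isSimpleModule
  have hNpos : 0 < Module.finrank ℂ W := by
    have : Nontrivial W := IsSimpleModule.nontrivial A W
    exact Module.finrank_pos
  -- traces vanish off the identity
  have htr : ∀ a, a ≠ 0 → LinearMap.trace ℂ W (r (uA a)) = 0 := by
    intro a ha
    obtain ⟨b, hb⟩ := hnd a ha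
    obtain ⟨c, rfl⟩ := hhalf b
    have h1 : uA a * uA c = (γ a c * γ a c) • (uA c * uA a) := by
      rw [huA_mul, huA_mul, smul_smul, add_comm c a]
      congr 1
      rw [mul_assoc, hskew, mul_one]
    have h2 : uA c * uA (-c) = 1 := by
      rw [huA_mul, add_neg_cancel, huA0, hneg, hγa, one_smul]
    have h3 : r (uA a) = (γ a c * γ a c) • (r (uA c) * (r (uA a) * r (uA (-c)))) := by
      rw [← map_mul, ← map_mul, ← map_smul, ← mul_assoc, ← smul_mul_assoc, ← h1, mul_assoc, h2,
        mul_one]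
    have h5 : r (uA (-c)) * r (uA c) = 1 := by
      rw [← map_mul, huA_mul, neg_add_cancel, huA0, hnegl, hγa, one_smul, map_one]
    have h4 := congrArg (LinearMap.trace ℂ W) h3
    rw [map_smul, LinearMap.trace_mul_comm, mul_assoc, h5, mul_one, smul_eq_mul, ← hγr] at h4
    have h6 : (γ a (c + c) - 1) * LinearMap.trace ℂ W (r (uA a)) = 0 := by
      linear_combination -h4
    exact (mul_eq_zero.1 h6).resolve_left (sub_ne_zero.2 hb)
  have hindep : ∀ c : 𝔳 → ℂ, r (∑ a, c a • uA a) = 0 → ∀ b, c b = 0 := by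
    intro c hc b
    have h1 : r ((∑ a, c a • uA a) * uA (-b)) = 0 := by rw [map_mul, hc, zero_mul]
    have h2 := congrArg (LinearMap.trace ℂ W) h1
    rw [Finset.sum_mul, map_sum, map_sum, map_zero, Finset.sum_eq_single b] at h2
    · rw [smul_mul_assoc, huA_mul, add_neg_cancel, huA0, hneg, hγa, one_smul, map_smul, map_one,
        map_smul, LinearMap.trace_one, smul_eq_mul] at h2
      exact (mul_eq_zero.1 h2).resolve_right (by exact_mod_cast hNpos.ne')
    · intro a _ hab
      rw [smul_mul_assoc, huA_mul, map_smul, map_smul, map_smul, map_smul, htr, smul_zero,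
        smul_zero]
      exact fun h => hab (by rwa [← sub_eq_add_neg, sub_eq_zero] at h)
    · simp
  have hexp : ∀ x : A, ∃ c : 𝔳 → ℂ, x = ∑ a, c a • uA a := by
    intro x
    obtain ⟨c, hc⟩ := (Submodule.mem_span_range_iff_exists_fun ℂ).1 (hsp ▸ Submodule.mem_top (x := x))
    exact ⟨c, hc.symm⟩
  have hrinj : Function.Injective r := by
    rw [injective_iff_map_eq_zero]
    intro x hx
    obtain ⟨c, rfl⟩ := hexp x
    have := hindep c hx
    simp [this]
  let re : A ≃ₐ[ℂ] Module.End ℂ W := AlgEquiv.ofBijective r ⟨hrinj, hrsurj⟩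
  have hcard : Module.finrank ℂ W ^ 2 = Nat.card 𝔳 := by
    have h1 : Module.finrank ℂ A = Fintype.card 𝔳 := by
      have hli : LinearIndependent ℂ uA := by
        rw [Fintype.linearIndependent_iff]
        intro c hc
        exact hindep c (by rw [hc, map_zero])
      rw [← finrank_top, ← hsp, finrank_span_eq_card hli]
    rw [Nat.card_eq_fintype_card, ← h1, re.toLinearEquiv.finrank_eq, Module.finrank_linearMap,
      sq]
  refine ⟨hcard, ?_⟩
  -- the parity operator
  set N : ℂ := (Module.finrank ℂ W : ℂ) with hN
  have hN0 : N ≠ 0 := by simpa [hN] using hNpos.ne'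
  let J : A := N⁻¹ • ∑ a, uA a
  have hJJ : J * J = 1 := by
    have h1 : (∑ a, uA a) * (∑ a, uA a) = (N ^ 2) • (1 : A) := by
      have e1 : (∑ a, uA a) * (∑ a, uA a) = ∑ b, (∑ a, γ a b) • uA b := by
        rw [Finset.sum_mul]
        simp_rw [Finset.mul_sum, huA_mul]
        have : ∀ a, ∑ b, γ a b • uA (a + b) = ∑ b, γ a b • uA b := by
          intro a
          rw [← Equiv.sum_comp (Equiv.addLeft a) (fun b => γ a b • uA b)]
          refine Finset.sum_congr rfl fun b _ => ?_
          simp only [Equiv.coe_addLeft]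
          rw [hγr, hγa, one_mul]
        simp_rw [this]
        rw [Finset.sum_comm]
        simp_rw [Finset.sum_smul]
      rw [e1, Finset.sum_eq_single 0]
      · simp_rw [hzr]
        rw [huA0]
        simp only [Finset.sum_const, Finset.card_univ, nsmul_eq_mul, mul_one]
        rw [← Nat.card_eq_fintype_card, ← hcard]; push_cast; rfl
      · intro b _ hb
        obtain ⟨a, ha⟩ := hnd b hb
        have ha' : γ a b ≠ 1 := fun h => ha (by have := hskew a b; rwa [h, one_mul] at this)
        have h2 : ∑ x, γ x b = γ a b * ∑ x, γ x b := by
          rw [Finset.mul_sum]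
          rw [← Equiv.sum_comp (Equiv.addLeft a) (fun x => γ x b)]
          exact Finset.sum_congr rfl fun x _ => by simp only [Equiv.coe_addLeft]; rw [hγl]
        have h3 : (γ a b - 1) * ∑ x, γ x b = 0 := by linear_combination -h2
        rw [(mul_eq_zero.1 h3).resolve_left (sub_ne_zero.2 ha'), zero_smul]
      · simp
    simp only [J]
    rw [smul_mul_assoc, mul_smul_comm, smul_smul, h1, smul_smul]
    rw [show N⁻¹ * N⁻¹ * N ^ 2 = 1 by field_simp, one_smul]
  have htrJ : LinearMap.trace ℂ W (r J) = 1 := by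
    simp only [J]
    rw [map_smul, map_smul, map_sum, map_sum, Finset.sum_eq_single 0]
    · rw [huA0, map_one, LinearMap.trace_one, smul_eq_mul, ← hN]; field_simp
    · intro a _ ha; exact htr a ha
    · simp
  have hT : ∀ i, ∃ t t' : A, t * t' = 1 ∧ t' * t = 1 ∧ ∀ x, α i x * t = t * x := by
    intro i
    obtain ⟨T, hT⟩ := ((re.symm.trans (α i)).trans
      re).eq_linearEquivConjAlgEquiv
    obtain ⟨t, ht⟩ := hrsurj (T : W →ₗ[ℂ] W)
    obtain ⟨t', ht'⟩ := hrsurj (T.symm : W →ₗ[ℂ] W)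
    refine ⟨t, t', hrinj ?_, hrinj ?_, fun x => hrinj ?_⟩
    · rw [map_mul, map_one, ht, ht']; ext w; simp
    · rw [map_mul, map_one, ht, ht']; ext w; simp
    · have h1 := congrArg (fun f => f (re x)) hT
      have h2 : r (α i x) = (T : W →ₗ[ℂ] W) * r x * (T.symm : W →ₗ[ℂ] W) := by
        have h3 : (((re.symm.trans (α i)).trans re) (re x))
          = r (α i x) := by
            simp only [re, AlgEquiv.trans_apply, AlgEquiv.symm_apply_apply]
            rfl
        rw [← h3]
        exact h1
      rw [map_mul, map_mul, h2, ht]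
      ext w; simp
  choose t t' ht ht' htx using hT
  have hJα : ∀ i, α i J = J := by
    intro i
    simp only [J]
    rw [map_smul, map_sum]
    congr 1
    rw [← Equiv.sum_comp (s i) (fun a => uA a)]
    exact Finset.sum_congr rfl fun a _ => hs i a
  have hJt : ∀ i, J * t i = t i * J := fun i => by
    have := htx i J
    rwa [hJα] at this
  have htcomm : ∀ i j, t i * t j = t j * t i := by
    intro i j
    -- `t i * t j` and `t j * t i` implement the same automorphism, so they are proportional
    have hz : ∀ x, (t i * t j * (t' i * t' j)) * x = x * (t i * t j * (t' i * t' j)) := by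
      have hinv : ∀ k x, t' k * α k x = x * t' k := by
        intro k x
        calc t' k * α k x = t' k * (α k x * t k) * t' k := by simp only [mul_assoc, ht, mul_one]
          _ = x * t' k := by rw [htx, ← mul_assoc, ht', one_mul]
      intro x
      obtain ⟨y, rfl⟩ := (α j).surjective x
      obtain ⟨z, rfl⟩ := (α i).surjective y
      calc t i * t j * (t' i * t' j) * α j (α i z)
          = t i * t j * (t' i * (t' j * α j (α i z))) := by simp only [mul_assoc]
        _ = t i * (t j * z) * (t' i * t' j) := by
            rw [hinv, ← mul_assoc (t' i), hinv]; simp only [mul_assoc]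
        _ = (t i * α j z) * (t j * (t' i * t' j)) := by rw [← htx j z]; simp only [mul_assoc]
        _ = _ := by rw [← htx i (α j z), hαcomm]; simp only [mul_assoc]
    obtain ⟨c, hc⟩ : ∃ c : ℂ, t i * t j * (t' i * t' j) = c • 1 := by
      have h1 : r (t i * t j * (t' i * t' j)) ∈ Subalgebra.center ℂ (Module.End ℂ W) := by
        rw [Subalgebra.mem_center_iff]
        intro X
        obtain ⟨x, rfl⟩ := hrsurj X
        rw [← map_mul, ← map_mul, hz]
      rw [Algebra.IsCentral.center_eq_bot, Algebra.mem_bot] at h1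
      obtain ⟨c, hc⟩ := h1
      refine ⟨c, hrinj ?_⟩
      rw [← hc, map_smul, map_one, Algebra.algebraMap_eq_smul_one]
    have h1 : t i * t j = c • (t j * t i) := by
      calc t i * t j = t i * t j * (t' i * t' j) * (t j * t i) := by
            have : (t' i * t' j) * (t j * t i) = 1 := by
              rw [mul_assoc, ← mul_assoc (t' j), ht', one_mul, ht']
            rw [mul_assoc, this, mul_one]
        _ = _ := by rw [hc, smul_mul_assoc, one_mul]
    have hc1 : c = 1 := by
      refine scalar_eq_one_of_involution_trace_one (S := r (t i)) (S' := r (t' i)) (T := r (t j))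
        (T' := r (t' j)) (J := r J) ?_ ?_ ?_ ?_ ?_ ?_ htrJ ?_ ?_ <;>
      simp only [← map_mul, ht, ht', map_one, h1, map_smul, hJJ, hJt]
    rw [h1, hc1, one_smul]
  exact ⟨t, t', ht, ht', htx, htcomm⟩

section Heisenberg

variable {V 𝔳 : Type*} [AddCommGroup V] [Module ℂ V] [AddCommGroup 𝔳]

/-- The span of a family of operators closed under multiplication up to scalars. -/
def spanSubalgebra (u : 𝔳 → Module.End ℂ V) (γ : 𝔳 → 𝔳 → ℂ) (h0 : u 0 = 1)
    (hu : ∀ a b, u a * u b = γ a b • u (a + b)) : Subalgebra ℂ (Module.End ℂ V) :=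
  (Submodule.span ℂ (Set.range u)).toSubalgebra (h0 ▸ Submodule.subset_span ⟨0, rfl⟩) (by
    intro x y hx hy
    induction hx, hy using Submodule.span_induction₂ with
    | mem_mem x y hx hy =>
      obtain ⟨a, rfl⟩ := hx
      obtain ⟨b, rfl⟩ := hy
      rw [hu]
      exact Submodule.smul_mem _ _ (Submodule.subset_span ⟨_, rfl⟩)
    | zero_left y _ => simp
    | zero_right x _ => simp
    | add_left x y z _ _ _ h1 h2 => rw [add_mul]; exact add_mem h1 h2
    | add_right x y z _ _ _ h1 h2 => rw [mul_add]; exact add_mem h1 h2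
    | smul_left r x y _ _ h => rw [smul_mul_assoc]; exact Submodule.smul_mem _ _ h
    | smul_right r x y _ _ h => rw [mul_smul_comm]; exact Submodule.smul_mem _ _ h)

theorem mem_spanSubalgebra {u : 𝔳 → Module.End ℂ V} {γ : 𝔳 → 𝔳 → ℂ} {h0 : u 0 = 1}
    {hu : ∀ a b, u a * u b = γ a b • u (a + b)} {x : Module.End ℂ V} :
    x ∈ spanSubalgebra u γ h0 hu ↔ x ∈ Submodule.span ℂ (Set.range u) := Iff.rfl

/-- Let `u` be operators indexed by a finite group, multiplying through a nondegenerate alternating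
cocycle `γ`, and let `ρ` be a commuting family of invertible operators permuting the `u v` by
conjugation. If the `u v` and the `ρ i` have no common invariant subspace, then the square of the
dimension is the order of the group. In other words, no multiplicity arises from the `ρ i`: each
`ρ i` differs by a scalar from an operator `t i` in the span of the `u v`, and the `t i` commute,
because they preserve the eigenspaces of the parity operator `∑ u v`. -/
theorem finrank_sq_eq_card_of_heisenberg [FiniteDimensional ℂ V] [Nontrivial V] [Finite 𝔳]
    (u : 𝔳 → Module.End ℂ V) (γ : 𝔳 → 𝔳 → ℂ) (h0 : u 0 = 1)
    (hu : ∀ a b, u a * u b = γ a b • u (a + b))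
    (hγl : ∀ a a' b, γ (a + a') b = γ a b * γ a' b)
    (hγr : ∀ a b b', γ a (b + b') = γ a b * γ a b')
    (hγa : ∀ a, γ a a = 1) (hnd : ∀ a, a ≠ 0 → ∃ b, γ a b ≠ 1)
    (hhalf : ∀ a : 𝔳, ∃ b, b + b = a)
    {I : Type*} (ρ ρ' : I → Module.End ℂ V) (hρ : ∀ i, ρ i * ρ' i = 1) (hρ' : ∀ i, ρ' i * ρ i = 1)
    (hcomm : ∀ i j, ρ i * ρ j = ρ j * ρ i) (s : I → 𝔳 ≃ 𝔳)
    (hs : ∀ i a, ρ i * u a = u (s i a) * ρ i)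
    (hirr : ∀ p : Submodule ℂ V, (∀ a, ∀ w ∈ p, u a w ∈ p) → (∀ i, ∀ w ∈ p, ρ i w ∈ p) →
      p = ⊥ ∨ p = ⊤) :
    Module.finrank ℂ V ^ 2 = Nat.card 𝔳 := by
  set A := spanSubalgebra u γ h0 hu with hA
  have huA : ∀ a, u a ∈ A := fun a => Submodule.subset_span ⟨a, rfl⟩
  -- a minimal submodule stable under `u`
  have : IsArtinian A V := isArtinian_of_tower ℂ inferInstance
  obtain ⟨W, hW⟩ : ∃ W : Submodule A V, IsAtom W := by
    obtain ⟨W, hW, -⟩ := (eq_bot_or_exists_atom_le (⊤ : Submodule A V)).resolve_left top_ne_bot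
    exact ⟨W, hW⟩
  have hsimple : IsSimpleModule A W := isSimpleModule_iff_isAtom.2 hW
  have : FiniteDimensional ℂ W :=
    inferInstanceAs (FiniteDimensional ℂ (W.restrictScalars ℂ))
  let uA : 𝔳 → A := fun a => ⟨u a, huA a⟩
  have hsp : Submodule.span ℂ (Set.range uA) = ⊤ := by
    have := Fintype.ofFinite 𝔳
    rw [eq_top_iff]
    rintro ⟨x, hx⟩ -
    obtain ⟨c, hc⟩ := (Submodule.mem_span_range_iff_exists_fun ℂ).1 (mem_spanSubalgebra.1 hx)
    have : (⟨x, hx⟩ : A) = ∑ a, c a • uA a := Subtype.ext (by simp [uA, ← hc])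
    rw [this]
    exact Submodule.sum_mem _ fun a _ =>
      Submodule.smul_mem _ _ (Submodule.subset_span ⟨a, rfl⟩)
  -- conjugation by `ρ i` on `A`
  have hconj : ∀ i, ∀ x ∈ A, ρ i * x * ρ' i ∈ A := by
    intro i x hx
    rw [hA, mem_spanSubalgebra] at hx
    induction hx using Submodule.span_induction with
    | mem x hx =>
      obtain ⟨a, rfl⟩ := hx
      rw [hs, mul_assoc, hρ, mul_one]; exact huA _
    | zero => simp
    | add x y _ _ h1 h2 => rw [mul_add, add_mul]; exact add_mem h1 h2
    | smul c x _ h => rw [mul_smul_comm, smul_mul_assoc]; exact A.smul_mem h c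
  let α : I → A →ₐ[ℂ] A := fun i =>
    { toFun := fun x => ⟨ρ i * x * ρ' i, hconj i x x.2⟩
      map_one' := Subtype.ext (by simp [hρ])
      map_mul' := fun x y => Subtype.ext (by
        simp only [MulMemClass.coe_mul]
        calc ρ i * (x * y) * ρ' i = ρ i * x * 1 * y * ρ' i := by simp only [mul_assoc, one_mul]
          _ = _ := by rw [← hρ' i]; simp only [mul_assoc])
      map_zero' := Subtype.ext (by simp)
      map_add' := fun x y => Subtype.ext (by simp [mul_add, add_mul])
      commutes' := fun c => Subtype.ext (by
        simp only [Algebra.algebraMap_eq_smul_one, SetLike.val_smul, OneMemClass.coe_one,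
          mul_smul_comm, smul_mul_assoc, mul_one, hρ]) }
  have hα : ∀ i (x : A), ((α i x : A) : Module.End ℂ V) * ρ i = ρ i * x := by
    intro i x
    change ρ i * x * ρ' i * ρ i = _
    rw [mul_assoc, hρ', mul_one]
  have hαinj : ∀ i, Function.Injective (α i) := by
    intro i x y hxy
    apply Subtype.ext
    have h1 := hα i x
    rw [hxy, hα] at h1
    have := congrArg (fun z => ρ' i * z) h1
    simpa only [← mul_assoc, hρ', one_mul] using this.symm
  have hαbij : ∀ i, Function.Bijective (α i) := fun i =>
    ⟨hαinj i, (LinearMap.injective_iff_surjective (f := (α i).toLinearMap)).1 (hαinj i)⟩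
  have hαcomm : ∀ i j x, α i (α j x) = α j (α i x) := by
    intro i j x
    have h1 : ((α i (α j x) : A) : Module.End ℂ V) * (ρ i * ρ j) =
        (α j (α i x) : A) * (ρ i * ρ j) := by
      rw [← mul_assoc, hα, mul_assoc, hα, hcomm i j, ← mul_assoc ((α j (α i x) : A) : Module.End ℂ V),
        hα, mul_assoc, hα, ← mul_assoc, ← mul_assoc, hcomm]
    have h2 := congrArg (fun z => z * (ρ' j * ρ' i)) h1
    have h3 : (ρ i * ρ j) * (ρ' j * ρ' i) = 1 := by
      rw [mul_assoc, ← mul_assoc (ρ j), hρ, one_mul, hρ]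
    simp only [mul_assoc _ (ρ i * ρ j), h3, mul_one] at h2
    exact Subtype.ext h2
  obtain ⟨hcard, t, t', ht, ht', htx, htcomm⟩ := exists_commuting_implementers (A := A) (W := W)
    uA γ (Subtype.ext h0) (fun a b => Subtype.ext (hu a b)) hγl hγr hγa hnd hhalf hsp
    (fun i => AlgEquiv.ofBijective (α i) (hαbij i)) s
    (fun i a => Subtype.ext (by
      change ρ i * u a * ρ' i = u (s i a)
      rw [hs, mul_assoc, hρ, mul_one])) hαcomm
  -- the operators `D i = t' i * ρ i` commute with everything, hence are scalars
  have hD : ∀ i, ∃ c : ℂ, (t' i : Module.End ℂ V) * ρ i = c • 1 := by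
    intro i
    set D : Module.End ℂ V := (t' i : Module.End ℂ V) * ρ i with hDdef
    have hcoe : ∀ k, ((t k : A) : Module.End ℂ V) * (t' k : A) = 1 := fun k => by
      exact_mod_cast congrArg Subtype.val (ht k)
    have hcoe' : ∀ k, ((t' k : A) : Module.End ℂ V) * (t k : A) = 1 := fun k => by
      exact_mod_cast congrArg Subtype.val (ht' k)
    have htρ : ∀ k, (t k : Module.End ℂ V) * (t' k * ρ k) = ρ k := fun k => by
      rw [← mul_assoc, hcoe, one_mul]
    have hDx : ∀ k, ∀ x : A, (t' k : Module.End ℂ V) * ρ k * x = x * (t' k * ρ k) := by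
      intro k x
      have h1 : ((α k x : A) : Module.End ℂ V) * t k = t k * x := by
        exact congrArg Subtype.val (htx k x)
      calc (t' k : Module.End ℂ V) * ρ k * x = t' k * (α k x * ρ k) := by rw [hα, mul_assoc]
        _ = t' k * (α k x * (t k * (t' k * ρ k))) := by rw [htρ]
        _ = t' k * ((α k x * t k) * (t' k * ρ k)) := by simp only [mul_assoc]
        _ = (t' k * t k) * (x * (t' k * ρ k)) := by rw [h1]; simp only [mul_assoc]
        _ = _ := by rw [hcoe', one_mul]
    have hDρ : ∀ j, D * ρ j = ρ j * D := by
      intro j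
      have htc : ((t i : A) : Module.End ℂ V) * t j = t j * t i := by
        exact_mod_cast congrArg Subtype.val (htcomm i j)
      -- cancel `t i * t j` in `ρ i * ρ j = ρ j * ρ i`
      have h2 : (t i * t j : Module.End ℂ V) * (D * (t' j * ρ j)) =
          (t i * t j : Module.End ℂ V) * ((t' j * ρ j) * D) := by
        calc (t i * t j : Module.End ℂ V) * (D * (t' j * ρ j))
            = t i * (t j * D) * (t' j * ρ j) := by simp only [mul_assoc]
          _ = (t i * D) * (t j * (t' j * ρ j)) := by
              rw [hDdef, ← hDx i (t j)]; simp only [mul_assoc]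
          _ = ρ i * ρ j := by rw [hDdef, htρ, htρ]
          _ = ρ j * ρ i := hcomm i j
          _ = (t j * (t' j * ρ j)) * (t i * D) := by rw [htρ, hDdef, htρ]
          _ = t j * ((t' j * ρ j) * t i) * D := by simp only [mul_assoc]
          _ = (t j * t i) * ((t' j * ρ j) * D) := by rw [hDx j (t i)]; simp only [mul_assoc]
          _ = _ := by rw [htc]
      have h4 : (t' j * t' i : Module.End ℂ V) * (t i * t j) = 1 := by
        rw [mul_assoc, ← mul_assoc (t' i : Module.End ℂ V), hcoe', one_mul, hcoe']
      have h3 : D * (t' j * ρ j) = (t' j * ρ j) * D := by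
        rw [← one_mul (D * (t' j * ρ j)), ← h4, mul_assoc (t' j * t' i : Module.End ℂ V), h2,
          ← mul_assoc (t' j * t' i : Module.End ℂ V), h4, one_mul]
      calc D * ρ j = D * (t j * (t' j * ρ j)) := by rw [htρ]
        _ = (D * t j) * (t' j * ρ j) := by simp only [mul_assoc]
        _ = t j * (D * (t' j * ρ j)) := by rw [hDdef, hDx i (t j)]; simp only [mul_assoc]
        _ = (t j * (t' j * ρ j)) * D := by rw [h3]; simp only [mul_assoc]
        _ = ρ j * D := by rw [htρ]
    obtain ⟨c, hc⟩ := Module.End.exists_eigenvalue D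
    refine ⟨c, ?_⟩
    have hE := hirr (Module.End.eigenspace D c) ?_ ?_
    · have := hE.resolve_left hc
      ext w
      have hw : w ∈ Module.End.eigenspace D c := by rw [this]; trivial
      simpa using Module.End.mem_eigenspace_iff.1 hw
    · intro a w hw
      rw [Module.End.mem_eigenspace_iff] at hw ⊢
      have := congrArg (fun f => f w) (hDx i (uA a))
      simp only [Module.End.mul_apply] at this
      change D (u a w) = _
      rw [show D (u a w) = u a (D w) from this, hw, map_smul]
    · intro j w hw
      rw [Module.End.mem_eigenspace_iff] at hw ⊢
      have := congrArg (fun f => f w) (hDρ j)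
      simp only [Module.End.mul_apply] at this
      rw [this, hw, map_smul]
  have htop : W.restrictScalars ℂ = ⊤ := by
    refine (hirr (W.restrictScalars ℂ) ?_ ?_).resolve_left ?_
    · intro a w hw
      exact W.smul_mem (uA a) hw
    · intro i w hw
      obtain ⟨c, hc⟩ := hD i
      have h1 : ρ i = c • (t i : Module.End ℂ V) := by
        have h2 := congrArg (fun z => (t i : Module.End ℂ V) * z) hc
        have hcoe : ((t i : A) : Module.End ℂ V) * (t' i : A) = 1 := by
          exact_mod_cast congrArg Subtype.val (ht i)
        simpa only [← mul_assoc, hcoe, one_mul, mul_smul_comm, mul_one] using h2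
      rw [h1]
      exact Submodule.smul_mem (W.restrictScalars ℂ) c (W.smul_mem (t i) hw)
    · intro h
      exact hW.1 ((Submodule.restrictScalars_eq_bot_iff ..).1 h)
  rw [← hcard, ← finrank_top (R := ℂ) (M := V), ← htop]
  rfl

end Heisenberg

/-! ### Characters and eigenvectors of normal subgroups -/

/-- Complex characters of a subgroup of an abelian group extend to the group. -/
theorem exists_addChar_extension {A B : Type*} [AddCommGroup A] [AddCommGroup B] (f : B →+ A)
    (hf : Function.Injective f) (χ : AddChar B ℂ) : ∃ Χ : AddChar A ℂ, ∀ b, Χ (f b) = χ b := by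
  let g : B →+ Additive ℂˣ :=
    { toFun := fun b => Additive.ofMul (χ.toMonoidHom.toHomUnits (Multiplicative.ofAdd b))
      map_zero' := by simp
      map_add' := fun a b => by simp }
  have hroot : ∀ {n : ℕ}, n ≠ 0 → Function.Surjective (fun a : Additive ℂˣ => n • a) := by
    intro n hn a
    obtain ⟨z, hz⟩ := IsAlgClosed.exists_pow_nat_eq ((Additive.toMul a : ℂˣ) : ℂ)
      (Nat.pos_of_ne_zero hn)
    have hz0 : z ≠ 0 := by
      rintro rfl
      rw [zero_pow hn] at hz
      exact (Additive.toMul a).ne_zero hz.symm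
    refine ⟨Additive.ofMul (Units.mk0 z hz0), ?_⟩
    apply Additive.toMul.injective
    ext
    simpa using hz
  let : DivisibleBy (Additive ℂˣ) ℕ := divisibleByOfSMulRightSurj _ _ hroot
  let : DivisibleBy (Additive ℂˣ) ℤ := AddGroup.divisibleByIntOfDivisibleByNat _
  obtain ⟨h, hh⟩ :=
    (Module.Baer.of_divisible (A := Additive ℂˣ)).extension_property_addMonoidHom f hf g
  refine ⟨⟨fun a => ((Additive.toMul (h a) : ℂˣ) : ℂ), by simp, fun a b => by simp⟩, fun b => ?_⟩
  have := DFunLike.congr_fun hh b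
  simp only [AddMonoidHom.comp_apply] at this
  change ((Additive.toMul (h (f b)) : ℂˣ) : ℂ) = χ b
  rw [this]
  simp [g]

/-- Commuting operators on a non-zero finite-dimensional complex space have a common eigenvector. -/
theorem exists_common_eigenvector {V I : Type*} [AddCommGroup V] [Module ℂ V]
    [FiniteDimensional ℂ V] [Nontrivial V] (T : I → Module.End ℂ V)
    (hT : ∀ i j, T i * T j = T j * T i) : ∃ w : V, w ≠ 0 ∧ ∀ i, ∃ c : ℂ, T i w = c • w := by
  let P : Set (Submodule ℂ V) := {p | p ≠ ⊥ ∧ ∀ i, ∀ w ∈ p, T i w ∈ p}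
  obtain ⟨p, ⟨hp0, hpT⟩, hmin⟩ := (wellFounded_lt (α := Submodule ℂ V)).has_min P
    ⟨⊤, top_ne_bot, fun _ _ _ => trivial⟩
  obtain ⟨w, hw, hw0⟩ := p.exists_mem_ne_zero_of_ne_bot hp0
  refine ⟨w, hw0, fun i => ?_⟩
  have : Nontrivial p := p.nontrivial_iff_ne_bot.2 hp0
  obtain ⟨c, hc⟩ := Module.End.exists_eigenvalue ((T i).restrict (hpT i))
  obtain ⟨x, hx⟩ := hc.exists_hasEigenvector
  refine ⟨c, ?_⟩
  let q := p ⊓ Module.End.eigenspace (T i) c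
  have hq : q ∈ P := by
    refine ⟨?_, ?_⟩
    · intro h
      have hxq : (x : V) ∈ q := by
        refine ⟨x.2, Module.End.mem_eigenspace_iff.2 ?_⟩
        simpa using congrArg Subtype.val hx.apply_eq_smul
      rw [h] at hxq
      exact hx.2 (Subtype.ext ((Submodule.mem_bot ℂ).1 hxq))
    · rintro j v ⟨hv1, hv2⟩
      refine ⟨hpT j v hv1, ?_⟩
      rw [SetLike.mem_coe, Module.End.mem_eigenspace_iff] at hv2 ⊢
      have := congrArg (fun f => f v) (hT i j)
      simp only [Module.End.mul_apply] at this
      rw [this, hv2, map_smul]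
  have hqp : q = p := by
    by_contra hne
    exact hmin q hq (lt_of_le_of_ne inf_le_left hne)
  have : w ∈ q := hqp ▸ hw
  exact Module.End.mem_eigenspace_iff.1 this.2

section Clifford

variable {G V : Type*} [Group G] [AddCommGroup V] [Module ℂ V]

theorem eq_bot_or_eq_top_of_isIrreducible {ρ : Representation ℂ G V} (h : ρ.IsIrreducible)
    (p : Submodule ℂ V) (hp : ∀ g, ∀ w ∈ p, ρ g w ∈ p) : p = ⊥ ∨ p = ⊤ := by
  rcases h.eq_bot_or_eq_top ⟨p, fun g w hw => hp g w hw⟩ with h | h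
  · left; exact congrArg Subrepresentation.toSubmodule h
  · right; exact congrArg Subrepresentation.toSubmodule h

theorem nontrivial_of_isIrreducible {ρ : Representation ℂ G V} (h : ρ.IsIrreducible) :
    Nontrivial V := by
  by_contra hV
  rw [not_nontrivial_iff_subsingleton] at hV
  have := h.toNontrivial
  exact bot_ne_top (α := Subrepresentation ρ)
    (Subrepresentation.toSubmodule_injective (Subsingleton.elim _ _))

/-- The vectors on which the elements `n` of the subgroup `N` act through the scalars `f n`. -/
def eigenSubmodule (ρ : Representation ℂ G V) (N : Subgroup G) (f : N → ℂ) : Submodule ℂ V :=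
  ⨅ n : N, Module.End.eigenspace (ρ n) (f n)

theorem mem_eigenSubmodule {ρ : Representation ℂ G V} {N : Subgroup G} {f : N → ℂ} {w : V} :
    w ∈ eigenSubmodule ρ N f ↔ ∀ n : N, ρ n w = f n • w := by
  simp [eigenSubmodule]

/-- Eigenspaces of a commuting family for distinct systems of eigenvalues are independent. -/
theorem iSupIndep_eigenSubmodule (ρ : Representation ℂ G V) (N : Subgroup G)
    (hN : ∀ a b : N, ρ a * ρ b = ρ b * ρ a) : iSupIndep (eigenSubmodule ρ N) := by
  have h := Module.End.independent_iInf_maxGenEigenspace_of_forall_mapsTo (fun n : N => ρ n)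
    (fun a b c => Module.End.mapsTo_maxGenEigenspace_of_comm (hN b a) c)
  exact h.mono fun f => iInf_mono fun n => Module.End.eigenspace_le_maxGenEigenspace

/-- The conjugate of a function on a normal subgroup by an element of the group. -/
def conjFun (N : Subgroup G) [N.Normal] (g : G) (f : N → ℂ) : N → ℂ :=
  fun n => f ⟨g⁻¹ * n * g, by
    have := (inferInstance : N.Normal).conj_mem n n.2 g⁻¹; rwa [inv_inv] at this⟩

theorem conjFun_mul (N : Subgroup G) [N.Normal] (g h : G) (f : N → ℂ) :
    conjFun N (g * h) f = conjFun N g (conjFun N h f) := by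
  funext n; simp [conjFun, mul_assoc]

theorem apply_mem_eigenSubmodule {ρ : Representation ℂ G V} {N : Subgroup G} [N.Normal]
    {f : N → ℂ} (g : G) {w : V} (hw : w ∈ eigenSubmodule ρ N f) :
    ρ g w ∈ eigenSubmodule ρ N (conjFun N g f) := by
  rw [mem_eigenSubmodule] at hw ⊢
  intro n
  have h1 := hw ⟨g⁻¹ * n * g, by
    have := (inferInstance : N.Normal).conj_mem n n.2 g⁻¹; rwa [inv_inv] at this⟩
  have h2 : ρ n (ρ g w) = ρ g (ρ (g⁻¹ * n * g) w) := by
    rw [← Module.End.mul_apply, ← Module.End.mul_apply, ← map_mul, ← map_mul]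
    congr 2; group
  rw [h2, h1, map_smul]
  rfl

variable {ρ : Representation ℂ G V} {N : Subgroup G} [N.Normal] {f : N → ℂ} {S : Subgroup G}

/-- Conjugates of an eigencharacter correspond to the cosets of its stabiliser. -/
theorem conjFun_eq_iff (hS : ∀ g, g ∈ S ↔ conjFun N g f = f) (g h : G) :
    conjFun N g f = conjFun N h f ↔ (g : G ⧸ S) = h := by
  rw [QuotientGroup.eq, hS]
  constructor
  · intro e
    rw [conjFun_mul, ← e, ← conjFun_mul]
    funext n; simp [conjFun]
  · intro e
    have := congrArg (conjFun N g) e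
    rw [← conjFun_mul] at this
    rw [← this]; simp

/-- The translates of a subspace by coset representatives of a subgroup stabilising it span an
irreducible representation. -/
theorem iSup_map_eq_top (hρ : ρ.IsIrreducible) {p : Submodule ℂ V} (hp0 : p ≠ ⊥)
    (hpS : ∀ g ∈ S, ∀ w ∈ p, ρ g w ∈ p) :
    ⨆ q : G ⧸ S, p.map (ρ q.out) = ⊤ := by
  refine (eq_bot_or_eq_top_of_isIrreducible hρ _ ?_).resolve_left ?_
  · intro g w hw
    have hle : (⨆ q : G ⧸ S, p.map (ρ q.out)) ≤
        (⨆ q : G ⧸ S, p.map (ρ q.out)).comap (ρ g) := by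
      refine iSup_le fun q => ?_
      rintro _ ⟨x, hx, rfl⟩
      rw [Submodule.mem_comap]
      refine Submodule.mem_iSup_of_mem ((g * q.out : G) : G ⧸ S) ?_
      set q' : G ⧸ S := ((g * q.out : G) : G ⧸ S)
      have hs : q'.out⁻¹ * (g * q.out) ∈ S := by
        rw [← QuotientGroup.eq]; simp [q']
      refine ⟨ρ (q'.out⁻¹ * (g * q.out)) x, hpS _ hs x hx, ?_⟩
      rw [← Module.End.mul_apply, ← Module.End.mul_apply, ← map_mul, ← map_mul]
      congr 2; group
    exact hle hw
  · intro h
    obtain ⟨w, hw, hw0⟩ := p.exists_mem_ne_zero_of_ne_bot hp0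
    rw [iSup_eq_bot] at h
    have h1 := h ((1 : G) : G ⧸ S)
    have : ρ ((1 : G) : G ⧸ S).out w ∈ p.map (ρ ((1 : G) : G ⧸ S).out) := ⟨w, hw, rfl⟩
    rw [h1, Submodule.mem_bot] at this
    have h2 := congrArg (ρ (((1 : G) : G ⧸ S).out)⁻¹) this
    rw [← Module.End.mul_apply, ← map_mul] at h2
    simp at h2
    exact hw0 h2

/-- Clifford theory: the dimension of an irreducible representation is the index of the stabiliser
of an eigencharacter times the dimension of any non-zero subspace of the eigenspace stable under the
stabiliser. -/
theorem finrank_eq_index_mul [FiniteDimensional ℂ V] (hρ : ρ.IsIrreducible)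
    (hN : ∀ a b : N, ρ a * ρ b = ρ b * ρ a) (hS : ∀ g, g ∈ S ↔ conjFun N g f = f)
    {p : Submodule ℂ V} (hp : p ≤ eigenSubmodule ρ N f) (hp0 : p ≠ ⊥)
    (hpS : ∀ g ∈ S, ∀ w ∈ p, ρ g w ∈ p) :
    Module.finrank ℂ V = S.index * Module.finrank ℂ p := by
  classical
  have hind : iSupIndep fun q : G ⧸ S => p.map (ρ q.out) := by
    have h1 : Function.Injective fun q : G ⧸ S => conjFun N q.out f := by
      intro a b hab
      have := (conjFun_eq_iff hS a.out b.out).1 hab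
      simpa using this
    refine ((iSupIndep_eigenSubmodule ρ N hN).comp h1).mono fun q => ?_
    rintro _ ⟨x, hx, rfl⟩
    exact apply_mem_eigenSubmodule _ (hp hx)
  have hinj : ∀ g, Function.Injective (ρ g) := by
    intro g
    refine Function.LeftInverse.injective (g := ρ g⁻¹) fun w => ?_
    rw [← Module.End.mul_apply, ← map_mul]; simp
  have hfr : ∀ q : G ⧸ S, Module.finrank ℂ (p.map (ρ q.out)) = Module.finrank ℂ p := fun q =>
    (Submodule.equivMapOfInjective _ (hinj _) p).finrank_eq.symm
  have hfin : Finite (G ⧸ S) := by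
    refine WellFoundedGT.finite_of_iSupIndep hind fun q h => hp0 ?_
    rw [← Submodule.map_bot (ρ q.out)] at h
    exact Submodule.map_injective_of_injective (hinj _) h
  have := Fintype.ofFinite (G ⧸ S)
  have hint := DirectSum.isInternal_submodule_of_iSupIndep_of_iSup_eq_top hind
    (iSup_map_eq_top hρ hp0 hpS)
  have e := LinearEquiv.ofBijective
    (DirectSum.coeLinearMap fun q : G ⧸ S => p.map (ρ q.out)) hint
  rw [← e.finrank_eq, Module.finrank_directSum]
  simp_rw [hfr]
  rw [Finset.sum_const, Finset.card_univ, smul_eq_mul, Subgroup.index, Nat.card_eq_fintype_card]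

/-- The eigencharacters of a normal subgroup on an irreducible representation are conjugate. -/
theorem exists_conjFun_eq (hρ : ρ.IsIrreducible)
    (hN : ∀ a b : N, ρ a * ρ b = ρ b * ρ a) (hf : eigenSubmodule ρ N f ≠ ⊥)
    {f' : N → ℂ} (hf' : eigenSubmodule ρ N f' ≠ ⊥) : ∃ g, f' = conjFun N g f := by
  by_contra! h
  have hind := iSupIndep_eigenSubmodule ρ N hN f'
  have htop := iSup_map_eq_top (S := ⊥) hρ hf (by
    intro g hg w hw; rw [Subgroup.mem_bot.1 hg]; simpa using hw)
  have : (⊤ : Submodule ℂ V) ≤ ⨆ j, ⨆ (_ : j ≠ f'), eigenSubmodule ρ N j := by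
    rw [← htop]
    refine iSup_le fun q => ?_
    refine le_trans ?_ (le_iSup₂ (conjFun N q.out f) (h q.out).symm)
    rintro _ ⟨x, hx, rfl⟩
    exact apply_mem_eigenSubmodule _ hx
  rw [top_le_iff.1 this] at hind
  exact hf' (disjoint_top.1 hind)

/-- The eigenspace of an eigencharacter is irreducible under the stabiliser. -/
theorem eq_bot_or_eq_eigenSubmodule [FiniteDimensional ℂ V] (hρ : ρ.IsIrreducible)
    (hN : ∀ a b : N, ρ a * ρ b = ρ b * ρ a) (hS : ∀ g, g ∈ S ↔ conjFun N g f = f)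
    {p : Submodule ℂ V} (hp : p ≤ eigenSubmodule ρ N f)
    (hpS : ∀ g ∈ S, ∀ w ∈ p, ρ g w ∈ p) : p = ⊥ ∨ p = eigenSubmodule ρ N f := by
  rw [or_iff_not_imp_left]
  intro hp0
  have h1 := finrank_eq_index_mul hρ hN hS hp hp0 hpS
  have h2 := finrank_eq_index_mul (p := eigenSubmodule ρ N f) hρ hN hS le_rfl
    (fun h => hp0 (le_bot_iff.1 (h ▸ hp))) (fun g hg w hw => by
      have := apply_mem_eigenSubmodule g hw
      rwa [(hS g).1 hg] at this)
  have hpos : 0 < Module.finrank ℂ V := by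
    have := nontrivial_of_isIrreducible hρ
    exact Module.finrank_pos
  have h3 : 0 < S.index := by
    rcases Nat.eq_zero_or_pos S.index with h | h
    · rw [h, zero_mul] at h1; omega
    · exact h
  exact Submodule.eq_of_le_of_finrank_eq hp (Nat.eq_of_mul_eq_mul_left h3 (h1.symm.trans h2))

end Clifford

/-! ### Cyclic matrices -/

section Cyclic

variable {A B : Type*} [CommRing A] [CommRing B] {n : ℕ}

/-- The matrix with columns `v, x v, …, x ^ (n - 1) v`. -/
def krylov (x : Matrix (Fin n) (Fin n) A) (v : Fin n → A) : Matrix (Fin n) (Fin n) A :=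
  Matrix.of fun i j => ((x ^ (j : ℕ)).mulVec v) i

/-- A matrix is cyclic if `v, x v, …, x ^ (n - 1) v` is a basis for some vector `v`. Over a field
this is regularity; over a local ring it can be tested over the residue field. -/
def IsCyclicMatrix (x : Matrix (Fin n) (Fin n) A) : Prop := ∃ v, IsUnit (krylov x v).det

theorem krylov_map (f : A →+* B) (x : Matrix (Fin n) (Fin n) A) (v : Fin n → A) :
    krylov (x.map f) (f ∘ v) = (krylov x v).map f := by
  ext i j
  simp only [krylov, Matrix.of_apply, Matrix.map_apply]
  rw [← RingHom.mapMatrix_apply f x, ← map_pow, RingHom.mapMatrix_apply, f.map_mulVec]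

theorem IsCyclicMatrix.map {x : Matrix (Fin n) (Fin n) A} (hx : IsCyclicMatrix x) (f : A →+* B) :
    IsCyclicMatrix (x.map f) := by
  obtain ⟨v, hv⟩ := hx
  refine ⟨f ∘ v, ?_⟩
  rw [krylov_map, ← RingHom.mapMatrix_apply, ← RingHom.map_det]
  exact hv.map f

theorem IsCyclicMatrix.of_map {x : Matrix (Fin n) (Fin n) A} (f : A →+* B) [IsLocalHom f]
    (hf : Function.Surjective f) (hx : IsCyclicMatrix (x.map f)) : IsCyclicMatrix x := by
  obtain ⟨w, hw⟩ := hx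
  choose g hg using hf
  refine ⟨g ∘ w, ?_⟩
  have : f ∘ (g ∘ w) = w := by ext i; simp [hg]
  rw [← this, krylov_map, ← RingHom.mapMatrix_apply, ← RingHom.map_det] at hw
  exact isUnit_of_map_unit f _ hw

theorem mul_krylov {x a : Matrix (Fin n) (Fin n) A} (ha : a * x = x * a) (v : Fin n → A) (i j) :
    (a * krylov x v) i j = ((x ^ (j : ℕ)).mulVec (a.mulVec v)) i := by
  have h : Commute a (x ^ (j : ℕ)) := Commute.pow_right ha _
  rw [Matrix.mulVec_mulVec, ← h.eq, ← Matrix.mulVec_mulVec]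
  rfl

theorem aeval_mulVec_eq_krylov (x : Matrix (Fin n) (Fin n) A) (v c : Fin n → A) :
    (aeval x (∑ j, C (c j) * X ^ (j : ℕ))).mulVec v = (krylov x v).mulVec c := by
  ext i
  simp only [map_sum, map_mul, aeval_C, map_pow, aeval_X, Matrix.sum_mulVec, Finset.sum_apply]
  rw [Matrix.mulVec, dotProduct]
  refine Finset.sum_congr rfl fun j _ => ?_
  rw [← Matrix.mulVec_mulVec, Matrix.algebraMap_eq_diagonal, Matrix.mulVec_diagonal]
  simp [krylov, mul_comm]

theorem aeval_commute (x : Matrix (Fin n) (Fin n) A) (p : A[X]) :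
    aeval x p * x = x * aeval x p := by
  have := (Polynomial.commute_X p).map (aeval x)
  simpa using this.symm.eq

/-- The matrices commuting with a cyclic matrix are polynomials in it. -/
theorem IsCyclicMatrix.exists_aeval {x : Matrix (Fin n) (Fin n) A} (hx : IsCyclicMatrix x)
    {a : Matrix (Fin n) (Fin n) A} (ha : a * x = x * a) :
    ∃ c : Fin n → A, a = aeval x (∑ j, C (c j) * X ^ (j : ℕ)) := by
  obtain ⟨v, hv⟩ := hx
  refine ⟨(krylov x v)⁻¹.mulVec (a.mulVec v), ?_⟩
  have h1 := aeval_mulVec_eq_krylov x v ((krylov x v)⁻¹.mulVec (a.mulVec v))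
  rw [Matrix.mulVec_mulVec (a.mulVec v) (krylov x v), Matrix.mul_nonsing_inv _ hv,
    Matrix.one_mulVec] at h1
  set b := aeval x (∑ j, C ((krylov x v)⁻¹.mulVec (a.mulVec v) j) * X ^ (j : ℕ))
  have h2 : a * krylov x v = b * krylov x v := by
    ext i j
    rw [mul_krylov ha, mul_krylov (aeval_commute x _), h1]
  have h3 := congrArg (fun z => z * (krylov x v)⁻¹) h2
  simpa only [Matrix.mul_assoc, Matrix.mul_nonsing_inv _ hv, Matrix.mul_one] using h3

theorem IsCyclicMatrix.commute {x : Matrix (Fin n) (Fin n) A} (hx : IsCyclicMatrix x)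
    {a b : Matrix (Fin n) (Fin n) A} (ha : a * x = x * a) (hb : b * x = x * b) :
    a * b = b * a := by
  obtain ⟨c, rfl⟩ := hx.exists_aeval ha
  obtain ⟨d, rfl⟩ := hx.exists_aeval hb
  rw [← map_mul, mul_comm, map_mul]

theorem IsCyclicMatrix.coeff_injective {x : Matrix (Fin n) (Fin n) A} (hx : IsCyclicMatrix x)
    {c d : Fin n → A} (h : aeval x (∑ j, C (c j) * X ^ (j : ℕ)) =
      aeval x (∑ j, C (d j) * X ^ (j : ℕ))) : c = d := by
  obtain ⟨v, hv⟩ := hx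
  have h1 := congrArg (fun z => (krylov x v)⁻¹.mulVec (z.mulVec v)) h
  simpa only [aeval_mulVec_eq_krylov, Matrix.mulVec_mulVec, Matrix.nonsing_inv_mul _ hv,
    Matrix.one_mulVec] using h1

theorem eq_sum_of_natDegree_lt {p : A[X]} (h : p.natDegree < n) :
    p = ∑ j : Fin n, C (p.coeff j) * X ^ (j : ℕ) := by
  conv_lhs => rw [p.as_sum_range' n h, ← Fin.sum_univ_eq_sum_range]
  simp [C_mul_X_pow_eq_monomial]

theorem IsCyclicMatrix.eq_zero_of_aeval_eq_zero {x : Matrix (Fin n) (Fin n) A}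
    (hx : IsCyclicMatrix x) {p : A[X]} (hp : p.natDegree < n) (h : aeval x p = 0) : p = 0 := by
  have h2 := hx.coeff_injective (c := fun j => p.coeff j) (d := 0) (by
    rw [← eq_sum_of_natDegree_lt hp, h]; simp)
  rw [eq_sum_of_natDegree_lt hp]
  exact Finset.sum_eq_zero fun j _ => by
    rw [show p.coeff j = 0 from congrFun h2 j]; simp

/-- A matrix conjugate to a cyclic matrix is cyclic. -/
theorem IsCyclicMatrix.conj {x : Matrix (Fin n) (Fin n) A} (hx : IsCyclicMatrix x)
    {g g' : Matrix (Fin n) (Fin n) A} (hg : g' * g = 1) : IsCyclicMatrix (g * x * g') := by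
  obtain ⟨v, hv⟩ := hx
  refine ⟨g.mulVec v, ?_⟩
  have : krylov (g * x * g') (g.mulVec v) = g * krylov x v := by
    ext i j
    have hpow : ∀ k : ℕ, (g * x * g') ^ k * g = g * x ^ k := by
      intro k
      induction k with
      | zero => simp
      | succ k ih =>
        rw [pow_succ', Matrix.mul_assoc, ih, pow_succ']
        simp only [Matrix.mul_assoc]
        rw [← Matrix.mul_assoc g', hg, Matrix.one_mul]
    change (((g * x * g') ^ (j : ℕ)).mulVec (g.mulVec v)) i = _
    rw [Matrix.mulVec_mulVec, hpow, ← Matrix.mulVec_mulVec]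
    rfl
  rw [this, Matrix.det_mul]
  exact (IsUnit.of_mul_eq_one_right _ (by rw [← Matrix.det_mul, hg, Matrix.det_one])).mul hv

end Cyclic

section Field

variable {κ : Type*} [Field κ] {n : ℕ}

/-- Some vector has the minimal polynomial of `x` as its annihilator: a sum of vectors, one for each
prime factor of the minimal polynomial. -/
theorem exists_vector_annihilator (x : Matrix (Fin n) (Fin n) κ) :
    ∃ v : Fin n → κ, ∀ p : κ[X], (aeval x p).mulVec v = 0 → minpoly κ x ∣ p := by
  classical
  set m := minpoly κ x with hm
  have hm0 : m ≠ 0 := minpoly.ne_zero (Matrix.isIntegral x)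
  let F := (UniqueFactorizationMonoid.normalizedFactors m).toFinset
  have hF : ∀ p ∈ F, Irreducible p ∧ p ∣ m := fun p hp => by
    rw [Multiset.mem_toFinset] at hp
    exact ⟨UniqueFactorizationMonoid.irreducible_of_normalized_factor p hp,
      UniqueFactorizationMonoid.dvd_of_mem_normalizedFactors hp⟩
  have hfac : ∀ p ∈ F, ∃ e q, m = p ^ (e + 1) * q ∧ ¬ p ∣ q := by
    intro p hp
    obtain ⟨hirr, hdvd⟩ := hF p hp
    have hfin : FiniteMultiplicity p m := FiniteMultiplicity.of_not_isUnit hirr.not_isUnit hm0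
    obtain ⟨q, hq, hpq⟩ := hfin.exists_eq_pow_mul_and_not_dvd
    have : multiplicity p m ≠ 0 := by
      intro h
      rw [h, pow_zero, one_mul] at hq
      exact hpq (hq ▸ hdvd)
    obtain ⟨e, he⟩ := Nat.exists_eq_succ_of_ne_zero this
    exact ⟨e, q, by rw [← Nat.succ_eq_add_one, ← he]; exact hq, hpq⟩
  choose! e q hmq hpq using hfac
  have hv : ∀ p ∈ F, ∃ v : Fin n → κ, (aeval x (p ^ e p * q p)).mulVec v ≠ 0 := by
    intro p hp
    by_contra! h
    have h0 : aeval x (p ^ e p * q p) = 0 := by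
      ext i j
      have := congrFun (h (Pi.single j 1)) i
      simpa using this
    have h1 := minpoly.dvd κ x h0
    rw [← hm, hmq p hp, pow_succ, mul_assoc, mul_dvd_mul_iff_left (pow_ne_zero _ (hF p hp).1.ne_zero)]
      at h1
    have hq0 : q p ≠ 0 := fun h => hpq p hp (h ▸ dvd_zero p)
    have h2 : p ∣ 1 := (mul_dvd_mul_iff_right hq0).1 (by simpa using h1)
    exact (hF p hp).1.not_isUnit (isUnit_of_dvd_one h2)
  choose! v hv using hv
  refine ⟨∑ p ∈ F, (aeval x (q p)).mulVec (v p), fun g hg => ?_⟩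
  by_contra hmg
  -- the gcd of `g` and `m` divides `m / p` for some prime factor `p`
  obtain ⟨d, hd⟩ := EuclideanDomain.gcd_dvd_right g m
  have hkill : (aeval x (EuclideanDomain.gcd g m)).mulVec
      (∑ p ∈ F, (aeval x (q p)).mulVec (v p)) = 0 := by
    rw [EuclideanDomain.gcd_eq_gcd_ab, map_add, Matrix.add_mulVec, mul_comm g, map_mul, map_mul,
      ← Matrix.mulVec_mulVec, hg, hm, minpoly.aeval]
    simp
  have hdu : ¬ IsUnit d := by
    intro hu
    apply hmg
    have : m ∣ EuclideanDomain.gcd g m := by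
      obtain ⟨d', hd'⟩ := hu.exists_right_inv
      refine ⟨d', ?_⟩
      conv_rhs => rw [hd, mul_assoc, hd', mul_one]
    exact this.trans (EuclideanDomain.gcd_dvd_left g m)
  have hd0 : d ≠ 0 := by rintro rfl; rw [mul_zero] at hd; exact hm0 hd
  obtain ⟨p, hpirr, hpd⟩ := WfDvdMonoid.exists_irreducible_factor hdu hd0
  obtain ⟨p', hp'F, hassoc⟩ := UniqueFactorizationMonoid.exists_mem_normalizedFactors_of_dvd hm0
    hpirr (hpd.trans (Dvd.intro_left _ hd.symm))
  have hpF : p' ∈ F := Multiset.mem_toFinset.2 hp'F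
  have hp'd : p' ∣ d := hassoc.symm.dvd.trans hpd
  obtain ⟨d', rfl⟩ := hp'd
  have hgd : EuclideanDomain.gcd g m * d' = p' ^ e p' * q p' := by
    have h1 := hmq p' hpF
    have h2 : p' * (EuclideanDomain.gcd g m * d') = p' * (p' ^ e p' * q p') := by
      calc p' * (EuclideanDomain.gcd g m * d') = EuclideanDomain.gcd g m * (p' * d') := by ring
        _ = m := hd.symm
        _ = _ := by rw [h1]; ring
    exact mul_left_cancel₀ (hF p' hpF).1.ne_zero h2
  have hkill2 : (aeval x (p' ^ e p' * q p')).mulVec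
      (∑ p ∈ F, (aeval x (q p)).mulVec (v p)) = 0 := by
    rw [← hgd, mul_comm, map_mul, ← Matrix.mulVec_mulVec, hkill, Matrix.mulVec_zero]
  rw [Matrix.mulVec_sum, Finset.sum_eq_single p'] at hkill2
  · set y := (aeval x (p' ^ e p' * q p')).mulVec (v p') with hy
    have hqy : (aeval x (q p')).mulVec y = 0 := by
      rw [hy, Matrix.mulVec_mulVec, ← map_mul, mul_comm, map_mul, ← Matrix.mulVec_mulVec]
      exact hkill2
    have hpy : (aeval x p').mulVec y = 0 := by
      rw [hy, Matrix.mulVec_mulVec, ← map_mul,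
        show p' * (p' ^ e p' * q p') = m by rw [hmq p' hpF]; ring, hm, minpoly.aeval,
        Matrix.zero_mulVec]
    obtain ⟨a, b, hab⟩ := ((hF p' hpF).1.coprime_iff_not_dvd).2 (hpq p' hpF)
    apply hv p' hpF
    rw [← hy]
    calc y = (aeval x (a * p' + b * q p')).mulVec y := by rw [hab]; simp
      _ = 0 := by
        rw [map_add, map_mul, map_mul, Matrix.add_mulVec, ← Matrix.mulVec_mulVec,
          ← Matrix.mulVec_mulVec, hqy, hpy]
        simp
  · intro r hr hne
    rw [Matrix.mulVec_mulVec, ← map_mul]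
    have hrdvd : r ^ (e r + 1) ∣ p' ^ e p' * q p' := by
      have hcop : IsCoprime (r ^ (e r + 1)) p' := by
        refine IsCoprime.pow_left (((hF r hr).1.coprime_iff_not_dvd).2 fun h => hne ?_)
        have hass := (hF r hr).1.associated_of_dvd (hF p' hpF).1 h
        rw [← UniqueFactorizationMonoid.normalize_normalized_factor r (Multiset.mem_toFinset.1 hr),
          ← UniqueFactorizationMonoid.normalize_normalized_factor p' hp'F]
        exact normalize_eq_normalize_iff_associated.2 hass
      refine hcop.dvd_of_dvd_mul_left (?_ : _ ∣ p' * (p' ^ e p' * q p'))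
      rw [← mul_assoc, ← pow_succ', ← hmq p' hpF, hmq r hr]
      exact Dvd.intro _ rfl
    obtain ⟨s, hs⟩ := hrdvd
    have : p' ^ e p' * q p' * q r = m * s := by rw [hs, hmq r hr]; ring
    rw [this, map_mul, hm, minpoly.aeval, zero_mul, Matrix.zero_mulVec]
  · exact fun h => absurd hpF h

theorem coeff_sum_fin {A : Type*} [CommRing A] (c : Fin n → A) (i : Fin n) :
    (∑ j : Fin n, C (c j) * X ^ (j : ℕ)).coeff i = c i := by
  rw [finsetSum_coeff, Finset.sum_eq_single i]
  · simp
  · intro j _ hj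
    rw [coeff_C_mul_X_pow, if_neg (fun h => hj (Fin.ext h.symm))]
  · simp

theorem isCyclicMatrix_of_isRegularMatrix {x : Matrix (Fin n) (Fin n) κ}
    (hx : IsRegularMatrix x) : IsCyclicMatrix x := by
  obtain ⟨v, hv⟩ := exists_vector_annihilator x
  refine ⟨v, ?_⟩
  rw [← Matrix.isUnit_iff_isUnit_det, ← Matrix.mulVec_injective_iff_isUnit]
  intro c d hcd
  set p : κ[X] := ∑ j : Fin n, C ((c - d) j) * X ^ (j : ℕ) with hp
  have h1 : (aeval x p).mulVec v = 0 := by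
    rw [hp, aeval_mulVec_eq_krylov, Matrix.mulVec_sub, sub_eq_zero]; exact hcd
  have h2 : p = 0 := by
    refine eq_zero_of_dvd_of_degree_lt (hv p h1) ?_
    rw [← hx, Matrix.charpoly_degree_eq_dim, Fintype.card_fin]
    exact degree_sum_fin_lt _
  funext i
  have := coeff_sum_fin (c - d) i
  rw [← hp, h2, coeff_zero] at this
  exact (sub_eq_zero.1 this.symm)

theorem isRegularMatrix_iff_forall_aeval {x : Matrix (Fin n) (Fin n) κ} :
    IsRegularMatrix x ↔ ∀ p : κ[X], p.natDegree < n → aeval x p = 0 → p = 0 := by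
  constructor
  · intro hx p hp h
    exact (isCyclicMatrix_of_isRegularMatrix hx).eq_zero_of_aeval_eq_zero hp h
  · intro hx
    refine (eq_of_monic_of_dvd_of_natDegree_le (minpoly.monic (Matrix.isIntegral x))
      x.charpoly_monic (Matrix.minpoly_dvd_charpoly x) ?_)
    rw [Matrix.charpoly_natDegree_eq_dim, Fintype.card_fin]
    by_contra! h
    exact minpoly.ne_zero (Matrix.isIntegral x) (hx _ h (minpoly.aeval κ x))

theorem isCyclicMatrix_iff_isRegularMatrix {x : Matrix (Fin n) (Fin n) κ} :
    IsCyclicMatrix x ↔ IsRegularMatrix x :=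
  ⟨fun hx => isRegularMatrix_iff_forall_aeval.2 fun _ hp h => hx.eq_zero_of_aeval_eq_zero hp h,
    isCyclicMatrix_of_isRegularMatrix⟩

theorem IsRegularMatrix.affine {x : Matrix (Fin n) (Fin n) κ} (hx : IsRegularMatrix x) {a : κ}
    (ha : a ≠ 0) (b : κ) : IsRegularMatrix (a • x + algebraMap κ _ b) := by
  rw [isRegularMatrix_iff_forall_aeval] at hx ⊢
  intro p hp h
  have hl : (C a * X + C b : κ[X]).natDegree = 1 := natDegree_linear ha
  have h1 : aeval x (p.comp (C a * X + C b)) = 0 := by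
    rw [aeval_comp, ← h]
    congr 1
    simp [Algebra.smul_def]
  have h2 := hx _ (by rw [natDegree_comp, hl, mul_one]; exact hp) h1
  rw [comp_eq_zero_iff] at h2
  rcases h2 with h2 | ⟨-, h2⟩
  · exact h2
  · have := congrArg natDegree h2
    rw [hl, natDegree_C] at this
    exact absurd this one_ne_zero

end Field

/-! ### Congruence subgroups and Cayley transforms -/

section Reduction

variable {R : Type*} [CommRing R] {n : ℕ}

/-- Reduction of matrices modulo the `i`-th power of the maximal ideal. -/
def redMat (n : ℕ) (R : Type*) [CommRing R] [IsLocalRing R] (i : ℕ) :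
    Matrix (Fin n) (Fin n) R →+* Matrix (Fin n) (Fin n) (R ⧸ maximalIdeal R ^ i) :=
  (Ideal.Quotient.mk (maximalIdeal R ^ i)).mapMatrix

theorem redMat_one_eq_iff [IsLocalRing R] {a b : Matrix (Fin n) (Fin n) R} :
    redMat n R 1 a = redMat n R 1 b ↔ a.map (residue R) = b.map (residue R) := by
  have hm : ∀ x y : R, (Ideal.Quotient.mk (maximalIdeal R ^ 1)) x =
      (Ideal.Quotient.mk (maximalIdeal R ^ 1)) y ↔ residue R x = residue R y := by
    intro x y
    rw [Ideal.Quotient.mk_eq_mk_iff_sub_mem, pow_one]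
    exact (Ideal.Quotient.mk_eq_mk_iff_sub_mem x y).symm
  constructor
  · intro h; ext j k; exact (hm _ _).1 (congrFun (congrFun h j) k)
  · intro h; ext j k; exact (hm _ _).2 (congrFun (congrFun h j) k)

theorem residue_irreducible [IsLocalRing R] {π : R} (hπ : Irreducible π) : residue R π = 0 := by
  rw [residue_eq_zero_iff]; exact (mem_maximalIdeal π).2 hπ.not_isUnit

variable [IsDomain R] [IsDiscreteValuationRing R] {π : R}

theorem redMat_eq_iff (hπ : Irreducible π) {i : ℕ} {a b : Matrix (Fin n) (Fin n) R} :
    redMat n R i a = redMat n R i b ↔ ∃ c, a = b + π ^ i • c := by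
  have hm : ∀ x y : R, (Ideal.Quotient.mk (maximalIdeal R ^ i)) x =
      (Ideal.Quotient.mk (maximalIdeal R ^ i)) y ↔ ∃ z, x = y + π ^ i * z := by
    intro x y
    rw [Ideal.Quotient.mk_eq_mk_iff_sub_mem, hπ.maximalIdeal_eq, Ideal.span_singleton_pow,
      Ideal.mem_span_singleton]
    exact ⟨fun ⟨z, hz⟩ => ⟨z, by rw [← hz]; ring⟩, fun ⟨z, hz⟩ => ⟨z, by rw [hz]; ring⟩⟩
  constructor
  · intro h
    have h1 : ∀ j k, ∃ z, a j k = b j k + π ^ i * z := fun j k =>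
      (hm _ _).1 (congrFun (congrFun h j) k)
    choose c hc using h1
    exact ⟨Matrix.of c, by ext j k; simp [hc]⟩
  · rintro ⟨c, rfl⟩
    ext j k
    exact (hm _ _).2 ⟨c j k, by simp⟩

theorem redMat_smul_pow (hπ : Irreducible π) {i j : ℕ} (h : i ≤ j)
    (c : Matrix (Fin n) (Fin n) R) : redMat n R i (π ^ j • c) = 0 := by
  rw [← map_zero (redMat n R i), redMat_eq_iff hπ]
  obtain ⟨k, rfl⟩ := Nat.exists_eq_add_of_le h
  exact ⟨π ^ k • c, by rw [zero_add, smul_smul, ← pow_add]⟩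

theorem redMat_eq_zero_iff (hπ : Irreducible π) {i : ℕ} {a : Matrix (Fin n) (Fin n) R} :
    redMat n R i a = 0 ↔ ∃ c, a = π ^ i • c := by
  rw [← map_zero (redMat n R i), redMat_eq_iff hπ]
  simp

theorem map_residue_eq_zero_iff (hπ : Irreducible π) {a : Matrix (Fin n) (Fin n) R} :
    a.map (residue R) = 0 ↔ ∃ c, a = π • c := by
  have h : redMat n R 1 a = 0 ↔ ∃ c, a = π • c := by
    rw [redMat_eq_zero_iff hπ]; simp only [pow_one]
  rw [← h, ← map_zero (redMat n R 1), redMat_one_eq_iff]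
  constructor
  · intro h; rw [h]; ext; simp
  · intro h; rw [h]; ext; simp

end Reduction

/-- In an algebra, the Cayley transforms `(2 + z) (2 - z)⁻¹` of nilpotent elements multiply by the
first terms of the Baker–Campbell–Hausdorff formula, up to terms of degree three. -/
theorem cayley_mul {A Q : Type*} [CommRing A] [Ring Q] [Algebra A Q] {t : A} (ht : t ^ 3 = 0)
    (h2 : IsUnit (2 : A)) {g h l y w b : Q} (hb : b + b = y * w - w * y)
    (hg : g * (2 - t • y) = 2 + t • y) (hh : h * (2 - t • w) = 2 + t • w)
    (hl : l * (2 - t • (y + w + t • b)) = 2 + t • (y + w + t • b)) : g * h = l := by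
  have h2' : ∀ {a c : Q}, (2 : A) • a = (2 : A) • c → a = c := fun {a c} hac => by
    exact h2.smul_left_cancel.1 hac
  -- a Cayley transform is `1 + t z + t ^ 2 z ^ 2 / 2`, as `t ^ 3 = 0`
  have key : ∀ {g z : Q}, g * (2 - t • z) = 2 + t • z →
      (2 : A) • g = (2 : A) • 1 + (2 * t) • z + t ^ 2 • (z * z) := by
    intro g z hgz
    have h1 : g * (2 - t • z) * (4 + (2 * t) • z + t ^ 2 • (z * z)) =
        (2 + t • z) * (4 + (2 * t) • z + t ^ 2 • (z * z)) := by rw [hgz]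
    have h3 : (2 - t • z) * (4 + (2 * t) • z + t ^ 2 • (z * z)) = (8 : A) • (1 : Q) := by
      have : (2 - t • z) * (4 + (2 * t) • z + t ^ 2 • (z * z)) =
          (8 : A) • (1 : Q) - t ^ 3 • (z * (z * z)) := by
        have e2 : (2 : Q) = (2 : A) • 1 := by rw [ofNat_smul_eq_nsmul]; simp
        have e4 : (4 : Q) = (4 : A) • 1 := by rw [ofNat_smul_eq_nsmul]; simp
        rw [e2, e4]
        simp only [sub_mul, mul_add, smul_mul_assoc, mul_smul_comm, one_mul, mul_one]
        module
      rw [this, ht, zero_smul, sub_zero]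
    rw [mul_assoc, h3] at h1
    have h4 : (2 + t • z) * (4 + (2 * t) • z + t ^ 2 • (z * z)) =
        (4 : A) • ((2 : A) • 1 + (2 * t) • z + t ^ 2 • (z * z)) + t ^ 3 • (z * (z * z)) := by
      have e2 : (2 : Q) = (2 : A) • 1 := by rw [ofNat_smul_eq_nsmul]; simp
      have e4 : (4 : Q) = (4 : A) • 1 := by rw [ofNat_smul_eq_nsmul]; simp
      rw [e2, e4]
      simp only [add_mul, mul_add, smul_mul_assoc, mul_smul_comm, one_mul, mul_one]
      module
    rw [h4, ht, zero_smul, add_zero, mul_smul_comm, mul_one] at h1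
    apply h2'
    apply h2'
    rw [smul_smul, smul_smul, smul_smul]
    convert h1 using 2 <;> norm_num
  have kg := key hg
  have kh := key hh
  have kl := key hl
  apply h2'
  apply h2'
  have e1 : (2 : A) • (2 : A) • (g * h) = ((2 : A) • g) * ((2 : A) • h) := by
    rw [smul_mul_assoc, mul_smul_comm]
  rw [e1, kl, kg, kh]
  simp only [add_mul, mul_add, smul_mul_assoc, mul_smul_comm, one_mul, mul_one, smul_smul, smul_add,
    mul_assoc]
  have hb' : (2 * t ^ 2) • b + (2 * t ^ 2) • b = (2 * t ^ 2) • (y * w) - (2 * t ^ 2) • (w * y) := by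
    rw [← smul_add, hb, smul_sub]
  linear_combination (norm := module) -hb' + ht • ((2 : A) • (y * (w * w)) + (2 : A) • (y * (y * w)) +
    t • (y * (y * (w * w))) - (2 : A) • (y * b + b * y + w * b + b * w) - (2 * t) • (b * b))

section CayleyPair

variable {R G : Type*} [CommRing R] [IsDomain R] [IsDiscreteValuationRing R] [Group G] {n : ℕ}

/-- A group `G` of invertible matrices over the discrete valuation ring `R` and an additive group
`𝔤` of matrices, its Lie algebra, related by the Cayley transform `π y ↦ (2 + π y) (2 - π y)⁻¹`: the
properties shared by `GL_n` and by unitary groups over unramified quadratic extensions. The last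
field says that an element of `G` approximating a matrix that commutes with `x ∈ 𝔤` may be corrected
to commute with `x`. -/
structure IsCayleyPair (ι : G →* GL (Fin n) R) (𝔤 : AddSubgroup (Matrix (Fin n) (Fin n) R))
    (π : R) : Prop where
  injective : Function.Injective ι
  irreducible : Irreducible π
  isUnit_two : IsUnit (2 : R)
  smul_mem : ∀ y, π • y ∈ 𝔤 ↔ y ∈ 𝔤
  half : ∀ y ∈ 𝔤, ∃ b ∈ 𝔤, b + b = y
  lie_mem : ∀ y ∈ 𝔤, ∀ w ∈ 𝔤, y * w - w * y ∈ 𝔤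
  conj_mem : ∀ (g : G), ∀ y ∈ 𝔤, (ι g : Matrix (Fin n) (Fin n) R) * y *
    ((ι g)⁻¹ : GL (Fin n) R) ∈ 𝔤
  exists_cayley : ∀ y ∈ 𝔤, ∃ g : G,
    (ι g : Matrix (Fin n) (Fin n) R) * (2 - π • y) = 2 + π • y
  exists_cayley_inv : ∀ g ∈ congruenceSubgroup ι 1, ∃ y ∈ 𝔤,
    (ι g : Matrix (Fin n) (Fin n) R) * (2 - π • y) = 2 + π • y
  exists_commute_group : ∀ x ∈ 𝔤, ∀ a, a * x = x * a → ∀ (g : G) (i : ℕ), 1 ≤ i →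
    redMat n R i a = redMat n R i (ι g) → ∃ c : G,
      (ι c : Matrix (Fin n) (Fin n) R) * x = x * ι c ∧
      redMat n R i (ι c) = redMat n R i (ι g)

theorem mem_congruenceSubgroup {ι : G →* GL (Fin n) R} {i : ℕ} {g : G} :
    g ∈ congruenceSubgroup ι i ↔ redMat n R i (ι g) = 1 := by
  rw [congruenceSubgroup, MonoidHom.mem_ker, Units.ext_iff]
  rfl

instance normal_congruenceSubgroup (ι : G →* GL (Fin n) R) (i : ℕ) :
    (congruenceSubgroup ι i).Normal := by
  unfold congruenceSubgroup; infer_instance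

theorem redMat_inv_mul_eq_one_iff {ι : G →* GL (Fin n) R} {i : ℕ} {g h : G} :
    g⁻¹ * h ∈ congruenceSubgroup ι i ↔ redMat n R i (ι g) = redMat n R i (ι h) := by
  rw [mem_congruenceSubgroup, map_mul, Units.val_mul, map_mul]
  have h1 : redMat n R i (ι g) * redMat n R i (ι g⁻¹) = 1 := by
    rw [← map_mul, ← Units.val_mul, ← map_mul]; simp
  have h2 : redMat n R i (ι g⁻¹) * redMat n R i (ι g) = 1 := by
    rw [← map_mul, ← Units.val_mul, ← map_mul]; simp
  constructor
  · intro h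
    have := congrArg (fun z => redMat n R i (ι g) * z) h
    simp only [← mul_assoc, h1, one_mul, mul_one] at this
    exact this.symm
  · intro h; rw [← h, h2]

theorem redMat_eq_of_le {π : R} (hπ : Irreducible π) {i j : ℕ} (hij : i ≤ j)
    {a b : Matrix (Fin n) (Fin n) R} (h : redMat n R j a = redMat n R j b) :
    redMat n R i a = redMat n R i b := by
  rw [redMat_eq_iff hπ] at h ⊢
  obtain ⟨c, rfl⟩ := h
  obtain ⟨k, rfl⟩ := Nat.exists_eq_add_of_le hij
  exact ⟨π ^ k • c, by rw [smul_smul, ← pow_add]⟩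

/-- The stabiliser of `x` modulo the `i`-th power of the maximal ideal. -/
def stabMod (ι : G →* GL (Fin n) R) (x : Matrix (Fin n) (Fin n) R) (i : ℕ) : Subgroup G where
  carrier := {g | redMat n R i (ι g * x) = redMat n R i (x * ι g)}
  one_mem' := by simp
  mul_mem' := by
    intro a b ha hb
    simp only [Set.mem_ofPred_eq, map_mul, Units.val_mul] at ha hb ⊢
    rw [mul_assoc, hb, ← mul_assoc, ha, mul_assoc]
  inv_mem' := by
    intro a ha
    simp only [Set.mem_ofPred_eq, map_mul] at ha ⊢
    have h1 : redMat n R i (ι a) * redMat n R i (ι a⁻¹) = 1 := by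
      rw [← map_mul, ← Units.val_mul, ← map_mul]; simp
    have h2 : redMat n R i (ι a⁻¹) * redMat n R i (ι a) = 1 := by
      rw [← map_mul, ← Units.val_mul, ← map_mul]; simp
    calc redMat n R i (ι a⁻¹) * redMat n R i x
        = redMat n R i (ι a⁻¹) * (redMat n R i x * redMat n R i (ι a)) * redMat n R i (ι a⁻¹) := by
          rw [mul_assoc, mul_assoc, h1, mul_one]
      _ = redMat n R i x * redMat n R i (ι a⁻¹) := by
          rw [← ha, ← mul_assoc, h2, one_mul]

theorem mem_stabMod {ι : G →* GL (Fin n) R} {x : Matrix (Fin n) (Fin n) R} {i : ℕ} {g : G} :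
    g ∈ stabMod ι x i ↔ redMat n R i (ι g * x) = redMat n R i (x * ι g) := Iff.rfl

namespace IsCayleyPair

variable {ι : G →* GL (Fin n) R} {𝔤 : AddSubgroup (Matrix (Fin n) (Fin n) R)} {π : R}

theorem pow_smul_mem (H : IsCayleyPair ι 𝔤 π) (i : ℕ) (y) : π ^ i • y ∈ 𝔤 ↔ y ∈ 𝔤 := by
  induction i with
  | zero => simp
  | succ i ih => rw [pow_succ', ← smul_smul, H.smul_mem, ih]

theorem isUnit_two_quot (H : IsCayleyPair ι 𝔤 π) (i : ℕ) :
    IsUnit (2 : R ⧸ maximalIdeal R ^ i) := by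
  have := H.isUnit_two.map (Ideal.Quotient.mk (maximalIdeal R ^ i))
  rwa [map_ofNat] at this

theorem smul_pow_injective (H : IsCayleyPair ι 𝔤 π) (i : ℕ)
    {a b : Matrix (Fin n) (Fin n) R} (h : π ^ i • a = π ^ i • b) : a = b := by
  ext j k
  have := congrFun (congrFun h j) k
  simp only [Matrix.smul_apply, smul_eq_mul] at this
  exact mul_left_cancel₀ (pow_ne_zero i H.irreducible.ne_zero) this

theorem two_smul_injective (H : IsCayleyPair ι 𝔤 π)
    {a b : Matrix (Fin n) (Fin n) R} (h : a + a = b + b) : a = b := by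
  rw [← two_smul R a, ← two_smul R b] at h
  exact H.isUnit_two.smul_left_cancel.1 h

/-- An element of `G` which is the Cayley transform of `π ^ i y`, for `y ∈ 𝔤` and `i ≥ 1`. -/
theorem exists_cayley_pow (H : IsCayleyPair ι 𝔤 π) {i : ℕ} (hi : 1 ≤ i) (y : 𝔤) :
    ∃ g : G, (ι g : Matrix (Fin n) (Fin n) R) * (2 - π ^ i • (y : Matrix (Fin n) (Fin n) R)) =
      2 + π ^ i • (y : Matrix (Fin n) (Fin n) R) := by
  obtain ⟨j, rfl⟩ := Nat.exists_eq_add_of_le hi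
  obtain ⟨g, hg⟩ := H.exists_cayley (π ^ j • y) ((H.pow_smul_mem j y).2 y.2)
  refine ⟨g, ?_⟩
  rw [smul_smul, ← pow_succ', add_comm j 1] at hg
  exact hg

/-- The Cayley transform of `π ^ i y`, as an element of `G`. -/
noncomputable def cay (H : IsCayleyPair ι 𝔤 π) {i : ℕ} (hi : 1 ≤ i) (y : 𝔤) : G :=
  (H.exists_cayley_pow hi y).choose

theorem cay_spec (H : IsCayleyPair ι 𝔤 π) {i : ℕ} (hi : 1 ≤ i) (y : 𝔤) :
    (ι (H.cay hi y) : Matrix (Fin n) (Fin n) R) *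
      (2 - π ^ i • (y : Matrix (Fin n) (Fin n) R)) =
      2 + π ^ i • (y : Matrix (Fin n) (Fin n) R) :=
  (H.exists_cayley_pow hi y).choose_spec

/-- The Cayley transform of `π ^ i y` is `1 + π ^ i y` to first order. -/
theorem redMat_eq_of_cayley (H : IsCayleyPair ι 𝔤 π) {i j : ℕ} (hij : j ≤ 2 * i)
    {a y : Matrix (Fin n) (Fin n) R} (ha : a * (2 - π ^ i • y) = 2 + π ^ i • y) :
    redMat n R j a = redMat n R j (1 + π ^ i • y) := by
  rw [redMat_eq_iff H.irreducible]
  obtain ⟨k, hk⟩ := Nat.exists_eq_add_of_le hij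
  -- `2 a = 2 + π ^ i y + a π ^ i y`, and `a = 1 + O(π ^ i)`
  have e1 : a + a = 1 + 1 + π ^ i • (y + a * y) := by
    have : a * (2 - π ^ i • y) = a + a - π ^ i • (a * y) := by
      rw [mul_sub, mul_two, mul_smul_comm]
    rw [this] at ha
    rw [smul_add]
    linear_combination (norm := abel) ha - one_add_one_eq_two (R := Matrix (Fin n) (Fin n) R)
  obtain ⟨h, hh⟩ := H.isUnit_two.exists_right_inv
  have e2 : a = 1 + π ^ i • (h • (y + a * y)) := by
    apply H.two_smul_injective
    rw [e1]
    have : (h • (y + a * y)) + (h • (y + a * y)) = y + a * y := by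
      rw [← two_smul R (h • (y + a * y)), smul_smul, hh, one_smul]
    calc 1 + 1 + π ^ i • (y + a * y) = 1 + 1 + π ^ i • ((h • (y + a * y)) + (h • (y + a * y))) := by
          rw [this]
      _ = _ := by rw [smul_add]; abel
  -- a second substitution of `a = 1 + π ^ i d` into `2 a = 2 + π ^ i (y + a y)`
  set d := h • (y + a * y) with hd
  refine ⟨π ^ k • h • (d * y), ?_⟩
  have e3 : π ^ j • π ^ k • h • (d * y) = (π ^ i * π ^ i) • h • (d * y) := by
    rw [smul_smul, ← pow_add, ← hk, two_mul, pow_add]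
  rw [e3]
  apply H.two_smul_injective
  have e4 : h • (d * y) + h • (d * y) = d * y := by
    rw [← two_smul R (h • (d * y)), smul_smul, hh, one_smul]
  calc a + a = 1 + 1 + π ^ i • (y + a * y) := e1
    _ = 1 + 1 + π ^ i • (y + (1 + π ^ i • d) * y) := by rw [← e2]
    _ = 1 + 1 + π ^ i • (y + y) + (π ^ i * π ^ i) • (h • (d * y) + h • (d * y)) := by
        rw [e4, add_mul, one_mul, smul_mul_assoc, mul_smul]
        simp only [smul_add]; abel
    _ = _ := by simp only [smul_add]; abel

theorem redMat_cay (H : IsCayleyPair ι 𝔤 π) {i j : ℕ} (hi : 1 ≤ i) (hij : j ≤ 2 * i) (y : 𝔤) :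
    redMat n R j (ι (H.cay hi y)) = redMat n R j (1 + π ^ i • (y : Matrix (Fin n) (Fin n) R)) :=
  H.redMat_eq_of_cayley hij (H.cay_spec hi y)

theorem cay_mem (H : IsCayleyPair ι 𝔤 π) {i : ℕ} (hi : 1 ≤ i) (y : 𝔤) :
    H.cay hi y ∈ congruenceSubgroup ι i := by
  rw [mem_congruenceSubgroup, H.redMat_cay hi (by omega), map_add, map_one,
    redMat_smul_pow H.irreducible le_rfl, add_zero]

theorem isUnit_two_sub (H : IsCayleyPair ι 𝔤 π) {i : ℕ} (hi : 1 ≤ i)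
    (y : Matrix (Fin n) (Fin n) R) : IsUnit (2 - π ^ i • y) := by
  rw [Matrix.isUnit_iff_isUnit_det]
  have hloc : IsLocalHom (residue R) := inferInstance
  apply isUnit_of_map_unit (residue R)
  rw [RingHom.map_det, ← Matrix.isUnit_iff_isUnit_det, map_sub]
  have : (residue R).mapMatrix (π ^ i • y) = 0 := by
    rw [RingHom.mapMatrix_apply, map_residue_eq_zero_iff H.irreducible]
    obtain ⟨j, rfl⟩ := Nat.exists_eq_add_of_le hi
    exact ⟨π ^ j • y, by rw [smul_smul, ← pow_succ', add_comm]⟩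
  rw [this, sub_zero]
  have h2 := (H.isUnit_two.map (algebraMap R (Matrix (Fin n) (Fin n) R))).map
    ((residue R).mapMatrix : Matrix (Fin n) (Fin n) R →+* _)
  rwa [map_ofNat] at h2

theorem cay_eq_of_spec (H : IsCayleyPair ι 𝔤 π) {i : ℕ} (hi : 1 ≤ i) {y : 𝔤} {g : G}
    (hg : (ι g : Matrix (Fin n) (Fin n) R) * (2 - π ^ i • (y : Matrix (Fin n) (Fin n) R)) =
      2 + π ^ i • (y : Matrix (Fin n) (Fin n) R)) : H.cay hi y = g := by
  apply H.injective
  apply Units.ext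
  exact (H.isUnit_two_sub hi y).mul_right_cancel ((H.cay_spec hi y).trans hg.symm)

/-- The congruence subgroups consist of Cayley transforms. -/
theorem exists_cay_eq (H : IsCayleyPair ι 𝔤 π) {i : ℕ} (hi : 1 ≤ i) {g : G}
    (hg : g ∈ congruenceSubgroup ι i) : ∃ y : 𝔤, H.cay hi y = g := by
  have hg1 : g ∈ congruenceSubgroup ι 1 := by
    rw [mem_congruenceSubgroup] at hg ⊢
    rw [← map_one (redMat n R 1)]
    exact redMat_eq_of_le H.irreducible hi (by rw [hg, map_one])
  obtain ⟨y, hy, hgy⟩ := H.exists_cayley_inv g hg1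
  have hgi := hg
  rw [mem_congruenceSubgroup, ← map_one (redMat n R i), redMat_eq_iff H.irreducible] at hgi
  obtain ⟨c, hc⟩ := hgi
  obtain ⟨h, hh⟩ := H.isUnit_two.exists_right_inv
  have e1 : π • (y + y) = π ^ i • (c * (2 - π • y)) := by
    rw [hc, add_mul, one_mul, smul_mul_assoc] at hgy
    rw [smul_add]
    linear_combination (norm := abel) -hgy
  obtain ⟨j, rfl⟩ := Nat.exists_eq_add_of_le hi
  have e2 : y = π ^ j • (h • (c * (2 - π • y))) := by
    apply H.two_smul_injective
    have e3 : y + y = π ^ j • (c * (2 - π • y)) := by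
      apply H.smul_pow_injective 1
      rw [pow_one, e1, smul_smul, ← pow_succ', add_comm]
    rw [← smul_add, ← two_smul R (h • (c * (2 - π • y))), smul_smul 2 h, hh, one_smul, ← e3]
  have hmem : h • (c * (2 - π • y)) ∈ 𝔤 := (H.pow_smul_mem j _).1 (e2 ▸ hy)
  refine ⟨⟨_, hmem⟩, H.cay_eq_of_spec hi ?_⟩
  have e4 : π ^ (1 + j) • (h • (c * (2 - π • y))) = π • y := by
    rw [add_comm, pow_succ', ← smul_smul, ← e2]
  simp only [e4]
  exact hgy

/-- The stabiliser of `x` modulo `𝔭 ^ i` is the product of the `i`-th congruence subgroup and the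
centralizer of `x`: modulo `𝔭 ^ i`, its elements are polynomials in `x`, as `x` is cyclic, and these
lift. -/
theorem exists_eq_mul_of_mem_stabMod (H : IsCayleyPair ι 𝔤 π)
    {x : Matrix (Fin n) (Fin n) R} (hx : x ∈ 𝔤) (hcyc : IsCyclicMatrix x) {i : ℕ} (hi : 1 ≤ i)
    {g : G} (hg : g ∈ stabMod ι x i) :
    ∃ c : G, (ι c : Matrix (Fin n) (Fin n) R) * x = x * ι c ∧
      ∃ k ∈ congruenceSubgroup ι i, g = k * c := by
  rw [mem_stabMod, map_mul, map_mul] at hg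
  obtain ⟨d, hd⟩ := (hcyc.map (Ideal.Quotient.mk (maximalIdeal R ^ i))).exists_aeval hg
  choose f hf using Ideal.Quotient.mk_surjective (I := maximalIdeal R ^ i)
  set a := aeval x (∑ j, C (f (d j)) * X ^ (j : ℕ)) with ha
  have hred : redMat n R i a = redMat n R i (ι g) := by
    rw [hd, ha]
    simp only [map_sum, map_mul, aeval_C, map_pow, aeval_X]
    refine Finset.sum_congr rfl fun j _ => ?_
    congr 1
    rw [Matrix.algebraMap_eq_diagonal, Matrix.algebraMap_eq_diagonal, redMat,
      RingHom.mapMatrix_apply, Matrix.diagonal_map (map_zero _)]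
    congr 1
    funext k
    exact hf (d j)
  obtain ⟨c, hc, hcg⟩ := H.exists_commute_group x hx a (aeval_commute x _) g i hi hred
  refine ⟨c, hc, g * c⁻¹, ?_, by group⟩
  have := redMat_inv_mul_eq_one_iff.2 hcg
  have h2 := (normal_congruenceSubgroup ι i).conj_mem _ this c
  rw [show c * (c⁻¹ * g) * c⁻¹ = g * c⁻¹ by group] at h2
  exact h2

theorem mem_stabMod_of_commute {x : Matrix (Fin n) (Fin n) R} {c : G}
    (hc : (ι c : Matrix (Fin n) (Fin n) R) * x = x * ι c) (i : ℕ) : c ∈ stabMod ι x i := by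
  rw [mem_stabMod, hc]

theorem congruenceSubgroup_le_stabMod (x : Matrix (Fin n) (Fin n) R) (i : ℕ) :
    congruenceSubgroup ι i ≤ stabMod ι x i := by
  intro g hg
  rw [mem_congruenceSubgroup] at hg
  rw [mem_stabMod, map_mul, map_mul, hg, one_mul, mul_one]

/-- The elements of `𝔤` whose reduction commutes with that of `x`. -/
def centMod (𝔤 : AddSubgroup (Matrix (Fin n) (Fin n) R)) (x : Matrix (Fin n) (Fin n) R) :
    AddSubgroup 𝔤 where
  carrier := {y | redMat n R 1 (y * x) = redMat n R 1 (x * y)}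
  zero_mem' := by simp
  add_mem' := by
    intro a b ha hb
    simp only [Set.mem_ofPred_eq, AddSubgroup.coe_add, add_mul, mul_add, map_add] at ha hb ⊢
    rw [ha, hb]
  neg_mem' := by
    intro a ha
    simp only [Set.mem_ofPred_eq, NegMemClass.coe_neg, neg_mul, mul_neg, map_neg] at ha ⊢
    rw [ha]

theorem mem_centMod {x : Matrix (Fin n) (Fin n) R} {y : 𝔤} :
    y ∈ centMod 𝔤 x ↔ redMat n R 1 (y * x) = redMat n R 1 (x * y) := Iff.rfl

/-- The index of successive stabilisers does not depend on the level: the Cayley transforms of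
`π ^ j y` are coset representatives, and `y` matters modulo the matrices commuting with `x`
modulo `π`. -/
theorem relIndex_stabMod (H : IsCayleyPair ι 𝔤 π)
    {x : Matrix (Fin n) (Fin n) R} (hx : x ∈ 𝔤) (hcyc : IsCyclicMatrix x) {j : ℕ} (hj : 1 ≤ j) :
    (stabMod ι x (j + 1)).relIndex (stabMod ι x j) = Nat.card (𝔤 ⧸ centMod 𝔤 x) := by
  have hmem : ∀ y : 𝔤, H.cay hj y ∈ stabMod ι x j := fun y =>
    congruenceSubgroup_le_stabMod x j (H.cay_mem hj y)
  have hiff : ∀ y w : 𝔤, (H.cay hj y)⁻¹ * H.cay hj w ∈ stabMod ι x (j + 1) ↔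
      -y + w ∈ centMod 𝔤 x := by
    intro y w
    have hd : ∃ d, (H.cay hj y)⁻¹ * H.cay hj w = d ∧
        redMat n R (j + 1) (ι d) = redMat n R (j + 1) (1 + π ^ j • ((-y + w : 𝔤) :
          Matrix (Fin n) (Fin n) R)) := by
      refine ⟨_, rfl, ?_⟩
      have h1 : redMat n R (j + 1) (ι (H.cay hj y)) * redMat n R (j + 1) (1 + π ^ j • ((-y + w : 𝔤) :
          Matrix (Fin n) (Fin n) R)) = redMat n R (j + 1) (ι (H.cay hj w)) := by
        rw [H.redMat_cay hj (by omega), H.redMat_cay hj (by omega), ← map_mul,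
          redMat_eq_iff H.irreducible]
        obtain ⟨k, rfl⟩ := Nat.exists_eq_add_of_le' hj
        refine ⟨π ^ k • ((y : Matrix (Fin n) (Fin n) R) * (-y + w)), ?_⟩
        rw [smul_smul, ← pow_add]
        simp only [AddSubgroup.coe_add, NegMemClass.coe_neg, add_mul, mul_add, one_mul, mul_one,
          smul_mul_assoc, mul_smul_comm, smul_smul, ← pow_add, smul_add, smul_neg, mul_neg]
        rw [show k + 1 + 1 + k = k + 1 + (k + 1) by ring]
        abel
      have h2 : redMat n R (j + 1) (ι (H.cay hj y)⁻¹) * redMat n R (j + 1) (ι (H.cay hj y)) = 1 := by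
        rw [← map_mul, ← Units.val_mul, ← map_mul]; simp
      rw [map_mul, Units.val_mul, map_mul, ← h1, ← mul_assoc, h2, one_mul]
    obtain ⟨d, hd, hd'⟩ := hd
    rw [hd, mem_stabMod, map_mul, map_mul, hd', ← map_mul, ← map_mul, mem_centMod]
    set z : Matrix (Fin n) (Fin n) R := ((-y + w : 𝔤) : Matrix (Fin n) (Fin n) R)
    rw [redMat_eq_iff H.irreducible, redMat_eq_iff H.irreducible]
    simp only [add_mul, mul_add, one_mul, mul_one, smul_mul_assoc, mul_smul_comm]
    constructor
    · rintro ⟨c, hc⟩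
      refine ⟨c, H.smul_pow_injective j ?_⟩
      rw [smul_add, smul_smul, ← pow_add]
      rw [add_assoc] at hc
      exact add_left_cancel hc
    · rintro ⟨c, hc⟩
      refine ⟨c, ?_⟩
      rw [hc, smul_add, smul_smul, ← pow_add, add_assoc]
  rw [Subgroup.relIndex, Subgroup.index]
  symm
  let F : 𝔤 ⧸ centMod 𝔤 x → stabMod ι x j ⧸ (stabMod ι x (j + 1)).subgroupOf (stabMod ι x j) :=
    Quotient.lift (fun y => ((⟨H.cay hj y, hmem y⟩ : stabMod ι x j) : _ ⧸ _)) (by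
      intro a b hab
      have hab' : -a + b ∈ centMod 𝔤 x := QuotientAddGroup.leftRel_apply.1 hab
      rw [QuotientGroup.eq, Subgroup.mem_subgroupOf]
      exact (hiff a b).2 hab')
  -- `hiff` is injectivity; surjectivity is the factorisation of the stabiliser
  refine Nat.card_congr (Equiv.ofBijective F ⟨?_, ?_⟩)
  · intro p q
    obtain ⟨a, rfl⟩ := QuotientAddGroup.mk_surjective p
    obtain ⟨b, rfl⟩ := QuotientAddGroup.mk_surjective q
    intro h
    have h' := QuotientGroup.eq.1 h
    rw [Subgroup.mem_subgroupOf] at h'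
    exact QuotientAddGroup.eq.2 ((hiff a b).1 h')
  · intro p
    obtain ⟨⟨g, hg⟩, rfl⟩ := QuotientGroup.mk_surjective p
    obtain ⟨c, hc, k, hk, rfl⟩ := H.exists_eq_mul_of_mem_stabMod hx hcyc hj hg
    obtain ⟨y, rfl⟩ := H.exists_cay_eq hj hk
    refine ⟨(y : 𝔤 ⧸ centMod 𝔤 x), ?_⟩
    refine QuotientGroup.eq.2 ?_
    rw [Subgroup.mem_subgroupOf]
    have : (H.cay hj y)⁻¹ * (H.cay hj y * c) ∈ stabMod ι x (j + 1) := by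
      rw [inv_mul_cancel_left]; exact mem_stabMod_of_commute hc _
    exact this

theorem index_stabMod (H : IsCayleyPair ι 𝔤 π)
    {x : Matrix (Fin n) (Fin n) R} (hx : x ∈ 𝔤) (hcyc : IsCyclicMatrix x) (j : ℕ) :
    (stabMod ι x (j + 1)).index = (stabMod ι x 1).index * Nat.card (𝔤 ⧸ centMod 𝔤 x) ^ j := by
  induction j with
  | zero => simp
  | succ j ih =>
    have hle : stabMod ι x (j + 1 + 1) ≤ stabMod ι x (j + 1) := fun g hg =>
      redMat_eq_of_le H.irreducible (Nat.le_succ _) hg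
    rw [← Subgroup.relIndex_mul_index hle, ih, H.relIndex_stabMod hx hcyc (by omega)]
    ring

end IsCayleyPair

end CayleyPair

/-! ### The trace pairing and characters of congruence subgroups -/

theorem addChar_ne_zero {A : Type*} [AddCommGroup A] (Φ : AddChar A ℂ) (a : A) : Φ a ≠ 0 := by
  intro h
  have h1 := Φ.map_add_eq_mul a (-a)
  rw [h, zero_mul, add_neg_cancel, Φ.map_zero_eq_one] at h1
  exact one_ne_zero h1

theorem exists_addChar_quotient {A : Type*} [AddCommGroup A] (P : AddSubgroup A) (χ : AddChar A ℂ)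
    (h : ∀ a ∈ P, χ a = 1) : ∃ χ' : AddChar (A ⧸ P) ℂ, ∀ a : A, χ' a = χ a := by
  refine ⟨AddChar.toAddMonoidHomEquiv.symm (QuotientAddGroup.lift P χ.toAddMonoidHom ?_), ?_⟩
  · intro a ha
    rw [AddMonoidHom.mem_ker]
    exact congrArg Additive.ofMul (h a ha)
  · intro a; rfl

section Pairing

variable {R G : Type*} [CommRing R] [IsDomain R] [IsDiscreteValuationRing R] [Group G] {n : ℕ}
  {ι : G →* GL (Fin n) R} {𝔤 : AddSubgroup (Matrix (Fin n) (Fin n) R)} {π : R}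

/-- An additive character `Φ` trivial on the multiples of `π ^ (ℓ + 1)`, for which the form
`Φ (π ^ ℓ tr (x y))` is nondegenerate on the reduction of `𝔤` modulo `π`. -/
structure IsPairing (𝔤 : AddSubgroup (Matrix (Fin n) (Fin n) R)) (π : R) (ℓ : ℕ)
    (Φ : AddChar R ℂ) : Prop where
  trivial : ∀ a, Φ (π ^ (ℓ + 1) * a) = 1
  nondeg : ∀ x ∈ 𝔤, (∀ y ∈ 𝔤, Φ (π ^ ℓ * (x * y).trace) = 1) → redMat n R 1 x = 0

/-- The character `y ↦ Φ (π ^ k tr (w y))` of `𝔤`. -/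
def trChar (𝔤 : AddSubgroup (Matrix (Fin n) (Fin n) R)) (π : R) (Φ : AddChar R ℂ) (k : ℕ)
    (w : Matrix (Fin n) (Fin n) R) : AddChar 𝔤 ℂ where
  toFun y := Φ (π ^ k * (w * y).trace)
  map_zero_eq_one' := by simp
  map_add_eq_mul' a b := by
    simp [mul_add, Matrix.trace_add, AddChar.map_add_eq_mul]

theorem trChar_apply (Φ : AddChar R ℂ) (k : ℕ) (w : Matrix (Fin n) (Fin n) R) (y : 𝔤) :
    trChar 𝔤 π Φ k w y = Φ (π ^ k * (w * y).trace) := rfl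

variable {Φ : AddChar R ℂ} {ℓ : ℕ}

theorem IsPairing.trivial_of_le (hP : IsPairing 𝔤 π ℓ Φ) {k : ℕ} (hk : ℓ + 1 ≤ k) (a : R) :
    Φ (π ^ k * a) = 1 := by
  obtain ⟨j, rfl⟩ := Nat.exists_eq_add_of_le hk
  rw [pow_add, mul_assoc]
  exact hP.trivial _

theorem IsPairing.congr (hP : IsPairing 𝔤 π ℓ Φ) (hπ : Irreducible π) {k j : ℕ}
    (hk : ℓ + 1 ≤ k + j) (x : Matrix (Fin n) (Fin n) R) {a b : Matrix (Fin n) (Fin n) R}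
    (h : redMat n R j a = redMat n R j b) :
    Φ (π ^ k * (x * a).trace) = Φ (π ^ k * (x * b).trace) := by
  obtain ⟨c, rfl⟩ := (redMat_eq_iff hπ).1 h
  rw [mul_add, Matrix.trace_add, mul_add, AddChar.map_add_eq_mul, mul_smul_comm, Matrix.trace_smul,
    smul_eq_mul, ← mul_assoc, ← pow_add, hP.trivial_of_le hk, mul_one]

/-- The form is nondegenerate modulo each power of `π`, by induction on the power. -/
theorem IsPairing.redMat_eq_zero (hP : IsPairing 𝔤 π ℓ Φ) (H : IsCayleyPair ι 𝔤 π) {j : ℕ}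
    (hj : j ≤ ℓ + 1) {x : Matrix (Fin n) (Fin n) R} (hx : x ∈ 𝔤)
    (h : ∀ y ∈ 𝔤, Φ (π ^ (ℓ + 1 - j) * (x * y).trace) = 1) : redMat n R j x = 0 := by
  induction j with
  | zero => rw [redMat_eq_zero_iff H.irreducible]; exact ⟨x, by simp⟩
  | succ j ih =>
    have h1 := ih (by omega) fun y hy => by
      have := h (π • y) ((H.smul_mem y).2 hy)
      rw [mul_smul_comm, Matrix.trace_smul, smul_eq_mul, ← mul_assoc, ← pow_succ] at this
      rwa [show ℓ + 1 - j = ℓ + 1 - (j + 1) + 1 by omega]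
    obtain ⟨x', rfl⟩ := (redMat_eq_zero_iff H.irreducible).1 h1
    have hx' := (H.pow_smul_mem j x').1 hx
    have h2 := hP.nondeg x' hx' fun y hy => by
      have := h y hy
      rw [smul_mul_assoc, Matrix.trace_smul, smul_eq_mul, ← mul_assoc, ← pow_add] at this
      rwa [show ℓ + 1 - (j + 1) + j = ℓ by omega] at this
    obtain ⟨c, rfl⟩ := (redMat_eq_zero_iff H.irreducible).1 h2
    rw [smul_smul, ← pow_add]
    exact redMat_smul_pow H.irreducible le_rfl c

variable [Finite (ResidueField R)]

theorem finite_quot (i : ℕ) : Finite (R ⧸ maximalIdeal R ^ i) := by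
  have : Finite (R ⧸ maximalIdeal R) := ‹Finite (ResidueField R)›
  exact Ideal.finite_quotient_pow (IsNoetherian.noetherian _) i

theorem finite_of_redMat {A : AddSubgroup 𝔤} (hA : ∀ y : 𝔤, redMat n R 1 y = 0 → y ∈ A) :
    Finite (𝔤 ⧸ A) := by
  have := finite_quot (R := R) 1
  refine Finite.of_injective (β := Matrix (Fin n) (Fin n) (R ⧸ maximalIdeal R ^ 1))
    (fun q => redMat n R 1 (q.out : 𝔤)) fun p q hpq => ?_
  have h1 : -p.out + q.out ∈ A := hA _ (by
    simp only [AddSubgroup.coe_add, NegMemClass.coe_neg, map_add, map_neg]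
    rw [show redMat n R 1 (p.out : 𝔤) = redMat n R 1 (q.out : 𝔤) from hpq, neg_add_cancel])
  have h2 := QuotientAddGroup.eq.2 h1
  simpa using h2

/-- The characters of `𝔤` trivial on `π 𝔤` are given by the trace pairing, by counting. -/
theorem IsPairing.exists_eq_trChar_one (hP : IsPairing 𝔤 π ℓ Φ) (H : IsCayleyPair ι 𝔤 π)
    (χ : AddChar 𝔤 ℂ) (hχ : ∀ y : 𝔤, redMat n R 1 y = 0 → χ y = 1) :
    ∃ w : 𝔤, χ = trChar 𝔤 π Φ ℓ w := by
  let P : AddSubgroup 𝔤 := ((redMat n R 1).toAddMonoidHom.comp 𝔤.subtype).ker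
  have hPm : ∀ y : 𝔤, y ∈ P ↔ redMat n R 1 y = 0 := fun y => Iff.rfl
  have : Finite (𝔤 ⧸ P) := finite_of_redMat fun y hy => hy
  have := Fintype.ofFinite (𝔤 ⧸ P)
  have htriv : ∀ w : 𝔤, ∀ a ∈ P, trChar 𝔤 π Φ ℓ w a = 1 := by
    intro w a ha
    rw [trChar_apply, hP.congr (b := 0) H.irreducible (j := 1) le_rfl _ (by rw [(hPm a).1 ha, map_zero])]
    simp
  choose F hF using fun w : 𝔤 => exists_addChar_quotient P (trChar 𝔤 π Φ ℓ w) (htriv w)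
  have hinj : Function.Injective fun q : 𝔤 ⧸ P => F q.out := by
    intro p q hpq
    have h1 : -p.out + q.out ∈ P := by
      rw [hPm]
      refine hP.nondeg _ (-p.out + q.out).2 fun y hy => ?_
      have h2 := congrArg (fun f => f ((⟨y, hy⟩ : 𝔤) : 𝔤 ⧸ P)) hpq
      simp only [hF, trChar_apply] at h2
      simp only [AddSubgroup.coe_add, NegMemClass.coe_neg, add_mul, neg_mul, Matrix.trace_add,
        Matrix.trace_neg, mul_add, mul_neg, AddChar.map_add_eq_mul]
      rw [← h2, ← AddChar.map_add_eq_mul, neg_add_cancel, AddChar.map_zero_eq_one]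
    simpa using QuotientAddGroup.eq.2 h1
  have hsurj := ((Fintype.bijective_iff_injective_and_card _).2 ⟨hinj, AddChar.card_eq.symm⟩).2
  obtain ⟨χ', hχ'⟩ := exists_addChar_quotient P χ fun a ha => hχ a ha
  obtain ⟨q, hq⟩ := hsurj χ'
  refine ⟨q.out, ?_⟩
  ext y
  rw [← hχ', ← hF, ← hq]

/-- The characters of `𝔤` trivial on `π ^ j 𝔤` are given by the trace pairing: the restriction to
`π ^ (j - 1) 𝔤` is, and dividing by it reduces `j`. -/
theorem IsPairing.exists_eq_trChar (hP : IsPairing 𝔤 π ℓ Φ) (H : IsCayleyPair ι 𝔤 π) {j : ℕ}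
    (hj : j ≤ ℓ + 1) (χ : AddChar 𝔤 ℂ) (hχ : ∀ y : 𝔤, redMat n R j y = 0 → χ y = 1) :
    ∃ w : 𝔤, χ = trChar 𝔤 π Φ (ℓ + 1 - j) w := by
  induction j generalizing χ with
  | zero =>
    refine ⟨0, ?_⟩
    ext y
    rw [hχ y (by rw [redMat_eq_zero_iff H.irreducible]; exact ⟨y, by simp⟩), trChar_apply]
    simp
  | succ j ih =>
    -- the restriction of `χ` to `π ^ j 𝔤`
    let χ₁ : AddChar 𝔤 ℂ := ⟨fun y => χ ⟨π ^ j • y, (H.pow_smul_mem j y).2 y.2⟩,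
      by rw [← AddChar.map_zero_eq_one χ]; congr 1; ext1; simp,
      fun a b => by rw [← AddChar.map_add_eq_mul]; congr 1; ext1; simp⟩
    obtain ⟨w₀, hw₀⟩ := hP.exists_eq_trChar_one H χ₁ fun y hy => by
      refine hχ _ ?_
      obtain ⟨c, hc⟩ := (redMat_eq_zero_iff H.irreducible).1 hy
      simp only [hc, smul_smul, ← pow_add]
      exact redMat_smul_pow H.irreducible le_rfl c
    -- `χ` corrected to be trivial on `π ^ j 𝔤`
    let χ₂ : AddChar 𝔤 ℂ := χ * trChar 𝔤 π Φ (ℓ + 1 - (j + 1)) (-w₀ : 𝔤)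
    obtain ⟨w, hw⟩ := ih (by omega) χ₂ fun y hy => by
      obtain ⟨c, hc⟩ := (redMat_eq_zero_iff H.irreducible).1 hy
      have hc𝔤 : c ∈ 𝔤 := (H.pow_smul_mem j c).1 (hc ▸ y.2)
      have h1 := congrArg (fun f => f ⟨c, hc𝔤⟩) hw₀
      have hy' : y = ⟨π ^ j • c, (H.pow_smul_mem j c).2 hc𝔤⟩ := Subtype.ext hc
      change χ ⟨π ^ j • c, _⟩ = Φ (π ^ ℓ * ((w₀ : Matrix (Fin n) (Fin n) R) * c).trace) at h1
      rw [AddChar.mul_apply, trChar_apply, hy', h1, ← AddChar.map_add_eq_mul,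
        ← AddChar.map_zero_eq_one Φ]
      congr 1
      simp only [NegMemClass.coe_neg, neg_mul, mul_smul_comm, Matrix.trace_neg, Matrix.trace_smul,
        smul_eq_mul]
      rw [show ℓ = ℓ + 1 - (j + 1) + j by omega]
      rw [show ℓ + 1 - (j + 1) + j + 1 - (j + 1) = ℓ + 1 - (j + 1) by omega, pow_add]
      ring
    refine ⟨w₀ + ⟨π • w, (H.smul_mem _).2 w.2⟩, ?_⟩
    ext y
    have h1 := congrArg (fun f => f y) hw
    simp only [χ₂, AddChar.mul_apply, trChar_apply] at h1
    have h2 : Φ (π ^ (ℓ + 1 - (j + 1)) * ((((-w₀ : 𝔤) : Matrix (Fin n) (Fin n) R)) *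
        (y : Matrix (Fin n) (Fin n) R)).trace) * Φ (π ^ (ℓ + 1 - (j + 1)) *
        ((w₀ : Matrix (Fin n) (Fin n) R) * (y : Matrix (Fin n) (Fin n) R)).trace) = 1 := by
      rw [← AddChar.map_add_eq_mul, ← AddChar.map_zero_eq_one Φ]
      congr 1
      simp
    rw [trChar_apply]
    have h3 : π ^ (ℓ + 1 - (j + 1)) * ((((w₀ + ⟨π • w, (H.smul_mem _).2 w.2⟩ : 𝔤)) :
        Matrix (Fin n) (Fin n) R) * y).trace = π ^ (ℓ + 1 - j) *
        ((w : Matrix (Fin n) (Fin n) R) * (y : Matrix (Fin n) (Fin n) R)).trace +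
        π ^ (ℓ + 1 - (j + 1)) *
        ((w₀ : Matrix (Fin n) (Fin n) R) * (y : Matrix (Fin n) (Fin n) R)).trace := by
      simp only [AddSubgroup.coe_add, add_mul, smul_mul_assoc, Matrix.trace_add, Matrix.trace_smul,
        smul_eq_mul]
      rw [show ℓ + 1 - j = ℓ + 1 - (j + 1) + 1 by omega, pow_succ]
      ring
    rw [h3, AddChar.map_add_eq_mul, ← h1, mul_assoc, h2, mul_one]

/-- The characters of an abelian congruence quotient are parametrised by `𝔤`. -/
theorem IsPairing.exists_eq_of_hom (hP : IsPairing 𝔤 π ℓ Φ) (H : IsCayleyPair ι 𝔤 π) {m : ℕ}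
    (hm : 1 ≤ m) (hmℓ : m ≤ ℓ + 1) (h2m : ℓ + 1 ≤ 2 * m) (θ : congruenceSubgroup ι m → ℂ)
    (hmul : ∀ a b, θ (a * b) = θ a * θ b)
    (htriv : ∀ a : congruenceSubgroup ι m, (a : G) ∈ congruenceSubgroup ι (ℓ + 1) → θ a = 1) :
    ∃ x ∈ 𝔤, ∀ a : congruenceSubgroup ι m, θ a = Φ ((x * ((ι a : Matrix _ _ R) - 1)).trace) := by
  have hcongr : ∀ a b : congruenceSubgroup ι m, redMat n R (ℓ + 1) (ι a) = redMat n R (ℓ + 1) (ι b) →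
      θ a = θ b := by
    intro a b hab
    have h1 := htriv (a⁻¹ * b) (redMat_inv_mul_eq_one_iff.2 hab)
    have h2 := hmul a (a⁻¹ * b)
    rw [h1, mul_one, mul_inv_cancel_left] at h2
    exact h2.symm
  let e : 𝔤 → congruenceSubgroup ι m := fun y => ⟨H.cay hm y, H.cay_mem hm y⟩
  have he : ∀ y : 𝔤, redMat n R (ℓ + 1) (ι (e y)) =
      redMat n R (ℓ + 1) (1 + π ^ m • (y : Matrix (Fin n) (Fin n) R)) := fun y =>
    H.redMat_cay hm h2m y
  -- the quotient being abelian, `y ↦ θ (1 + π ^ m y)` is additive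
  let χ : AddChar 𝔤 ℂ := ⟨fun y => θ (e y), by
      refine htriv _ ?_
      rw [mem_congruenceSubgroup, he]; simp, fun a b => by
      change θ (e (a + b)) = θ (e a) * θ (e b)
      rw [← hmul]
      refine hcongr _ _ ?_
      have : ((e a * e b : congruenceSubgroup ι m) : G) = e a * e b := rfl
      rw [this, map_mul, Units.val_mul, map_mul, he, he, he, ← map_mul, redMat_eq_iff H.irreducible]
      obtain ⟨k, hk⟩ := Nat.exists_eq_add_of_le h2m
      refine ⟨-(π ^ k • ((a : Matrix (Fin n) (Fin n) R) * b)), ?_⟩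
      rw [smul_neg, smul_smul, ← pow_add, ← hk, two_mul, pow_add]
      simp only [AddSubgroup.coe_add, add_mul, mul_add, one_mul, mul_one, smul_mul_assoc,
        mul_smul_comm, smul_smul, smul_add]
      abel⟩
  obtain ⟨w, hw⟩ := hP.exists_eq_trChar H (j := ℓ + 1 - m) (by omega) χ fun y hy => by
    refine htriv _ ?_
    rw [mem_congruenceSubgroup, he]
    obtain ⟨c, hc⟩ := (redMat_eq_zero_iff H.irreducible).1 hy
    rw [hc, smul_smul, ← pow_add, map_add, map_one,
      redMat_smul_pow H.irreducible (by omega), add_zero]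
  refine ⟨w, w.2, fun a => ?_⟩
  obtain ⟨y, hy⟩ := H.exists_cay_eq hm a.2
  have h1 : a = e y := Subtype.ext hy.symm
  have h2 : θ (e y) = trChar 𝔤 π Φ (ℓ + 1 - (ℓ + 1 - m)) w y := congrArg (fun f => f y) hw
  rw [h1, h2, trChar_apply, show ℓ + 1 - (ℓ + 1 - m) = m by omega]
  have h3 : redMat n R (ℓ + 1) ((ι (e y) : Matrix (Fin n) (Fin n) R) - 1) =
      redMat n R (ℓ + 1) (π ^ m • (y : Matrix (Fin n) (Fin n) R)) := by
    rw [map_sub, he, map_add, map_one]; abel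
  have h4 := hP.congr (k := 0) H.irreducible (j := ℓ + 1) (by omega) w h3
  rw [pow_zero, one_mul, one_mul] at h4
  rw [h4, mul_smul_comm, Matrix.trace_smul, smul_eq_mul]

/-- The stabiliser of the character attached to `x` is the stabiliser of `x` modulo a power of the
maximal ideal. -/
theorem IsPairing.conjFun_eq_iff (hP : IsPairing 𝔤 π ℓ Φ) (H : IsCayleyPair ι 𝔤 π) {m : ℕ}
    (hm : 1 ≤ m) (hmℓ : m ≤ ℓ + 1) (h2m : ℓ + 1 ≤ 2 * m) {θ : congruenceSubgroup ι m → ℂ}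
    {x : Matrix (Fin n) (Fin n) R} (hx : x ∈ 𝔤)
    (hθ : ∀ a : congruenceSubgroup ι m, θ a = Φ ((x * ((ι a : Matrix _ _ R) - 1)).trace)) (g : G) :
    g ∈ stabMod ι x (ℓ + 1 - m) ↔ conjFun (congruenceSubgroup ι m) g θ = θ := by
  set gM : Matrix (Fin n) (Fin n) R := (ι g).val with hgM
  set gI : Matrix (Fin n) (Fin n) R := (ι g)⁻¹.val with hgI'
  have hgI : gM * gI = 1 := Units.mul_inv _
  have hIg : gI * gM = 1 := Units.inv_mul _
  set d := gM * x * gI - x with hd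
  have hd𝔤 : d ∈ 𝔤 := sub_mem (H.conj_mem g x hx) hx
  -- conjugation by `g` multiplies `θ` by the character attached to `d = g x g⁻¹ - x`
  have hconj : ∀ a : congruenceSubgroup ι m, conjFun (congruenceSubgroup ι m) g θ a =
      θ a * Φ ((d * ((ι a : Matrix _ _ R) - 1)).trace) := by
    intro a
    rw [conjFun, hθ, hθ, ← AddChar.map_add_eq_mul]
    congr 1
    rw [← Matrix.trace_add, ← add_mul, hd, add_sub_cancel]
    have e1 : ((ι (g⁻¹ * a * g) : GL (Fin n) R) : Matrix (Fin n) (Fin n) R) - 1 =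
        gI * ((ι a : Matrix _ _ R) - 1) * gM := by
      rw [map_mul, map_mul, map_inv, mul_sub, sub_mul, mul_one, hIg]; rfl
    change (x * (((ι (g⁻¹ * a * g) : GL (Fin n) R) : Matrix (Fin n) (Fin n) R) - 1)).trace = _
    rw [e1, ← mul_assoc, ← mul_assoc, Matrix.trace_mul_comm]
    simp only [mul_assoc]
  have hstab : g ∈ stabMod ι x (ℓ + 1 - m) ↔ redMat n R (ℓ + 1 - m) d = 0 := by
    rw [mem_stabMod, hd, map_sub, sub_eq_zero]
    change redMat n R (ℓ + 1 - m) (gM * x) = redMat n R (ℓ + 1 - m) (x * gM) ↔ _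
    constructor
    · intro h
      rw [map_mul, h, ← map_mul, mul_assoc, hgI, mul_one]
    · intro h
      have h2 : gM * x = gM * x * gI * gM := by rw [mul_assoc _ gI, hIg, mul_one]
      rw [h2, map_mul, h, ← map_mul]
  rw [hstab]
  constructor
  · intro h
    funext a
    rw [hconj]
    obtain ⟨c, hc⟩ := (redMat_eq_zero_iff H.irreducible).1 h
    obtain ⟨e, he⟩ := (redMat_eq_iff H.irreducible).1
      ((mem_congruenceSubgroup.1 a.2).trans (map_one _).symm)
    rw [hc, he, add_sub_cancel_left, smul_mul_assoc, mul_smul_comm, smul_smul, ← pow_add,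
      Matrix.trace_smul, smul_eq_mul, hP.trivial_of_le (by omega), mul_one]
  · intro h
    refine hP.redMat_eq_zero H (by omega) hd𝔤 fun y hy => ?_
    let a : congruenceSubgroup ι m := ⟨H.cay hm ⟨y, hy⟩, H.cay_mem hm _⟩
    have h1 := hconj a
    rw [h] at h1
    have hne : θ a ≠ 0 := by rw [hθ]; exact addChar_ne_zero Φ _
    have h2 : Φ ((d * ((ι a : Matrix _ _ R) - 1)).trace) = 1 :=
      mul_left_cancel₀ hne (by rw [← h1, mul_one])
    have h3 : redMat n R (ℓ + 1) ((ι a : Matrix (Fin n) (Fin n) R) - 1) =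
        redMat n R (ℓ + 1) (π ^ m • y) := by
      rw [map_sub, H.redMat_cay hm h2m, map_add, map_one]; simp
    have h4 := hP.congr (k := 0) H.irreducible (j := ℓ + 1) (by omega) d h3
    rw [pow_zero, one_mul, one_mul, h2] at h4
    rw [show ℓ + 1 - (ℓ + 1 - m) = m by omega, h4, mul_smul_comm, Matrix.trace_smul, smul_eq_mul]

end Pairing

/-! ### The dimension of a regular representation -/

section OddLevel

variable {R G V : Type*} [CommRing R] [IsDomain R] [IsDiscreteValuationRing R] [Group G] {n : ℕ}
  [AddCommGroup V] [Module ℂ V]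

/-- The situation over an eigencharacter of `K ^ (k + 1)`, attached to `x`, for an irreducible
representation `ρ` trivial on `K ^ (2 k + 1)`: the eigenspace `p` is irreducible under the
stabiliser, which contains the non-abelian group `K ^ k`. -/
structure IsOddDatum (ι : G →* GL (Fin n) R) (𝔤 : AddSubgroup (Matrix (Fin n) (Fin n) R))
    (π : R) (Φ : AddChar R ℂ) (k : ℕ) (ρ : Representation ℂ G V)
    (x : Matrix (Fin n) (Fin n) R) (p : Submodule ℂ V) : Prop where
  pair : IsCayleyPair ι 𝔤 π
  pairing : IsPairing 𝔤 π (2 * k) Φ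
  pos : 1 ≤ k
  mem : x ∈ 𝔤
  cyclic : IsCyclicMatrix x
  trivial : ∀ g ∈ congruenceSubgroup ι (2 * k + 1), ρ g = 1
  apply_eq : ∀ g ∈ congruenceSubgroup ι (k + 1), ∀ w ∈ p,
    ρ g w = Φ ((x * ((ι g : Matrix (Fin n) (Fin n) R) - 1)).trace) • w
  stable : ∀ g ∈ stabMod ι x k, ∀ w ∈ p, ρ g w ∈ p
  irreducible : ∀ q ≤ p, (∀ g ∈ stabMod ι x k, ∀ w ∈ q, ρ g w ∈ q) → q = ⊥ ∨ q = p
  ne_bot : p ≠ ⊥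

namespace IsOddDatum

variable {ι : G →* GL (Fin n) R} {𝔤 : AddSubgroup (Matrix (Fin n) (Fin n) R)} {π : R}
  {Φ : AddChar R ℂ} {k : ℕ} {ρ : Representation ℂ G V} {x : Matrix (Fin n) (Fin n) R}
  {p : Submodule ℂ V}

theorem cay_mem_stabMod (D : IsOddDatum ι 𝔤 π Φ k ρ x p) (y : 𝔤) :
    D.pair.cay D.pos y ∈ stabMod ι x k :=
  IsCayleyPair.congruenceSubgroup_le_stabMod x k (D.pair.cay_mem D.pos y)

/-- An element of the stabiliser acting on the eigenspace. -/
def stabOp (D : IsOddDatum ι 𝔤 π Φ k ρ x p) (g : stabMod ι x k) : Module.End ℂ p :=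
  (ρ g).restrict (D.stable g g.2)

theorem stabOp_apply (D : IsOddDatum ι 𝔤 π Φ k ρ x p) (g : stabMod ι x k) (w : p) :
    (D.stabOp g w : V) = ρ g w := rfl

theorem stabOp_mul (D : IsOddDatum ι 𝔤 π Φ k ρ x p) (g h : stabMod ι x k) :
    D.stabOp (g * h) = D.stabOp g * D.stabOp h := by
  ext w; simp [stabOp_apply]

theorem stabOp_one (D : IsOddDatum ι 𝔤 π Φ k ρ x p) : D.stabOp 1 = 1 := by
  ext w; simp [stabOp_apply]

theorem stabOp_congr (D : IsOddDatum ι 𝔤 π Φ k ρ x p) {g h : stabMod ι x k}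
    (e : redMat n R (2 * k + 1) (ι g) = redMat n R (2 * k + 1) (ι h)) :
    D.stabOp g = D.stabOp h := by
  have h1 := D.trivial _ (redMat_inv_mul_eq_one_iff.2 e)
  ext w
  rw [stabOp_apply, stabOp_apply]
  have h2 : ρ (h : G) = ρ g * ρ ((g : G)⁻¹ * h) := by rw [← map_mul, mul_inv_cancel_left]
  rw [h2, h1, mul_one]

/-- The Cayley transform of `π ^ k y`, normalised by the character attached to `x`. -/
noncomputable def heis (D : IsOddDatum ι 𝔤 π Φ k ρ x p) (y : 𝔤) : Module.End ℂ p :=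
  Φ (-(π ^ k * (x * y).trace)) • D.stabOp ⟨D.pair.cay D.pos y, D.cay_mem_stabMod y⟩

theorem stabOp_cay (D : IsOddDatum ι 𝔤 π Φ k ρ x p) (y : 𝔤) :
    D.stabOp ⟨D.pair.cay D.pos y, D.cay_mem_stabMod y⟩ =
      Φ (π ^ k * (x * y).trace) • D.heis y := by
  rw [heis, smul_smul, ← AddChar.map_add_eq_mul, add_neg_cancel, AddChar.map_zero_eq_one, one_smul]

/-- On the part of `𝔤` divisible by `π`, the normalised operators are trivial. -/
theorem heis_eq_one (D : IsOddDatum ι 𝔤 π Φ k ρ x p) {y : 𝔤} (hy : redMat n R 1 y = 0) :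
    D.heis y = 1 := by
  obtain ⟨c, hc⟩ := (redMat_eq_zero_iff D.pair.irreducible).1 hy
  rw [pow_one] at hc
  have hspec := D.pair.cay_spec D.pos y
  rw [hc, smul_smul, ← pow_succ] at hspec
  have h1 : redMat n R (2 * k + 1) (ι (D.pair.cay D.pos y)) =
      redMat n R (2 * k + 1) (1 + π ^ (k + 1) • c) :=
    D.pair.redMat_eq_of_cayley (by omega) hspec
  have h2 : D.pair.cay D.pos y ∈ congruenceSubgroup ι (k + 1) := by
    rw [mem_congruenceSubgroup, D.pair.redMat_eq_of_cayley (by omega) hspec, map_add, map_one,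
      redMat_smul_pow D.pair.irreducible le_rfl, add_zero]
  ext w
  rw [heis, LinearMap.smul_apply, Submodule.coe_smul, stabOp_apply]
  simp only
  rw [D.apply_eq _ h2 w w.2, smul_smul, ← AddChar.map_add_eq_mul]
  have h3 : redMat n R (2 * k + 1) ((ι (D.pair.cay D.pos y) : Matrix (Fin n) (Fin n) R) - 1) =
      redMat n R (2 * k + 1) (π ^ (k + 1) • c) := by
    rw [map_sub, h1, map_add, map_one]; abel
  have h4 := D.pairing.congr (k := 0) D.pair.irreducible (j := 2 * k + 1) (by omega) x h3
  rw [pow_zero, one_mul, one_mul] at h4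
  have h5 : π ^ k * (x * (y : Matrix (Fin n) (Fin n) R)).trace = (x * π ^ (k + 1) • c).trace := by
    rw [hc, mul_smul_comm, mul_smul_comm, Matrix.trace_smul, Matrix.trace_smul, smul_eq_mul,
      smul_eq_mul]
    ring
  rw [AddChar.map_add_eq_mul, h4, h5, ← AddChar.map_add_eq_mul, neg_add_cancel,
    AddChar.map_zero_eq_one, one_smul]
  rfl

/-- Cayley transforms multiply by the Baker–Campbell–Hausdorff formula in degree two: modulo
`π ^ (2 k + 1)`, third powers of `π ^ k` vanish, as `k ≥ 1`. -/
theorem cay_mul (D : IsOddDatum ι 𝔤 π Φ k ρ x p) {y w b s : 𝔤}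
    (hb : (b : Matrix (Fin n) (Fin n) R) + b = y * w - w * y)
    (hs : redMat n R (k + 1) (s : Matrix (Fin n) (Fin n) R) =
      redMat n R (k + 1) (y + w + π ^ k • (b : Matrix (Fin n) (Fin n) R))) :
    redMat n R (2 * k + 1) (ι (D.pair.cay D.pos y * D.pair.cay D.pos w)) =
      redMat n R (2 * k + 1) (ι (D.pair.cay D.pos s)) := by
  set φ := redMat n R (2 * k + 1) with hφ
  set t : R ⧸ maximalIdeal R ^ (2 * k + 1) := Ideal.Quotient.mk _ (π ^ k) with ht
  have ht3 : t ^ 3 = 0 := by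
    rw [ht, ← map_pow, Ideal.Quotient.eq_zero_iff_mem, D.pair.irreducible.maximalIdeal_eq,
      Ideal.span_singleton_pow, Ideal.mem_span_singleton, ← pow_mul]
    exact pow_dvd_pow _ (by have := D.pos; omega)
  have hsm : ∀ z : Matrix (Fin n) (Fin n) R, φ (π ^ k • z) = t • φ z := by
    intro z; ext i j
    simp [hφ, redMat, ht]
  have hspec : ∀ z : 𝔤, φ (ι (D.pair.cay D.pos z)) * (2 - t • φ z) = 2 + t • φ z := by
    intro z
    have := congrArg φ (D.pair.cay_spec D.pos z)
    rwa [map_mul, map_sub, map_add, map_ofNat, hsm] at this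
  have hs' : t • φ s = t • (φ y + φ w + t • φ b) := by
    rw [← hsm, ← hsm, ← map_add, ← map_add, ← hsm, hφ, redMat_eq_iff D.pair.irreducible]
    obtain ⟨c, hc⟩ := (redMat_eq_iff D.pair.irreducible).1 hs
    refine ⟨c, ?_⟩
    rw [hc, smul_add, smul_smul _ _ c, ← pow_add]
    congr 3; omega
  rw [map_mul, Units.val_mul, map_mul]
  refine cayley_mul ht3 (D.pair.isUnit_two_quot _) (b := φ b) (y := φ y) (w := φ w) ?_
    (hspec y) (hspec w) ?_
  · rw [← map_add, hb]; simp
  · rw [← hs']; exact hspec s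

/-- The alternating form on `𝔤` governing the products of the normalised operators; here `h` is the
inverse of `2`. -/
noncomputable def heisForm (Φ : AddChar R ℂ) (π : R) (k : ℕ) (h : R)
    (x y w : Matrix (Fin n) (Fin n) R) : ℂ :=
  Φ (π ^ (2 * k) * (h * (x * (y * w - w * y)).trace))

/-- The normalised operators multiply through a bimultiplicative alternating cocycle. -/
theorem heis_mul (D : IsOddDatum ι 𝔤 π Φ k ρ x p) {h : R} (hh : 2 * h = 1) (y w : 𝔤) :
    D.heis y * D.heis w = heisForm Φ π k h x y w • D.heis (y + w) := by
  have hhalf : ∀ a b : Matrix (Fin n) (Fin n) R, b + b = a → b = h • a := by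
    rintro a b rfl
    rw [← two_smul R b, smul_smul, mul_comm, hh, one_smul]
  obtain ⟨b, hb𝔤, hb⟩ := D.pair.half _ (D.pair.lie_mem y y.2 w w.2)
  -- `y * w ↦ y + w + B`, and `B` acts by a scalar, as it is divisible by `π`
  set B : 𝔤 := ⟨π ^ k • b, (D.pair.pow_smul_mem k b).2 hb𝔤⟩ with hB
  have hk := D.pos
  have e1 : D.stabOp ⟨_, D.cay_mem_stabMod y⟩ * D.stabOp ⟨_, D.cay_mem_stabMod w⟩ =
      D.stabOp ⟨_, D.cay_mem_stabMod (y + w + B)⟩ := by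
    rw [← stabOp_mul]
    exact D.stabOp_congr (D.cay_mul (b := ⟨b, hb𝔤⟩) hb rfl)
  have e2 : D.stabOp ⟨_, D.cay_mem_stabMod (y + w)⟩ * D.stabOp ⟨_, D.cay_mem_stabMod B⟩ =
      D.stabOp ⟨_, D.cay_mem_stabMod (y + w + B)⟩ := by
    rw [← stabOp_mul]
    obtain ⟨c, hc𝔤, hc⟩ := D.pair.half _ (D.pair.lie_mem _ (y + w).2 b hb𝔤)
    refine D.stabOp_congr (D.cay_mul (b := ⟨π ^ k • c, (D.pair.pow_smul_mem k c).2 hc𝔤⟩) ?_ ?_)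
    · simp only [hB]
      rw [← smul_add, hc, smul_sub, mul_smul_comm, smul_mul_assoc]
    · rw [smul_smul, ← pow_add]
      simp only [AddSubgroup.coe_add, map_add]
      rw [redMat_smul_pow D.pair.irreducible (i := k + 1) (j := k + k) (by omega), add_zero]
  have e3 : D.heis B = 1 := D.heis_eq_one (redMat_smul_pow D.pair.irreducible hk b)
  rw [← e1, D.stabOp_cay, D.stabOp_cay, D.stabOp_cay, D.stabOp_cay, e3] at e2
  simp only [smul_mul_assoc, mul_smul_comm, smul_smul, mul_one] at e2
  have e4 : ∀ a c : ℂ, c ≠ 0 → ∀ f g : Module.End ℂ p, c • f = a • g → f = (c⁻¹ * a) • g := by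
    intro a c hc f g hfg
    rw [mul_smul, ← hfg, smul_smul, inv_mul_cancel₀ hc, one_smul]
  have e5 := e4 _ _ (mul_ne_zero (addChar_ne_zero _ _) (addChar_ne_zero _ _)) _ _ e2.symm
  rw [e5]
  congr 1
  rw [← AddChar.map_add_eq_mul, ← AddChar.map_add_eq_mul, heisForm]
  have e6 : ∀ a c d : R, a = c + d → (Φ c)⁻¹ * Φ a = Φ d := by
    rintro a c d rfl
    rw [AddChar.map_add_eq_mul, inv_mul_cancel_left₀ (addChar_ne_zero _ _)]
  refine e6 _ _ _ ?_
  simp only [hB, AddSubgroup.coe_add, mul_add, Matrix.trace_add, mul_smul_comm, Matrix.trace_smul,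
    smul_eq_mul]
  rw [hhalf _ _ hb, mul_smul_comm, Matrix.trace_smul, smul_eq_mul]
  ring

theorem heisForm_eq (h : R) (x y w : Matrix (Fin n) (Fin n) R) :
    heisForm Φ π k h x y w = Φ (π ^ (2 * k) * (h * ((x * y - y * x) * w).trace)) := by
  have : (x * (y * w - w * y)).trace = ((x * y - y * x) * w).trace := by
    rw [mul_sub, sub_mul, Matrix.trace_sub, Matrix.trace_sub, ← mul_assoc, ← mul_assoc,
      Matrix.trace_mul_comm (x * w), ← mul_assoc]
  rw [heisForm, this]

theorem heisForm_add_left (h : R) (x y y' w : Matrix (Fin n) (Fin n) R) :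
    heisForm Φ π k h x (y + y') w = heisForm Φ π k h x y w * heisForm Φ π k h x y' w := by
  rw [heisForm, heisForm, heisForm, ← AddChar.map_add_eq_mul]
  congr 1
  simp only [add_mul, mul_add, mul_sub, Matrix.trace_sub, Matrix.trace_add]
  ring

theorem heisForm_add_right (h : R) (x y w w' : Matrix (Fin n) (Fin n) R) :
    heisForm Φ π k h x y (w + w') = heisForm Φ π k h x y w * heisForm Φ π k h x y w' := by
  rw [heisForm, heisForm, heisForm, ← AddChar.map_add_eq_mul]
  congr 1
  simp only [add_mul, mul_add, mul_sub, Matrix.trace_sub, Matrix.trace_add]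
  ring

theorem heisForm_self (h : R) (x y : Matrix (Fin n) (Fin n) R) :
    heisForm Φ π k h x y y = 1 := by
  simp [heisForm]

theorem heisForm_swap (h : R) (x y w : Matrix (Fin n) (Fin n) R) :
    heisForm Φ π k h x y w * heisForm Φ π k h x w y = 1 := by
  have := heisForm_self (Φ := Φ) (π := π) (k := k) h x (y + w)
  rw [heisForm_add_left, heisForm_add_right, heisForm_add_right, heisForm_self, heisForm_self,
    one_mul, mul_one] at this
  exact this

/-- The matrices commuting with `x` modulo `π` lie in the radical of the form. -/
theorem heisForm_eq_one_of_mem (hπ : Irreducible π) (hP : IsPairing 𝔤 π (2 * k) Φ) (h : R)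
    {y : 𝔤} (hy : y ∈ IsCayleyPair.centMod 𝔤 x) (w : Matrix (Fin n) (Fin n) R) :
    heisForm Φ π k h x y w = 1 := by
  rw [heisForm_eq]
  obtain ⟨c, hc⟩ := (redMat_eq_iff hπ).1 (IsCayleyPair.mem_centMod.1 hy)
  rw [hc, pow_one, sub_add_cancel_left, neg_mul, smul_mul_assoc, Matrix.trace_neg,
    Matrix.trace_smul, smul_eq_mul,
    show π ^ (2 * k) * (h * -(π * (c * w).trace)) = π ^ (2 * k + 1) * (-(h * (c * w).trace)) by ring,
    hP.trivial]

/-- Conjugation by an element of `G`, as an automorphism of `𝔤`. -/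
def conjEquiv (H : IsCayleyPair ι 𝔤 π) (g : G) : 𝔤 ≃+ 𝔤 where
  toFun y := ⟨(ι g).val * y * (ι g)⁻¹.val, H.conj_mem g y y.2⟩
  invFun y := ⟨(ι g⁻¹).val * y * (ι g⁻¹)⁻¹.val, H.conj_mem g⁻¹ y y.2⟩
  left_inv y := Subtype.ext (by simp [mul_assoc])
  right_inv y := Subtype.ext (by simp [mul_assoc])
  map_add' y w := Subtype.ext (by simp [mul_add, add_mul])

/-- The centralizer of `x` permutes the normalised operators by conjugation. -/
theorem stabOp_mul_heis (D : IsOddDatum ι 𝔤 π Φ k ρ x p) {c : G}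
    (hc : (ι c : Matrix (Fin n) (Fin n) R) * x = x * ι c) (y : 𝔤) :
    D.stabOp ⟨c, IsCayleyPair.mem_stabMod_of_commute hc k⟩ * D.heis y =
      D.heis (conjEquiv D.pair c y) * D.stabOp ⟨c, IsCayleyPair.mem_stabMod_of_commute hc k⟩ := by
  have hM : (ι c).val * (ι c)⁻¹.val = 1 := Units.mul_inv _
  have hM' : (ι c)⁻¹.val * (ι c).val = 1 := Units.inv_mul _
  have h1 : D.pair.cay D.pos (conjEquiv D.pair c y) = c * D.pair.cay D.pos y * c⁻¹ := by
    apply D.pair.cay_eq_of_spec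
    have hs := D.pair.cay_spec D.pos y
    have e1 : ∀ z : Matrix (Fin n) (Fin n) R, (2 : Matrix (Fin n) (Fin n) R) - π ^ k •
        ((ι c).val * z * (ι c)⁻¹.val) = (ι c).val * (2 - π ^ k • z) * (ι c)⁻¹.val := by
      intro z
      rw [mul_sub, sub_mul, mul_two, add_mul, hM, mul_smul_comm, smul_mul_assoc,
        one_add_one_eq_two]
    have e2 : ∀ z : Matrix (Fin n) (Fin n) R, (2 : Matrix (Fin n) (Fin n) R) + π ^ k •
        ((ι c).val * z * (ι c)⁻¹.val) = (ι c).val * (2 + π ^ k • z) * (ι c)⁻¹.val := by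
      intro z
      rw [mul_add, add_mul, mul_two, add_mul, hM, mul_smul_comm, smul_mul_assoc,
        one_add_one_eq_two]
    have e3 : (ι (c * D.pair.cay D.pos y * c⁻¹)).val =
        (ι c).val * (ι (D.pair.cay D.pos y)).val * (ι c)⁻¹.val := by
      rw [map_mul, map_mul, map_inv]; rfl
    change (ι (c * D.pair.cay D.pos y * c⁻¹)).val * (2 - π ^ k • ((ι c).val * _ * (ι c)⁻¹.val)) =
      2 + π ^ k • ((ι c).val * _ * (ι c)⁻¹.val)
    rw [e1, e2, e3, ← hs]
    simp only [mul_assoc]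
    rw [← mul_assoc (ι c)⁻¹.val (ι c).val, hM', one_mul]
  have h2 : (x * (conjEquiv D.pair c y : 𝔤).val).trace = (x * (y : Matrix (Fin n) (Fin n) R)).trace := by
    change (x * ((ι c).val * (y : Matrix (Fin n) (Fin n) R) * (ι c)⁻¹.val)).trace = _
    rw [← mul_assoc, ← mul_assoc, ← hc, mul_assoc (ι c).val, mul_assoc, Matrix.trace_mul_comm,
      mul_assoc, hM', mul_one]
  rw [heis, heis, h2, mul_smul_comm, smul_mul_assoc, ← stabOp_mul, ← stabOp_mul]
  congr 2
  apply Subtype.ext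
  change c * D.pair.cay D.pos y = D.pair.cay D.pos (conjEquiv D.pair c y) * c
  rw [h1]; group

/-- Common stable subspaces of the normalised operators and of the centraliser of `x` are trivial. -/
theorem eq_bot_or_eq_top (D : IsOddDatum ι 𝔤 π Φ k ρ x p) (q : Submodule ℂ p)
    (hu : ∀ y, ∀ w ∈ q, D.heis y w ∈ q)
    (hc : ∀ c, ∀ hc : (ι c : Matrix (Fin n) (Fin n) R) * x = x * ι c, ∀ w ∈ q,
      D.stabOp ⟨c, IsCayleyPair.mem_stabMod_of_commute hc k⟩ w ∈ q) : q = ⊥ ∨ q = ⊤ := by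
  have h := D.irreducible (q.map p.subtype) (Submodule.map_subtype_le p q) ?_
  · rcases h with h | h
    · left
      rw [← Submodule.map_bot p.subtype] at h
      exact Submodule.map_injective_of_injective p.injective_subtype h
    · right
      rw [eq_top_iff]
      intro w _
      have : (w : V) ∈ q.map p.subtype := by rw [h]; exact w.2
      obtain ⟨w', hw', e⟩ := this
      rwa [← Subtype.ext e]
  · rintro g hg _ ⟨w, hw, rfl⟩
    obtain ⟨c, hcx, l, hl, rfl⟩ := D.pair.exists_eq_mul_of_mem_stabMod D.mem D.cyclic D.pos hg
    obtain ⟨y, rfl⟩ := D.pair.exists_cay_eq D.pos hl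
    have h1 := hc c hcx w hw
    have h2 := hu y _ h1
    refine ⟨Φ (π ^ k * (x * y).trace) • _, q.smul_mem (Φ (π ^ k * (x * y).trace)) h2, ?_⟩
    rw [← LinearMap.smul_apply, ← stabOp_cay, map_mul]
    rfl

/-- On the radical, the normalised operators are scalars: they commute with the other normalised
operators and with the centralizer of `x`, so that their eigenspaces are stable. -/
theorem exists_heis_eq_smul [FiniteDimensional ℂ V] (D : IsOddDatum ι 𝔤 π Φ k ρ x p) {y : 𝔤}
    (hy : y ∈ IsCayleyPair.centMod 𝔤 x) : ∃ c : ℂ, D.heis y = c • 1 := by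
  obtain ⟨h, hh⟩ := D.pair.isUnit_two.exists_right_inv
  have hγ := heisForm_eq_one_of_mem D.pair.irreducible D.pairing h hy
  have hcommu : ∀ w : 𝔤, D.heis y * D.heis w = D.heis w * D.heis y := by
    intro w
    rw [D.heis_mul hh, D.heis_mul hh, add_comm w y, hγ]
    have := heisForm_swap (Φ := Φ) (π := π) (k := k) h x y w
    rw [hγ, one_mul] at this
    rw [this]
  have hcommc : ∀ c, ∀ hc : (ι c : Matrix (Fin n) (Fin n) R) * x = x * ι c,
      D.stabOp ⟨c, IsCayleyPair.mem_stabMod_of_commute hc k⟩ * D.heis y =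
        D.heis y * D.stabOp ⟨c, IsCayleyPair.mem_stabMod_of_commute hc k⟩ := by
    intro c hc
    rw [D.stabOp_mul_heis hc]
    congr 1
    -- modulo `π`, both `c` and `y` are polynomials in `x`
    set d : 𝔤 := -y + conjEquiv D.pair c y with hd
    have hd0 : redMat n R 1 d = 0 := by
      have hc1 : redMat n R 1 (ι c) * redMat n R 1 x = redMat n R 1 x * redMat n R 1 (ι c) := by
        rw [← map_mul, hc, map_mul]
      have hy1 : redMat n R 1 (y : Matrix (Fin n) (Fin n) R) * redMat n R 1 x =
          redMat n R 1 x * redMat n R 1 (y : Matrix (Fin n) (Fin n) R) := by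
        rw [← map_mul, IsCayleyPair.mem_centMod.1 hy, map_mul]
      have h1 := (D.cyclic.map (Ideal.Quotient.mk (maximalIdeal R ^ 1))).commute hc1 hy1
      have h2 : ((conjEquiv D.pair c y : 𝔤) : Matrix (Fin n) (Fin n) R) =
        (ι c).val * y * (ι c)⁻¹.val := rfl
      have hM : (ι c).val * (ι c)⁻¹.val = 1 := Units.mul_inv _
      rw [hd, AddSubgroup.coe_add, NegMemClass.coe_neg, h2, map_add, map_mul, map_mul, h1,
        mul_assoc, ← map_mul, hM, map_one, mul_one, map_neg, neg_add_cancel]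
    have h3 : conjEquiv D.pair c y = y + d := by rw [hd]; abel
    have h4 := D.heis_mul hh y d
    rw [hγ, one_smul, D.heis_eq_one hd0, mul_one] at h4
    rw [h3, ← h4]
  have : Nontrivial p := p.nontrivial_iff_ne_bot.2 D.ne_bot
  obtain ⟨c, hc⟩ := Module.End.exists_eigenvalue (D.heis y)
  refine ⟨c, ?_⟩
  have htop := (D.eq_bot_or_eq_top (Module.End.eigenspace (D.heis y) c) ?_ ?_).resolve_left hc
  · ext1 w
    have hw : w ∈ Module.End.eigenspace (D.heis y) c := by rw [htop]; trivial
    simpa using Module.End.mem_eigenspace_iff.1 hw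
  · intro w v hv
    rw [Module.End.mem_eigenspace_iff] at hv ⊢
    have := congrArg (fun f => f v) (hcommu w)
    simp only [Module.End.mul_apply] at this
    rw [this, hv, map_smul]
  · intro g hg v hv
    rw [Module.End.mem_eigenspace_iff] at hv ⊢
    have := congrArg (fun f => f v) (hcommc g hg)
    simp only [Module.End.mul_apply] at this
    rw [← this, hv, map_smul]

variable [Finite (ResidueField R)]

theorem finite_quot_centMod : Finite (𝔤 ⧸ IsCayleyPair.centMod 𝔤 x) :=
  finite_of_redMat fun y hy => by
    rw [IsCayleyPair.mem_centMod, map_mul, map_mul, hy, zero_mul, mul_zero]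

/-- The square of the dimension of the eigenspace, when the normalised operators are trivial on the
radical: they then form a Heisenberg representation of the quotient of `𝔤` by the radical, on which
the centralizer of `x`, a commutative group, acts. -/
theorem finrank_sq_of_heis_eq_one [FiniteDimensional ℂ V] (D : IsOddDatum ι 𝔤 π Φ k ρ x p)
    (h1 : ∀ y ∈ IsCayleyPair.centMod 𝔤 x, D.heis y = 1) :
    Module.finrank ℂ p ^ 2 = Nat.card (𝔤 ⧸ IsCayleyPair.centMod 𝔤 x) := by
  obtain ⟨h, hh⟩ := D.pair.isUnit_two.exists_right_inv
  have : Nontrivial p := p.nontrivial_iff_ne_bot.2 D.ne_bot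
  have : Finite (𝔤 ⧸ IsCayleyPair.centMod 𝔤 x) := finite_quot_centMod
  set Z := IsCayleyPair.centMod 𝔤 x with hZ
  have hcl : ∀ {y : 𝔤}, y ∈ Z → ∀ w, heisForm Φ π k h x y w = 1 := fun hy w =>
    heisForm_eq_one_of_mem D.pair.irreducible D.pairing h hy w
  have hcr : ∀ {y : 𝔤}, y ∈ Z → ∀ w, heisForm Φ π k h x w y = 1 := fun {y} hy w => by
    have := heisForm_swap (Φ := Φ) (π := π) (k := k) h x y w
    rwa [hcl hy, one_mul] at this
  have hout : ∀ y : 𝔤, ∃ z ∈ Z, ((y : 𝔤 ⧸ Z)).out = y + z := fun y =>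
    ⟨-y + ((y : 𝔤 ⧸ Z)).out, QuotientAddGroup.eq.1 (by simp), by abel⟩
  let u : 𝔤 ⧸ Z → Module.End ℂ p := fun q => D.heis q.out
  let γ : 𝔤 ⧸ Z → 𝔤 ⧸ Z → ℂ := fun q q' => heisForm Φ π k h x q.out q'.out
  have hu : ∀ y : 𝔤, u y = D.heis y := by
    intro y
    obtain ⟨z, hz, e⟩ := hout y
    have := D.heis_mul hh y z
    rw [hcr hz, one_smul, h1 z hz, mul_one] at this
    change D.heis (y : 𝔤 ⧸ Z).out = _
    rw [e, this]
  have hγ : ∀ y w : 𝔤, γ y w = heisForm Φ π k h x y w := by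
    intro y w
    obtain ⟨z, hz, e⟩ := hout y
    obtain ⟨z', hz', e'⟩ := hout w
    change heisForm Φ π k h x ((y : 𝔤 ⧸ Z).out : 𝔤) ((w : 𝔤 ⧸ Z).out : 𝔤) = _
    rw [e, e', AddSubgroup.coe_add, AddSubgroup.coe_add, heisForm_add_left, heisForm_add_right,
      hcl hz, mul_one, hcr hz', mul_one]
  -- the centralizer of `x` in `G`
  let I := {c : G // (ι c : Matrix (Fin n) (Fin n) R) * x = x * ι c}
  have hmemI : ∀ i : I, (i : G) ∈ stabMod ι x k := fun i =>
    IsCayleyPair.mem_stabMod_of_commute i.2 k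
  have hconjZ : ∀ (i : I) (y : 𝔤), y ∈ Z → conjEquiv D.pair i y ∈ Z := by
    intro i y hy
    rw [hZ, IsCayleyPair.mem_centMod] at hy ⊢
    change redMat n R 1 ((ι i.1).val * y * (ι i.1)⁻¹.val * x) =
      redMat n R 1 (x * ((ι i.1).val * y * (ι i.1)⁻¹.val))
    have hM : (ι i.1).val * (ι i.1)⁻¹.val = 1 := Units.mul_inv _
    have hM' : (ι i.1)⁻¹.val * (ι i.1).val = 1 := Units.inv_mul _
    have e1 : (ι i.1)⁻¹.val * x = x * (ι i.1)⁻¹.val := by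
      calc (ι i.1)⁻¹.val * x = (ι i.1)⁻¹.val * (x * (ι i.1).val) * (ι i.1)⁻¹.val := by
            rw [mul_assoc, mul_assoc, hM, mul_one]
        _ = x * (ι i.1)⁻¹.val := by rw [← i.2, ← mul_assoc, hM', one_mul]
    rw [mul_assoc, e1, ← mul_assoc, mul_assoc (ι i.1).val, map_mul, map_mul, hy, ← map_mul,
      ← map_mul, ← mul_assoc, i.2]
    simp only [mul_assoc]
  -- its action by conjugation on the quotient by the radical
  let s : I → 𝔤 ⧸ Z ≃ 𝔤 ⧸ Z := fun i =>
    (QuotientAddGroup.congr Z Z (conjEquiv D.pair i) (by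
      apply le_antisymm
      · rintro _ ⟨y, hy, rfl⟩
        exact hconjZ i y hy
      · intro y hy
        have hinv : (ι (i.1)⁻¹ : Matrix (Fin n) (Fin n) R) * x = x * ι (i.1)⁻¹ := by
          have hM : (ι i.1).val * (ι (i.1)⁻¹).val = 1 := by
            rw [map_inv]; exact Units.mul_inv _
          have hM' : (ι (i.1)⁻¹).val * (ι i.1).val = 1 := by
            rw [map_inv]; exact Units.inv_mul _
          calc (ι (i.1)⁻¹).val * x = (ι (i.1)⁻¹).val * (x * (ι i.1).val) * (ι (i.1)⁻¹).val := by
                rw [mul_assoc, mul_assoc, hM, mul_one]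
            _ = x * (ι (i.1)⁻¹).val := by rw [← i.2, ← mul_assoc, hM', one_mul]
        exact ⟨(conjEquiv D.pair i).symm y, hconjZ ⟨(i.1)⁻¹, hinv⟩ y hy,
          (conjEquiv D.pair i).apply_symm_apply y⟩)).toEquiv
  have hsm : ∀ (i : I) (y : 𝔤), s i y = ((conjEquiv D.pair i y : 𝔤) : 𝔤 ⧸ Z) := fun i y => rfl
  have hinvmem : ∀ i : I, (i : G)⁻¹ ∈ stabMod ι x k := fun i => inv_mem (hmemI i)
  refine finrank_sq_eq_card_of_heisenberg u γ ?_ ?_ ?_ ?_ ?_ ?_ ?_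
    (fun i : I => D.stabOp ⟨i, hmemI i⟩) (fun i : I => D.stabOp ⟨(i : G)⁻¹, hinvmem i⟩)
    ?_ ?_ ?_ s ?_ ?_
  · rw [← QuotientAddGroup.mk_zero, hu, h1 0 (zero_mem _)]
  · intro a b
    obtain ⟨y, rfl⟩ := QuotientAddGroup.mk_surjective a
    obtain ⟨w, rfl⟩ := QuotientAddGroup.mk_surjective b
    rw [← QuotientAddGroup.mk_add, hu, hu, hu, hγ, D.heis_mul hh]
  · intro a a' b
    obtain ⟨y, rfl⟩ := QuotientAddGroup.mk_surjective a
    obtain ⟨y', rfl⟩ := QuotientAddGroup.mk_surjective a'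
    obtain ⟨w, rfl⟩ := QuotientAddGroup.mk_surjective b
    rw [← QuotientAddGroup.mk_add, hγ, hγ, hγ, AddSubgroup.coe_add, heisForm_add_left]
  · intro a b b'
    obtain ⟨y, rfl⟩ := QuotientAddGroup.mk_surjective a
    obtain ⟨w, rfl⟩ := QuotientAddGroup.mk_surjective b
    obtain ⟨w', rfl⟩ := QuotientAddGroup.mk_surjective b'
    rw [← QuotientAddGroup.mk_add, hγ, hγ, hγ, AddSubgroup.coe_add, heisForm_add_right]
  · intro a
    exact heisForm_self _ _ _
  · intro a ha
    obtain ⟨y, rfl⟩ := QuotientAddGroup.mk_surjective a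
    by_contra! hcon
    apply ha
    rw [QuotientAddGroup.eq_zero_iff, hZ, IsCayleyPair.mem_centMod]
    -- the trace pairing with `[x, y]` is trivial; doubling `w` removes the factor `h = 1 / 2`
    have h2 := D.pairing.nondeg _ (D.pair.lie_mem x D.mem y y.2) fun w hw => by
      have h3 := hcon ((⟨w + w, add_mem hw hw⟩ : 𝔤) : 𝔤 ⧸ Z)
      rw [hγ, heisForm_eq] at h3
      rw [← h3]
      congr 2
      simp only [mul_add, Matrix.trace_add]
      linear_combination -((x * (y : Matrix (Fin n) (Fin n) R) - y * x) * w).trace * hh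
    rw [map_sub, sub_eq_zero] at h2
    exact h2.symm
  · intro a
    obtain ⟨y, rfl⟩ := QuotientAddGroup.mk_surjective a
    obtain ⟨b, hb, e⟩ := D.pair.half y y.2
    refine ⟨((⟨b, hb⟩ : 𝔤) : 𝔤 ⧸ Z), ?_⟩
    rw [← QuotientAddGroup.mk_add]
    congr 1
    exact Subtype.ext e
  · intro i
    rw [← stabOp_mul, ← D.stabOp_one]
    congr 1
    exact Subtype.ext (mul_inv_cancel _)
  · intro i
    rw [← stabOp_mul, ← D.stabOp_one]
    congr 1
    exact Subtype.ext (inv_mul_cancel _)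
  · intro i j
    rw [← stabOp_mul, ← stabOp_mul]
    congr 1
    apply Subtype.ext
    apply D.pair.injective
    apply Units.ext
    change (ι ((i : G) * j)).val = (ι ((j : G) * i)).val
    rw [map_mul, map_mul, Units.val_mul, Units.val_mul]
    exact D.cyclic.commute i.2 j.2
  · intro i a
    obtain ⟨y, rfl⟩ := QuotientAddGroup.mk_surjective a
    rw [hsm, hu, hu]
    exact D.stabOp_mul_heis i.2 y
  · intro q hq hq'
    refine D.eq_bot_or_eq_top q (fun y w hw => ?_) (fun c hc w hw => hq' ⟨c, hc⟩ w hw)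
    rw [← hu]; exact hq _ w hw

/-- The square of the dimension of the eigenspace. The element `x` matters only modulo `π ^ k`; it
can be changed so that the normalised operators become trivial on the radical. -/
theorem finrank_sq [FiniteDimensional ℂ V] (D : IsOddDatum ι 𝔤 π Φ k ρ x p) :
    Module.finrank ℂ p ^ 2 = Nat.card (𝔤 ⧸ IsCayleyPair.centMod 𝔤 x) := by
  obtain ⟨h, hh⟩ := D.pair.isUnit_two.exists_right_inv
  set Z := IsCayleyPair.centMod 𝔤 x with hZ
  have hp1 : (1 : Module.End ℂ p) ≠ 0 := by
    have : Nontrivial p := p.nontrivial_iff_ne_bot.2 D.ne_bot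
    exact one_ne_zero
  choose! χ₀ hχ₀ using fun (y : 𝔤) (hy : y ∈ Z) => D.exists_heis_eq_smul hy
  have hsmul_inj : ∀ a b : ℂ, a • (1 : Module.End ℂ p) = b • 1 → a = b := fun a b hab =>
    smul_left_injective ℂ hp1 hab
  -- the scalars form a character of the radical, which extends to `𝔤`
  let χ : AddChar Z ℂ := ⟨fun z => χ₀ z, by
      apply hsmul_inj
      rw [← hχ₀ _ (0 : Z).2, one_smul]
      exact D.heis_eq_one (by simp), fun a b => by
      apply hsmul_inj
      have h1 := D.heis_mul hh a b
      rw [heisForm_eq_one_of_mem D.pair.irreducible D.pairing h a.2, one_smul, hχ₀ _ a.2,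
        hχ₀ _ b.2] at h1
      rw [← hχ₀ _ (a + b).2, AddSubgroup.coe_add, ← h1, smul_mul_smul_comm, one_mul]⟩
  obtain ⟨Χ, hΧ⟩ := exists_addChar_extension Z.subtype Z.subtype_injective χ
  have hred : ∀ y : 𝔤, redMat n R 1 y = 0 → y ∈ Z := fun y hy => by
    rw [hZ, IsCayleyPair.mem_centMod, map_mul, map_mul, hy, zero_mul, mul_zero]
  obtain ⟨w, hw⟩ := D.pairing.exists_eq_trChar_one D.pair Χ fun y hy => by
    have h1 := hΧ ⟨y, hred y hy⟩
    change Χ y = χ₀ y at h1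
    rw [h1]
    apply hsmul_inj
    rw [← hχ₀ y (hred y hy), D.heis_eq_one hy, one_smul]
  have hk := D.pos
  -- the extension is the trace pairing with `w`, to be absorbed into `x`
  set x' := x + π ^ k • (w : Matrix (Fin n) (Fin n) R) with hx'
  have hx'red : ∀ i ≤ k, redMat n R i x' = redMat n R i x := fun i hi => by
    rw [hx', map_add, redMat_smul_pow D.pair.irreducible hi, add_zero]
  have hstab : stabMod ι x' k = stabMod ι x k := by
    ext g
    rw [mem_stabMod, mem_stabMod, map_mul, map_mul, map_mul, map_mul, hx'red k le_rfl]
  have hcent : IsCayleyPair.centMod 𝔤 x' = Z := by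
    ext y
    rw [hZ, IsCayleyPair.mem_centMod, IsCayleyPair.mem_centMod, map_mul, map_mul, map_mul, map_mul,
      hx'red 1 hk]
  have D' : IsOddDatum ι 𝔤 π Φ k ρ x' p :=
    { pair := D.pair
      pairing := D.pairing
      pos := hk
      mem := add_mem D.mem ((D.pair.pow_smul_mem k _).2 w.2)
      cyclic := by
        refine IsCyclicMatrix.of_map (residue R) residue_surjective ?_
        rw [redMat_one_eq_iff.1 (hx'red 1 hk)]
        exact D.cyclic.map _
      trivial := D.trivial
      apply_eq := by
        intro g hg v hv
        rw [D.apply_eq g hg v hv, hx', add_mul, Matrix.trace_add, AddChar.map_add_eq_mul]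
        obtain ⟨c, hc⟩ := (redMat_eq_iff D.pair.irreducible).1
          ((mem_congruenceSubgroup.1 hg).trans (map_one _).symm)
        rw [hc, add_sub_cancel_left (1 : Matrix (Fin n) (Fin n) R) (π ^ (k + 1) • c),
          smul_mul_assoc, mul_smul_comm, mul_smul_comm, smul_smul, ← pow_add,
          Matrix.trace_smul (π ^ (k + (k + 1))), smul_eq_mul,
          D.pairing.trivial_of_le (k := k + (k + 1)) (by omega), mul_one]
      stable := by rw [hstab]; exact D.stable
      irreducible := by rw [hstab]; exact D.irreducible
      ne_bot := D.ne_bot }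
  rw [← hcent]
  refine D'.finrank_sq_of_heis_eq_one fun y hy => ?_
  rw [hcent] at hy
  have h1 : D'.heis y = Φ (-(π ^ (2 * k) * ((w : Matrix (Fin n) (Fin n) R) * y).trace)) •
      D.heis y := by
    have hs : D'.stabOp ⟨D'.pair.cay D'.pos y, D'.cay_mem_stabMod y⟩ =
        D.stabOp ⟨D.pair.cay D.pos y, D.cay_mem_stabMod y⟩ := by ext v; rfl
    rw [heis, heis, hs, smul_smul, ← AddChar.map_add_eq_mul]
    congr 2
    rw [hx', add_mul, Matrix.trace_add, smul_mul_assoc, Matrix.trace_smul, smul_eq_mul]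
    ring
  have h2 : Φ (π ^ (2 * k) * ((w : Matrix (Fin n) (Fin n) R) * y).trace) = χ₀ y := by
    have := congrArg (fun f => f y) hw
    simp only [trChar_apply] at this
    rw [← this]
    exact hΧ ⟨y, hy⟩
  rw [h1, hχ₀ y hy, ← h2, smul_smul, ← AddChar.map_add_eq_mul, neg_add_cancel,
    AddChar.map_zero_eq_one, one_smul]

end IsOddDatum

end OddLevel

/-! ### Dimensions for all levels -/

section Dimension

variable {R G V : Type*} [CommRing R] [IsDomain R] [IsDiscreteValuationRing R] [Group G] {n : ℕ}
  [AddCommGroup V] [Module ℂ V] {ι : G →* GL (Fin n) R}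
  {𝔤 : AddSubgroup (Matrix (Fin n) (Fin n) R)} {π : R}

/-- Congruence quotients are abelian up to twice the level. -/
theorem redMat_mul_comm (hπ : Irreducible π) {m r : ℕ} (hr : r ≤ 2 * m)
    {g h : G} (hg : g ∈ congruenceSubgroup ι m) (hh : h ∈ congruenceSubgroup ι m) :
    redMat n R r (ι (g * h)) = redMat n R r (ι (h * g)) := by
  obtain ⟨c, hc⟩ := (redMat_eq_iff hπ).1 ((mem_congruenceSubgroup.1 hg).trans (map_one _).symm)
  obtain ⟨d, hd⟩ := (redMat_eq_iff hπ).1 ((mem_congruenceSubgroup.1 hh).trans (map_one _).symm)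
  obtain ⟨k, hk⟩ := Nat.exists_eq_add_of_le hr
  rw [redMat_eq_iff hπ]
  refine ⟨π ^ k • (c * d - d * c), ?_⟩
  rw [smul_smul, ← pow_add, ← hk, map_mul, map_mul, Units.val_mul, Units.val_mul, hc, hd, two_mul,
    pow_add]
  simp only [add_mul, mul_add, one_mul, mul_one, smul_mul_assoc, mul_smul_comm, smul_sub]
  module

theorem apply_eq_of_redMat_eq {ρ : Representation ℂ G V} {r : ℕ}
    (htriv : ∀ g ∈ congruenceSubgroup ι r, ρ g = 1) {g h : G}
    (e : redMat n R r (ι g) = redMat n R r (ι h)) : ρ g = ρ h := by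
  have h1 := htriv _ (redMat_inv_mul_eq_one_iff.2 e)
  have h2 : ρ (h : G) = ρ g * ρ ((g : G)⁻¹ * h) := by rw [← map_mul, mul_inv_cancel_left]
  rw [h2, h1, mul_one]

theorem commute_apply (hπ : Irreducible π) {ρ : Representation ℂ G V} {m r : ℕ} (hr : r ≤ 2 * m)
    (htriv : ∀ g ∈ congruenceSubgroup ι r, ρ g = 1) (a b : congruenceSubgroup ι m) :
    ρ a * ρ b = ρ b * ρ a := by
  rw [← map_mul, ← map_mul]
  exact apply_eq_of_redMat_eq htriv (redMat_mul_comm hπ hr a.2 b.2)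

variable [Finite (ResidueField R)] [FiniteDimensional ℂ V]

/-- The dimension of an irreducible representation containing the character attached to the cyclic
matrix `x`. The character lives on the `m`-th congruence subgroup, for `m = ⌈(ℓ + 1) / 2⌉`, whose
action factors through an abelian quotient. -/
theorem IsPairing.finrank_sq {Φ : AddChar R ℂ} {ℓ : ℕ} (hP : IsPairing 𝔤 π ℓ Φ)
    (H : IsCayleyPair ι 𝔤 π) (hℓ : 1 ≤ ℓ) {ρ : Representation ℂ G V} (hρ : ρ.IsIrreducible)
    (htriv : ∀ g ∈ congruenceSubgroup ι (ℓ + 1), ρ g = 1)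
    {x : Matrix (Fin n) (Fin n) R} (hx : x ∈ 𝔤) (hcyc : IsCyclicMatrix x)
    (hne : eigenSubmodule ρ (congruenceSubgroup ι (ℓ + 1 - (ℓ + 1) / 2)) (fun a =>
      Φ ((x * ((ι a : Matrix _ _ R) - 1)).trace)) ≠ ⊥) :
    Module.finrank ℂ V ^ 2 = (stabMod ι x 1).index ^ 2 *
      Nat.card (𝔤 ⧸ IsCayleyPair.centMod 𝔤 x) ^ (ℓ - 1) := by
  obtain ⟨m, hm⟩ : ∃ m, m = ℓ + 1 - (ℓ + 1) / 2 := ⟨_, rfl⟩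
  rw [← hm] at hne
  set θ : congruenceSubgroup ι m → ℂ := fun a => Φ ((x * ((ι a : Matrix _ _ R) - 1)).trace) with hθ
  have hm1 : 1 ≤ m := by omega
  have hS := hP.conjFun_eq_iff H hm1 (by omega) (by omega) (θ := θ) hx (fun a => rfl)
  have hN := commute_apply (ι := ι) (ρ := ρ) (m := m) H.irreducible (by omega) htriv
  have hstable : ∀ g ∈ stabMod ι x (ℓ + 1 - m), ∀ w ∈ eigenSubmodule ρ (congruenceSubgroup ι m) θ,
      ρ g w ∈ eigenSubmodule ρ (congruenceSubgroup ι m) θ := fun g hg w hw => by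
    have := apply_mem_eigenSubmodule g hw
    rwa [(hS g).1 hg] at this
  rcases Nat.even_or_odd' ℓ with ⟨k, hk | hk⟩
  · have hmk : m = k + 1 := by omega
    have hmk' : ℓ + 1 - m = k := by omega
    subst hk
    subst hmk
    rw [hmk'] at hS hstable
    -- `ℓ + 1 = 2 k + 1` and `m = k + 1`: the stabiliser acts through a Heisenberg representation
    have D : IsOddDatum ι 𝔤 π Φ k ρ x (eigenSubmodule ρ (congruenceSubgroup ι (k + 1)) θ) :=
      { pair := H
        pairing := hP
        pos := by omega
        mem := hx
        cyclic := hcyc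
        trivial := htriv
        apply_eq := fun g hg w hw => mem_eigenSubmodule.1 hw ⟨g, hg⟩
        stable := hstable
        irreducible := fun q hq hqS => eq_bot_or_eq_eigenSubmodule hρ hN hS hq hqS
        ne_bot := hne }
    obtain ⟨j, rfl⟩ : ∃ j, k = j + 1 := ⟨k - 1, by omega⟩
    rw [finrank_eq_index_mul hρ hN hS le_rfl hne hstable, mul_pow, D.finrank_sq,
      H.index_stabMod hx hcyc, mul_pow, show 2 * (j + 1) - 1 = j * 2 + 1 by omega]
    ring
  · have hmk : m = k + 1 := by omega
    have hmk' : ℓ + 1 - m = k + 1 := by omega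
    subst hmk
    rw [hmk'] at hS hstable
    set p := eigenSubmodule ρ (congruenceSubgroup ι (k + 1)) θ with hp
    have : Nontrivial p := p.nontrivial_iff_ne_bot.2 hne
    let I := {c : G // (ι c : Matrix (Fin n) (Fin n) R) * x = x * ι c}
    have hI : ∀ c : I, (c : G) ∈ stabMod ι x (k + 1) := fun c =>
      IsCayleyPair.mem_stabMod_of_commute c.2 _
    -- `ℓ + 1 = 2 m`: the stabiliser acts through the commutative centralizer of `x`, so that the
    -- eigenspace contains a stable line
    obtain ⟨w, hw0, hw⟩ := exists_common_eigenvector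
      (fun c : I => (ρ c).restrict (hstable c (hI c))) (fun c d => by
        ext v
        have hcd : (c : G) * d = d * c := by
          apply H.injective
          apply Units.ext
          rw [map_mul, map_mul, Units.val_mul, Units.val_mul]
          exact hcyc.commute c.2 d.2
        change ρ c (ρ d v) = ρ d (ρ c v)
        rw [← Module.End.mul_apply, ← Module.End.mul_apply, ← map_mul, ← map_mul, hcd])
    have hwV : (w : V) ≠ 0 := fun h => hw0 (Subtype.ext h)
    have hle : ℂ ∙ (w : V) ≤ p := by
      rw [Submodule.span_singleton_le_iff_mem]; exact w.2
    have hdim := finrank_eq_index_mul hρ hN hS hle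
      (fun h => hwV (Submodule.span_singleton_eq_bot.1 h)) (fun g hg v hv => by
        obtain ⟨a, rfl⟩ := Submodule.mem_span_singleton.1 hv
        obtain ⟨c, hc, l, hl, rfl⟩ := H.exists_eq_mul_of_mem_stabMod hx hcyc (by omega) hg
        obtain ⟨b, hb⟩ := hw ⟨c, hc⟩
        have hb' : ρ c (w : V) = b • (w : V) := congrArg Subtype.val hb
        rw [map_smul, map_mul, Module.End.mul_apply, hb', map_smul,
          mem_eigenSubmodule.1 w.2 ⟨l, hl⟩, smul_smul, smul_smul]
        exact Submodule.smul_mem _ _ (Submodule.mem_span_singleton_self _))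
    rw [hdim, finrank_span_singleton hwV, mul_one, H.index_stabMod hx hcyc, mul_pow, ← pow_mul,
      show ℓ - 1 = k * 2 by omega]

end Dimension

/-- A group of matrices over `R`, which is `o` or an extension of `o`, with its Lie algebra `𝔤` and
the reduction `L` of `𝔤`: the properties of `GL_n` and of unitary groups on which the description
of regular representations rests. -/
structure IsRegularSetting (o : Type*) {R G : Type*} [CommRing o] [CommRing R] [IsDomain R]
    [IsDiscreteValuationRing R] [Algebra o R] [Group G] {n : ℕ} (ι : G →* GL (Fin n) R)
    (𝔤 : AddSubgroup (Matrix (Fin n) (Fin n) R))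
    (L : Set (Matrix (Fin n) (Fin n) (ResidueField R))) : Prop where
  pair : ∀ π : o, Irreducible π → IsCayleyPair ι 𝔤 (algebraMap o R π)
  mem_iff : ∀ x, x ∈ L ↔ ∃ y ∈ 𝔤, y.map (residue R) = x
  nondeg : ∀ ψ : AddChar (ResidueField R) ℂ, (∃ a : o, ψ (residue R (algebraMap o R a)) ≠ 1) →
    ∀ x ∈ L, (∀ y ∈ L, ψ (x * y).trace = 1) → x = 0

section Setting

variable {o R G V : Type*} [CommRing o] [CommRing R] [IsDomain R] [IsDiscreteValuationRing R]
  [Algebra o R] [Group G] {n : ℕ} [AddCommGroup V] [Module ℂ V] {ι : G →* GL (Fin n) R}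
  {𝔤 : AddSubgroup (Matrix (Fin n) (Fin n) R)} {L : Set (Matrix (Fin n) (Fin n) (ResidueField R))}

theorem trace_map (f : R →+* ResidueField R) (x : Matrix (Fin n) (Fin n) R) :
    (x.map f).trace = f x.trace := by
  simp [Matrix.trace]

/-- An additive character of `R` extending `π ^ ℓ a ↦ ψ a`; it need not be continuous. -/
theorem IsRegularSetting.exists_isPairing (E : IsRegularSetting o ι 𝔤 L) {π : o}
    (hπ : Irreducible π) {ψ : AddChar (ResidueField R) ℂ}
    (hψ : ∃ a : o, ψ (residue R (algebraMap o R a)) ≠ 1) (ℓ : ℕ) :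
    ∃ Φ : AddChar R ℂ, IsPairing 𝔤 (algebraMap o R π) ℓ Φ ∧
      ∀ a, Φ (algebraMap o R π ^ ℓ * a) = ψ (residue R a) := by
  have hπ' := (E.pair π hπ).irreducible
  obtain ⟨Φ, hΦ⟩ := exists_addChar_extension (AddMonoidHom.mulLeft (algebraMap o R π ^ ℓ))
    (fun a b hab => mul_left_cancel₀ (pow_ne_zero ℓ hπ'.ne_zero) hab)
    (ψ.compAddMonoidHom (residue R).toAddMonoidHom)
  have hΦ' : ∀ a, Φ (algebraMap o R π ^ ℓ * a) = ψ (residue R a) := hΦ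
  refine ⟨Φ, ⟨fun a => ?_, fun x hx h => ?_⟩, hΦ'⟩
  · rw [pow_succ, mul_assoc, hΦ', map_mul, residue_irreducible hπ', zero_mul,
      AddChar.map_zero_eq_one]
  · rw [← map_zero (redMat n R 1), redMat_one_eq_iff,
      E.nondeg ψ hψ (x.map (residue R)) ((E.mem_iff _).2 ⟨x, hx, rfl⟩) fun y hy => ?_]
    · ext; simp
    · obtain ⟨y, hy', rfl⟩ := (E.mem_iff _).1 hy
      rw [← Matrix.map_mul, trace_map, ← hΦ']
      exact h y hy'

end Setting

/-! ### Existence of irreducible representations -/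

section Irreducible

variable {G W : Type*} [Group G] [AddCommGroup W] [Module ℂ W]

/-- A finite-dimensional representation contains an irreducible one. -/
theorem exists_isIrreducible (ρ : Representation ℂ G W) (Y : Submodule ℂ W)
    [FiniteDimensional ℂ Y] (hY : ∀ g, ∀ w ∈ Y, ρ g w ∈ Y) (hY0 : Y ≠ ⊥) :
    ∃ (d : ℕ) (σ : Representation ℂ G (Fin d → ℂ)) (j : (Fin d → ℂ) →ₗ[ℂ] W),
      σ.IsIrreducible ∧ Function.Injective j ∧ (∀ v, j v ∈ Y) ∧
      ∀ g v, j (σ g v) = ρ g (j v) := by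
  -- a minimal non-zero subspace of `Y` stable under `G`
  let S : Set (Submodule ℂ Y) := {p | p ≠ ⊥ ∧ ∀ g, ∀ w ∈ p, ∀ h, (⟨ρ g (w : W), h⟩ : Y) ∈ p}
  have : Nontrivial Y := Y.nontrivial_iff_ne_bot.2 hY0
  obtain ⟨p, ⟨hp0, hpS⟩, hmin⟩ := (wellFounded_lt (α := Submodule ℂ Y)).has_min S
    ⟨⊤, top_ne_bot, fun _ _ _ _ => trivial⟩
  let T : G → Module.End ℂ p := fun g =>
    ((ρ g).restrict (hY g)).restrict (fun w hw => hpS g w hw (hY g w w.2))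
  have hT : ∀ g (w : p), ((T g w : Y) : W) = ρ g (w : Y) := fun g w => rfl
  let e := (Module.finBasis ℂ p).equivFun
  let σ : Representation ℂ G (Fin (Module.finrank ℂ p) → ℂ) :=
    { toFun := fun g => e.conj (T g)
      map_one' := by
        have : T 1 = 1 := by ext w; simp [hT]
        rw [this]; exact e.conj_id
      map_mul' := fun g h => by
        have : T (g * h) = T g * T h := by ext w; simp [hT]
        rw [this]; exact e.conj_comp _ _ }
  have hσ : ∀ g v, e.symm (σ g v) = T g (e.symm v) := fun g v => by
    change e.symm (e (T g (e.symm v))) = _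
    rw [e.symm_apply_apply]
  refine ⟨_, σ, Y.subtype ∘ₗ p.subtype ∘ₗ e.symm.toLinearMap, ?_, ?_, ?_, ?_⟩
  · have hpn : Nontrivial p := p.nontrivial_iff_ne_bot.2 hp0
    have hn : Nontrivial (Fin (Module.finrank ℂ p) → ℂ) := e.toEquiv.symm.nontrivial
    have hbt : (⊥ : Subrepresentation σ) ≠ ⊤ := fun h => by
      have h2 : (⊥ : Submodule ℂ (Fin (Module.finrank ℂ p) → ℂ)) = ⊤ :=
        congrArg Subrepresentation.toSubmodule h
      exact bot_ne_top h2
    refine { exists_pair_ne := ⟨_, _, hbt⟩, eq_bot_or_eq_top := fun a => ?_ }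
    let q : Submodule ℂ Y := (a.toSubmodule.map e.symm.toLinearMap).map p.subtype
    have hqp : q ≤ p := Submodule.map_subtype_le p _
    by_cases hq : q = ⊥
    · left
      apply Subrepresentation.toSubmodule_injective
      rw [← Submodule.map_bot p.subtype] at hq
      have h1 := Submodule.map_injective_of_injective p.injective_subtype hq
      rw [← Submodule.map_bot e.symm.toLinearMap] at h1
      exact Submodule.map_injective_of_injective e.symm.injective h1
    · right
      have hqS : q ∈ S := by
        refine ⟨hq, ?_⟩
        rintro g _ ⟨_, ⟨w, hw, rfl⟩, rfl⟩ h
        exact ⟨_, ⟨σ g w, a.apply_mem_toSubmodule g hw, hσ g w⟩, rfl⟩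
      have hqe : q = p := by
        by_contra hne
        exact hmin q hqS (lt_of_le_of_ne hqp hne)
      apply Subrepresentation.toSubmodule_injective
      change a.toSubmodule = ⊤
      rw [eq_top_iff]
      intro v _
      have : (e.symm v : Y) ∈ q := by rw [hqe]; exact (e.symm v).2
      obtain ⟨_, ⟨w, hw, rfl⟩, h⟩ := this
      have := e.symm.injective (Subtype.ext h)
      rwa [← this]
  · exact Y.injective_subtype.comp (p.injective_subtype.comp e.symm.injective)
  · intro v; exact (e.symm v : Y).2
  · intro g v
    change ((e.symm (σ g v) : Y) : W) = _
    rw [hσ]; rfl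

/-- Right translation of functions on a group. -/
def rightTranslation (G : Type*) [Group G] : Representation ℂ G (G → ℂ) where
  toFun g := LinearMap.funLeft ℂ ℂ (fun h => h * g)
  map_one' := by ext; simp [LinearMap.funLeft]
  map_mul' a b := by
    refine LinearMap.ext fun f => ?_
    funext h
    simp [LinearMap.funLeft, mul_assoc]

theorem rightTranslation_apply (g h : G) (f : G → ℂ) :
    rightTranslation G g f h = f (h * g) := rfl

/-- Every linear character `θ` of a normal subgroup `N`, trivial on a normal subgroup `K` of finite
index, occurs in an irreducible representation trivial on `K`: one contained in the representation induced
from `θ`, realised by functions on `G`. -/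
theorem exists_isIrreducible_of_character (N K : Subgroup G) [N.Normal] [K.Normal]
    [Finite (G ⧸ K)] (θ : N → ℂ) (hθ1 : θ 1 = 1) (hθ : ∀ a b, θ (a * b) = θ a * θ b)
    (hKN : K ≤ N) (hK : ∀ a : N, (a : G) ∈ K → θ a = 1)
    (hcomm : ∀ a b : N, (a * b : G)⁻¹ * (b * a) ∈ K) :
    ∃ (d : ℕ) (σ : Representation ℂ G (Fin d → ℂ)), σ.IsIrreducible ∧ (∀ g ∈ K, σ g = 1) ∧
      eigenSubmodule σ N θ ≠ ⊥ := by
  classical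
  let Y : Submodule ℂ (G → ℂ) :=
    { carrier := {f | ∀ (a : N) (h : G), f (a * h) = θ a * f h}
      zero_mem' := fun a h => by simp
      add_mem' := fun {f f'} hf hf' a h => by
        simp only [Pi.add_apply]; rw [hf a h, hf' a h, mul_add]
      smul_mem' := fun c f hf a h => by
        simp only [Pi.smul_apply, smul_eq_mul]; rw [hf a h]; ring }
  have hYm : ∀ f, f ∈ Y ↔ ∀ (a : N) (h : G), f (a * h) = θ a * f h := fun f => Iff.rfl
  have hYK : ∀ f ∈ Y, ∀ g ∈ K, ∀ h, f (h * g) = f h := by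
    intro f hf g hg h
    have h1 := hf ⟨h * g * h⁻¹, hKN ((inferInstance : K.Normal).conj_mem g hg h)⟩ h
    rw [hK _ ((inferInstance : K.Normal).conj_mem g hg h), one_mul] at h1
    simpa using h1
  have : FiniteDimensional ℂ Y := by
    let F : Y →ₗ[ℂ] (G ⧸ K → ℂ) := LinearMap.funLeft ℂ ℂ (fun q : G ⧸ K => q.out) ∘ₗ Y.subtype
    refine FiniteDimensional.of_injective F fun f f' hff => ?_
    ext h
    have h1 : (f : G → ℂ) ((h : G ⧸ K).out) = (f' : G → ℂ) ((h : G ⧸ K).out) :=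
      congrFun hff (h : G ⧸ K)
    obtain ⟨k, hk⟩ := QuotientGroup.mk_out_eq_mul K h
    rwa [hk, hYK f f.2 k k.2, hYK f' f'.2 k k.2] at h1
  have hYst : ∀ g, ∀ w ∈ Y, rightTranslation G g w ∈ Y := by
    intro g w hw a h
    rw [rightTranslation_apply, rightTranslation_apply, mul_assoc, hw]
  have hY0 : Y ≠ ⊥ := by
    let f : G → ℂ := fun h => if hh : h ∈ N then θ ⟨h, hh⟩ else 0
    have hf : f ∈ Y := by
      intro a h
      by_cases hh : h ∈ N
      · simp only [f, dif_pos hh, dif_pos (mul_mem a.2 hh)]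
        rw [← hθ]; rfl
      · have : (a : G) * h ∉ N := fun h' => hh ((N.mul_mem_cancel_left a.2).1 h')
        simp only [f, dif_neg hh, dif_neg this, mul_zero]
    intro h
    rw [h, Submodule.mem_bot] at hf
    have h1 := congrFun hf 1
    simp only [f, dif_pos (one_mem N), Pi.zero_apply] at h1
    rw [show (⟨1, one_mem N⟩ : N) = 1 from rfl, hθ1] at h1
    exact one_ne_zero h1
  obtain ⟨d, σ, j, hirr, hj, hjY, hjσ⟩ := exists_isIrreducible (rightTranslation G) Y hYst hY0
  have hσK : ∀ g ∈ K, σ g = 1 := by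
    intro g hg
    refine LinearMap.ext fun v => hj ?_
    rw [hjσ]
    funext h
    rw [rightTranslation_apply, hYK _ (hjY v) g hg]
    rfl
  refine ⟨d, σ, hirr, hσK, ?_⟩
  have hnt := nontrivial_of_isIrreducible hirr
  obtain ⟨w, hw0, hw⟩ := exists_common_eigenvector (fun a : N => σ a) (fun a b => by
    rw [← map_mul, ← map_mul]
    have h1 : (b * a : G) = a * b * ((a * b : G)⁻¹ * (b * a)) := by group
    rw [h1, map_mul σ (a * b : G), hσK _ (hcomm a b), mul_one])
  choose θ' hθ' using hw
  have hjw : j w ≠ 0 := fun h => hw0 (hj (by rw [h, map_zero]))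
  obtain ⟨h₀, hh₀⟩ := Function.ne_iff.1 hjw
  -- evaluation at `h₀` shows that `θ` is conjugate to an eigencharacter `θ'` of `N` on `w`
  have key : conjFun N h₀ θ' = θ := by
    funext a
    have h1 := hθ' ⟨h₀⁻¹ * a * h₀, by
      have := (inferInstance : N.Normal).conj_mem a a.2 h₀⁻¹; rwa [inv_inv] at this⟩
    have h2 := congrFun (congrArg j h1) h₀
    rw [hjσ, rightTranslation_apply, map_smul, Pi.smul_apply, smul_eq_mul] at h2
    simp only [← mul_assoc, mul_inv_cancel, one_mul] at h2
    rw [hjY w a h₀] at h2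
    exact (mul_right_cancel₀ hh₀ h2).symm
  rw [Submodule.ne_bot_iff]
  refine ⟨σ h₀ w, ?_, ?_⟩
  · rw [← key]
    exact apply_mem_eigenSubmodule h₀ (mem_eigenSubmodule.2 hθ')
  · intro h
    apply hw0
    have := congrArg (σ h₀⁻¹) h
    rwa [← Module.End.mul_apply, ← map_mul, inv_mul_cancel, map_one, map_zero] at this

end Irreducible

/-! ### Degrees of regular representations -/

section Setting

variable {o R G V : Type*} [CommRing o] [CommRing R] [IsDomain R] [IsDiscreteValuationRing R]
  [Algebra o R] [Group G] {n : ℕ} [AddCommGroup V] [Module ℂ V] {ι : G →* GL (Fin n) R}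
  {𝔤 : AddSubgroup (Matrix (Fin n) (Fin n) R)} {L : Set (Matrix (Fin n) (Fin n) (ResidueField R))}

theorem map_residue_add_smul {π : R} (hπ : Irreducible π) (y c : Matrix (Fin n) (Fin n) R) :
    (y + π • c).map (residue R) = y.map (residue R) := by
  ext i j
  change residue R (y i j + π * c i j) = residue R (y i j)
  rw [map_add, map_mul, residue_irreducible hπ, zero_mul, add_zero]

theorem congruenceSubgroup_le {π : R} (hπ : Irreducible π) {i j : ℕ} (hij : i ≤ j) :
    congruenceSubgroup ι j ≤ congruenceSubgroup ι i := by
  intro g hg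
  rw [mem_congruenceSubgroup] at hg ⊢
  rw [← map_one (redMat n R i)]
  exact redMat_eq_of_le hπ hij (by rw [hg, map_one])

variable [Finite (ResidueField R)]

theorem finite_quot_congruenceSubgroup (i : ℕ) : Finite (G ⧸ congruenceSubgroup ι i) := by
  have := finite_quot (R := R) i
  exact Finite.of_injective _ (QuotientGroup.kerLift_injective
    ((Matrix.GeneralLinearGroup.map (n := Fin n)
    (Ideal.Quotient.mk (maximalIdeal R ^ i))).comp ι))

/-- The dimension of a regular representation of positive level: regularity is a condition on the
last congruence subgroup, and passes to any character of a larger one, because regular matrices lift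
to cyclic ones. -/
theorem IsRegularSetting.exists_finrank_sq [FiniteDimensional ℂ V] (E : IsRegularSetting o ι 𝔤 L)
    {ℓ : ℕ} (hℓ : 1 ≤ ℓ) {ρ : Representation ℂ G V} (h : IsRegularOfLevel o ι L ℓ ρ) :
    ∃ x ∈ 𝔤, IsCyclicMatrix x ∧ Module.finrank ℂ V ^ 2 = (stabMod ι x 1).index ^ 2 *
      Nat.card (𝔤 ⧸ IsCayleyPair.centMod 𝔤 x) ^ (ℓ - 1) := by
  have := nontrivial_of_isIrreducible h.irreducible
  obtain ⟨m, hm⟩ : ∃ m, m = ℓ + 1 - (ℓ + 1) / 2 := ⟨_, rfl⟩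
  have htriv := h.level.1
  have hπR : ∃ π : R, Irreducible π := IsDiscreteValuationRing.exists_irreducible R
  obtain ⟨π₀, hπ₀⟩ := hπR
  obtain ⟨w, hw0, hw⟩ := exists_common_eigenvector (fun a : congruenceSubgroup ι m => ρ a)
    (commute_apply hπ₀ (by omega) htriv)
  choose θ hθ using hw
  have hθinj : ∀ a b : ℂ, a • w = b • w → a = b := fun a b hab => smul_left_injective ℂ hw0 hab
  have hθ1 : θ 1 = 1 := hθinj _ _ (by rw [← hθ]; simp)
  have hθmul : ∀ a b, θ (a * b) = θ a * θ b := fun a b => hθinj _ _ (by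
    rw [← hθ, Subgroup.coe_mul, map_mul, Module.End.mul_apply, hθ, map_smul, hθ, smul_smul, mul_comm])
  have hle : congruenceSubgroup ι ℓ ≤ congruenceSubgroup ι m :=
    congruenceSubgroup_le hπ₀ (by omega)
  let θ₁ : congruenceSubgroup ι m →* ℂ := ⟨⟨θ, hθ1⟩, hθmul⟩
  let θ₂ : congruenceSubgroup ι ℓ →* ℂˣ := (θ₁.comp (Subgroup.inclusion hle)).toHomUnits
  obtain ⟨π, hπ, ψ, hψ, x₀, hx₀, hreg, hθx⟩ := h.regular θ₂
    ⟨w, hw0, fun g => hθ (Subgroup.inclusion hle g)⟩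
  obtain ⟨Φ, hP, hΦ⟩ := E.exists_isPairing hπ hψ ℓ
  have H := E.pair π hπ
  obtain ⟨x, hx, hxθ⟩ := hP.exists_eq_of_hom H (m := m) (by omega) (by omega) (by omega) θ hθmul
    fun a ha => hθinj _ _ (by rw [← hθ, htriv _ ha, one_smul]; rfl)
  -- both define the same character of the last congruence subgroup
  have hxx₀ : x.map (residue R) = x₀ := by
    rw [← sub_eq_zero]
    refine E.nondeg ψ hψ _ ?_ fun y hy => ?_
    · obtain ⟨z, hz, rfl⟩ := (E.mem_iff _).1 hx₀
      refine (E.mem_iff _).2 ⟨x - z, sub_mem hx hz, ?_⟩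
      ext; simp
    · obtain ⟨y, hy', rfl⟩ := (E.mem_iff _).1 hy
      obtain ⟨c, hc⟩ := (redMat_eq_iff H.irreducible).1
        (H.redMat_cay hℓ (j := ℓ + 1) (by omega) ⟨y, hy'⟩)
      have hc' : (ι (H.cay hℓ ⟨y, hy'⟩) : Matrix (Fin n) (Fin n) R) =
          1 + algebraMap o R π ^ ℓ • (y + algebraMap o R π • c) := by
        rw [hc, pow_succ, mul_smul, smul_add, add_assoc]
      set a : congruenceSubgroup ι ℓ := ⟨H.cay hℓ ⟨y, hy'⟩, H.cay_mem hℓ _⟩ with ha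
      have h1 := hθx a _ hc'
      have h2 : (θ₂ a : ℂ) = Φ ((x * ((ι (a : G) : Matrix (Fin n) (Fin n) R) - 1)).trace) :=
        hxθ (Subgroup.inclusion hle a)
      rw [h1] at h2
      have h3 : (ι (a : G) : Matrix (Fin n) (Fin n) R) = _ := hc'
      rw [h3, add_sub_cancel_left, mul_smul_comm, Matrix.trace_smul, smul_eq_mul, hΦ, ← trace_map,
        Matrix.map_mul] at h2
      have h4 : (y + algebraMap o R π • c).map (residue R) = y.map (residue R) :=
        map_residue_add_smul H.irreducible y c
      rw [h4] at h2
      rw [sub_mul, Matrix.trace_sub, AddChar.map_sub_eq_div, h2, div_self (addChar_ne_zero _ _)]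
  refine ⟨x, hx, ?_, ?_⟩
  · refine IsCyclicMatrix.of_map (residue R) residue_surjective ?_
    rw [hxx₀]
    exact isCyclicMatrix_of_isRegularMatrix hreg
  · refine hP.finrank_sq H hℓ h.irreducible htriv hx ?_ ?_
    · refine IsCyclicMatrix.of_map (residue R) residue_surjective ?_
      rw [hxx₀]
      exact isCyclicMatrix_of_isRegularMatrix hreg
    · rw [← hm, Submodule.ne_bot_iff]
      exact ⟨w, mem_eigenSubmodule.2 fun a => by rw [hθ, hxθ], hw0⟩

/-- Every matrix in `𝔤` whose reduction is regular and non-zero gives rise to a regular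
representation. -/
theorem IsRegularSetting.exists_mem_regularDegrees (E : IsRegularSetting o ι 𝔤 L)
    {ℓ : ℕ} (hℓ : 1 ≤ ℓ) (hπ : ∃ π : o, Irreducible π) {x : Matrix (Fin n) (Fin n) R} (hx : x ∈ 𝔤)
    (hcyc : IsCyclicMatrix x) (hx0 : x.map (residue R) ≠ 0) :
    ∃ d ∈ regularDegrees o ι L ℓ, d ^ 2 = (stabMod ι x 1).index ^ 2 *
      Nat.card (𝔤 ⧸ IsCayleyPair.centMod 𝔤 x) ^ (ℓ - 1) := by
  obtain ⟨π, hπ⟩ := hπ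
  have H := E.pair π hπ
  obtain ⟨ψ, hψ1⟩ := (AddChar.exists_apply_ne_zero (a := (1 : ResidueField R))).2 one_ne_zero
  have hψ : ∃ a : o, ψ (residue R (algebraMap o R a)) ≠ 1 := ⟨1, by simpa using hψ1⟩
  obtain ⟨Φ, hP, hΦ⟩ := E.exists_isPairing hπ hψ ℓ
  obtain ⟨m, hm⟩ : ∃ m, m = ℓ + 1 - (ℓ + 1) / 2 := ⟨_, rfl⟩
  set θ : congruenceSubgroup ι m → ℂ := fun a => Φ ((x * ((ι a : Matrix _ _ R) - 1)).trace) with hθ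
  have hθmul : ∀ a b, θ (a * b) = θ a * θ b := by
    intro a b
    obtain ⟨c, hc⟩ := (redMat_eq_iff H.irreducible).1
      ((mem_congruenceSubgroup.1 a.2).trans (map_one _).symm)
    obtain ⟨d, hd⟩ := (redMat_eq_iff H.irreducible).1
      ((mem_congruenceSubgroup.1 b.2).trans (map_one _).symm)
    have e : (x * ((ι (a * b : congruenceSubgroup ι m) : Matrix (Fin n) (Fin n) R) - 1)).trace =
        (x * ((ι a : Matrix (Fin n) (Fin n) R) - 1)).trace +
        (x * ((ι b : Matrix (Fin n) (Fin n) R) - 1)).trace +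
        algebraMap o R π ^ (m + m) * (x * (c * d)).trace := by
      have e' : algebraMap o R π ^ (m + m) * (x * (c * d)).trace =
          (x * algebraMap o R π ^ (m + m) • (c * d)).trace := by
        rw [mul_smul_comm, Matrix.trace_smul, smul_eq_mul]
      rw [e', ← Matrix.trace_add, ← Matrix.trace_add, ← mul_add, ← mul_add,
        Subgroup.coe_mul, map_mul, Units.val_mul, hc, hd]
      congr 2
      simp only [add_mul, mul_add, one_mul, mul_one, smul_mul_assoc, mul_smul_comm, smul_smul,
        smul_add, ← pow_add]
      abel
    rw [hθ]
    simp only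
    rw [e, AddChar.map_add_eq_mul, AddChar.map_add_eq_mul, hP.trivial_of_le (by omega), mul_one]
  have := finite_quot_congruenceSubgroup (ι := ι) (ℓ + 1)
  have hle : congruenceSubgroup ι ℓ ≤ congruenceSubgroup ι m :=
    congruenceSubgroup_le H.irreducible (by omega)
  obtain ⟨d, σ, hirr, hσ, hne⟩ := exists_isIrreducible_of_character (congruenceSubgroup ι m)
    (congruenceSubgroup ι (ℓ + 1)) θ (by simp [hθ]) hθmul
    (congruenceSubgroup_le H.irreducible (by omega))
    (fun a ha => by
      obtain ⟨c, hc⟩ := (redMat_eq_iff H.irreducible).1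
        ((mem_congruenceSubgroup.1 ha).trans (map_one _).symm)
      rw [hθ]; simp only
      rw [hc, add_sub_cancel_left, mul_smul_comm, Matrix.trace_smul, smul_eq_mul, hP.trivial])
    (fun a b => redMat_inv_mul_eq_one_iff.2
      (redMat_mul_comm H.irreducible (by omega) a.2 b.2))
  obtain ⟨w, hw, hw0⟩ := (Submodule.ne_bot_iff _).1 hne
  rw [mem_eigenSubmodule] at hw
  -- the restriction of `θ` to the last congruence subgroup
  have hres : ∀ (g : congruenceSubgroup ι ℓ) (y : Matrix (Fin n) (Fin n) R),
      (ι (g : G) : Matrix (Fin n) (Fin n) R) = 1 + algebraMap o R π ^ ℓ • y →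
      θ (Subgroup.inclusion hle g) = ψ ((x.map (residue R) * y.map (residue R)).trace) := by
    intro g y hgy
    change Φ ((x * ((ι (g : G) : Matrix (Fin n) (Fin n) R) - 1)).trace) = _
    rw [hgy, add_sub_cancel_left, mul_smul_comm, Matrix.trace_smul, smul_eq_mul, hΦ, ← trace_map,
      Matrix.map_mul]
  refine ⟨d, ⟨σ, hirr, ⟨hσ, fun r hr => ?_⟩, ?_⟩, ?_⟩
  · -- in smaller level the character attached to `x` would be trivial
    by_contra! hlt
    apply hx0
    refine E.nondeg ψ hψ _ ((E.mem_iff _).2 ⟨x, hx, rfl⟩) fun y hy => ?_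
    obtain ⟨y, hy', rfl⟩ := (E.mem_iff _).1 hy
    obtain ⟨c, hc⟩ := (redMat_eq_iff H.irreducible).1
      (H.redMat_cay hℓ (j := ℓ + 1) (by omega) ⟨y, hy'⟩)
    have hc' : (ι (H.cay hℓ ⟨y, hy'⟩) : Matrix (Fin n) (Fin n) R) =
        1 + algebraMap o R π ^ ℓ • (y + algebraMap o R π • c) := by
      rw [hc, pow_succ, mul_smul, smul_add, add_assoc]
    have h4 : (y + algebraMap o R π • c).map (residue R) = y.map (residue R) :=
      map_residue_add_smul H.irreducible y c
    set a : congruenceSubgroup ι ℓ := ⟨H.cay hℓ ⟨y, hy'⟩, H.cay_mem hℓ _⟩ with ha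
    rw [← h4, ← hres a _ hc']
    apply smul_left_injective ℂ hw0
    have h5 := hw (Subgroup.inclusion hle a)
    have h6 := hr a (congruenceSubgroup_le H.irreducible (by omega) a.2)
    have h7 : σ (a : G) w = θ (Subgroup.inclusion hle a) • w := h5
    rw [h6] at h7
    simpa using h7.symm
  · rintro θ' ⟨w', hw'0, hw'⟩
    have hf : eigenSubmodule σ (congruenceSubgroup ι ℓ)
        (fun g => θ (Subgroup.inclusion hle g)) ≠ ⊥ := by
      rw [Submodule.ne_bot_iff]
      exact ⟨w, mem_eigenSubmodule.2 fun g => hw (Subgroup.inclusion hle g), hw0⟩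
    have hf' : eigenSubmodule σ (congruenceSubgroup ι ℓ) (fun g => (θ' g : ℂ)) ≠ ⊥ := by
      rw [Submodule.ne_bot_iff]
      exact ⟨w', mem_eigenSubmodule.2 hw', hw'0⟩
    -- the other eigencharacters are conjugate, and correspond to conjugates of `x`
    obtain ⟨g, hg⟩ := exists_conjFun_eq hirr (commute_apply (ι := ι) H.irreducible (by omega) hσ)
      hf hf'
    have hMI : (ι g).val * (ι g)⁻¹.val = 1 := Units.mul_inv _
    have hIM : (ι g)⁻¹.val * (ι g).val = 1 := Units.inv_mul _
    refine ⟨π, hπ, ψ, hψ, ((ι g).val * x * (ι g)⁻¹.val).map (residue R),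
      (E.mem_iff _).2 ⟨_, H.conj_mem g x hx, rfl⟩, ?_, ?_⟩
    · rw [← isCyclicMatrix_iff_isRegularMatrix]
      exact (hcyc.conj hIM).map _
    · intro a y hay
      have h1 := congrFun hg a
      simp only [conjFun] at h1
      rw [h1, hres _ ((ι g)⁻¹.val * y * (ι g).val), ← Matrix.map_mul, ← Matrix.map_mul, trace_map,
        trace_map, ← mul_assoc, ← mul_assoc, Matrix.trace_mul_comm]
      · simp only [mul_assoc]
      · rw [map_mul, map_mul, map_inv, Units.val_mul, Units.val_mul, hay, mul_add, add_mul, mul_one,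
          hIM, mul_smul_comm, smul_mul_assoc]
  · have h1 := hP.finrank_sq H hℓ hirr hσ hx hcyc (by rw [← hm]; exact hne)
    rwa [Module.finrank_fin_fun] at h1

end Setting

/-! ### The general linear group -/

section GeneralLinear

variable {R : Type*} [CommRing R] [IsDomain R] [IsDiscreteValuationRing R] {n : ℕ}

theorem isUnit_two (h : ringChar (ResidueField R) ≠ 2) : IsUnit (2 : R) := by
  apply isUnit_of_map_unit (residue R)
  rw [map_ofNat]
  exact (Ring.two_ne_zero h).isUnit

theorem isUnit_of_map_residue {a : Matrix (Fin n) (Fin n) R} (h : IsUnit (a.map (residue R))) :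
    IsUnit a := by
  rw [Matrix.isUnit_iff_isUnit_det] at h ⊢
  apply isUnit_of_map_unit (residue R)
  rw [RingHom.map_det]
  exact h

theorem isUnit_two_matrix {κ : Type*} [CommRing κ] (h : IsUnit (2 : κ)) :
    IsUnit (2 : Matrix (Fin n) (Fin n) κ) := by
  have := h.map (algebraMap κ (Matrix (Fin n) (Fin n) κ))
  rwa [map_ofNat] at this

theorem isUnit_add_smul {π : R} (hπ : Irreducible π) {a : Matrix (Fin n) (Fin n) R}
    (h : IsUnit a) (y : Matrix (Fin n) (Fin n) R) : IsUnit (a + π • y) := by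
  apply isUnit_of_map_residue
  rw [map_residue_add_smul hπ]
  exact h.map (residue R).mapMatrix

theorem isUnit_sub_smul {π : R} (hπ : Irreducible π) {a : Matrix (Fin n) (Fin n) R}
    (h : IsUnit a) (y : Matrix (Fin n) (Fin n) R) : IsUnit (a - π • y) := by
  rw [sub_eq_add_neg, ← smul_neg]
  exact isUnit_add_smul hπ h _

theorem isUnit_of_redMat_eq {π : R} (hπ : Irreducible π) {a b : Matrix (Fin n) (Fin n) R} {i : ℕ}
    (hi : 1 ≤ i) (h : redMat n R i a = redMat n R i b) (hb : IsUnit b) : IsUnit a := by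
  obtain ⟨c, rfl⟩ := (redMat_eq_iff hπ).1 h
  obtain ⟨j, rfl⟩ := Nat.exists_eq_add_of_le hi
  rw [pow_add, pow_one, mul_smul]
  exact isUnit_add_smul hπ hb _

/-- `GL_n` over a discrete valuation ring of odd residue characteristic. -/
theorem isRegularSetting_GL (h2 : ringChar (ResidueField R) ≠ 2) :
    IsRegularSetting R (MonoidHom.id (GL (Fin n) R)) ⊤ Set.univ := by
  refine ⟨fun π hπ => ?_, fun x => ?_, fun ψ hψ x _ hx => ?_⟩
  · have hu := isUnit_two h2
    have hu2 : IsUnit (2 : Matrix (Fin n) (Fin n) R) := isUnit_two_matrix hu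
    obtain ⟨h, hh⟩ := hu.exists_right_inv
    change IsCayleyPair (MonoidHom.id (GL (Fin n) R)) ⊤ π
    refine
      { injective := fun _ _ => id
        irreducible := hπ
        isUnit_two := hu
        smul_mem := fun _ => by simp
        half := fun y _ => ⟨h • y, trivial, ?_⟩
        lie_mem := fun _ _ _ _ => trivial
        conj_mem := fun _ _ _ => trivial
        exists_cayley := fun y _ => ?_
        exists_cayley_inv := fun g hg => ?_
        exists_commute_group := fun x _ a ha g i hi hag => ?_ }
    · rw [← two_smul R (h • y), smul_smul, hh, one_smul]
    · obtain ⟨s, hs⟩ := isUnit_sub_smul hπ hu2 y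
      obtain ⟨t, ht⟩ := isUnit_add_smul hπ hu2 y
      refine ⟨t * s⁻¹, ?_⟩
      change (t * s⁻¹ : GL (Fin n) R).val * (2 - π • y) = 2 + π • y
      rw [← hs, ← ht, ← Units.val_mul, inv_mul_cancel_right]
    · obtain ⟨c, hc⟩ := (redMat_eq_iff hπ).1 ((mem_congruenceSubgroup.1 hg).trans (map_one _).symm)
      rw [pow_one] at hc
      obtain ⟨s, hs⟩ := isUnit_add_smul hπ hu2 c
      refine ⟨(2 : R) • (s⁻¹.val * c), trivial, ?_⟩
      -- with `g = 1 + π c`, the matrix `y = 2 (2 + π c)⁻¹ c` has `Cay (π y) = g`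
      have h1 : π • c = s.val - 2 := by rw [hs]; abel
      have h2 : π • (2 : R) • (s⁻¹.val * c) = 2 - (4 : R) • s⁻¹.val := by
        rw [smul_comm, ← mul_smul_comm, h1, mul_sub, Units.inv_mul, mul_two, smul_sub, ← two_smul R,
          smul_smul, two_smul R (1 : Matrix (Fin n) (Fin n) R), one_add_one_eq_two]
        norm_num
      have h3 : ((MonoidHom.id (GL (Fin n) R)) g).val = s.val - 1 := by
        rw [hc, h1, ← one_add_one_eq_two]; abel
      rw [h2, h3, sub_sub_cancel, mul_smul_comm, sub_mul, Units.mul_inv, one_mul, smul_sub]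
      have h4 : (4 : R) • (1 : Matrix (Fin n) (Fin n) R) = 2 + 2 := by
        rw [ofNat_smul_eq_nsmul]; norm_num
      rw [h4]; abel
    · obtain ⟨c, hc⟩ := isUnit_of_redMat_eq hπ hi hag g.isUnit
      exact ⟨c, by simpa [hc] using ha, by simpa [hc] using hag⟩
  · simp only [Set.mem_univ, AddSubgroup.mem_top, true_and, true_iff]
    choose f hf using residue_surjective (R := R)
    exact ⟨x.map f, by ext i j; simp [hf]⟩
  · obtain ⟨a, ha⟩ := hψ
    ext i j
    rw [Matrix.zero_apply]
    by_contra hij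
    apply ha
    rw [← hx (Matrix.single j i ((x i j)⁻¹ * residue R (algebraMap R R a))) trivial,
      Matrix.trace_mul_single, op_smul_eq_mul, mul_inv_cancel_left₀ hij]

end GeneralLinear

/-! ### Unramified quadratic extensions -/

/-- `B` is free over `A` with basis `1, δ`, where `δ ^ 2 = η`, and `σ` is its conjugation. -/
structure IsQuadratic {A B : Type*} [CommRing A] [CommRing B] [Algebra A B] (σ : B →+* B) (δ : B)
    (η : A) : Prop where
  map_algebraMap : ∀ a, σ (algebraMap A B a) = algebraMap A B a
  map_delta : σ δ = -δ
  sq : δ * δ = algebraMap A B η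
  exists_eq : ∀ z, ∃ a b, z = algebraMap A B a + algebraMap A B b * δ
  eq_zero : ∀ a b, algebraMap A B a + algebraMap A B b * δ = 0 → a = 0 ∧ b = 0

namespace IsQuadratic

variable {A B : Type*} [CommRing A] [CommRing B] [Algebra A B] {σ : B →+* B} {δ : B} {η : A}

theorem ext_iff (Q : IsQuadratic σ δ η) {a b a' b' : A} : algebraMap A B a + algebraMap A B b * δ =
    algebraMap A B a' + algebraMap A B b' * δ ↔ a = a' ∧ b = b' := by
  constructor
  · intro h
    have := Q.eq_zero (a - a') (b - b') (by rw [map_sub, map_sub]; linear_combination h)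
    exact ⟨sub_eq_zero.1 this.1, sub_eq_zero.1 this.2⟩
  · rintro ⟨rfl, rfl⟩; rfl

theorem injective (Q : IsQuadratic σ δ η) : Function.Injective (algebraMap A B) := by
  intro a b h
  exact (Q.ext_iff.1 (show algebraMap A B a + algebraMap A B 0 * δ =
    algebraMap A B b + algebraMap A B 0 * δ by rw [h])).1

theorem map_eq (Q : IsQuadratic σ δ η) (a b : A) : σ (algebraMap A B a + algebraMap A B b * δ) =
    algebraMap A B a - algebraMap A B b * δ := by
  rw [map_add, map_mul, Q.map_algebraMap, Q.map_algebraMap, Q.map_delta]; ring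

theorem involutive (Q : IsQuadratic σ δ η) (z : B) : σ (σ z) = z := by
  obtain ⟨a, b, rfl⟩ := Q.exists_eq z
  rw [Q.map_eq, map_sub, map_mul, Q.map_algebraMap, Q.map_algebraMap, Q.map_delta]; ring

theorem mul_map (Q : IsQuadratic σ δ η) (a b : A) :
    σ (algebraMap A B a + algebraMap A B b * δ) * (algebraMap A B a + algebraMap A B b * δ) =
      algebraMap A B (a * a - η * (b * b)) := by
  rw [Q.map_eq]
  simp only [map_sub, map_mul]
  linear_combination -(algebraMap A B b) ^ 2 * Q.sq

end IsQuadratic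

section Unramified

variable {o O : Type*} [CommRing o] [IsDomain o] [IsDiscreteValuationRing o] [CommRing O]
  [IsDomain O] [IsDiscreteValuationRing O] [Algebra o O]

theorem IsUnramifiedQuadratic.injective (h : IsUnramifiedQuadratic o O) :
    Function.Injective (algebraMap o O) := by
  rw [injective_iff_map_eq_zero]
  intro a ha
  by_contra ha0
  have h0 : Module.finrank o O = 0 := by
    have := h.finite
    rw [Module.finrank_eq_zero_iff]
    intro x
    exact ⟨a, ha0, by rw [Algebra.smul_def, ha, zero_mul]⟩
  rw [h.finrank_eq] at h0
  exact two_ne_zero h0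

theorem IsUnramifiedQuadratic.mem_maximalIdeal (h : IsUnramifiedQuadratic o O) {π : o}
    (hπ : Irreducible π) {z : O} : z ∈ maximalIdeal O ↔ ∃ w, z = algebraMap o O π * w := by
  rw [← h.unramified, hπ.maximalIdeal_eq, Ideal.map_span, Set.image_singleton,
    Ideal.mem_span_singleton]
  rfl

theorem IsUnramifiedQuadratic.irreducible (h : IsUnramifiedQuadratic o O) {π : o}
    (hπ : Irreducible π) : Irreducible (algebraMap o O π) := by
  rw [IsDiscreteValuationRing.irreducible_iff_uniformizer, ← h.unramified, hπ.maximalIdeal_eq,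
    Ideal.map_span, Set.image_singleton]

theorem IsUnramifiedQuadratic.isLocalHom (h : IsUnramifiedQuadratic o O) :
    IsLocalHom (algebraMap o O) := by
  refine ⟨fun a ha => ?_⟩
  by_contra hna
  have : algebraMap o O a ∈ maximalIdeal O := by
    rw [← h.unramified]
    exact Ideal.mem_map_of_mem _ hna
  exact this ha

/-- An unramified quadratic extension is generated by one element: by Nakayama, `1` is part of a
basis. -/
theorem IsUnramifiedQuadratic.exists_generator (h : IsUnramifiedQuadratic o O) :
    ∃ α : O, ∀ z, ∃ a b, z = algebraMap o O a + algebraMap o O b * α := by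
  have := h.finite
  have : FaithfulSMul o O := (faithfulSMul_iff_algebraMap_injective o O).2 h.injective
  have : Module.Free o O := inferInstance
  let b := Module.finBasisOfFinrankEq o O h.finrank_eq
  have hb : ∀ z, z = algebraMap o O (b.repr z 0) * b 0 + algebraMap o O (b.repr z 1) * b 1 := by
    intro z
    conv_lhs => rw [← b.sum_repr z, Fin.sum_univ_two, Algebra.smul_def, Algebra.smul_def]
  have h1 := hb 1
  set u := b.repr 1 0
  set v := b.repr 1 1
  by_cases hu : IsUnit u
  · obtain ⟨w, hw⟩ := hu.exists_left_inv
    refine ⟨b 1, fun z => ⟨b.repr z 0 * w, b.repr z 1 - b.repr z 0 * w * v, ?_⟩⟩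
    have hw' : algebraMap o O w * algebraMap o O u = 1 := by rw [← map_mul, hw, map_one]
    conv_lhs => rw [hb z]
    simp only [map_sub, map_mul]
    linear_combination (algebraMap o O (b.repr z 0) * algebraMap o O w) * (-h1) -
      algebraMap o O (b.repr z 0) * b 0 * hw'
  by_cases hv : IsUnit v
  · obtain ⟨w, hw⟩ := hv.exists_left_inv
    refine ⟨b 0, fun z => ⟨b.repr z 1 * w, b.repr z 0 - b.repr z 1 * w * u, ?_⟩⟩
    have hw' : algebraMap o O w * algebraMap o O v = 1 := by rw [← map_mul, hw, map_one]
    conv_lhs => rw [hb z]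
    simp only [map_sub, map_mul]
    linear_combination (algebraMap o O (b.repr z 1) * algebraMap o O w) * (-h1) -
      algebraMap o O (b.repr z 1) * b 1 * hw'
  · exfalso
    have hmem : ∀ {u : o}, ¬ IsUnit u → ∀ z, algebraMap o O u * z ∈ maximalIdeal O := by
      intro u hu z
      rw [← h.unramified]
      exact Ideal.mul_mem_right _ _ (Ideal.mem_map_of_mem _ hu)
    have : (1 : O) ∈ maximalIdeal O := by
      rw [h1]; exact add_mem (hmem hu _) (hmem hv _)
    exact this isUnit_one

/-- In odd residue characteristic, completing the square gives a generator `δ` with `δ ^ 2 ∈ o` and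
`ν δ = -δ`. -/
theorem IsUnramifiedQuadratic.exists_isQuadratic (h : IsUnramifiedQuadratic o O)
    (h2 : ringChar (ResidueField o) ≠ 2) {ν : O ≃ₐ[o] O} (hν : ν ≠ AlgEquiv.refl) :
    ∃ (δ : O) (η : o), IsQuadratic (ν : O →+* O) δ η := by
  obtain ⟨t, ht⟩ := (isUnit_two h2).exists_right_inv
  have ht' : (2 : O) * algebraMap o O t = 1 := by
    rw [← map_ofNat (algebraMap o O), ← map_mul, ht, map_one]
  obtain ⟨α, hα⟩ := h.exists_generator
  obtain ⟨c, s, hs⟩ := hα (α * α)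
  -- complete the square in the quadratic equation of the generator
  set δ := α - algebraMap o O (t * s) with hδ
  have hsq : δ * δ = algebraMap o O (c + t * s * (t * s)) := by
    simp only [hδ, map_add, map_mul]
    linear_combination hs - algebraMap o O s * α * ht'
  have hgen : ∀ z, ∃ a b, z = algebraMap o O a + algebraMap o O b * δ := by
    intro z
    obtain ⟨a, b, rfl⟩ := hα z
    exact ⟨a + b * (t * s), b, by rw [hδ]; simp only [map_add, map_mul]; ring⟩
  have hconj : ν δ = -δ := by
    have h1 : (ν δ - δ) * (ν δ + δ) = 0 := by
      have h3 := congrArg ν hsq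
      rw [map_mul, AlgEquiv.commutes, ← hsq] at h3
      linear_combination h3
    rcases mul_eq_zero.1 h1 with h1 | h1
    · exfalso
      apply hν
      ext z
      obtain ⟨a, b, rfl⟩ := hgen z
      rw [map_add, map_mul, AlgEquiv.commutes, AlgEquiv.commutes, sub_eq_zero.1 h1]
      rfl
    · exact eq_neg_of_add_eq_zero_left h1
  refine ⟨δ, _, ⟨fun a => ν.commutes a, hconj, hsq, hgen, fun a b hab => ?_⟩⟩
  have h4 := congrArg ν hab
  rw [map_add, map_mul, AlgEquiv.commutes, AlgEquiv.commutes, hconj, map_zero] at h4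
  have h5 : algebraMap o O a = 0 := by
    linear_combination (algebraMap o O t) * (hab + h4) - algebraMap o O a * ht'
  have h6 : algebraMap o O b * δ = 0 := by rwa [h5, zero_add] at hab
  have hδ0 : δ ≠ 0 := by
    intro h0
    apply hν
    ext z
    obtain ⟨a, b, rfl⟩ := hgen z
    rw [h0, mul_zero, add_zero, AlgEquiv.commutes]
    rfl
  refine ⟨h.injective (by rw [h5, map_zero]), h.injective ?_⟩
  rw [map_zero]
  exact (mul_eq_zero.1 h6).resolve_right hδ0

theorem residueAut_residue (ν : O ≃ₐ[o] O) (z : O) :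
    residueAut ν (residue O z) = residue O (ν z) := rfl

section

variable {ν : O ≃ₐ[o] O} {δ : O} {η : o}

theorem IsQuadratic.mem_maximalIdeal (Q : IsQuadratic (ν : O →+* O) δ η)
    (h : IsUnramifiedQuadratic o O) {a b : o} :
    algebraMap o O a + algebraMap o O b * δ ∈ maximalIdeal O ↔
      a ∈ maximalIdeal o ∧ b ∈ maximalIdeal o := by
  obtain ⟨π, hπ⟩ := IsDiscreteValuationRing.exists_irreducible o
  rw [h.mem_maximalIdeal hπ, hπ.maximalIdeal_eq, Ideal.mem_span_singleton, Ideal.mem_span_singleton]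
  constructor
  · rintro ⟨w, hw⟩
    obtain ⟨c, d, rfl⟩ := Q.exists_eq w
    have : algebraMap o O a + algebraMap o O b * δ =
        algebraMap o O (π * c) + algebraMap o O (π * d) * δ := by
      rw [hw, map_mul, map_mul]; ring
    rw [Q.ext_iff] at this
    exact ⟨⟨c, this.1⟩, ⟨d, this.2⟩⟩
  · rintro ⟨⟨c, rfl⟩, ⟨d, rfl⟩⟩
    exact ⟨algebraMap o O c + algebraMap o O d * δ, by rw [map_mul, map_mul]; ring⟩

/-- A quadratic structure descends to the residue fields. -/
theorem IsQuadratic.reduction (Q : IsQuadratic (ν : O →+* O) δ η) (h : IsUnramifiedQuadratic o O)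
    [IsLocalHom (algebraMap o O)] :
    IsQuadratic (residueAut ν) (residue O δ) (residue o η) := by
  refine ⟨fun a => ?_, ?_, ?_, fun z => ?_, fun a b hab => ?_⟩
  · obtain ⟨a, rfl⟩ := residue_surjective a
    rw [ResidueField.algebraMap_residue, residueAut_residue, ν.commutes]
  · rw [residueAut_residue, ← map_neg, ← Q.map_delta]; rfl
  · rw [← map_mul, Q.sq, ResidueField.algebraMap_residue]
  · obtain ⟨z, rfl⟩ := residue_surjective z
    obtain ⟨a, b, rfl⟩ := Q.exists_eq z
    exact ⟨residue o a, residue o b, by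
      rw [ResidueField.algebraMap_residue, ResidueField.algebraMap_residue, map_add, map_mul]⟩
  · obtain ⟨a, rfl⟩ := residue_surjective a
    obtain ⟨b, rfl⟩ := residue_surjective b
    rw [ResidueField.algebraMap_residue, ResidueField.algebraMap_residue, ← map_mul, ← map_add,
      residue_eq_zero_iff, Q.mem_maximalIdeal h] at hab
    rwa [residue_eq_zero_iff, residue_eq_zero_iff]

/-- The discriminant is not a square in the residue field: otherwise the residue field of `O` would
have zero divisors. -/
theorem IsQuadratic.not_isSquare (Q : IsQuadratic (ν : O →+* O) δ η)
    (h : IsUnramifiedQuadratic o O) : ¬ IsSquare (residue o η) := by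
  have := h.isLocalHom
  have Q' := Q.reduction h
  rintro ⟨r, hr⟩
  have h1 : (residue O δ - algebraMap _ _ r) * (residue O δ + algebraMap _ _ r) = 0 := by
    have := Q'.sq
    rw [hr, map_mul] at this
    linear_combination this
  have h3 : ∀ s, residue O δ + algebraMap (ResidueField o) (ResidueField O) s ≠ 0 := by
    intro s hs
    have := (Q'.eq_zero s 1 (by rw [map_one, one_mul, add_comm]; exact hs)).2
    exact one_ne_zero this
  rcases mul_eq_zero.1 h1 with h1 | h1
  · exact h3 (-r) (by rw [map_neg, ← sub_eq_add_neg]; exact h1)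
  · exact h3 r h1

end

end Unramified

/-! ### Unitary groups -/

section ConjTr

variable {A : Type*} [CommRing A] {n : ℕ} {σ : A →+* A}

theorem conjTr_add (x y : Matrix (Fin n) (Fin n) A) :
    conjTr σ (x + y) = conjTr σ x + conjTr σ y := by
  ext; simp [conjTr]

theorem conjTr_neg (x : Matrix (Fin n) (Fin n) A) : conjTr σ (-x) = -conjTr σ x := by
  ext; simp [conjTr]

theorem conjTr_sub (x y : Matrix (Fin n) (Fin n) A) :
    conjTr σ (x - y) = conjTr σ x - conjTr σ y := by
  ext; simp [conjTr]

theorem conjTr_smul (a : A) (x : Matrix (Fin n) (Fin n) A) :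
    conjTr σ (a • x) = σ a • conjTr σ x := by
  ext; simp [conjTr]

theorem conjTr_zero : conjTr σ (0 : Matrix (Fin n) (Fin n) A) = 0 := by
  ext; simp [conjTr]

theorem conjTr_two : conjTr σ (2 : Matrix (Fin n) (Fin n) A) = 2 := by
  rw [← one_add_one_eq_two, conjTr_add, conjTr_one]

theorem conjTr_conjTr (hσ : ∀ a, σ (σ a) = a) (x : Matrix (Fin n) (Fin n) A) :
    conjTr σ (conjTr σ x) = x := by
  ext; simp [conjTr, hσ]

theorem trace_conjTr (x : Matrix (Fin n) (Fin n) A) : (conjTr σ x).trace = σ x.trace := by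
  simp [conjTr, Matrix.trace]

/-- The additive group of anti-hermitian matrices. -/
def antiHermitianSubgroup (σ : A →+* A) (n : ℕ) : AddSubgroup (Matrix (Fin n) (Fin n) A) where
  carrier := antiHermitian σ n
  zero_mem' := by simp [antiHermitian, conjTr_zero]
  add_mem' := by
    intro a b ha hb
    change a + b + conjTr σ (a + b) = 0
    rw [conjTr_add]
    have ha' : a + conjTr σ a = 0 := ha
    have hb' : b + conjTr σ b = 0 := hb
    linear_combination (norm := abel) ha' + hb'
  neg_mem' := by
    intro a ha
    change -a + conjTr σ (-a) = 0
    rw [conjTr_neg]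
    have ha' : a + conjTr σ a = 0 := ha
    linear_combination (norm := abel) -ha'

theorem mem_antiHermitianSubgroup {x : Matrix (Fin n) (Fin n) A} :
    x ∈ antiHermitianSubgroup σ n ↔ conjTr σ x = -x := by
  change x + conjTr σ x = 0 ↔ _
  rw [add_comm, add_eq_zero_iff_eq_neg]

theorem mem_unitary {g : GL (Fin n) A} :
    g ∈ unitary σ n ↔ conjTr σ (g : Matrix (Fin n) (Fin n) A) * g.val = 1 := Iff.rfl

theorem conjTr_eq_inv {g : GL (Fin n) A} (hg : g ∈ unitary σ n) :
    conjTr σ g.val = g⁻¹.val :=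
  Units.eq_inv_of_mul_eq_one_right (mem_unitary.1 hg)

/-- The Cayley transform of an anti-hermitian matrix is unitary. -/
theorem mem_unitary_of_cayley {g : GL (Fin n) A} {y : Matrix (Fin n) (Fin n) A}
    (hy : conjTr σ y = -y) (hu : IsUnit (2 - y)) (hu' : IsUnit (2 + y))
    (hg : g.val * (2 - y) = 2 + y) :
    g ∈ unitary σ n := by
  have h1 := congrArg (conjTr σ) hg
  rw [conjTr_mul, conjTr_sub, conjTr_add, conjTr_two, hy, sub_neg_eq_add] at h1
  rw [mem_unitary]
  apply hu'.mul_left_cancel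
  apply hu.mul_right_cancel
  rw [← mul_assoc, h1, mul_assoc, hg, mul_one]
  noncomm_ring

end ConjTr

section Setting

variable {o O : Type*} [CommRing o] [IsDomain o] [IsDiscreteValuationRing o] [CommRing O]
  [IsDomain O] [IsDiscreteValuationRing O] [Algebra o O] {n : ℕ} {ν : O ≃ₐ[o] O} {δ : O} {η : o}

/-- Half the difference of a matrix and its conjugate transpose; `h` is the inverse of `2`. -/
def antiPart (σ : O →+* O) (h : O) (y : Matrix (Fin n) (Fin n) O) : Matrix (Fin n) (Fin n) O :=
  h • (y - conjTr σ y)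

theorem conjTr_antiPart {σ : O →+* O} (hσ : ∀ a, σ (σ a) = a) {h : O} (hh : σ h = h)
    (y : Matrix (Fin n) (Fin n) O) : conjTr σ (antiPart σ h y) = -antiPart σ h y := by
  rw [antiPart, conjTr_smul, conjTr_sub, conjTr_conjTr hσ, hh, ← smul_neg, neg_sub]

theorem redMat_conjTr (h : IsUnramifiedQuadratic o O) {i : ℕ} {a b : Matrix (Fin n) (Fin n) O}
    (hab : redMat n O i a = redMat n O i b) :
    redMat n O i (conjTr (ν : O →+* O) a) = redMat n O i (conjTr (ν : O →+* O) b) := by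
  obtain ⟨π, hπ⟩ := IsDiscreteValuationRing.exists_irreducible o
  rw [redMat_eq_iff (h.irreducible hπ)] at hab ⊢
  obtain ⟨c, rfl⟩ := hab
  refine ⟨conjTr (ν : O →+* O) c, ?_⟩
  rw [conjTr_add, conjTr_smul, map_pow]
  congr 3
  exact ν.commutes π

theorem redMat_smul (i : ℕ) (c : O) (a : Matrix (Fin n) (Fin n) O) :
    redMat n O i (c • a) = Ideal.Quotient.mk (maximalIdeal O ^ i) c • redMat n O i a := by
  ext; simp [redMat]

/-- Half the difference with the conjugate transpose, on matrices anti-hermitian modulo `𝔭 ^ i`. -/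
theorem redMat_antiPart {t : O} (ht : 2 * t = 1) {i : ℕ}
    {y : Matrix (Fin n) (Fin n) O}
    (hy : redMat n O i (conjTr (ν : O →+* O) y) = redMat n O i (-y)) :
    redMat n O i (antiPart (ν : O →+* O) t y) = redMat n O i y := by
  rw [antiPart, redMat_smul, map_sub, hy, ← map_sub, sub_neg_eq_add, ← redMat_smul,
    ← two_smul O y, smul_smul, mul_comm, ht, one_smul]

theorem commute_antiPart {σ : O →+* O} (t : O)
    {x y : Matrix (Fin n) (Fin n) O} (hx : conjTr σ x = -x) (hxy : y * x = x * y) :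
    antiPart σ t y * x = x * antiPart σ t y := by
  have h1 := congrArg (conjTr σ) hxy
  rw [conjTr_mul, conjTr_mul, hx, neg_mul, mul_neg, neg_inj] at h1
  rw [antiPart, smul_mul_assoc, mul_smul_comm, sub_mul, mul_sub, hxy, h1]

/-- As `q > n`, some norm-one multiple of a matrix has no eigenvalue `-1`: here, the eigenvalue is
avoided for the multiple by `(t + δ) / (t - δ)`. -/
theorem exists_isUnit_smul_add (h : IsUnramifiedQuadratic o O) (h2 : IsUnit (2 : O)) (hδ : IsUnit δ)
    [Finite (ResidueField o)] (hq : n < Nat.card (ResidueField o))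
    (a : Matrix (Fin n) (Fin n) O) (ha : IsUnit a) :
    ∃ t : o, IsUnit ((algebraMap o O t + δ) • a + (algebraMap o O t - δ) • 1) := by
  have := h.isLocalHom
  have := Fintype.ofFinite (ResidueField o)
  by_contra! hcon
  set κ := ResidueField O
  set r := residue O with hr
  set P : κ[X] := ((X : κ[X]) • (a.map r + 1).map C + (r δ • (a.map r - 1)).map C).det with hP
  have heval : ∀ s : κ, P.eval s = (s • (a.map r + 1) + r δ • (a.map r - 1)).det := by
    intro s
    rw [hP, ← coe_evalRingHom, RingHom.map_det]
    congr 1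
    ext i j
    simp [mul_add]
    ring
  have hdeg : P.natDegree ≤ n := by
    have := natDegree_det_X_add_C_le (a.map r + 1) (r δ • (a.map r - 1))
    rwa [Fintype.card_fin] at this
  have hroot : ∀ s : ResidueField o, P.eval (algebraMap _ κ s) = 0 := by
    intro s
    obtain ⟨t, rfl⟩ := residue_surjective s
    have h3 := hcon t
    rw [heval, ResidueField.algebraMap_residue]
    by_contra hne
    apply h3
    apply isUnit_of_map_residue
    rw [Matrix.isUnit_iff_isUnit_det]
    have h4 : (((algebraMap o O t + δ) • a + (algebraMap o O t - δ) • 1).map (residue O)) =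
        r (algebraMap o O t) • (a.map r + 1) + r δ • (a.map r - 1) := by
      ext i j
      simp [Matrix.one_apply, hr]
      split_ifs <;> simp <;> ring
    rw [h4]
    exact Ne.isUnit hne
  -- `P` has degree at most `n` and the `q > n` elements of the residue field as roots
  have hP0 : P = 0 := by
    refine eq_zero_of_natDegree_lt_card_of_eval_eq_zero P (f := algebraMap (ResidueField o) κ)
      (FaithfulSMul.algebraMap_injective _ κ) hroot ?_
    rw [← Nat.card_eq_fintype_card]
    omega
  -- but `P (δ) = det (2 δ a)`
  have h5 := heval (r δ)
  rw [hP0, eval_zero, ← smul_add, show a.map r + 1 + (a.map r - 1) = (2 : κ) • a.map r by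
    rw [two_smul]; abel, smul_smul] at h5
  have h6 : IsUnit ((r δ * 2) • a.map r).det := by
    rw [← Matrix.isUnit_iff_isUnit_det]
    have h7 : IsUnit (r δ * 2) := by
      have := (hδ.mul h2).map r
      rwa [map_mul, map_ofNat] at this
    have h8 : IsUnit (a.map r) := ha.map r.mapMatrix
    obtain ⟨c, hc⟩ := h7
    rw [← hc]
    exact h8.smul c
  rw [← h5] at h6
  exact not_isUnit_zero h6

/-- A matrix which is unitary modulo a power of the maximal ideal is congruent to a unitary matrix,
commuting with the anti-hermitian matrices with which the given matrix commutes. Multiplied by a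
scalar of norm one, the matrix has an inverse Cayley transform; its anti-hermitian part is
transformed back, and the result divided by the scalar. -/
theorem exists_unitary_lift (h : IsUnramifiedQuadratic o O)
    (Q : IsQuadratic (ν : O →+* O) δ η) (h2 : ringChar (ResidueField o) ≠ 2)
    [Finite (ResidueField o)] (hq : n < Nat.card (ResidueField o)) {i : ℕ} (hi : 1 ≤ i)
    (a : Matrix (Fin n) (Fin n) O) (ha : redMat n O i (conjTr (ν : O →+* O) a * a) = 1) :
    ∃ g ∈ unitary (ν : O →+* O) n, redMat n O i g.val = redMat n O i a ∧
      ∀ x, conjTr (ν : O →+* O) x = -x → Commute a x → Commute g.val x := by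
  obtain ⟨π, hπ⟩ := IsDiscreteValuationRing.exists_irreducible o
  have hπ' := h.irreducible hπ
  set σ : O →+* O := (ν : O →+* O) with hσ
  obtain ⟨k, hk⟩ := (isUnit_two h2).exists_right_inv
  set t : O := algebraMap o O k with ht
  have htt : 2 * t = 1 := by rw [ht, ← map_ofNat (algebraMap o O), ← map_mul, hk, map_one]
  have hσt : σ t = t := Q.map_algebraMap k
  have hunit : ∀ b c : o, IsUnit c → IsUnit (algebraMap o O b + algebraMap o O c * δ) := by
    intro b c hc
    by_contra hn
    exact ((Q.mem_maximalIdeal h).1 hn).2 hc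
  have h2O : IsUnit (2 : O) := IsUnit.of_mul_eq_one _ htt
  have hδ : IsUnit δ := by simpa using hunit 0 1 isUnit_one
  have haU : IsUnit a := by
    have := isUnit_of_redMat_eq hπ' hi (ha.trans (map_one _).symm) isUnit_one
    exact isUnit_of_mul_isUnit_right this
  obtain ⟨b, M, hM⟩ := exists_isUnit_smul_add h h2O hδ hq a haU
  set s₁ := algebraMap o O b + δ with hs₁
  set s₂ := algebraMap o O b - δ with hs₂
  have hσ₁ : σ s₁ = s₂ := by
    rw [hs₁, hs₂, map_add, Q.map_algebraMap, Q.map_delta, sub_eq_add_neg]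
  have hσ₂ : σ s₂ = s₁ := by rw [← hσ₁, Q.involutive]
  obtain ⟨w₁, hw₁⟩ : ∃ w, s₁ * w = 1 := by
    have : IsUnit s₁ := by simpa using hunit b 1 isUnit_one
    exact this.exists_right_inv
  have hw₂ : s₂ * σ w₁ = 1 := by rw [← hσ₁, ← map_mul, hw₁, map_one]
  set w₂ := σ w₁ with hw₂'
  have hσw₂ : σ w₂ = w₁ := Q.involutive w₁
  -- the inverse Cayley transform of `(s₁ / s₂) a`
  set y := (2 : O) • ((s₁ • a - s₂ • 1) * M⁻¹.val) with hy
  have hyM : y * M.val = (2 : O) • (s₁ • a - s₂ • 1) := by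
    rw [hy, smul_mul_assoc, Units.inv_mul_cancel_right]
  have hsub : (2 - y) * M.val = (4 * s₂) • 1 := by
    rw [sub_mul, hyM, hM, ← one_add_one_eq_two, add_mul, one_mul]
    module
  have hadd : (2 + y) * M.val = (4 * s₁) • a := by
    rw [add_mul, hyM, hM, ← one_add_one_eq_two, add_mul, one_mul]
    module
  have h4 : IsUnit (4 : O) := by
    have := h2O.mul h2O
    norm_num at this
    exact this
  have hsubU : IsUnit (2 - y) := by
    have : IsUnit ((2 - y) * M.val) := by
      rw [hsub]
      obtain ⟨c, hc⟩ := h4.mul (IsUnit.of_mul_eq_one _ hw₂)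
      rw [← hc]
      exact isUnit_one.smul c
    exact isUnit_of_mul_isUnit_left this
  have haddU : IsUnit (2 + y) := by
    have : IsUnit ((2 + y) * M.val) := by
      rw [hadd]
      obtain ⟨c, hc⟩ := h4.mul (IsUnit.of_mul_eq_one _ hw₁)
      rw [← hc]
      exact haU.smul c
    exact isUnit_of_mul_isUnit_left this
  have hyanti : redMat n O i (conjTr σ y) = redMat n O i (-y) := by
    have hMc : IsUnit (conjTr σ M.val) := by
      refine IsUnit.of_mul_eq_one (conjTr σ M⁻¹.val) ?_
      rw [← conjTr_mul, Units.inv_mul, conjTr_one]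
    apply (hMc.map (redMat n O i)).mul_left_cancel
    apply (M.isUnit.map (redMat n O i)).mul_right_cancel
    rw [← map_mul, ← map_mul, ← map_mul, ← map_mul, ← conjTr_mul, hyM, mul_assoc _ (-y), neg_mul,
      hyM, hM]
    have e1 : conjTr σ ((2 : O) • (s₁ • a - s₂ • 1)) = (2 : O) • (s₂ • conjTr σ a - s₁ • 1) := by
      rw [conjTr_smul, map_ofNat, conjTr_sub, conjTr_smul, conjTr_smul, hσ₁, hσ₂, conjTr_one]
    have e2 : conjTr σ (s₁ • a + s₂ • 1) = s₂ • conjTr σ a + s₁ • 1 := by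
      rw [conjTr_add, conjTr_smul, conjTr_smul, hσ₁, hσ₂, conjTr_one]
    rw [e1, e2]
    have e3 : ((2 : O) • (s₂ • conjTr σ a - s₁ • 1)) * (s₁ • a + s₂ • 1) =
        (s₂ • conjTr σ a + s₁ • 1) * -((2 : O) • (s₁ • a - s₂ • 1)) +
        (4 * s₁ * s₂) • (conjTr σ a * a - 1) := by
      simp only [mul_add, sub_mul, add_mul, smul_mul_assoc, mul_smul_comm, one_mul, mul_one,
        mul_neg, mul_sub]
      module
    rw [e3, map_add, redMat_smul, map_sub, ha, map_one, sub_self, smul_zero, add_zero]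
  set y' := antiPart σ t y with hy'
  have hy'anti : conjTr σ y' = -y' := conjTr_antiPart Q.involutive hσt y
  have hy'red : redMat n O i y' = redMat n O i y := redMat_antiPart htt hyanti
  obtain ⟨S, hS⟩ := isUnit_of_redMat_eq (a := 2 - y') hπ' hi (by rw [map_sub, map_sub, hy'red]) hsubU
  obtain ⟨T, hT⟩ := isUnit_of_redMat_eq (a := 2 + y') hπ' hi (by rw [map_add, map_add, hy'red]) haddU
  have hc : (T * S⁻¹).val * (2 - y') = 2 + y' := by
    rw [← hS, ← hT, Units.val_mul, Units.inv_mul_cancel_right]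
  have hcu := mem_unitary_of_cayley hy'anti ⟨S, hS⟩ ⟨T, hT⟩ hc
  set c := T * S⁻¹ with hc'
  have hl : (s₂ * w₁) * (s₁ * w₂) = 1 := by linear_combination s₁ * w₁ * hw₂ + hw₁
  let g : GL (Fin n) O := ⟨(s₂ * w₁) • c.val, (s₁ * w₂) • c⁻¹.val, by
    rw [smul_mul_smul_comm, hl, Units.mul_inv, one_smul], by
    rw [smul_mul_smul_comm, mul_comm, hl, Units.inv_mul, one_smul]⟩
  have hg : g.val = (s₂ * w₁) • c.val := rfl
  refine ⟨g, ?_, ?_, fun x hx hax => ?_⟩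
  · rw [mem_unitary, hg, conjTr_smul, smul_mul_smul_comm, mem_unitary.1 hcu, map_mul, hσ₂, mul_comm,
      hl, one_smul]
  · rw [hg, redMat_smul]
    apply (hsubU.map (redMat n O i)).mul_right_cancel
    apply (M.isUnit.map (redMat n O i)).mul_right_cancel
    have e1 : redMat n O i (2 - y) = redMat n O i (2 - y') := by rw [map_sub, map_sub, hy'red]
    have e2 : redMat n O i (2 + y') = redMat n O i (2 + y) := by rw [map_add, map_add, hy'red]
    rw [← redMat_smul, e1, ← map_mul, smul_mul_assoc, hc, redMat_smul, e2, ← redMat_smul, ← map_mul,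
      smul_mul_assoc, hadd, ← e1, ← map_mul, ← map_mul, mul_assoc, hsub, mul_smul_comm, mul_one,
      smul_smul]
    congr 2
    linear_combination 4 * s₂ * hw₁
  · have hMx : Commute M.val x := by
      rw [hM]
      exact (hax.smul_left _).add_left ((Commute.one_left x).smul_left _)
    have hyx : Commute y x := by
      rw [hy]
      refine Commute.smul_left (Commute.mul_left ?_ hMx.units_inv_left) _
      exact (hax.smul_left _).sub_left ((Commute.one_left x).smul_left _)
    have hy'x : Commute y' x := commute_antiPart t hx hyx
    have hSx : Commute S.val x := by
      rw [hS]; exact (Commute.ofNat_left 2 x).sub_left hy'x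
    have hTx : Commute T.val x := by
      rw [hT]; exact (Commute.ofNat_left 2 x).add_left hy'x
    rw [hg]
    refine Commute.smul_left ?_ _
    rw [hc', Units.val_mul]
    exact hTx.mul_left hSx.units_inv_left

theorem mem_antiHermitian_residueAut {x : Matrix (Fin n) (Fin n) (ResidueField O)} :
    x ∈ antiHermitian (residueAut ν) n ↔ conjTr (residueAut ν) x = -x :=
  mem_antiHermitianSubgroup

theorem conjTr_map_residue (y : Matrix (Fin n) (Fin n) O) :
    conjTr (residueAut ν) (y.map (residue O)) = (conjTr (ν : O →+* O) y).map (residue O) := by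
  ext i j
  exact residueAut_residue ν (y j i)

/-- Unitary groups over unramified quadratic extensions of odd residue characteristic. -/
theorem isRegularSetting_GU (h : IsUnramifiedQuadratic o O)
    (Q : IsQuadratic (ν : O →+* O) δ η) (h2 : ringChar (ResidueField o) ≠ 2)
    [Finite (ResidueField o)] (hq : n < Nat.card (ResidueField o)) :
    IsRegularSetting o (unitary (ν : O →+* O) n).subtype (antiHermitianSubgroup (ν : O →+* O) n)
      (antiHermitian (residueAut ν) n) := by
  obtain ⟨k, hk⟩ := (isUnit_two h2).exists_right_inv
  set σ : O →+* O := (ν : O →+* O) with hσ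
  set t : O := algebraMap o O k with ht
  have htt : 2 * t = 1 := by rw [ht, ← map_ofNat (algebraMap o O), ← map_mul, hk, map_one]
  have hσt : σ t = t := Q.map_algebraMap k
  have h2O : IsUnit (2 : O) := IsUnit.of_mul_eq_one _ htt
  have hu2 : IsUnit (2 : Matrix (Fin n) (Fin n) O) := isUnit_two_matrix h2O
  have hlocal := h.isLocalHom
  refine ⟨fun π hπ => ?_, fun x => ?_, fun ψ hψ x hx hxψ => ?_⟩
  · have hπ' := h.irreducible hπ
    have hσπ : σ (algebraMap o O π) = algebraMap o O π := Q.map_algebraMap π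
    refine
      { injective := Subtype.val_injective
        irreducible := hπ'
        isUnit_two := h2O
        smul_mem := fun y => ?_
        half := fun y hy => ⟨t • y, ?_, ?_⟩
        lie_mem := fun y hy w hw => ?_
        conj_mem := fun g y hy => ?_
        exists_cayley := fun y hy => ?_
        exists_cayley_inv := fun g hg => ?_
        exists_commute_group := fun x hx a ha g i hi hag => ?_ }
    · rw [mem_antiHermitianSubgroup, mem_antiHermitianSubgroup, conjTr_smul, hσπ, ← smul_neg]
      constructor
      · intro e
        ext i j
        have := congrFun (congrFun e i) j
        simp only [Matrix.smul_apply, smul_eq_mul] at this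
        exact mul_left_cancel₀ hπ'.ne_zero this
      · intro e; rw [e]
    · rw [mem_antiHermitianSubgroup] at hy ⊢
      rw [conjTr_smul, hσt, hy, smul_neg]
    · rw [← two_smul O (t • y), smul_smul, htt, one_smul]
    · rw [mem_antiHermitianSubgroup] at hy hw ⊢
      rw [conjTr_sub, conjTr_mul, conjTr_mul, hy, hw, neg_mul_neg, neg_mul_neg, neg_sub]
    · rw [mem_antiHermitianSubgroup] at hy ⊢
      have hg := conjTr_eq_inv g.2
      have hg' : conjTr σ (g.1)⁻¹.val = g.1.val := by
        rw [← hg, conjTr_conjTr Q.involutive]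
      change conjTr σ (g.1.val * y * (g.1)⁻¹.val) = -(g.1.val * y * (g.1)⁻¹.val)
      rw [conjTr_mul, conjTr_mul, hy, hg, hg', neg_mul, mul_neg, mul_assoc]
    · rw [mem_antiHermitianSubgroup] at hy
      obtain ⟨s, hs⟩ := isUnit_sub_smul hπ' hu2 y
      obtain ⟨r, hr⟩ := isUnit_add_smul hπ' hu2 y
      have hc : (r * s⁻¹).val * (2 - algebraMap o O π • y) = 2 + algebraMap o O π • y := by
        rw [← hs, ← hr, ← Units.val_mul, inv_mul_cancel_right]
      refine ⟨⟨r * s⁻¹, mem_unitary_of_cayley ?_ ⟨s, hs⟩ ⟨r, hr⟩ hc⟩, hc⟩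
      rw [conjTr_smul, hσπ, hy, smul_neg]
    · obtain ⟨c, hc⟩ := (redMat_eq_iff hπ').1
        ((mem_congruenceSubgroup.1 hg).trans (map_one _).symm)
      rw [pow_one] at hc
      have hc' : g.1.val = 1 + algebraMap o O π • c := hc
      obtain ⟨s, hs⟩ := isUnit_add_smul hπ' hu2 c
      have h1 : algebraMap o O π • c = s.val - 2 := by rw [hs]; abel
      have h3 : g.1.val = s.val - 1 := by
        rw [hc', h1, ← one_add_one_eq_two]; abel
      have h4 : (4 : O) • (1 : Matrix (Fin n) (Fin n) O) = 2 + 2 := by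
        rw [ofNat_smul_eq_nsmul]; norm_num
      have hπy : algebraMap o O π • (2 : O) • (s⁻¹.val * c) = 2 - (4 : O) • s⁻¹.val := by
        rw [smul_comm, ← mul_smul_comm, h1, mul_sub, Units.inv_mul, mul_two, smul_sub,
          ← two_smul O, smul_smul, two_smul O (1 : Matrix (Fin n) (Fin n) O), one_add_one_eq_two]
        norm_num
      refine ⟨(2 : O) • (s⁻¹.val * c), ?_, ?_⟩
      · -- `π y = 2 - 4 s⁻¹` is anti-hermitian, since `s = g + 1` with `g` unitary
        have hcancel : algebraMap o O π • conjTr σ ((2 : O) • (s⁻¹.val * c)) =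
            algebraMap o O π • -((2 : O) • (s⁻¹.val * c)) := by
          have h5 : algebraMap o O π • conjTr σ ((2 : O) • (s⁻¹.val * c)) =
              conjTr σ (algebraMap o O π • (2 : O) • (s⁻¹.val * c)) := by
            rw [conjTr_smul (algebraMap o O π), hσπ]
          rw [h5, smul_neg, hπy, conjTr_sub, conjTr_two, conjTr_smul, map_ofNat]
          have hsU : IsUnit (conjTr σ s.val) := by
            refine IsUnit.of_mul_eq_one (conjTr σ s⁻¹.val) ?_
            rw [← conjTr_mul, Units.inv_mul, conjTr_one]
          apply hsU.mul_left_cancel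
          apply s.isUnit.mul_right_cancel
          have e1 : conjTr σ s.val * conjTr σ s⁻¹.val = 1 := by
            rw [← conjTr_mul, Units.inv_mul, conjTr_one]
          have e2 : conjTr σ s.val * s.val = conjTr σ s.val + s.val := by
            have hs1 : s.val = g.1.val + 1 := by rw [h3, sub_add_cancel]
            have := mem_unitary.1 g.2
            rw [hs1, conjTr_add, conjTr_one, add_mul, mul_add, this]
            simp only [one_mul, mul_one]
            abel
          have e3 : conjTr σ s.val * (2 - (4 : O) • conjTr σ s⁻¹.val) * s.val =
              (2 : O) • (conjTr σ s.val * s.val) - (4 : O) • s.val := by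
            rw [mul_sub, sub_mul, mul_smul_comm, e1, smul_mul_assoc, one_mul, mul_two, add_mul,
              two_smul]
          have e4 : conjTr σ s.val * -(2 - (4 : O) • s⁻¹.val) * s.val =
              (4 : O) • conjTr σ s.val - (2 : O) • (conjTr σ s.val * s.val) := by
            rw [mul_neg, neg_mul, mul_sub, sub_mul, mul_smul_comm, smul_mul_assoc,
              Units.inv_mul_cancel_right, mul_two, add_mul, two_smul, neg_sub]
          rw [e3, e4, e2]
          module
        rw [mem_antiHermitianSubgroup]
        ext i j
        have := congrFun (congrFun hcancel i) j
        simp only [Matrix.smul_apply, smul_eq_mul] at this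
        exact mul_left_cancel₀ hπ'.ne_zero this
      · change g.1.val * _ = _
        rw [hπy, h3, sub_sub_cancel, mul_smul_comm, sub_mul, Units.mul_inv, one_mul, smul_sub, h4]
        abel
    · rw [mem_antiHermitianSubgroup] at hx
      obtain ⟨c, hc, hcr, hcx⟩ := exists_unitary_lift h Q h2 hq hi a (by
        rw [map_mul, redMat_conjTr h hag, hag, ← map_mul]
        change redMat n O i (conjTr σ g.1.val * g.1.val) = 1
        rw [mem_unitary.1 g.2, map_one])
      exact ⟨⟨c, hc⟩, hcx x hx ha, hcr.trans hag⟩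
  · rw [mem_antiHermitian_residueAut]
    constructor
    · intro hx
      choose f hf using residue_surjective (R := O)
      have hfx : (x.map f).map (residue O) = x := by ext i j; simp [hf]
      refine ⟨antiPart σ t (x.map f), ?_, ?_⟩
      · rw [mem_antiHermitianSubgroup]
        exact conjTr_antiPart Q.involutive hσt _
      · rw [redMat_one_eq_iff.1 (redMat_antiPart (ν := ν) (i := 1) htt (y := x.map f) ?_)]
        · exact hfx
        · rw [redMat_one_eq_iff, ← conjTr_map_residue, hfx, hx]
          conv_lhs => rw [← hfx]
          ext; simp
    · rintro ⟨y, hy, rfl⟩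
      rw [mem_antiHermitianSubgroup] at hy
      rw [conjTr_map_residue, hy]
      ext; simp
  · obtain ⟨a, ha⟩ := hψ
    rw [mem_antiHermitian_residueAut] at hx
    have hinv : ∀ z, residueAut ν (residueAut ν z) = z := (Q.reduction h).involutive
    ext i j
    rw [Matrix.zero_apply]
    by_contra hij
    apply ha
    -- the trace of `x (z - z°)` is the trace of `tr (x z)` from the residue field of `O`
    set s := residue O (t * algebraMap o O a) with hs
    have hs' : residueAut ν s = s := by
      rw [hs, residueAut_residue]
      congr 1
      change σ (t * algebraMap o O a) = _
      rw [map_mul, hσt, Q.map_algebraMap]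
    set z : Matrix (Fin n) (Fin n) (ResidueField O) := Matrix.single j i ((x i j)⁻¹ * s) with hz
    have hxz : (x * z).trace = s := by
      rw [hz, Matrix.trace_mul_single, op_smul_eq_mul, mul_inv_cancel_left₀ hij]
    have h1 := hxψ (z - conjTr (residueAut ν) z) (by
      rw [mem_antiHermitian_residueAut, conjTr_sub, conjTr_conjTr hinv, neg_sub])
    have h3 : (x * conjTr (residueAut ν) z).trace = -s := by
      have : x * conjTr (residueAut ν) z = -conjTr (residueAut ν) (z * x) := by
        rw [conjTr_mul, hx, neg_mul, neg_neg]
      rw [this, Matrix.trace_neg, trace_conjTr, Matrix.trace_mul_comm, hxz, hs']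
    rw [mul_sub, Matrix.trace_sub, hxz, h3, sub_neg_eq_add] at h1
    rw [← h1]
    congr 1
    rw [hs, ← map_add]
    congr 1
    linear_combination -algebraMap o O a * htt

end Setting

/-! ### Reduction to the residue field -/

/-- The invertible matrices commuting with `x`. -/
def unitCommutant {κ : Type*} [CommRing κ] {n : ℕ} (x : Matrix (Fin n) (Fin n) κ) :
    Subgroup (GL (Fin n) κ) where
  carrier := {g | Commute g.val x}
  one_mem' := Commute.one_left x
  mul_mem' := fun ha hb => Commute.mul_left ha hb
  inv_mem' := fun ha => Commute.units_inv_left ha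

/-- The matrices commuting with `x`. -/
def commutant {κ : Type*} [CommRing κ] {n : ℕ} (x : Matrix (Fin n) (Fin n) κ) :
    AddSubgroup (Matrix (Fin n) (Fin n) κ) where
  carrier := {y | Commute y x}
  zero_mem' := Commute.zero_left x
  add_mem' := fun ha hb => Commute.add_left ha hb
  neg_mem' := fun ha => Commute.neg_left ha

section Reduction

variable {R G : Type*} [CommRing R] [IsDomain R] [IsDiscreteValuationRing R] [Group G] {n : ℕ}
  (ι : G →* GL (Fin n) R) (𝔤 : AddSubgroup (Matrix (Fin n) (Fin n) R))

theorem index_stabMod_one_mul_card (H : Subgroup (GL (Fin n) (ResidueField R)))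
    (hH : ∀ h, h ∈ H ↔ ∃ g : G, Matrix.GeneralLinearGroup.map (residue R) (ι g) = h)
    (x : Matrix (Fin n) (Fin n) R) : (stabMod ι x 1).index *
      Nat.card ((unitCommutant (x.map (residue R))).subgroupOf H) = Nat.card H := by
  set f := (Matrix.GeneralLinearGroup.map (n := Fin n) (residue R)).comp ι with hf
  have h1 : stabMod ι x 1 = (unitCommutant (x.map (residue R))).comap f := by
    ext g
    rw [mem_stabMod, redMat_one_eq_iff, Subgroup.mem_comap, Matrix.map_mul, Matrix.map_mul]
    rfl
  have h2 : f.range = H := by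
    ext h
    rw [hH]; rfl
  rw [h1, Subgroup.index_comap, h2, Subgroup.relIndex, Subgroup.index_mul_card]

theorem card_quot_centMod_mul_card (L : AddSubgroup (Matrix (Fin n) (Fin n) (ResidueField R)))
    (hL : ∀ y, y ∈ L ↔ ∃ z ∈ 𝔤, z.map (residue R) = y) (x : Matrix (Fin n) (Fin n) R) :
    Nat.card (𝔤 ⧸ IsCayleyPair.centMod 𝔤 x) *
      Nat.card ((commutant (x.map (residue R))).addSubgroupOf L) = Nat.card L := by
  set f : 𝔤 →+ Matrix (Fin n) (Fin n) (ResidueField R) :=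
    ((residue R).mapMatrix (m := Fin n)).toAddMonoidHom.comp 𝔤.subtype with hf
  have h1 : IsCayleyPair.centMod 𝔤 x = (commutant (x.map (residue R))).comap f := by
    ext y
    rw [IsCayleyPair.mem_centMod, redMat_one_eq_iff, AddSubgroup.mem_comap, Matrix.map_mul,
      Matrix.map_mul]
    rfl
  have h2 : f.range = L := by
    ext y
    rw [hL]
    constructor
    · rintro ⟨z, rfl⟩; exact ⟨z, z.2, rfl⟩
    · rintro ⟨z, hz, rfl⟩; exact ⟨⟨z, hz⟩, rfl⟩
  change AddSubgroup.index _ * _ = _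
  rw [h1, AddSubgroup.index_comap, h2, AddSubgroup.relIndex, AddSubgroup.index_mul_card]

end Reduction

section Commutant

variable {κ : Type*} [Field κ] [Finite κ] {n : ℕ}

theorem card_commutant {x : Matrix (Fin n) (Fin n) κ} (hx : IsCyclicMatrix x) :
    Nat.card (commutant x) = Nat.card κ ^ n := by
  have h : Function.Bijective (fun c : Fin n → κ =>
      (⟨aeval x (∑ j, C (c j) * X ^ (j : ℕ)), aeval_commute x _⟩ : commutant x)) := by
    constructor
    · intro c d hcd
      exact hx.coeff_injective (congrArg Subtype.val hcd)
    · rintro ⟨a, ha⟩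
      obtain ⟨c, hc⟩ := hx.exists_aeval ha
      exact ⟨c, Subtype.ext hc.symm⟩
  rw [← Nat.card_congr (Equiv.ofBijective _ h), Nat.card_fun,
    Nat.card_eq_fintype_card (α := Fin n), Fintype.card_fin]

theorem card_matrix : Nat.card (Matrix (Fin n) (Fin n) κ) = Nat.card κ ^ (n ^ 2) := by
  rw [show Matrix (Fin n) (Fin n) κ = (Fin n → Fin n → κ) from rfl, Nat.card_fun, Nat.card_fun,
    Nat.card_eq_fintype_card (α := Fin n), Fintype.card_fin, ← pow_mul, sq]

theorem eq_pow_choose_sq {q N n : ℕ} (hq : 0 < q) (h : N * q ^ n = q ^ (n ^ 2)) :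
    N = (q ^ n.choose 2) ^ 2 := by
  apply Nat.eq_of_mul_eq_mul_right (pow_pos hq n)
  rw [h, ← pow_mul, ← pow_add, Nat.choose_two_right,
    Nat.div_mul_cancel (Nat.even_mul_pred_self n).two_dvd]
  congr 1
  cases n with
  | zero => rfl
  | succ n => simp; ring

/-- The commutant of a cyclic matrix has `q ^ n` elements, and therefore index `q ^ (n (n - 1))`. -/
theorem index_commutant {x : Matrix (Fin n) (Fin n) κ} (hx : IsCyclicMatrix x) {N : ℕ}
    (hN : N * Nat.card ((commutant x).addSubgroupOf ⊤) =
      Nat.card (⊤ : AddSubgroup (Matrix (Fin n) (Fin n) κ))) :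
    N = (Nat.card κ ^ n.choose 2) ^ 2 := by
  have h1 : Nat.card ((commutant x).addSubgroupOf ⊤) = Nat.card κ ^ n := by
    rw [← card_commutant hx]
    exact Nat.card_congr (AddSubgroup.addSubgroupOfEquivOfLe le_top).toEquiv
  rw [h1, Nat.card_congr AddSubgroup.topEquiv.toEquiv, card_matrix] at hN
  exact eq_pow_choose_sq Nat.card_pos hN

variable {k : Type*} [Field k] [Algebra k κ] {σ : κ →+* κ} {δ : κ} {η : k}

theorem IsQuadratic.card_eq (Q : IsQuadratic σ δ η) : Nat.card κ = Nat.card k ^ 2 := by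
  have h : Function.Bijective (fun p : k × k => algebraMap k κ p.1 + algebraMap k κ p.2 * δ) := by
    constructor
    · rintro ⟨a, b⟩ ⟨c, d⟩ h
      exact Prod.ext_iff.2 (Q.ext_iff.1 h)
    · intro z
      obtain ⟨a, b, rfl⟩ := Q.exists_eq z
      exact ⟨(a, b), rfl⟩
  rw [← Nat.card_congr (Equiv.ofBijective _ h), Nat.card_prod, pow_two]

theorem IsQuadratic.delta_ne_zero (Q : IsQuadratic σ δ η) : δ ≠ 0 := by
  intro h
  have := (Q.eq_zero 0 1 (by rw [h]; simp)).2
  exact one_ne_zero this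

/-- As `δ` is anti-hermitian, matrices are sums `y + δ w` with `y` and `w` anti-hermitian. -/
theorem IsQuadratic.card_antiHermitian_sq (Q : IsQuadratic σ δ η) (h2 : (2 : k) ≠ 0)
    (B : AddSubgroup (Matrix (Fin n) (Fin n) κ))
    (hBs : ∀ (a : κ) (y), y ∈ B → a • y ∈ B) (hBc : ∀ y ∈ B, conjTr σ y ∈ B) :
    Nat.card (B.addSubgroupOf (antiHermitianSubgroup σ n)) ^ 2 = Nat.card B := by
  have h2' : (2 : κ) ≠ 0 := by
    intro h
    apply h2
    apply Q.injective
    rw [map_ofNat, map_zero, h]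
  have hδ := Q.delta_ne_zero
  set S := B.addSubgroupOf (antiHermitianSubgroup σ n) with hS
  have hanti : ∀ y : S, conjTr σ (y : Matrix (Fin n) (Fin n) κ) = -y := fun y =>
    mem_antiHermitianSubgroup.1 y.1.2
  have hmemB : ∀ y : S, ((y : antiHermitianSubgroup σ n) : Matrix (Fin n) (Fin n) κ) ∈ B := fun y => y.2
  let F : S × S → B := fun p => ⟨p.1 + δ • (p.2 : Matrix (Fin n) (Fin n) κ),
    add_mem p.1.2 (hBs _ _ p.2.2)⟩
  have hF : Function.Bijective F := by
    constructor
    · rintro ⟨y, w⟩ ⟨y', w'⟩ h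
      have h1 : (y : Matrix (Fin n) (Fin n) κ) + δ • (w : Matrix (Fin n) (Fin n) κ) =
        y' + δ • (w' : Matrix (Fin n) (Fin n) κ) := congrArg Subtype.val h
      have h3 := congrArg (conjTr σ) h1
      rw [conjTr_add, conjTr_add, conjTr_smul, conjTr_smul, hanti, hanti, hanti, hanti, Q.map_delta]
        at h3
      have h4 : (2 : κ) • (y : Matrix (Fin n) (Fin n) κ) = (2 : κ) • (y' : Matrix (Fin n) (Fin n) κ) := by
        linear_combination (norm := module) h1 - h3
      have h5 : (y : Matrix (Fin n) (Fin n) κ) = y' := smul_right_injective _ h2' h4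
      rw [h5] at h1
      have h6 : (w : Matrix (Fin n) (Fin n) κ) = w' :=
        smul_right_injective _ hδ (add_left_cancel h1)
      exact Prod.ext (Subtype.ext (Subtype.ext h5)) (Subtype.ext (Subtype.ext h6))
    · rintro ⟨z, hz⟩
      have hσ2 : σ (2⁻¹ : κ) = 2⁻¹ := by rw [map_inv₀, map_ofNat]
      have hσδ : σ (δ⁻¹) = -δ⁻¹ := by rw [map_inv₀, Q.map_delta, inv_neg]
      set y := (2⁻¹ : κ) • (z - conjTr σ z) with hy
      set w := (2⁻¹ * δ⁻¹ : κ) • (z + conjTr σ z) with hw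
      have hyA : y ∈ antiHermitianSubgroup σ n := by
        rw [mem_antiHermitianSubgroup, hy, conjTr_smul, conjTr_sub, conjTr_conjTr Q.involutive, hσ2]
        module
      have hwA : w ∈ antiHermitianSubgroup σ n := by
        rw [mem_antiHermitianSubgroup, hw, conjTr_smul, conjTr_add, conjTr_conjTr Q.involutive,
          map_mul, hσ2, hσδ]
        module
      refine ⟨(⟨⟨y, hyA⟩, hBs _ _ (sub_mem hz (hBc z hz))⟩,
        ⟨⟨w, hwA⟩, hBs _ _ (add_mem hz (hBc z hz))⟩), Subtype.ext ?_⟩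
      change y + δ • w = z
      rw [hy, hw, smul_smul, mul_comm (2⁻¹ : κ), mul_inv_cancel_left₀ hδ]
      have : (2⁻¹ : κ) • (z - conjTr σ z) + (2⁻¹ : κ) • (z + conjTr σ z) = (2⁻¹ * 2 : κ) • z := by
        module
      rw [this, inv_mul_cancel₀ h2', one_smul]
  rw [← Nat.card_congr (Equiv.ofBijective F hF), Nat.card_prod, pow_two]

theorem IsQuadratic.index_commutant (Q : IsQuadratic σ δ η) (h2 : (2 : k) ≠ 0)
    {x : Matrix (Fin n) (Fin n) κ} (hx : IsCyclicMatrix x) (hxa : conjTr σ x = -x) {N : ℕ}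
    (hN : N * Nat.card ((commutant x).addSubgroupOf (antiHermitianSubgroup σ n)) =
      Nat.card (antiHermitianSubgroup σ n)) :
    N = (Nat.card k ^ n.choose 2) ^ 2 := by
  have h1 := Q.card_antiHermitian_sq h2 (commutant x) (fun a y hy => Commute.smul_left hy a)
    (fun y hy => by
      have := congrArg (conjTr σ) (show y * x = x * y from hy)
      rw [conjTr_mul, conjTr_mul, hxa, neg_mul, mul_neg, neg_inj] at this
      exact this.symm)
  have h3 := Q.card_antiHermitian_sq (n := n) h2 ⊤ (fun _ _ _ => trivial) (fun _ _ => trivial)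
  have h4 : Nat.card ((⊤ : AddSubgroup _).addSubgroupOf (antiHermitianSubgroup σ n)) =
      Nat.card (antiHermitianSubgroup σ n) :=
    Nat.card_congr (Equiv.subtypeUnivEquiv fun _ => trivial)
  rw [h4, ← hN, mul_pow, h1, card_commutant hx, Nat.card_congr AddSubgroup.topEquiv.toEquiv,
    card_matrix, Q.card_eq, pow_right_comm, ← mul_pow, pow_right_comm] at h3
  have : Finite k := Finite.of_injective _ Q.injective
  exact eq_pow_choose_sq Nat.card_pos (Nat.pow_left_injective two_ne_zero h3)

end Commutant

/-! ### Counting norm-one elements -/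

/-- The solutions of `a ^ 2 - η b ^ 2 = 1`. -/
def conic (A : Type*) [CommRing A] (η : A) : Set (A × A) :=
  {p | p.1 * p.1 - η * (p.2 * p.2) = 1}

section LocalCount

variable {A F : Type*} [CommRing A] [Finite A] [Field F] (φ : A →+* F)

/-- The fibres of a surjective homomorphism have the size of its kernel. -/
theorem card_subtype_comp (hφ : Function.Surjective φ) (P : F → Prop) :
    Nat.card {t : A // P (φ t)} = Nat.card (RingHom.ker φ) * Nat.card {s : F // P s} := by
  choose g hg using hφ
  rw [← Nat.card_prod]
  refine Nat.card_congr
    { toFun := fun t => (⟨t - g (φ t), ?_⟩, ⟨φ t, t.2⟩)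
      invFun := fun p => ⟨p.1 + g p.2, ?_⟩
      left_inv := fun t => ?_
      right_inv := fun p => ?_ }
  · rw [RingHom.mem_ker, map_sub, hg, sub_self]
  · rw [map_add, hg, (RingHom.mem_ker).1 p.1.2, zero_add]; exact p.2.2
  · exact Subtype.ext (sub_add_cancel _ _)
  · have h1 : φ (p.1 + g p.2) = p.2 := by rw [map_add, hg, (RingHom.mem_ker).1 p.1.2, zero_add]
    refine Prod.ext (Subtype.ext ?_) (Subtype.ext h1)
    change (p.1 : A) + g p.2 - g (φ (p.1 + g p.2)) = p.1
    rw [h1, add_sub_cancel_right]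

/-- The number of norm-one elements over a finite local ring with residue field `F`, by the rational
parametrisation of a conic. -/
theorem card_conic_add (hφ : Function.Surjective φ) [IsLocalHom φ] (h2 : (2 : F) ≠ 0) {η : A}
    (hη : φ η ≠ 0) :
    Nat.card (conic A η) + Nat.card (RingHom.ker φ) * Nat.card {t : F // φ η * (t * t) = 1} =
      Nat.card A + Nat.card (RingHom.ker φ) := by
  classical
  have hunit : ∀ {a : A}, φ a ≠ 0 → IsUnit a := fun h => isUnit_of_map_unit φ _ (Ne.isUnit h)
  have h2A : IsUnit (2 : A) := hunit (by rwa [map_ofNat])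
  obtain ⟨h, hh⟩ := h2A.exists_right_inv
  have hc1 : Nat.card (conic A η) = Nat.card {p : conic A η // φ (1 + p.1.1) ≠ 0} +
      Nat.card {p : conic A η // ¬ φ (1 + p.1.1) ≠ 0} := by
    rw [← Nat.card_sum]
    exact Nat.card_congr (Equiv.sumCompl _).symm
  have hc2 : Nat.card A = Nat.card {t : A // φ (1 - η * (t * t)) ≠ 0} +
      Nat.card {t : A // ¬ φ (1 - η * (t * t)) ≠ 0} := by
    rw [← Nat.card_sum]
    exact Nat.card_congr (Equiv.sumCompl _).symm
  have hc3 : Nat.card {t : A // ¬ φ (1 - η * (t * t)) ≠ 0} =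
      Nat.card (RingHom.ker φ) * Nat.card {t : F // φ η * (t * t) = 1} := by
    rw [← card_subtype_comp φ hφ]
    refine Nat.card_congr (Equiv.subtypeEquivRight fun t => ?_)
    rw [not_not, map_sub, map_one, map_mul, map_mul, sub_eq_zero, eq_comm]
  -- the point `(a, b)` with parameter `t`, and `t = b / (1 + a)`
  have key : ∀ t w : A, (1 - η * (t * t)) * w = 1 →
      (((1 + η * (t * t)) * w, 2 * t * w) : A × A) ∈ conic A η := by
    intro t w hw
    change (1 + η * (t * t)) * w * ((1 + η * (t * t)) * w) - η * (2 * t * w * (2 * t * w)) = 1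
    linear_combination ((1 - η * (t * t)) * w + 1) * hw
  have key' : ∀ t w : A, (1 - η * (t * t)) * w = 1 →
      ((-((1 + η * (t * t)) * w), 2 * t * w) : A × A) ∈ conic A η := by
    intro t w hw
    have := key t w hw
    change _ = _ at this ⊢
    linear_combination this
  have inv : ∀ a b w : A, a * a - η * (b * b) = 1 → (1 + a) * w = 1 →
      (1 - η * (b * w * (b * w))) * (h * (1 + a)) = 1 ∧
      (1 + η * (b * w * (b * w))) * (h * (1 + a)) = a ∧ 2 * (b * w) * (h * (1 + a)) = b := by
    intro a b w hab hw
    have e1 : η * (b * w * (b * w)) = (a - 1) * w := by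
      linear_combination (-w * w) * hab + (a - 1) * w * hw
    rw [e1]
    refine ⟨?_, ?_, ?_⟩
    · linear_combination (1 - a) * h * hw + hh
    · linear_combination (a - 1) * h * hw + a * hh
    · linear_combination b * (2 * h) * hw + b * hh
  have hA : Nat.card {p : conic A η // φ (1 + p.1.1) ≠ 0} =
      Nat.card {t : A // φ (1 - η * (t * t)) ≠ 0} := by
    choose w hw using fun t : {t : A // φ (1 - η * (t * t)) ≠ 0} => (hunit t.2).exists_right_inv
    symm
    have hsum : ∀ t, 1 + (1 + η * (t.1 * t.1)) * w t = 2 * w t := fun t => by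
      linear_combination -hw t
    refine Nat.card_congr (Equiv.ofBijective
      (fun t => ⟨⟨_, key t (w t) (hw t)⟩, ?_⟩) ⟨?_, ?_⟩)
    · have : IsUnit (2 * w t) := h2A.mul (IsUnit.of_mul_eq_one_right _ (hw t))
      rw [hsum]
      exact (this.map φ).ne_zero
    · intro t s hts
      have e := congrArg (fun p => p.1.1) hts
      have e1 : (1 + η * (t.1 * t.1)) * w t = (1 + η * (s.1 * s.1)) * w s := congrArg Prod.fst e
      have e2 : 2 * t.1 * w t = 2 * s.1 * w s := congrArg Prod.snd e
      have e3 : 2 * w t = 2 * w s := by rw [← hsum, ← hsum, e1]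
      have e4 : w t = w s := h2A.mul_left_cancel e3
      apply Subtype.ext
      have hwu : IsUnit (w t) := IsUnit.of_mul_eq_one_right _ (hw t)
      apply hwu.mul_right_cancel
      apply h2A.mul_left_cancel
      rw [← mul_assoc, e2, e4, mul_assoc]
    · rintro ⟨⟨⟨a, b⟩, hab⟩, hp⟩
      obtain ⟨v, hv⟩ := (hunit hp).exists_right_inv
      obtain ⟨i1, i2, i3⟩ := inv a b v hab hv
      have hne : φ (1 - η * (b * v * (b * v))) ≠ 0 :=
        ((IsUnit.of_mul_eq_one _ i1).map φ).ne_zero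
      refine ⟨⟨b * v, hne⟩, ?_⟩
      have hwv : w ⟨b * v, hne⟩ = h * (1 + a) :=
        (IsUnit.of_mul_eq_one _ i1).mul_left_cancel ((hw ⟨b * v, hne⟩).trans i1.symm)
      apply Subtype.ext
      apply Subtype.ext
      simp only [hwv]
      exact Prod.ext i2 i3
  -- the points reducing to `(-1, 0)`: the negatives of those with parameter in the maximal ideal
  have hB : Nat.card {p : conic A η // ¬ φ (1 + p.1.1) ≠ 0} = Nat.card (RingHom.ker φ) := by
    have hu : ∀ t : RingHom.ker φ, φ (1 - η * (t.1 * t.1)) ≠ 0 := fun t => by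
      rw [map_sub, map_mul, map_mul, (RingHom.mem_ker).1 t.2, zero_mul, mul_zero, sub_zero, map_one]
      exact one_ne_zero
    choose w hw using fun t : RingHom.ker φ => (hunit (hu t)).exists_right_inv
    symm
    have hsum : ∀ t, 1 + (1 + η * (t.1 * t.1)) * w t = 2 * w t := fun t => by
      linear_combination -hw t
    have hsum' : ∀ t, 1 + -((1 + η * (t.1 * t.1)) * w t) = -(2 * η * (t.1 * t.1)) * w t := fun t => by
      linear_combination -hw t
    refine Nat.card_congr (Equiv.ofBijective
      (fun t => ⟨⟨_, key' t (w t) (hw t)⟩, ?_⟩) ⟨?_, ?_⟩)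
    · rw [not_not, hsum']
      simp [(RingHom.mem_ker).1 t.2]
    · intro t s hts
      have e := congrArg (fun p => p.1.1) hts
      have e1 : (1 + η * (t.1 * t.1)) * w t = (1 + η * (s.1 * s.1)) * w s :=
        neg_injective (congrArg Prod.fst e)
      have e2 : 2 * t.1 * w t = 2 * s.1 * w s := congrArg Prod.snd e
      have e3 : 2 * w t = 2 * w s := by rw [← hsum, ← hsum, e1]
      have e4 : w t = w s := h2A.mul_left_cancel e3
      apply Subtype.ext
      have hwu : IsUnit (w t) := IsUnit.of_mul_eq_one_right _ (hw t)
      apply hwu.mul_right_cancel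
      apply h2A.mul_left_cancel
      rw [← mul_assoc, e2, e4, mul_assoc]
    · rintro ⟨⟨⟨a, b⟩, hab⟩, hp⟩
      rw [not_not] at hp
      have hab' : a * a - η * (b * b) = 1 := hab
      have ha : φ a = -1 := by
        rw [map_add, map_one] at hp
        linear_combination hp
      have hna : φ (1 + -a) ≠ 0 := by
        rw [map_add, map_neg, ha, map_one, neg_neg, one_add_one_eq_two]; exact h2
      obtain ⟨v, hv⟩ := (hunit hna).exists_right_inv
      obtain ⟨i1, i2, i3⟩ := inv (-a) b v (by linear_combination hab') hv
      have hb : φ b = 0 := by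
        have := congrArg φ hab'
        rw [map_sub, map_mul, map_mul, map_mul, ha, map_one] at this
        have h3 : φ η * (φ b * φ b) = 0 := by linear_combination -this
        exact mul_self_eq_zero.1 ((mul_eq_zero.1 h3).resolve_left hη)
      have hker : b * v ∈ RingHom.ker φ := by rw [RingHom.mem_ker, map_mul, hb, zero_mul]
      refine ⟨⟨b * v, hker⟩, ?_⟩
      have hwv : w ⟨b * v, hker⟩ = h * (1 + -a) :=
        (IsUnit.of_mul_eq_one _ i1).mul_left_cancel ((hw ⟨b * v, hker⟩).trans i1.symm)
      apply Subtype.ext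
      apply Subtype.ext
      simp only [hwv]
      exact Prod.ext (by simp only [i2, neg_neg]) i3
  rw [hc1, hA, hB, hc2, hc3]
  ring

open Classical in
theorem card_square_roots (h2 : (2 : F) ≠ 0) {c : F} (hc : c ≠ 0) :
    Nat.card {t : F // c * (t * t) = 1} = if IsSquare c then 2 else 0 := by
  split_ifs with h
  · obtain ⟨r, rfl⟩ := h
    have hr : r ≠ 0 := fun h => hc (by rw [h, zero_mul])
    have hset : {t : F | r * r * (t * t) = 1} = {r⁻¹, -r⁻¹} := by
      ext t
      rw [Set.mem_ofPred_eq, Set.mem_insert_iff, Set.mem_singleton_iff]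
      constructor
      · intro ht
        have : (t * r - 1) * (t * r + 1) = 0 := by linear_combination ht
        rcases mul_eq_zero.1 this with h | h
        · left; exact eq_inv_of_mul_eq_one_left (sub_eq_zero.1 h)
        · right
          have : -t * r = 1 := by linear_combination -h
          rw [← eq_inv_of_mul_eq_one_left this, neg_neg]
      · rintro (rfl | rfl) <;> field_simp
    have hne : r⁻¹ ≠ -r⁻¹ := by
      intro h
      have h3 : 2 * r⁻¹ = 0 := by linear_combination h
      exact (mul_ne_zero h2 (inv_ne_zero hr)) h3
    change Nat.card {t : F | r * r * (t * t) = 1} = 2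
    rw [hset, Nat.card_coe_set_eq, Set.ncard_pair hne]
  · rw [Nat.card_eq_zero]
    left
    refine ⟨fun t => h ⟨t.1⁻¹, ?_⟩⟩
    have ht : t.1 ≠ 0 := by
      intro h0
      have := t.2
      rw [h0] at this
      simp at this
    have := t.2
    field_simp
    linear_combination this

end LocalCount

section FieldExtension

variable {k F : Type*} [Field k] [Finite k] [Field F] [Algebra k F]

theorem two_ne_zero_of_ringChar (h2 : ringChar k ≠ 2) : (2 : F) ≠ 0 := by
  have : (2 : k) ≠ 0 := Ring.two_ne_zero h2
  rw [← map_ofNat (algebraMap k F)]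
  exact (_root_.map_ne_zero _).2 this

/-- A non-square in a finite field becomes a square in the extensions of even degree only. -/
theorem isSquare_algebraMap_iff [Finite F] (h2 : ringChar k ≠ 2) {η : k} (hη : ¬ IsSquare η) :
    IsSquare (algebraMap k F η) ↔ Even (Module.finrank k F) := by
  have := Fintype.ofFinite k
  have := Fintype.ofFinite F
  have hη0 : η ≠ 0 := fun h => hη (by rw [h]; exact IsSquare.zero)
  have h2F : ringChar F ≠ 2 := fun h => two_ne_zero_of_ringChar (F := F) h2 (by
    have := CharP.cast_eq_zero F (ringChar F)
    rwa [h, Nat.cast_ofNat] at this)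
  have hodd : Odd (Fintype.card k) := by
    rw [← Nat.not_even_iff_odd, Nat.even_iff, ← FiniteField.even_card_iff_char_two]
    exact h2
  have hpow : ∀ d, η ^ (Fintype.card k ^ d / 2) = (-1) ^ d := by
    intro d
    induction d with
    | zero => simp
    | succ d ih =>
      obtain ⟨a, ha⟩ := hodd
      obtain ⟨b, hb⟩ : Odd (Fintype.card k ^ d) := Odd.pow ⟨a, ha⟩
      have e : Fintype.card k ^ (d + 1) / 2 = Fintype.card k * (Fintype.card k ^ d / 2) +
          Fintype.card k / 2 := by
        rw [pow_succ, hb, ha]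
        have : (2 * b + 1) * (2 * a + 1) = 2 * ((2 * a + 1) * b + a) + 1 := by ring
        rw [this, show (2 * b + 1) / 2 = b by omega, show (2 * a + 1) / 2 = a by omega]
        omega
      rw [e, pow_add, pow_mul, FiniteField.pow_card, ih, pow_succ]
      congr 1
      exact (FiniteField.pow_dichotomy h2 hη0).resolve_left fun h =>
        hη ((FiniteField.isSquare_iff h2 hη0).2 h)
  rw [FiniteField.isSquare_iff h2F ((_root_.map_ne_zero _).2 hη0), Module.card_eq_pow_finrank (K := k),
    ← map_pow, hpow]
  have hne : (-1 : F) ≠ 1 := Ring.neg_one_ne_one_of_char_ne_two h2F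
  rcases Nat.even_or_odd (Module.finrank k F) with h | h
  · simp [h.neg_one_pow, h]
  · simp [h.neg_one_pow, hne, h]

/-- The sign `ε` is `1` or `-1` according to whether `η` is a square. -/
def IsSign (ε : ℤ) (η : k) : Prop := η ≠ 0 ∧ (ε = 1 ∧ IsSquare η ∨ ε = -1 ∧ ¬ IsSquare η)

theorem IsSign.card_square_roots [Finite F] (h2 : ringChar k ≠ 2) {ε : ℤ} {η : k}
    (h : IsSign ε η) : (Nat.card {t : F // algebraMap k F η * (t * t) = 1} : ℤ) =
      1 + ε ^ Module.finrank k F := by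
  rw [RegChar.card_square_roots (two_ne_zero_of_ringChar h2) ((_root_.map_ne_zero _).2 h.1)]
  rcases h.2 with ⟨rfl, hs⟩ | ⟨rfl, hs⟩
  · rw [if_pos (hs.map _)]; simp
  · rw [isSquare_algebraMap_iff h2 hs]
    split_ifs with hev
    · rw [hev.neg_one_pow]; rfl
    · rw [(Nat.not_even_iff_odd.1 hev).neg_one_pow]; rfl

/-- The number of norm-one elements of a finite local algebra over `k`, with residue field `F`. -/
theorem IsSign.card_conic {A : Type*} [CommRing A] [Finite A] [Algebra k A] (φ : A →ₐ[k] F)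
    (hφ : Function.Surjective φ) [IsLocalHom (φ : A →+* F)] (h2 : ringChar k ≠ 2) {ε : ℤ} {η : k}
    (h : IsSign ε η) : (Nat.card (conic A (algebraMap k A η)) : ℤ) =
      Nat.card (RingHom.ker (φ : A →+* F)) * ((Nat.card k : ℤ) ^ Module.finrank k F -
        ε ^ Module.finrank k F) := by
  have : Finite F := Finite.of_surjective φ hφ
  have e : (φ : A →+* F) (algebraMap k A η) = algebraMap k F η := φ.commutes η
  have h1 := card_conic_add (φ : A →+* F) hφ (two_ne_zero_of_ringChar h2)
    (η := algebraMap k A η) (by rw [e]; exact (_root_.map_ne_zero _).2 h.1)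
  have h3 := card_subtype_comp (φ : A →+* F) hφ fun _ => True
  rw [Nat.card_congr (Equiv.subtypeUnivEquiv fun _ => trivial),
    Nat.card_congr (Equiv.subtypeUnivEquiv fun _ => trivial),
    Module.natCard_eq_pow_finrank (K := k) (V := F)] at h3
  rw [e, h3] at h1
  have h4 := congrArg (Nat.cast : ℕ → ℤ) h1
  push_cast at h4
  rw [h.card_square_roots h2] at h4
  linear_combination h4

end FieldExtension

section Product

theorem card_conic_congr {A B : Type*} [CommRing A] [CommRing B] (e : A ≃+* B) (η : A) :
    Nat.card (conic A η) = Nat.card (conic B (e η)) := by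
  refine Nat.card_congr (Equiv.subtypeEquiv (Equiv.prodCongr e.toEquiv e.toEquiv) fun p => ?_)
  change p.1 * p.1 - η * (p.2 * p.2) = 1 ↔ e p.1 * e p.1 - e η * (e p.2 * e p.2) = 1
  rw [← map_mul, ← map_mul, ← map_mul, ← map_sub, ← map_one e, e.injective.eq_iff]

theorem card_conic_prod {A B : Type*} [CommRing A] [CommRing B] (η : A × B) :
    Nat.card (conic (A × B) η) = Nat.card (conic A η.1) * Nat.card (conic B η.2) := by
  rw [← Nat.card_prod]
  refine Nat.card_congr
    { toFun := fun p => (⟨(p.1.1.1, p.1.2.1), congrArg Prod.fst p.2⟩,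
        ⟨(p.1.1.2, p.1.2.2), congrArg Prod.snd p.2⟩)
      invFun := fun p => ⟨((p.1.1.1, p.2.1.1), (p.1.1.2, p.2.1.2)), Prod.ext p.1.2 p.2.2⟩
      left_inv := fun p => rfl
      right_inv := fun p => rfl }

variable {k : Type*} [Field k]

theorem card_conic_adjoinRoot_mul {f g : k[X]} (h : IsCoprime f g) (η : k) :
    Nat.card (conic (AdjoinRoot (f * g)) (algebraMap k _ η)) =
      Nat.card (conic (AdjoinRoot f) (algebraMap k _ η)) *
        Nat.card (conic (AdjoinRoot g) (algebraMap k _ η)) := by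
  let e₁ : AdjoinRoot (f * g) ≃+* k[X] ⧸ (Ideal.span {f} * Ideal.span {g}) :=
    Ideal.quotEquivOfEq (by rw [Ideal.span_singleton_mul_span_singleton])
  let e := e₁.trans (Ideal.quotientMulEquivQuotientProd (Ideal.span {f}) (Ideal.span {g})
    (Ideal.isCoprime_span_singleton_iff f g |>.2 h))
  have := card_conic_congr e (algebraMap k _ η)
  rw [this]
  exact card_conic_prod _

theorem card_conic_adjoinRoot_prod {I : Type*} (s : Finset I) (g : I → k[X])
    (h : ∀ i ∈ s, ∀ j ∈ s, i ≠ j → IsCoprime (g i) (g j)) (η : k) :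
    Nat.card (conic (AdjoinRoot (∏ i ∈ s, g i)) (algebraMap k _ η)) =
      ∏ i ∈ s, Nat.card (conic (AdjoinRoot (g i)) (algebraMap k _ η)) := by
  classical
  induction s using Finset.induction_on with
  | empty =>
    rw [Finset.prod_empty, Finset.prod_empty, Nat.card_eq_one_iff_unique]
    have : Subsingleton (AdjoinRoot (1 : k[X])) := by
      refine Ideal.Quotient.subsingleton_iff.2 ?_
      exact Ideal.span_singleton_one
    refine ⟨⟨fun p q => Subsingleton.elim _ _⟩, ⟨⟨(0, 0), Subsingleton.elim _ _⟩⟩⟩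
  | insert a s ha ih =>
    rw [Finset.prod_insert ha, Finset.prod_insert ha, card_conic_adjoinRoot_mul, ih]
    · exact fun i hi j hj => h i (Finset.mem_insert_of_mem hi) j (Finset.mem_insert_of_mem hj)
    · refine IsCoprime.prod_right fun i hi => h a (Finset.mem_insert_self _ _) i
        (Finset.mem_insert_of_mem hi) fun e => ha (e ▸ hi)

variable [Finite k]

theorem finrank_adjoinRoot {f : k[X]} (hf : f.Monic) :
    Module.finrank k (AdjoinRoot f) = f.natDegree := by
  rw [(AdjoinRoot.powerBasis' hf).finrank, AdjoinRoot.powerBasis'_dim]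

theorem finite_adjoinRoot {f : k[X]} (hf : f.Monic) : Finite (AdjoinRoot f) := by
  have := (AdjoinRoot.powerBasis' hf).finite
  exact Module.finite_of_finite k

theorem card_adjoinRoot {f : k[X]} (hf : f.Monic) :
    Nat.card (AdjoinRoot f) = Nat.card k ^ f.natDegree := by
  have := (AdjoinRoot.powerBasis' hf).finite
  rw [Module.natCard_eq_pow_finrank (K := k), finrank_adjoinRoot hf]

/-- The number of norm-one elements attached to a power of an irreducible polynomial. -/
theorem IsSign.card_conic_pow (h2 : ringChar k ≠ 2) {ε : ℤ} {η : k} (h : IsSign ε η) {p : k[X]}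
    (hp : Irreducible p) (hpm : p.Monic) (e : ℕ) :
    (Nat.card (conic (AdjoinRoot (p ^ (e + 1))) (algebraMap k _ η)) : ℤ) =
      (Nat.card k : ℤ) ^ (p.natDegree * e) *
        ((Nat.card k : ℤ) ^ p.natDegree - ε ^ p.natDegree) := by
  have hpe : (p ^ (e + 1)).Monic := hpm.pow _
  have : Fact (Irreducible p) := ⟨hp⟩
  have := finite_adjoinRoot hpe
  have := finite_adjoinRoot hpm
  let φ : AdjoinRoot (p ^ (e + 1)) →ₐ[k] AdjoinRoot p :=
    AdjoinRoot.algHomOfDvd k _ _ (dvd_pow_self p (Nat.succ_ne_zero e))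
  have hφmk : ∀ g : k[X], φ (AdjoinRoot.mk _ g) = AdjoinRoot.mk p g := by
    intro g
    rw [← AdjoinRoot.aeval_eq, ← AdjoinRoot.aeval_eq, ← aeval_algHom_apply,
      AdjoinRoot.algHomOfDvd_root]
  have hφ : Function.Surjective φ := fun z => by
    obtain ⟨g, rfl⟩ := AdjoinRoot.mk_surjective z
    exact ⟨AdjoinRoot.mk _ g, hφmk g⟩
  have hloc : IsLocalHom (φ : AdjoinRoot (p ^ (e + 1)) →+* AdjoinRoot p) := by
    refine ⟨fun a ha => ?_⟩
    obtain ⟨g, rfl⟩ := AdjoinRoot.mk_surjective a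
    have hne : AdjoinRoot.mk p g ≠ 0 := by
      rw [← hφmk]; exact ha.ne_zero
    rw [Ne, AdjoinRoot.mk_eq_zero] at hne
    have hcop : IsCoprime (p ^ (e + 1)) g := ((hp.coprime_iff_not_dvd).2 hne).pow_left
    obtain ⟨a, b, hab⟩ := hcop
    have h3 := congrArg (AdjoinRoot.mk (p ^ (e + 1))) hab
    rw [map_add, map_mul, AdjoinRoot.mk_self, mul_zero, zero_add, map_mul, map_one, mul_comm] at h3
    exact IsUnit.of_mul_eq_one _ h3
  have hfr := finrank_adjoinRoot hpm
  have h4 := h.card_conic φ hφ h2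
  rw [h4, hfr]
  congr 1
  have h3 := card_subtype_comp (φ : AdjoinRoot (p ^ (e + 1)) →+* AdjoinRoot p) hφ fun _ => True
  rw [Nat.card_congr (Equiv.subtypeUnivEquiv fun _ => trivial),
    Nat.card_congr (Equiv.subtypeUnivEquiv fun _ => trivial), card_adjoinRoot hpe,
    card_adjoinRoot hpm, natDegree_pow, mul_comm (e + 1), mul_add, mul_one, pow_add] at h3
  have h5 := Nat.eq_of_mul_eq_mul_right (pow_pos Nat.card_pos _) h3
  rw [← h5, Nat.cast_pow]

end Product

/-! ### Types of polynomials -/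

section Types

variable {k : Type*} [Field k] [Finite k]

/-- A finite field has many irreducible polynomials of each degree, the translates of one. -/
theorem exists_finset_irreducible (d : ℕ) (hd : d ≠ 0) : ∃ S : Finset k[X],
    (∀ p ∈ S, p.Monic ∧ Irreducible p ∧ p.natDegree = d) ∧ Nat.card k ≤ d * S.card := by
  classical
  have := Fintype.ofFinite k
  obtain ⟨p, hp⟩ := CharP.exists k
  have : Fact p.Prime := ⟨CharP.char_is_prime k p⟩
  have : NeZero d := ⟨hd⟩
  let E := FiniteField.Extension k p d
  have hfin : Module.finrank k E = d := FiniteField.finrank_extension k p d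
  obtain ⟨γ, hγ⟩ := Field.exists_primitive_element k E
  have hγd : (minpoly k γ).natDegree = d := by
    exact ((Field.primitive_element_iff_minpoly_natDegree_eq k γ).1 hγ).trans hfin
  have hint : ∀ a : k, IsIntegral k (γ + algebraMap k E a) := fun a => IsIntegral.of_finite k _
  refine ⟨Finset.univ.image fun a : k => minpoly k (γ + algebraMap k E a), ?_, ?_⟩
  · intro p hp
    obtain ⟨a, -, rfl⟩ := Finset.mem_image.1 hp
    refine ⟨minpoly.monic (hint a), minpoly.irreducible (hint a), ?_⟩
    rw [minpoly.add_algebraMap, natDegree_comp, natDegree_X_sub_C, mul_one, hγd]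
  · rw [Nat.card_eq_fintype_card, ← Finset.card_univ]
    refine Finset.card_le_mul_card_image _ _ fun P hP => ?_
    obtain ⟨b, -, rfl⟩ := Finset.mem_image.1 hP
    set P := minpoly k (γ + algebraMap k E b) with hP'
    have hPd : P.natDegree = d := by
      rw [hP', minpoly.add_algebraMap, natDegree_comp, natDegree_X_sub_C, mul_one, hγd]
    have hP0 : P.map (algebraMap k E) ≠ 0 :=
      ((minpoly.monic (hint b)).map _).ne_zero
    calc _ ≤ (P.map (algebraMap k E)).roots.toFinset.card := by
          refine Finset.card_le_card_of_injOn (fun a => γ + algebraMap k E a) ?_ ?_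
          · intro a ha
            have ha' : minpoly k (γ + algebraMap k E a) = P := (Finset.mem_filter.1 ha).2
            rw [Finset.mem_coe, Multiset.mem_toFinset, mem_roots hP0, IsRoot, eval_map_algebraMap,
              ← ha', minpoly.aeval]
          · intro a _ a' _ h
            exact (algebraMap k E).injective (add_left_cancel h)
      _ ≤ (P.map (algebraMap k E)).roots.card := Multiset.toFinset_card_le _
      _ ≤ (P.map (algebraMap k E)).natDegree := card_roots' _
      _ = d := by rw [natDegree_map, hPd]

theorem IsSign.card_conic_prod_pow (h2 : ringChar k ≠ 2) {ε : ℤ} {η : k} (h : IsSign ε η)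
    {I : Type*} (s : Finset I) (p : I → k[X]) (e : I → ℕ)
    (hp : ∀ i ∈ s, (p i).Monic ∧ Irreducible (p i)) (hinj : Set.InjOn p s) :
    (Nat.card (conic (AdjoinRoot (∏ i ∈ s, p i ^ (e i + 1))) (algebraMap k _ η)) : ℚ) =
      ∏ i ∈ s, ((Nat.card k : ℚ) ^ ((p i).natDegree * (e i + 1)) *
        (1 - (ε : ℚ) ^ (p i).natDegree * ((Nat.card k : ℚ) ^ (p i).natDegree)⁻¹)) := by
  have hq : (Nat.card k : ℚ) ≠ 0 := Nat.cast_ne_zero.2 Nat.card_pos.ne'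
  rw [card_conic_adjoinRoot_prod]
  · rw [Nat.cast_prod]
    refine Finset.prod_congr rfl fun i hi => ?_
    have := congrArg (Int.cast : ℤ → ℚ) (h.card_conic_pow h2 (hp i hi).2 (hp i hi).1 (e i))
    push_cast at this
    rw [this, mul_add, mul_one, pow_add]
    field_simp
  · intro i hi j hj hij
    refine IsCoprime.pow ?_
    rw [(hp i hi).2.coprime_iff_not_dvd, (hp i hi).2.dvd_irreducible_iff_associated (hp j hj).2]
    intro hass
    exact hij (hinj hi hj (eq_of_monic_of_associated (hp i hi).1 (hp j hj).1 hass))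

/-- Regrouping a product over irreducible factors according to degrees and multiplicities. -/
theorem prod_eq_prod_prod_pow {M I : Type*} [CommMonoid M] (n : ℕ) (s : Finset I) (a b : I → ℕ)
    (ha : ∀ i ∈ s, a i < n) (hb : ∀ i ∈ s, b i < n) (G : ℕ → ℕ → M) :
    ∏ i ∈ s, G (a i) (b i) = ∏ d : Fin n, ∏ e : Fin n,
      G d e ^ (s.filter fun i => a i = d ∧ b i = e).card := by
  classical
  have h1 : ∀ d e : Fin n, G d e ^ (s.filter fun i => a i = d ∧ b i = e).card =
      ∏ i ∈ s, if a i = d ∧ b i = e then G d e else 1 := by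
    intro d e
    rw [← Finset.prod_filter, Finset.prod_const]
  simp only [h1]
  have h2 : ∀ d : Fin n, ∏ e : Fin n, ∏ i ∈ s, (if a i = d ∧ b i = e then G d e else 1) =
      ∏ i ∈ s, ∏ e : Fin n, (if a i = d ∧ b i = e then G d e else 1) := fun d => Finset.prod_comm
  simp only [h2]
  rw [Finset.prod_comm]
  refine Finset.prod_congr rfl fun i hi => ?_
  rw [Finset.prod_eq_single (⟨a i, ha i hi⟩ : Fin n), Finset.prod_eq_single (⟨b i, hb i hi⟩ : Fin n)]
  · simp
  · intro e _ he
    rw [if_neg]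
    rintro ⟨-, h⟩
    exact he (Fin.ext h.symm)
  · simp
  · intro d _ hd
    refine Finset.prod_eq_one fun e _ => ?_
    rw [if_neg]
    rintro ⟨h, -⟩
    exact hd (Fin.ext h.symm)
  · simp

/-- The type of a polynomial, and the number of norm-one elements that it determines: `τ_{d,e}` is
the number of irreducible factors of degree `d` and multiplicity `e`. In the proof, `d` and `e` are
shifted by one, to be indices in `Fin n`. -/
theorem IsSign.exists_card_conic_eq_uEval (h2 : ringChar k ≠ 2) {ε : ℤ} {η : k} (h : IsSign ε η)
    {n : ℕ} {f : k[X]} (hf : f.Monic) (hn : f.natDegree = n) :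
    ∃ τ : Matrix (Fin n) (Fin n) ℕ, IsType τ ∧
      (Nat.card (conic (AdjoinRoot f) (algebraMap k _ η)) : ℚ) = uEval ε τ (Nat.card k) := by
  classical
  open UniqueFactorizationMonoid in
  set m := normalizedFactors f with hm
  set s := m.toFinset with hs
  have hmem : ∀ p ∈ s, p.Monic ∧ Irreducible p := by
    intro p hp
    rw [hs, Multiset.mem_toFinset] at hp
    have hirr := irreducible_of_normalized_factor p hp
    refine ⟨?_, hirr⟩
    rw [← normalize_normalized_factor p hp]
    exact monic_normalize hirr.ne_zero
  have hcount : ∀ p ∈ s, 1 ≤ m.count p := fun p hp =>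
    Multiset.one_le_count_iff_mem.2 (Multiset.mem_toFinset.1 hp)
  have hprod : f = ∏ p ∈ s, p ^ (m.count p - 1 + 1) := by
    have h1 : m.prod = f := by
      rw [hm, prod_normalizedFactors_eq hf.ne_zero, hf.normalize_eq_self]
    conv_lhs => rw [← h1, Finset.prod_multiset_count]
    refine Finset.prod_congr rfl fun p hp => ?_
    rw [Nat.sub_add_cancel (hcount p hp)]
  have hdeg : ∑ p ∈ s, p.natDegree * (m.count p - 1 + 1) = n := by
    rw [← hn]
    conv_rhs => rw [hprod]
    rw [natDegree_prod_of_monic _ _ fun p hp => (hmem p hp).1.pow _]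
    refine Finset.sum_congr rfl fun p hp => ?_
    rw [natDegree_pow, mul_comm]
  have hdpos : ∀ p ∈ s, 1 ≤ p.natDegree := fun p hp => (hmem p hp).2.natDegree_pos
  have hle : ∀ p ∈ s, p.natDegree * (m.count p - 1 + 1) ≤ n := fun p hp => by
    rw [← hdeg]
    exact Finset.single_le_sum (f := fun p => p.natDegree * (m.count p - 1 + 1))
      (fun _ _ => Nat.zero_le _) hp
  have ha : ∀ p ∈ s, p.natDegree - 1 < n := fun p hp => by
    have h1 := hle p hp
    have h3 := hdpos p hp
    have : p.natDegree * 1 ≤ p.natDegree * (m.count p - 1 + 1) := Nat.mul_le_mul_left _ (by omega)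
    omega
  have hb : ∀ p ∈ s, m.count p - 1 < n := fun p hp => by
    have h1 := hle p hp
    have h3 := hdpos p hp
    have : 1 * (m.count p - 1 + 1) ≤ p.natDegree * (m.count p - 1 + 1) := Nat.mul_le_mul_right _ h3
    omega
  refine ⟨Matrix.of fun (d e : Fin n) =>
    (s.filter fun p => p.natDegree - 1 = (d : ℕ) ∧ m.count p - 1 = (e : ℕ)).card, ?_, ?_⟩
  · have := prod_eq_prod_prod_pow (M := Multiplicative ℕ) n s _ _ ha hb
      fun d e => Multiplicative.ofAdd ((d + 1) * (e + 1))
    have h1 := congrArg Multiplicative.toAdd this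
    simp only [toAdd_prod, toAdd_pow, toAdd_ofAdd, smul_eq_mul] at h1
    refine Eq.trans ?_ hdeg
    refine Eq.trans ?_ (h1.symm.trans ?_)
    · refine Finset.sum_congr rfl fun d _ => Finset.sum_congr rfl fun e _ => ?_
      rw [mul_comm]
      rfl
    · refine Finset.sum_congr rfl fun p hp => ?_
      rw [Nat.sub_add_cancel (hdpos p hp)]
  · have h1 := h.card_conic_prod_pow h2 s id (fun p => m.count p - 1) hmem (Set.injOn_id _)
    simp only [id] at h1
    have h3 : ∀ g : k[X], g = ∏ p ∈ s, p ^ (m.count p - 1 + 1) →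
        (Nat.card (conic (AdjoinRoot g) (algebraMap k _ η)) : ℚ) =
        ∏ p ∈ s, ((Nat.card k : ℚ) ^ (p.natDegree * (m.count p - 1 + 1)) *
          (1 - (ε : ℚ) ^ p.natDegree * ((Nat.card k : ℚ) ^ p.natDegree)⁻¹)) := by
      rintro _ rfl
      exact h1
    rw [h3 f hprod, Finset.prod_mul_distrib, Finset.prod_pow_eq_pow_sum, hdeg, uEval]
    congr 1
    refine Eq.trans ?_ (prod_eq_prod_prod_pow n s _ _ ha hb fun d e =>
      (1 - (ε : ℚ) ^ (d + 1) * ((Nat.card k : ℚ) ^ (d + 1))⁻¹))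
    refine Finset.prod_congr rfl fun p hp => ?_
    rw [Nat.sub_add_cancel (hdpos p hp)]

/-- Every type is the type of a polynomial, if the field is large enough. -/
theorem exists_monic_of_isType (h2 : ringChar k ≠ 2) {n : ℕ} (hq : n < Nat.card k)
    {τ : Matrix (Fin n) (Fin n) ℕ} (hτ : IsType τ) : ∃ f : k[X], f.Monic ∧ f.natDegree = n ∧
      ∀ (ε : ℤ) (η : k), IsSign ε η →
        (Nat.card (conic (AdjoinRoot f) (algebraMap k _ η)) : ℚ) = uEval ε τ (Nat.card k) := by
  classical
  obtain ⟨t, ht⟩ : ∃ t : Fin n → Fin n → ℕ, ∀ d e, τ d e = t d e :=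
    ⟨fun d e => τ d e, fun _ _ => rfl⟩
  replace hτ : ∑ d : Fin n, ∑ e : Fin n, ((d : ℕ) + 1) * ((e : ℕ) + 1) * t d e = n := by
    simpa only [IsType, ht] using hτ
  choose S hS hcard using fun d : Fin n => exists_finset_irreducible (k := k) (d + 1) (by omega)
  have hle : ∀ d : Fin n, ∑ e, t d e ≤ (S d).card := by
    intro d
    have h1 : ((d : ℕ) + 1) * ∑ e, t d e ≤ n := by
      rw [Finset.mul_sum]
      refine le_trans ?_ ((Finset.single_le_sum (f := fun d : Fin n => ∑ e : Fin n,
        ((d : ℕ) + 1) * ((e : ℕ) + 1) * t d e) (fun _ _ => Nat.zero_le _) (Finset.mem_univ d)).trans hτ.le)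
      refine Finset.sum_le_sum fun e _ => ?_
      nlinarith [Nat.zero_le (((d : ℕ) + 1) * (e : ℕ) * t d e)]
    have h3 : ((d : ℕ) + 1) * ∑ e, t d e ≤ (d + 1) * (S d).card := (h1.trans hq.le).trans (hcard d)
    exact Nat.le_of_mul_le_mul_left h3 (Nat.succ_pos _)
  have hemb : ∀ d : Fin n, ∃ F : (Σ e : Fin n, Fin (t d e)) → k[X], Function.Injective F ∧
      ∀ x, F x ∈ S d := by
    intro d
    have : Fintype.card (Σ e : Fin n, Fin (t d e)) ≤ Fintype.card (S d) := by
      rw [Fintype.card_sigma, Fintype.card_coe]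
      simpa using hle d
    obtain ⟨F⟩ := Function.Embedding.nonempty_of_card_le this
    exact ⟨fun x => F x, Subtype.val_injective.comp F.injective, fun x => (F x).2⟩
  choose F hFinj hFS using hemb
  let p : (Σ d : Fin n, Σ e : Fin n, Fin (t d e)) → k[X] := fun i => F i.1 i.2
  have hpS : ∀ i, p i ∈ S i.1 := fun i => hFS i.1 i.2
  have hpd : ∀ i, (p i).natDegree = i.1 + 1 := fun i => (hS _ _ (hpS i)).2.2
  have hpinj : Function.Injective p := by
    rintro ⟨d, x⟩ ⟨d', x'⟩ h
    have h1 := congrArg natDegree h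
    rw [hpd, hpd] at h1
    have h3 : d = d' := Fin.ext (by simpa using h1)
    subst h3
    exact congrArg _ (hFinj d h)
  have hprod : ∀ {M : Type} [CommMonoid M] (G : Fin n → Fin n → M),
      ∏ i : (Σ d : Fin n, Σ e : Fin n, Fin (t d e)), G i.1 i.2.1 = ∏ d, ∏ e, G d e ^ t d e := by
    intro M _ G
    rw [Fintype.prod_sigma]
    refine Finset.prod_congr rfl fun d _ => ?_
    rw [Fintype.prod_sigma]
    refine Finset.prod_congr rfl fun e _ => ?_
    simp
  have hsum : ∑ i : (Σ d : Fin n, Σ e : Fin n, Fin (t d e)), ((i.1 : ℕ) + 1) * ((i.2.1 : ℕ) + 1) = n := by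
    have := hprod (M := Multiplicative ℕ) fun d e => Multiplicative.ofAdd (((d : ℕ) + 1) * (e + 1))
    have h1 := congrArg Multiplicative.toAdd this
    simp only [toAdd_prod, toAdd_pow, toAdd_ofAdd, smul_eq_mul] at h1
    refine (h1.trans ?_).trans hτ
    refine Finset.sum_congr rfl fun d _ => Finset.sum_congr rfl fun e _ => ?_
    rw [mul_comm]
  refine ⟨∏ i : (Σ d : Fin n, Σ e : Fin n, Fin (t d e)), p i ^ ((i.2.1 : ℕ) + 1), monic_prod_of_monic _ _ fun i _ =>
    (hS _ _ (hpS i)).1.pow _, ?_, fun ε η h => ?_⟩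
  · rw [natDegree_prod_of_monic _ _ fun i _ => (hS _ _ (hpS i)).1.pow _]
    refine Eq.trans ?_ hsum
    refine Finset.sum_congr rfl fun i _ => ?_
    rw [natDegree_pow, hpd, mul_comm]
  · rw [h.card_conic_prod_pow h2 Finset.univ p (fun i => i.2.1)
      (fun i _ => ⟨(hS _ _ (hpS i)).1, (hS _ _ (hpS i)).2.1⟩) hpinj.injOn,
      Finset.prod_mul_distrib, Finset.prod_pow_eq_pow_sum]
    simp only [hpd]
    simp only [uEval, ht]
    rw [hsum, hprod fun d e => (1 - (ε : ℚ) ^ ((d : ℕ) + 1) * ((Nat.card k : ℚ) ^ ((d : ℕ) + 1))⁻¹)]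

end Types

/-! ### Centralizers over finite fields -/

section PolyEval

variable {k κ : Type*} [Field k] [Field κ] [Algebra k κ] {n : ℕ}
  {x : Matrix (Fin n) (Fin n) κ} {f : k[X]}

/-- Evaluation of polynomials over a subfield at a matrix, on the quotient by the characteristic
polynomial. -/
noncomputable def polyEval (x : Matrix (Fin n) (Fin n) κ) (f : k[X])
    (hf : f.map (algebraMap k κ) = x.charpoly) : AdjoinRoot f →ₐ[k] Matrix (Fin n) (Fin n) κ :=
  Ideal.Quotient.liftₐ (Ideal.span {f}) (aeval x) fun a ha => by
    obtain ⟨g, rfl⟩ := Ideal.mem_span_singleton.1 ha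
    rw [map_mul, ← aeval_map_algebraMap κ x f, hf, Matrix.aeval_self_charpoly, zero_mul]

theorem polyEval_mk (hf : f.map (algebraMap k κ) = x.charpoly) (g : k[X]) :
    polyEval x f hf (AdjoinRoot.mk f g) = aeval x g := rfl

theorem monic_of_map_eq_charpoly (hf : f.map (algebraMap k κ) = x.charpoly) : f.Monic :=
  monic_of_injective (algebraMap k κ).injective (hf ▸ Matrix.charpoly_monic x)

theorem natDegree_of_map_eq_charpoly (hf : f.map (algebraMap k κ) = x.charpoly) :
    f.natDegree = n := by
  rw [← natDegree_map (algebraMap k κ), hf, Matrix.charpoly_natDegree_eq_dim, Fintype.card_fin]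

/-- Every class modulo `f` contains a polynomial of degree less than `n`. -/
theorem exists_mk_sum (hf : f.map (algebraMap k κ) = x.charpoly) (z : AdjoinRoot f) :
    ∃ c : Fin n → k, z = AdjoinRoot.mk f (∑ j, C (c j) * X ^ (j : ℕ)) := by
  obtain ⟨g, rfl⟩ := AdjoinRoot.mk_surjective z
  rcases Nat.eq_zero_or_pos n with h0 | hn
  · subst h0
    have h1 : f = 1 := (monic_of_map_eq_charpoly hf).natDegree_eq_zero.1
      (natDegree_of_map_eq_charpoly hf)
    refine ⟨Fin.elim0, ?_⟩
    rw [AdjoinRoot.mk_eq_mk, h1]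
    exact one_dvd _
  · have hm := monic_of_map_eq_charpoly hf
    have hd := natDegree_of_map_eq_charpoly hf
    have hf1 : f ≠ 1 := by
      rintro rfl
      rw [natDegree_one] at hd
      omega
    have hlt : (g %ₘ f).natDegree < n := hd ▸ natDegree_modByMonic_lt g hm hf1
    refine ⟨fun j => (g %ₘ f).coeff j, ?_⟩
    rw [← eq_sum_of_natDegree_lt hlt, AdjoinRoot.mk_eq_mk]
    exact ⟨g /ₘ f, by rw [sub_eq_iff_eq_add', modByMonic_add_div]⟩

theorem aeval_sum_algebraMap (x : Matrix (Fin n) (Fin n) κ) (c : Fin n → k) :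
    aeval x (∑ j : Fin n, C (c j) * X ^ (j : ℕ)) =
      aeval x (∑ j : Fin n, C (algebraMap k κ (c j)) * X ^ (j : ℕ)) := by
  rw [← aeval_map_algebraMap κ]
  simp [Polynomial.map_sum]

theorem polyEval_injective (hx : IsCyclicMatrix x) (hf : f.map (algebraMap k κ) = x.charpoly) :
    Function.Injective (polyEval x f hf) := by
  rw [injective_iff_map_eq_zero]
  intro z hz
  obtain ⟨c, rfl⟩ := exists_mk_sum hf z
  rw [polyEval_mk, aeval_sum_algebraMap] at hz
  have h1 := hx.coeff_injective (c := fun j => algebraMap k κ (c j)) (d := 0) (by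
    rw [hz]; simp)
  have h3 : c = 0 := funext fun j => (algebraMap k κ).injective
    ((congrFun h1 j).trans (map_zero _).symm)
  rw [h3]
  simp

theorem commute_polyEval (hf : f.map (algebraMap k κ) = x.charpoly) (z : AdjoinRoot f) :
    Commute (polyEval x f hf z) x := by
  obtain ⟨g, rfl⟩ := AdjoinRoot.mk_surjective z
  rw [polyEval_mk, ← aeval_map_algebraMap κ]
  exact aeval_commute x _

theorem polyEval_commute (hf : f.map (algebraMap k κ) = x.charpoly) (z w : AdjoinRoot f) :
    Commute (polyEval x f hf z) (polyEval x f hf w) := (Commute.all z w).map (polyEval x f hf)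

end PolyEval

section Linear

variable {k : Type*} [Field k] {n : ℕ} {x : Matrix (Fin n) (Fin n) k}

/-- The centralizer of a regular matrix `x` is the group of units of `k[x]`; a unit `u` is
determined by `a = (u + u⁻¹) / 2` and `b = (u - u⁻¹) / 2`, with `a ^ 2 - b ^ 2 = 1`. -/
theorem card_unitCommutant (h2 : (2 : k) ≠ 0) (hx : IsCyclicMatrix x) :
    Nat.card ((unitCommutant x).subgroupOf ⊤) =
      Nat.card (conic (AdjoinRoot x.charpoly) (algebraMap k _ 1)) := by
  have hf : x.charpoly.map (algebraMap k k) = x.charpoly := Polynomial.map_id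
  set E := polyEval x x.charpoly hf with hE
  have hEi : Function.Injective E := polyEval_injective hx hf
  have hsurj : ∀ a : Matrix (Fin n) (Fin n) k, Commute a x → ∃ z, E z = a := by
    intro a ha
    obtain ⟨c, rfl⟩ := hx.exists_aeval ha
    exact ⟨_, polyEval_mk hf _⟩
  have e2 : (2 : AdjoinRoot x.charpoly) * algebraMap k _ 2⁻¹ = 1 := by
    rw [← map_ofNat (algebraMap k (AdjoinRoot x.charpoly)) 2, ← map_mul, mul_inv_cancel₀ h2, map_one]
  have hu2 : IsUnit (2 : AdjoinRoot x.charpoly) := IsUnit.of_mul_eq_one _ e2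
  have key : ∀ p : conic (AdjoinRoot x.charpoly) (algebraMap k _ 1),
      (p.1.1 + p.1.2) * (p.1.1 - p.1.2) = 1 := by
    rintro ⟨⟨a, b⟩, hp⟩
    have hp' : a * a - algebraMap k _ 1 * (b * b) = 1 := hp
    rw [map_one] at hp'
    linear_combination hp'
  symm
  refine Nat.card_congr (Equiv.ofBijective (fun p => ⟨⟨⟨E (p.1.1 + p.1.2), E (p.1.1 - p.1.2),
    ?_, ?_⟩, trivial⟩, commute_polyEval hf _⟩) ⟨?_, ?_⟩)
  · rw [← map_mul, key, map_one]
  · rw [← map_mul, mul_comm, key, map_one]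
  · rintro ⟨⟨a, b⟩, hp⟩ ⟨⟨c, d⟩, hq⟩ h
    have h1 : (⟨E (a + b), E (a - b), _, _⟩ : GL (Fin n) k) = ⟨E (c + d), E (c - d), _, _⟩ :=
      congrArg (fun g => g.1.1) h
    have h3 : a + b = c + d := hEi (congrArg Units.val h1)
    have h4 : a - b = c - d := hEi (congrArg (fun g => Units.val g⁻¹) h1)
    have h5 : a = c := hu2.mul_left_cancel (by linear_combination h3 + h4)
    subst h5
    have h6 : b = d := add_left_cancel h3
    subst h6
    rfl
  · rintro ⟨⟨g, hg0⟩, hg⟩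
    have hg1 : Commute g.val x := hg
    obtain ⟨u, hu⟩ := hsurj _ hg1
    obtain ⟨v, hv⟩ := hsurj _ (hg1.units_inv_left (u := g))
    have huv : u * v = 1 := hEi (by rw [map_mul, hu, hv, map_one]; exact g.mul_inv)
    set t : AdjoinRoot x.charpoly := algebraMap k _ 2⁻¹
    refine ⟨⟨(t * (u + v), t * (u - v)), ?_⟩, ?_⟩
    · change t * (u + v) * (t * (u + v)) - algebraMap k _ 1 * (t * (u - v) * (t * (u - v))) = 1
      rw [map_one]
      linear_combination (2 * t * (2 * t)) * huv + (2 * t + 1) * e2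
    · refine Subtype.ext (Subtype.ext (Units.ext ?_))
      change E (t * (u + v) + t * (u - v)) = g.val
      rw [← hu]
      congr 1
      linear_combination u * e2

end Linear

section Unitary

variable {k κ : Type*} [Field k] [Field κ] [Algebra k κ] {n : ℕ} {σ : κ →+* κ} {δ : κ} {η : k}
  {h : Matrix (Fin n) (Fin n) κ} {f : k[X]}

/-- The characteristic polynomial of a hermitian matrix is defined over the fixed field. -/
theorem IsQuadratic.exists_map_eq_charpoly (Q : IsQuadratic σ δ η) (h2 : (2 : k) ≠ 0)
    (hh : conjTr σ h = h) : ∃ f : k[X], f.map (algebraMap k κ) = h.charpoly := by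
  have h1 : h.charpoly.map σ = h.charpoly := by
    conv_rhs => rw [← hh, conjTr, Matrix.charpoly_transpose, Matrix.charpoly_map]
  have h3 : h.charpoly ∈ lifts (algebraMap k κ) := by
    rw [lifts_iff_coeff_lifts]
    intro m
    obtain ⟨a, b, hab⟩ := Q.exists_eq (h.charpoly.coeff m)
    have h4 : σ (h.charpoly.coeff m) = h.charpoly.coeff m := by rw [← coeff_map, h1]
    rw [hab, Q.map_eq] at h4
    have h5 := (Q.ext_iff (a := a) (b := -b) (a' := a) (b' := b)).1 (by
      rw [map_neg, ← h4]; ring)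
    have h6 : b = 0 := by
      have : 2 * b = 0 := by linear_combination -h5.2
      exact (mul_eq_zero.1 this).resolve_left h2
    exact ⟨a, by rw [hab, h6]; simp⟩
  exact h3

theorem IsQuadratic.conjTr_polyEval (Q : IsQuadratic σ δ η) (hh : conjTr σ h = h)
    (hf : f.map (algebraMap k κ) = h.charpoly) (z : AdjoinRoot f) :
    conjTr σ (polyEval h f hf z) = polyEval h f hf z := by
  obtain ⟨g, rfl⟩ := AdjoinRoot.mk_surjective z
  rw [polyEval_mk]
  induction g using Polynomial.induction_on with
  | C a =>
    rw [aeval_C, Matrix.algebraMap_eq_diagonal, conjTr, Matrix.diagonal_map (map_zero _),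
      Matrix.diagonal_transpose]
    congr 1
    funext i
    exact Q.map_algebraMap a
  | add p q hp hq => rw [map_add, conjTr_add, hp, hq]
  | monomial m a hm =>
    have e : C a * X ^ (m + 1) = (C a * X ^ m) * X := by rw [pow_succ, mul_assoc]
    rw [e, map_mul, conjTr_mul, hm, aeval_X, hh, ← aeval_map_algebraMap κ, aeval_commute]

/-- The matrices commuting with a regular hermitian matrix `h` are the `a + δ b` with `a, b` in
`k[h]`, and such a matrix is unitary if and only if `a ^ 2 - η b ^ 2 = 1`. -/
theorem IsQuadratic.card_unitCommutant (Q : IsQuadratic σ δ η) (hh : conjTr σ h = h)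
    (hx : IsCyclicMatrix h) (hf : f.map (algebraMap k κ) = h.charpoly) :
    Nat.card ((unitCommutant (δ • h)).subgroupOf (unitary σ n)) =
      Nat.card (conic (AdjoinRoot f) (algebraMap k _ η)) := by
  set E := polyEval h f hf with hE
  have hδ : δ ≠ 0 := fun h0 => one_ne_zero (Q.eq_zero 0 1 (by rw [h0]; simp)).2
  have hEsum : ∀ u v : Fin n → k, aeval h (∑ j : Fin n,
      C (algebraMap k κ (u j) + algebraMap k κ (v j) * δ) * X ^ (j : ℕ)) =
      E (AdjoinRoot.mk f (∑ j, C (u j) * X ^ (j : ℕ))) +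
        δ • E (AdjoinRoot.mk f (∑ j, C (v j) * X ^ (j : ℕ))) := by
    intro u v
    rw [polyEval_mk, polyEval_mk, aeval_sum_algebraMap h u, aeval_sum_algebraMap h v,
      ← map_smul, ← map_add, Finset.smul_sum, ← Finset.sum_add_distrib]
    congr 1
    refine Finset.sum_congr rfl fun j _ => ?_
    rw [smul_eq_C_mul, C_add, C_mul]
    ring
  have hcomm : ∀ a : Matrix (Fin n) (Fin n) κ, Commute a (δ • h) ↔ Commute a h := by
    intro a
    constructor
    · intro h1
      have := h1.smul_right δ⁻¹
      rwa [smul_smul, inv_mul_cancel₀ hδ, one_smul] at this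
    · exact fun h1 => h1.smul_right δ
  -- `η = δ ^ 2` becomes a scalar
  have hEη : ∀ z, E (algebraMap k _ η * z) = δ • δ • E z := by
    intro z
    rw [map_mul, AlgHom.commutes, smul_smul, Q.sq, Algebra.algebraMap_eq_smul_one, smul_mul_assoc,
      one_mul, algebraMap_smul]
  -- matrices commuting with `h` are polynomials in `h` over `κ = k + δ k`
  have hinj : ∀ a b c d, E a + δ • E b = E c + δ • E d → a = c ∧ b = d := by
    intro a b c d h1
    have h3 : E (a - c) + δ • E (b - d) = 0 := by
      rw [map_sub, map_sub, smul_sub]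
      linear_combination (norm := abel) h1
    obtain ⟨u, hu⟩ := exists_mk_sum hf (a - c)
    obtain ⟨v, hv⟩ := exists_mk_sum hf (b - d)
    have h4 : aeval h (∑ j : Fin n, C (algebraMap k κ (u j) + algebraMap k κ (v j) * δ) *
        X ^ (j : ℕ)) = 0 := by
      rw [← h3, hu, hv, hEsum]
    have h5 := hx.coeff_injective (c := fun j => algebraMap k κ (u j) + algebraMap k κ (v j) * δ)
      (d := 0) (by rw [h4]; simp)
    have hu0 : u = 0 := funext fun j => (Q.eq_zero _ _ (congrFun h5 j)).1
    have hv0 : v = 0 := funext fun j => (Q.eq_zero _ _ (congrFun h5 j)).2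
    rw [hu0] at hu
    rw [hv0] at hv
    exact ⟨sub_eq_zero.1 (by rw [hu]; simp), sub_eq_zero.1 (by rw [hv]; simp)⟩
  have hsurj : ∀ a : Matrix (Fin n) (Fin n) κ, Commute a h → ∃ z w, a = E z + δ • E w := by
    intro a ha
    obtain ⟨c, rfl⟩ := hx.exists_aeval ha
    choose u v huv using fun j => Q.exists_eq (c j)
    refine ⟨AdjoinRoot.mk f (∑ j, C (u j) * X ^ (j : ℕ)),
      AdjoinRoot.mk f (∑ j, C (v j) * X ^ (j : ℕ)), ?_⟩
    simp only [huv]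
    exact hEsum u v
  have hconj : ∀ a b, conjTr σ (E a + δ • E b) = E a - δ • E b := by
    intro a b
    rw [conjTr_add, conjTr_smul, Q.conjTr_polyEval hh, Q.conjTr_polyEval hh, Q.map_delta, neg_smul,
      sub_eq_add_neg]
  have hnorm : ∀ a b, conjTr σ (E a + δ • E b) * (E a + δ • E b) =
      E (a * a - algebraMap k _ η * (b * b)) := by
    intro a b
    rw [hconj, map_sub, hEη, map_mul, map_mul, sub_mul, mul_add, mul_add, smul_mul_smul_comm,
      smul_mul_assoc, mul_smul_comm, (polyEval_commute hf b a).eq, smul_smul]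
    abel
  have hnorm1 : ∀ p : conic (AdjoinRoot f) (algebraMap k _ η),
      conjTr σ (E p.1.1 + δ • E p.1.2) * (E p.1.1 + δ • E p.1.2) = 1 := fun p => by
    rw [hnorm, show p.1.1 * p.1.1 - algebraMap k _ η * (p.1.2 * p.1.2) = 1 from p.2, map_one]
  symm
  refine Nat.card_congr (Equiv.ofBijective (fun p => ⟨⟨⟨E p.1.1 + δ • E p.1.2,
    conjTr σ (E p.1.1 + δ • E p.1.2), mul_eq_one_comm.1 (hnorm1 p), hnorm1 p⟩, hnorm1 p⟩,
    (hcomm _).2 ((commute_polyEval hf _).add_left ((commute_polyEval hf _).smul_left δ))⟩) ⟨?_, ?_⟩)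
  · intro p q hpq
    have h1 : E p.1.1 + δ • E p.1.2 = E q.1.1 + δ • E q.1.2 :=
      congrArg (fun g => g.1.1.val) hpq
    exact Subtype.ext (Prod.ext (hinj _ _ _ _ h1).1 (hinj _ _ _ _ h1).2)
  · rintro ⟨⟨g, hg0⟩, hg⟩
    have hg1 : Commute g.val h := (hcomm _).1 hg
    obtain ⟨z, w, hzw⟩ := hsurj _ hg1
    have hg2 : conjTr σ g.val * g.val = 1 := hg0
    refine ⟨⟨(z, w), ?_⟩, Subtype.ext (Subtype.ext (Units.ext hzw.symm))⟩
    rw [hzw, hnorm, ← map_one E] at hg2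
    exact (hinj _ 0 _ 0 (by rw [hg2])).1

end Unitary

/-! ### Orders of the finite groups -/

section Orders

theorem card_GL_eq_vEval {k : Type*} [Field k] [Finite k] (n : ℕ) :
    (Nat.card (⊤ : Subgroup (GL (Fin n) k)) : ℚ) = vEval n 1 (Nat.card k) := by
  have := Fintype.ofFinite k
  have hq : (Nat.card k : ℚ) ≠ 0 := Nat.cast_ne_zero.2 Nat.card_pos.ne'
  rw [Subgroup.card_top, Matrix.card_GL_field, Nat.cast_prod, vEval, pow_two, pow_mul,
    ← Equiv.prod_comp Fin.revPerm]
  conv_rhs => rw [← Fin.prod_const n, ← Finset.prod_mul_distrib]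
  refine Finset.prod_congr rfl fun d _ => ?_
  have hd : n = (d + 1) + (Fin.rev d : ℕ) := by rw [Fin.val_rev]; omega
  rw [Fin.revPerm_apply, Nat.cast_sub (Nat.pow_le_pow_right
    (by rw [← Nat.card_eq_fintype_card]; exact Nat.card_pos) (Fin.is_lt _).le), Nat.cast_pow,
    Nat.cast_pow,
    ← Nat.card_eq_fintype_card, Int.cast_one, one_pow, one_mul]
  generalize (Fin.rev d : ℕ) = r at *
  generalize (d : ℕ) = m at *
  subst hd
  rw [pow_add, mul_sub, mul_one, mul_right_comm, mul_inv_cancel₀ (pow_ne_zero _ hq), one_mul]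

theorem vEval_succ (n : ℕ) (ε : ℤ) {x : ℚ} (hx : x ≠ 0) :
    vEval (n + 1) ε x = x ^ n * (x ^ (n + 1) - (ε : ℚ) ^ (n + 1)) * vEval n ε x := by
  rw [vEval, vEval, Fin.prod_univ_castSucc]
  simp only [Fin.val_castSucc, Fin.val_last]
  have : (n + 1) ^ 2 = n + (n + 1) + n ^ 2 := by ring
  rw [this, pow_add, pow_add]
  field_simp

variable {k κ : Type*} [Field k] [Finite k] [Field κ] [Finite κ] [Algebra k κ] {σ : κ →+* κ} {δ : κ}
  {η : k}

theorem IsQuadratic.exists_norm (Q : IsQuadratic σ δ η) :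
    ∃ N : κ → k, ∀ z, algebraMap k κ (N z) = σ z * z := by
  choose a b h using Q.exists_eq
  refine ⟨fun z => a z * a z - η * (b z * b z), fun z => ?_⟩
  rw [← Q.mul_map, ← h]

/-- The norm of a quadratic extension of finite fields is surjective. -/
theorem IsQuadratic.exists_map_mul_eq (Q : IsQuadratic σ δ η) (h2 : ringChar k ≠ 2)
    (hη : ¬ IsSquare η) (s : k) : ∃ z, σ z * z = algebraMap k κ s := by
  have := Fintype.ofFinite k
  have hη0 : η ≠ 0 := fun h => hη (by rw [h]; exact IsSquare.zero)
  obtain ⟨a, b, hab⟩ := FiniteField.exists_root_sum_quadratic (R := k) (f := X ^ 2)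
    (g := C (-η) * X ^ 2 + C 0 * X + C (-s)) (degree_X_pow 2)
    (degree_quadratic (neg_ne_zero.2 hη0)) (FiniteField.odd_card_of_char_ne_two h2)
  refine ⟨algebraMap k κ a + algebraMap k κ b * δ, ?_⟩
  rw [Q.mul_map]
  congr 1
  simp at hab
  linear_combination hab

theorem IsQuadratic.isSign (hη : ¬ IsSquare η) : IsSign (-1) η :=
  ⟨fun h => hη (by rw [h]; exact IsSquare.zero), Or.inr ⟨rfl, hη⟩⟩

/-- There are `q + 1` elements of norm one in the quadratic extension. -/
theorem card_norm_one (Q : IsQuadratic σ δ η) (h2 : ringChar k ≠ 2) (hη : ¬ IsSquare η)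
    {N : κ → k} (hN : ∀ z, algebraMap k κ (N z) = σ z * z) :
    Nat.card {z : κ // N z = 1} = Nat.card k + 1 := by
  have h1 := (IsQuadratic.isSign hη).card_conic (AlgHom.id k k) Function.surjective_id h2
  have h3 : Nat.card {z : κ // N z = 1} = Nat.card (conic k η) := by
    symm
    refine Nat.card_congr (Equiv.ofBijective
      (fun p => ⟨algebraMap k κ p.1.1 + algebraMap k κ p.1.2 * δ, ?_⟩) ⟨?_, ?_⟩)
    · apply Q.injective
      rw [hN, Q.mul_map]
      exact congrArg _ p.2
    · intro p q h
      have := Q.ext_iff.1 (congrArg Subtype.val h)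
      exact Subtype.ext (Prod.ext this.1 this.2)
    · rintro ⟨z, hz⟩
      obtain ⟨a, b, rfl⟩ := Q.exists_eq z
      refine ⟨⟨(a, b), ?_⟩, rfl⟩
      apply Q.injective
      change algebraMap k κ (a * a - η * (b * b)) = _
      rw [← Q.mul_map, ← hN, hz]
  have h4 : Nat.card (RingHom.ker ((AlgHom.id k k : k →ₐ[k] k) : k →+* k)) = 1 := by
    have : RingHom.ker ((AlgHom.id k k : k →ₐ[k] k) : k →+* k) = ⊥ := by
      ext; simp [RingHom.mem_ker]
    rw [this]
    simp
  rw [h4, Module.finrank_self] at h1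
  rw [h3]
  have h5 : algebraMap k k η = η := rfl
  rw [h5] at h1
  push_cast at h1
  zify
  linear_combination h1

/-- The number of vectors of norm `1` for the standard hermitian form. -/
theorem card_unit_vectors (Q : IsQuadratic σ δ η) (h2 : ringChar k ≠ 2) (hη : ¬ IsSquare η)
    {N : κ → k} (hN : ∀ z, algebraMap k κ (N z) = σ z * z) (n : ℕ) :
    (Nat.card k : ℤ) * Nat.card {v : Fin n → κ // ∑ i, N (v i) = 1} =
      (Nat.card k : ℤ) ^ n * ((Nat.card k : ℤ) ^ n - (-1) ^ n) := by
  classical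
  have := Fintype.ofFinite k
  have := Fintype.ofFinite κ
  have hmul : ∀ z w, N (z * w) = N z * N w := fun z w => Q.injective (by
    rw [hN, map_mul, map_mul, hN, hN]; ring)
  induction n with
  | zero => simp
  | succ n ih =>
    -- `c s` counts the vectors of norm `s`; it depends only on whether `s = 0`, and the two values
    -- for `n` determine those for `n + 1`
    set c : k → ℕ := fun s => Nat.card {v : Fin n → κ // ∑ i, N (v i) = s} with hc
    have hscale : ∀ s, s ≠ 0 → c s = c 1 := by
      intro s hs
      obtain ⟨z, hz⟩ := Q.exists_map_mul_eq h2 hη s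
      have hz' : N z = s := Q.injective ((hN z).trans hz)
      have hz0 : z ≠ 0 := by
        rintro rfl
        rw [mul_zero] at hz
        exact hs (Q.injective (hz.symm.trans (map_zero _).symm))
      symm
      refine Nat.card_congr (Equiv.subtypeEquiv
        (Equiv.piCongrRight fun _ : Fin n => Equiv.mulLeft₀ z hz0) fun v => ?_)
      have : ∀ i, N (z * v i) = s * N (v i) := fun i => by rw [hmul, hz']
      change _ ↔ ∑ i, N (z * v i) = s
      simp only [this]
      rw [← Finset.mul_sum]
      constructor
      · intro h; rw [h, mul_one]
      · intro h; exact mul_left_cancel₀ hs (h.trans (mul_one s).symm)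
    have htot : (c 0 : ℤ) + ((Nat.card k : ℤ) - 1) * c 1 = (Nat.card k : ℤ) ^ (2 * n) := by
      have h1 : Nat.card (Fin n → κ) = ∑ s, c s := by
        rw [← Nat.card_sigma]
        exact Nat.card_congr (Equiv.sigmaFiberEquiv fun v : Fin n → κ => ∑ i, N (v i)).symm
      rw [Nat.card_fun, Nat.card_fin, Q.card_eq, ← pow_mul] at h1
      rw [← Nat.cast_pow, h1, ← Finset.add_sum_erase _ _ (Finset.mem_univ 0),
        Finset.sum_congr rfl fun s hs => hscale s (Finset.ne_of_mem_erase hs), Finset.sum_const,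
        Finset.card_erase_of_mem (Finset.mem_univ _), Finset.card_univ, ← Nat.card_eq_fintype_card,
        smul_eq_mul]
      push_cast [Nat.cast_sub (Nat.card_pos (α := k))]
      ring
    have hrec : Nat.card {v : Fin (n + 1) → κ // ∑ i, N (v i) = 1} = ∑ z, c (1 - N z) := by
      rw [← Nat.card_sigma]
      refine Nat.card_congr
        { toFun := fun v => ⟨v.1 0, ⟨fun i => v.1 i.succ, ?_⟩⟩
          invFun := fun p => ⟨Fin.cons p.1 p.2.1, ?_⟩
          left_inv := fun v => Subtype.ext (Fin.cons_self_tail v.1)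
          right_inv := fun p => rfl }
      · rw [eq_sub_iff_add_eq']
        exact (Fin.sum_univ_succ _).symm.trans v.2
      · rw [Fin.sum_univ_succ]
        have := p.2.2
        rw [eq_sub_iff_add_eq'] at this
        exact this
    have hsum : (∑ z, c (1 - N z) : ℤ) = ((Nat.card k : ℤ) + 1) * c 0 +
        ((Nat.card k : ℤ) ^ 2 - Nat.card k - 1) * c 1 := by
      have h1 : ∀ z, (c (1 - N z) : ℤ) = c 1 + if N z = 1 then (c 0 - c 1 : ℤ) else 0 := by
        intro z
        split_ifs with h
        · rw [h, sub_self]; ring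
        · rw [hscale _ (sub_ne_zero.2 (Ne.symm h)), add_zero]
      simp only [h1]
      rw [Finset.sum_add_distrib, ← Finset.sum_filter, Finset.sum_const, Finset.sum_const,
        Finset.card_univ, ← Nat.card_eq_fintype_card, Q.card_eq, ← Fintype.card_subtype,
        ← Nat.card_eq_fintype_card, card_norm_one Q h2 hη hN]
      simp only [nsmul_eq_mul]
      push_cast
      ring
    rw [hrec]
    push_cast
    rw [hsum]
    linear_combination ((Nat.card k : ℤ) + 1) * Nat.card k * htot - Nat.card k * ih

/-- The unitary group acts transitively on the vectors of norm `1`: a quasi-reflection, possibly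
composed with `-1`, maps the first basis vector to a given one. -/
theorem exists_conjTr_mul_eq_one_col (hσ : ∀ z, σ (σ z) = z) (h2 : (2 : κ) ≠ 0) {n : ℕ}
    (v : Fin (n + 1) → κ) (hv : ∑ i, σ (v i) * v i = 1) :
    ∃ t : Matrix (Fin (n + 1)) (Fin (n + 1)) κ, conjTr σ t * t = 1 ∧ ∀ i, t i 0 = v i := by
  have key : ∀ v : Fin (n + 1) → κ, ∑ i, σ (v i) * v i = 1 → v 0 ≠ 1 →
      ∃ t : Matrix (Fin (n + 1)) (Fin (n + 1)) κ, conjTr σ t * t = 1 ∧ ∀ i, t i 0 = v i := by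
    intro v hv hv1
    -- the quasi-reflection in the direction of `w = v - e₀`, which maps `e₀` to `v`
    set w : Fin (n + 1) → κ := fun i => v i - (1 : Matrix (Fin (n + 1)) (Fin (n + 1)) κ) i 0 with hw
    have hw0 : w 0 ≠ 0 := by
      rw [hw]
      simpa [sub_eq_zero] using hv1
    have hσw0 : σ (w 0) ≠ 0 := (_root_.map_ne_zero σ).2 hw0
    set P : Matrix (Fin (n + 1)) (Fin (n + 1)) κ := Matrix.vecMulVec w (σ ∘ w) with hP
    have hPt : conjTr σ P = P := by
      ext i j
      simp [hP, conjTr, Matrix.vecMulVec_apply, hσ, mul_comm]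
    have hwN : ∑ i, σ (w i) * w i = -(w 0 + σ (w 0)) := by
      have e : ∀ i, σ (w i) * w i = σ (v i) * v i -
          (1 : Matrix (Fin (n + 1)) (Fin (n + 1)) κ) i 0 * (v i + σ (v i)) +
          (1 : Matrix (Fin (n + 1)) (Fin (n + 1)) κ) i 0 := by
        intro i
        by_cases hi : i = 0
        · subst hi; simp [hw]; ring
        · simp [hw, Matrix.one_apply_ne hi]
      simp only [e]
      rw [Finset.sum_add_distrib, Finset.sum_sub_distrib, hv]
      simp [Matrix.one_apply, hw]
      ring
    have hPP : P * P = -(w 0 + σ (w 0)) • P := by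
      rw [hP, Matrix.vecMulVec_mul_vecMulVec, ← hwN]
      ext i j
      simp [Matrix.vecMulVec_apply, dotProduct, Finset.mul_sum, Finset.sum_mul]
      exact Finset.sum_congr rfl fun l _ => by ring
    refine ⟨1 + (σ (w 0))⁻¹ • P, ?_, fun i => ?_⟩
    · rw [conjTr_add, conjTr_one, conjTr_smul, hPt, map_inv₀, hσ]
      rw [add_mul, one_mul, mul_add, mul_one, smul_mul_smul_comm, hPP, smul_smul]
      have e : (w 0)⁻¹ * (σ (w 0))⁻¹ * -(w 0 + σ (w 0)) = -(w 0)⁻¹ - (σ (w 0))⁻¹ := by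
        field_simp
        ring
      rw [e, sub_smul, neg_smul]
      abel
    · rw [Matrix.add_apply, Matrix.smul_apply, hP, Matrix.vecMulVec_apply, smul_eq_mul,
        Function.comp_apply, mul_comm (w i), inv_mul_cancel_left₀ hσw0, hw]
      ring
  -- if `v 0 = 1`, the quasi-reflection is undefined; then `-v` has another first coordinate
  by_cases h1 : v 0 = 1
  · obtain ⟨t, ht, htv⟩ := key (fun i => -v i) (by simpa using hv) (by
      rw [h1]
      intro h
      exact h2 (by linear_combination -h))
    exact ⟨-t, by rw [conjTr_neg, neg_mul_neg, ht], fun i => by rw [Matrix.neg_apply, htv, neg_neg]⟩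
  · exact key v hv h1

/-- The block matrix with diagonal blocks `1` and `u`. -/
def oneBlock {n : ℕ} (u : Matrix (Fin n) (Fin n) κ) : Matrix (Fin (n + 1)) (Fin (n + 1)) κ :=
  Matrix.of (Fin.cons (Fin.cons 1 0) fun i => Fin.cons 0 (u i))

theorem conjTr_oneBlock_mul {n : ℕ} (σ : κ →+* κ) (u : Matrix (Fin n) (Fin n) κ) :
    conjTr σ (oneBlock u) * oneBlock u = oneBlock (conjTr σ u * u) := by
  ext i j
  rw [Matrix.mul_apply, Fin.sum_univ_succ]
  refine Fin.cases ?_ (fun i => ?_) i <;> refine Fin.cases ?_ (fun j => ?_) j <;>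
    simp [oneBlock, conjTr, Matrix.mul_apply]

theorem oneBlock_one {n : ℕ} : oneBlock (1 : Matrix (Fin n) (Fin n) κ) = 1 := by
  ext i j
  refine Fin.cases ?_ (fun i => ?_) i <;> refine Fin.cases ?_ (fun j => ?_) j <;>
    simp [oneBlock, Matrix.one_apply, Fin.ext_iff]

theorem oneBlock_submatrix {n : ℕ} (σ : κ →+* κ) (g : Matrix (Fin (n + 1)) (Fin (n + 1)) κ)
    (hg : conjTr σ g * g = 1) (h0 : ∀ i, g i 0 = (1 : Matrix (Fin (n + 1)) (Fin (n + 1)) κ) i 0) :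
    oneBlock (g.submatrix Fin.succ Fin.succ) = g := by
  have h1 : ∀ j, g 0 j = (1 : Matrix (Fin (n + 1)) (Fin (n + 1)) κ) 0 j := by
    intro j
    have := congrFun (congrFun hg 0) j
    rw [Matrix.mul_apply] at this
    rw [← this]
    simp [conjTr, h0, Matrix.one_apply]
  ext i j
  refine Fin.cases ?_ (fun i => ?_) i <;> refine Fin.cases ?_ (fun j => ?_) j
  · simp [oneBlock, h0]
  · rw [h1, Matrix.one_apply_ne (Fin.succ_ne_zero j).symm]; rfl
  · simp [oneBlock, h0]
  · rfl

/-- Orbit counting: the stabiliser of the first basis vector is the unitary group of its orthogonal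
complement. -/
theorem card_unitary_succ (hσ : ∀ z, σ (σ z) = z) (h2 : (2 : κ) ≠ 0) (n : ℕ) :
    Nat.card {g : Matrix (Fin (n + 1)) (Fin (n + 1)) κ // conjTr σ g * g = 1} =
      Nat.card {v : Fin (n + 1) → κ // ∑ i, σ (v i) * v i = 1} *
        Nat.card {g : Matrix (Fin n) (Fin n) κ // conjTr σ g * g = 1} := by
  choose t ht htv using fun v : {v : Fin (n + 1) → κ // ∑ i, σ (v i) * v i = 1} =>
    exists_conjTr_mul_eq_one_col hσ h2 v.1 v.2
  have ht' : ∀ v, t v * conjTr σ (t v) = 1 := fun v => mul_eq_one_comm.1 (ht v)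
  have hmul : ∀ a b : Matrix (Fin (n + 1)) (Fin (n + 1)) κ, conjTr σ a * a = 1 →
      conjTr σ b * b = 1 → conjTr σ (a * b) * (a * b) = 1 := by
    intro a b ha hb
    rw [conjTr_mul, mul_assoc, ← mul_assoc _ a, ha, one_mul, hb]
  have hblock : ∀ u : Matrix (Fin n) (Fin n) κ, conjTr σ u * u = 1 →
      conjTr σ (oneBlock u) * oneBlock u = 1 := fun u hu => by
    rw [conjTr_oneBlock_mul, hu, oneBlock_one]
  have hcol : ∀ (a : Matrix (Fin (n + 1)) (Fin (n + 1)) κ) (u : Matrix (Fin n) (Fin n) κ) i,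
      (a * oneBlock u) i 0 = a i 0 := by
    intro a u i
    rw [Matrix.mul_apply, Fin.sum_univ_succ]
    simp [oneBlock]
  rw [← Nat.card_prod]
  symm
  refine Nat.card_congr (Equiv.ofBijective
    (fun p => ⟨t p.1 * oneBlock p.2.1, hmul _ _ (ht _) (hblock _ p.2.2)⟩) ⟨?_, ?_⟩)
  · rintro ⟨v, u⟩ ⟨v', u'⟩ h
    have h1 : t v * oneBlock u.1 = t v' * oneBlock u'.1 := congrArg Subtype.val h
    have hvv : v = v' := by
      apply Subtype.ext
      funext i
      calc v.1 i = t v i 0 := (htv v i).symm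
        _ = (t v * oneBlock u.1) i 0 := (hcol _ _ _).symm
        _ = (t v' * oneBlock u'.1) i 0 := by rw [h1]
        _ = t v' i 0 := hcol _ _ _
        _ = v'.1 i := htv v' i
    subst hvv
    have h3 := congrArg (fun z => conjTr σ (t v) * z) h1
    simp only [← mul_assoc, ht, one_mul] at h3
    have h4 : u = u' := by
      apply Subtype.ext
      ext i j
      exact congrFun (congrFun h3 i.succ) j.succ
    rw [h4]
  · rintro ⟨g, hg⟩
    let v : {v : Fin (n + 1) → κ // ∑ i, σ (v i) * v i = 1} := ⟨fun i => g i 0, by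
      have := congrFun (congrFun hg 0) 0
      rw [Matrix.mul_apply, Matrix.one_apply_eq] at this
      exact this⟩
    set s := conjTr σ (t v) * g with hs
    have hs1 : conjTr σ s * s = 1 :=
      hmul _ _ (by rw [conjTr_conjTr hσ, ht']) hg
    have hs0 : ∀ i, s i 0 = (1 : Matrix (Fin (n + 1)) (Fin (n + 1)) κ) i 0 := by
      intro i
      rw [← ht v, hs, Matrix.mul_apply, Matrix.mul_apply]
      refine Finset.sum_congr rfl fun j _ => ?_
      rw [htv]
    have hsb := oneBlock_submatrix σ s hs1 hs0
    refine ⟨(v, ⟨s.submatrix Fin.succ Fin.succ, ?_⟩), ?_⟩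
    · rw [← hsb, conjTr_oneBlock_mul] at hs1
      ext i j
      have := congrFun (congrFun hs1 i.succ) j.succ
      rw [← oneBlock_one] at this
      exact this
    · apply Subtype.ext
      change t v * oneBlock (s.submatrix Fin.succ Fin.succ) = g
      rw [hsb, hs, ← mul_assoc, ht', one_mul]

theorem card_unitary_eq_vEval (Q : IsQuadratic σ δ η) (h2 : ringChar k ≠ 2) (hη : ¬ IsSquare η)
    (n : ℕ) : (Nat.card (unitary σ n) : ℚ) = vEval n (-1) (Nat.card k) := by
  have hq : (Nat.card k : ℚ) ≠ 0 := Nat.cast_ne_zero.2 Nat.card_pos.ne'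
  have h2κ : (2 : κ) ≠ 0 := two_ne_zero_of_ringChar (k := k) h2
  have h1 : ∀ n, Nat.card (unitary σ n) =
      Nat.card {g : Matrix (Fin n) (Fin n) κ // conjTr σ g * g = 1} := by
    intro n
    refine Nat.card_congr
      { toFun := fun g => ⟨g.1.val, g.2⟩
        invFun := fun g => ⟨⟨g.1, conjTr σ g.1, mul_eq_one_comm.1 g.2, g.2⟩, g.2⟩
        left_inv := fun g => Subtype.ext (Units.ext rfl)
        right_inv := fun g => rfl }
  rw [h1]
  obtain ⟨N, hN⟩ := Q.exists_norm
  induction n with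
  | zero =>
    have : Subsingleton (Matrix (Fin 0) (Fin 0) κ) := inferInstance
    rw [Nat.card_eq_one_iff_unique.2 ⟨inferInstance, ⟨⟨1, Subsingleton.elim _ _⟩⟩⟩]
    simp [vEval]
  | succ n ih =>
    have h3 : Nat.card {v : Fin (n + 1) → κ // ∑ i, σ (v i) * v i = 1} =
        Nat.card {v : Fin (n + 1) → κ // ∑ i, N (v i) = 1} := by
      refine Nat.card_congr (Equiv.subtypeEquivRight fun v => ?_)
      rw [← Q.injective.eq_iff, map_sum, map_one]
      simp only [hN]
    have h4 := congrArg (Int.cast : ℤ → ℚ) (card_unit_vectors Q h2 hη hN (n + 1))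
    rw [card_unitary_succ Q.involutive h2κ, h3, Nat.cast_mul, ih, vEval_succ _ _ hq]
    congr 1
    apply mul_left_cancel₀ hq
    push_cast at h4 ⊢
    rw [h4]
    ring

end Orders

/-! ### Symmetric and hermitian matrices with given characteristic polynomial -/

section Existence

variable {k : Type*} [Field k] {f : k[X]}

/-- The coefficient of the highest possible power on `k[X] / (f)`. -/
noncomputable def topCoeff (hf : f.Monic) : AdjoinRoot f →ₗ[k] k :=
  (lcoeff k (f.natDegree - 1)).comp (AdjoinRoot.modByMonicHom hf)

theorem topCoeff_mk (hf : f.Monic) (g : k[X]) :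
    topCoeff hf (AdjoinRoot.mk f g) = (g %ₘ f).coeff (f.natDegree - 1) := rfl

/-- The form `topCoeff (z * w)` is nondegenerate. -/
theorem exists_topCoeff_mul_ne_zero (hf : f.Monic) {z : AdjoinRoot f} (hz : z ≠ 0) :
    ∃ w, topCoeff hf (z * w) ≠ 0 := by
  obtain ⟨g, rfl⟩ := AdjoinRoot.mk_surjective z
  have hf1 : f ≠ 1 := by
    rintro rfl
    exact hz (AdjoinRoot.mk_eq_zero.2 (one_dvd _))
  have h1 : AdjoinRoot.mk f g = AdjoinRoot.mk f (g %ₘ f) :=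
    (AdjoinRoot.mk_leftInverse hf (AdjoinRoot.mk f g)).symm
  set r := g %ₘ f with hr
  have hr0 : r ≠ 0 := by
    intro h
    rw [h1, h, map_zero] at hz
    exact hz rfl
  have hlt : r.natDegree < f.natDegree := natDegree_modByMonic_lt g hf hf1
  refine ⟨AdjoinRoot.mk f (X ^ (f.natDegree - 1 - r.natDegree)), ?_⟩
  have hd : (r * X ^ (f.natDegree - 1 - r.natDegree)).natDegree = f.natDegree - 1 := by
    rw [natDegree_mul_X_pow _ hr0]; omega
  rw [h1, ← map_mul, topCoeff_mk, (modByMonic_eq_self_iff hf).2]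
  · have h3 := coeff_natDegree (p := r * X ^ (f.natDegree - 1 - r.natDegree))
    rw [hd] at h3
    rw [h3, leadingCoeff_mul_X_pow]
    exact leadingCoeff_ne_zero.2 hr0
  · rw [← natDegree_lt_natDegree_iff (mul_ne_zero hr0 (pow_ne_zero _ X_ne_zero)), hd]
    omega

/-- Every monic polynomial is the characteristic polynomial of a cyclic matrix that is
self-adjoint for a non-degenerate diagonal form: multiplication by `X` on `k[X] / (f)`, in an
orthogonal basis for the form given by the highest coefficient of the product. -/
theorem exists_selfAdjoint_charpoly_eq (h2 : (2 : k) ≠ 0) (hf : f.Monic) {n : ℕ}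
    (hn : f.natDegree = n) : ∃ (x : Matrix (Fin n) (Fin n) k) (d : Fin n → k), x.charpoly = f ∧
      IsRegularMatrix x ∧ (∀ i, d i ≠ 0) ∧ ∀ i j, d i * x i j = d j * x j i := by
  have := (AdjoinRoot.powerBasis' hf).finite
  let B : LinearMap.BilinForm k (AdjoinRoot f) := (LinearMap.mul k (AdjoinRoot f)).compr₂ (topCoeff hf)
  have hB : ∀ a b, B a b = topCoeff hf (a * b) := fun _ _ => rfl
  have hsymm : LinearMap.IsSymm B := ⟨fun a b => by simp only [hB, mul_comm]; rfl⟩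
  have hsep : B.SeparatingLeft := by
    intro z hz
    by_contra h0
    obtain ⟨w, hw⟩ := exists_topCoeff_mul_ne_zero hf h0
    exact hw (hz w)
  have : Invertible (2 : k) := invertibleOfNonzero h2
  obtain ⟨v', hv'⟩ := LinearMap.BilinForm.exists_orthogonal_basis hsymm
  have hfr : Module.finrank k (AdjoinRoot f) = n := by
    rw [(AdjoinRoot.powerBasis' hf).finrank, AdjoinRoot.powerBasis'_dim, hn]
  let v := v'.reindex (finCongr hfr)
  have hv : B.IsOrthoᵢ v := by
    intro i j hij
    change B (v i) (v j) = 0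
    rw [Module.Basis.reindex_apply, Module.Basis.reindex_apply]
    exact hv' (fun h => hij ((finCongr hfr).symm.injective h))
  have hd := hv.not_isOrtho_basis_self_of_separatingLeft hsep
  have hrepr : ∀ i y, B (v i) y = B (v i) (v i) * v.repr y i := by
    intro i y
    conv_lhs => rw [← v.sum_repr y]
    rw [map_sum, Finset.sum_eq_single i]
    · rw [map_smul, smul_eq_mul, mul_comm]
    · intro j _ hj
      rw [map_smul, show B (v i) (v j) = 0 from hv hj.symm, smul_zero]
    · simp
  set x := Algebra.leftMulMatrix v (AdjoinRoot.root f) with hx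
  have hmin : minpoly k x = f := by
    rw [hx, minpoly.algHom_eq _ (Algebra.leftMulMatrix_injective v), AdjoinRoot.minpoly_root hf.ne_zero,
      hf.leadingCoeff, inv_one, C_1, mul_one]
  have hchar : x.charpoly = f := by
    refine eq_of_monic_of_dvd_of_natDegree_le hf (Matrix.charpoly_monic x) ?_ ?_
    · conv_lhs => rw [← hmin]
      exact Matrix.minpoly_dvd_charpoly x
    · rw [Matrix.charpoly_natDegree_eq_dim, Fintype.card_fin, hn]
  refine ⟨x, fun i => B (v i) (v i), hchar, hchar.trans hmin.symm, hd, fun i j => ?_⟩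
  have hxe : ∀ i j, x i j = v.repr (AdjoinRoot.root f * v j) i := fun i j =>
    Algebra.leftMulMatrix_eq_repr_mul v _ i j
  rw [hxe, hxe, ← hrepr, ← hrepr, hB, hB]
  congr 1
  ring

/-- Centralizers do not change when a multiple of the identity matrix is added. -/
theorem unitCommutant_add_algebraMap {n : ℕ} (x : Matrix (Fin n) (Fin n) k) (b : k) :
    unitCommutant (x + algebraMap k _ b) = unitCommutant x := by
  ext g
  have h : Commute g.val (algebraMap k (Matrix (Fin n) (Fin n) k) b) :=
    (Algebra.commutes b g.val).symm
  constructor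
  · intro hg
    have : Commute g.val (x + algebraMap k _ b - algebraMap k _ b) := Commute.sub_right hg h
    rwa [add_sub_cancel_right] at this
  · intro hg
    exact Commute.add_right hg h

/-- Every type is the type of a non-zero regular matrix; the zero matrix, regular if `n = 1`, is
replaced by the identity. -/
theorem exists_isCyclicMatrix_GL [Finite k] (h2 : ringChar k ≠ 2) {n : ℕ} (hn : 1 ≤ n)
    (hq : n < Nat.card k) {τ : Matrix (Fin n) (Fin n) ℕ} (hτ : IsType τ) :
    ∃ x : Matrix (Fin n) (Fin n) k, x ≠ 0 ∧ IsCyclicMatrix x ∧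
      (Nat.card ((unitCommutant x).subgroupOf ⊤) : ℚ) = uEval 1 τ (Nat.card k) := by
  have h2' : (2 : k) ≠ 0 := Ring.two_ne_zero h2
  have : Nonempty (Fin n) := ⟨⟨0, hn⟩⟩
  obtain ⟨f, hf, hfn, hcard⟩ := exists_monic_of_isType h2 hq hτ
  obtain ⟨x, d, hxf, hx, -⟩ := exists_selfAdjoint_charpoly_eq h2' hf hfn
  subst hxf
  have h3 : (Nat.card ((unitCommutant x).subgroupOf ⊤) : ℚ) = uEval 1 τ (Nat.card k) := by
    rw [card_unitCommutant h2' (isCyclicMatrix_iff_isRegularMatrix.2 hx),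
      hcard 1 1 ⟨one_ne_zero, Or.inl ⟨rfl, IsSquare.one⟩⟩]
  by_cases h0 : x = 0
  · refine ⟨x + algebraMap k _ 1, ?_, ?_, ?_⟩
    · rw [h0, zero_add, map_one]
      exact one_ne_zero
    · have := hx.affine one_ne_zero 1
      rw [one_smul] at this
      exact isCyclicMatrix_iff_isRegularMatrix.2 this
    · rw [unitCommutant_add_algebraMap, h3]
  · exact ⟨x, h0, isCyclicMatrix_iff_isRegularMatrix.2 hx, h3⟩

/-- Every type is the type of a non-zero regular anti-hermitian matrix: norms being surjective, the
diagonal form of `exists_selfAdjoint_charpoly_eq` is equivalent to the standard hermitian form over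
the quadratic extension. -/
theorem IsQuadratic.exists_isCyclicMatrix {κ : Type*} [Finite k] [Field κ] [Finite κ] [Algebra k κ]
    {σ : κ →+* κ} {δ : κ} {η : k} (Q : IsQuadratic σ δ η) (hη : ¬ IsSquare η) (h2 : ringChar k ≠ 2)
    {n : ℕ} (hn : 1 ≤ n) (hq : n < Nat.card k) {τ : Matrix (Fin n) (Fin n) ℕ} (hτ : IsType τ) :
    ∃ x ∈ antiHermitian σ n, x ≠ 0 ∧ IsCyclicMatrix x ∧
      (Nat.card ((unitCommutant x).subgroupOf (unitary σ n)) : ℚ) = uEval (-1) τ (Nat.card k) := by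
  have h2' : (2 : k) ≠ 0 := Ring.two_ne_zero h2
  have : Nonempty (Fin n) := ⟨⟨0, hn⟩⟩
  have hδ := Q.delta_ne_zero
  obtain ⟨f, hf, hfn, hcard⟩ := exists_monic_of_isType h2 hq hτ
  obtain ⟨x, d, hxf, hx, hd0, hd⟩ := exists_selfAdjoint_charpoly_eq h2' hf hfn
  choose c hc using fun i => Q.exists_map_mul_eq h2 hη (d i)
  have hc0 : ∀ i, c i ≠ 0 := by
    intro i h
    have := hc i
    rw [h, mul_zero] at this
    exact hd0 i (Q.injective (this.symm.trans (map_zero _).symm))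
  -- `d i = σ (c i) * c i`, so that conjugation by the diagonal matrix of the `c i` makes `x` hermitian
  set y := x.map (algebraMap k κ) with hy
  have hinv : Matrix.diagonal (fun i => (c i)⁻¹) * Matrix.diagonal c = 1 := by
    rw [Matrix.diagonal_mul_diagonal, ← Matrix.diagonal_one]
    congr 1
    funext i
    exact inv_mul_cancel₀ (hc0 i)
  set h := Matrix.diagonal c * y * Matrix.diagonal (fun i => (c i)⁻¹) with hh
  have hherm : conjTr σ h = h := by
    ext i j
    have e : ∀ i j, h i j = c i * algebraMap k κ (x i j) * (c j)⁻¹ := by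
      intro i j
      rw [hh, Matrix.mul_diagonal, Matrix.diagonal_mul, hy, Matrix.map_apply]
    have hs : ∀ i, σ (c i) ≠ 0 := fun i => (_root_.map_ne_zero σ).2 (hc0 i)
    have h4 := congrArg (algebraMap k κ) (hd i j)
    rw [map_mul, map_mul, ← hc, ← hc] at h4
    change σ (h j i) = _
    rw [e, e, map_mul, map_mul, map_inv₀, Q.map_algebraMap]
    have h5 := hs i
    have h6 := hc0 j
    field_simp
    linear_combination -h4
  have hchar : f.map (algebraMap k κ) = h.charpoly := by
    rw [hh, Matrix.charpoly_mul_comm, ← Matrix.mul_assoc, hinv, Matrix.one_mul, hy,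
      Matrix.charpoly_map, hxf]
  have hcyc : IsCyclicMatrix h :=
    ((isCyclicMatrix_iff_isRegularMatrix.2 hx).map (algebraMap k κ)).conj hinv
  have hsign := IsQuadratic.isSign hη
  have h3 : (Nat.card ((unitCommutant (δ • h)).subgroupOf (unitary σ n)) : ℚ) =
      uEval (-1) τ (Nat.card k) := by
    rw [Q.card_unitCommutant hherm hcyc hchar, hcard (-1) η hsign]
  have hreg := (isCyclicMatrix_iff_isRegularMatrix.1 hcyc).affine hδ
  have hanti : δ • h ∈ antiHermitian σ n := by
    change δ • h + conjTr σ (δ • h) = 0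
    rw [conjTr_smul, hherm, Q.map_delta, neg_smul, add_neg_cancel]
  by_cases h0 : δ • h = 0
  · refine ⟨δ • h + algebraMap κ _ δ, ?_, ?_, isCyclicMatrix_iff_isRegularMatrix.2 (hreg δ), ?_⟩
    · rw [h0, zero_add, Algebra.algebraMap_eq_smul_one]
      change δ • (1 : Matrix (Fin n) (Fin n) κ) + conjTr σ (δ • 1) = 0
      rw [conjTr_smul, conjTr_one, Q.map_delta, neg_smul, add_neg_cancel]
    · rw [h0, zero_add]
      exact (_root_.map_ne_zero _).2 hδ
    · rw [unitCommutant_add_algebraMap, h3]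
  · refine ⟨δ • h, hanti, h0, ?_, h3⟩
    have := hreg 0
    rw [map_zero, add_zero] at this
    exact isCyclicMatrix_iff_isRegularMatrix.2 this

end Existence

/-! ### The set of degrees -/

section Formula

theorem one_sub_pow_ne_zero {ε : ℤ} (hε : ε = 1 ∨ ε = -1) {q : ℕ} (hq : 1 < q) (d : ℕ) :
    (1 - (ε : ℚ) ^ (d + 1) * ((q : ℚ) ^ (d + 1))⁻¹) ≠ 0 := by
  have h1 : (1 : ℚ) < (q : ℚ) ^ (d + 1) := one_lt_pow₀ (by exact_mod_cast hq) (Nat.succ_ne_zero d)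
  have h2 : (ε : ℚ) ^ (d + 1) = 1 ∨ (ε : ℚ) ^ (d + 1) = -1 := by
    rcases hε with rfl | rfl
    · left; simp
    · simpa using neg_one_pow_eq_or ℚ (d + 1)
  have h3 : ((q : ℚ) ^ (d + 1))⁻¹ < 1 := inv_lt_one_of_one_lt₀ h1
  have h4 : 0 < ((q : ℚ) ^ (d + 1))⁻¹ := by positivity
  rcases h2 with h | h <;> rw [h] <;> intro h5 <;> linarith

theorem uEval_ne_zero {ε : ℤ} (hε : ε = 1 ∨ ε = -1) {n q : ℕ} (hq : 1 < q)
    (τ : Matrix (Fin n) (Fin n) ℕ) : uEval ε τ q ≠ 0 := by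
  refine mul_ne_zero (pow_ne_zero _ (by positivity)) ?_
  exact Finset.prod_ne_zero_iff.2 fun d _ => Finset.prod_ne_zero_iff.2 fun e _ =>
    pow_ne_zero _ (one_sub_pow_ne_zero hε hq _)

variable {o R G : Type*} [CommRing o] [CommRing R] [IsDomain R] [IsDiscreteValuationRing R]
  [Algebra o R] [Group G] {n : ℕ} {ι : G →* GL (Fin n) R}
  {𝔤 : AddSubgroup (Matrix (Fin n) (Fin n) R)} {L : Set (Matrix (Fin n) (Fin n) (ResidueField R))}

/-- The degrees of regular characters, from the orders of the image `H` of `G` over the residue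
field and of the centralizers in `H`: the degree is the index of the centralizer of `x` in `H`, times
`q ^ (n.choose 2)` for each level above the first. -/
theorem IsRegularSetting.image_regularDegrees [Finite (ResidueField R)]
    (E : IsRegularSetting o ι 𝔤 L) {ℓ : ℕ} (hℓ : 1 ≤ ℓ) (hπ : ∃ π : o, Irreducible π)
    {H : Subgroup (GL (Fin n) (ResidueField R))}
    (hH : ∀ h, h ∈ H ↔ ∃ g, Matrix.GeneralLinearGroup.map (residue R) (ι g) = h)
    {q : ℕ} (hq : 1 < q) {ε : ℤ} (hε : ε = 1 ∨ ε = -1) (horder : (Nat.card H : ℚ) = vEval n ε q)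
    (hcent : ∀ x ∈ 𝔤, IsCyclicMatrix x →
      Nat.card (𝔤 ⧸ IsCayleyPair.centMod 𝔤 x) = (q ^ n.choose 2) ^ 2)
    (htype : ∀ x ∈ L, IsCyclicMatrix x → ∃ τ : Matrix (Fin n) (Fin n) ℕ, IsType τ ∧
      (Nat.card ((unitCommutant x).subgroupOf H) : ℚ) = uEval ε τ q)
    (hex : ∀ τ : Matrix (Fin n) (Fin n) ℕ, IsType τ → ∃ x ∈ L, x ≠ 0 ∧ IsCyclicMatrix x ∧
      (Nat.card ((unitCommutant x).subgroupOf H) : ℚ) = uEval ε τ q) :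
    (Nat.cast : ℕ → ℚ) '' regularDegrees o ι L ℓ = degreeFormula n ℓ ε q := by
  have key : ∀ (d : ℕ) (x : Matrix (Fin n) (Fin n) R) (τ : Matrix (Fin n) (Fin n) ℕ), x ∈ 𝔤 →
      IsCyclicMatrix x →
      (Nat.card ((unitCommutant (x.map (residue R))).subgroupOf H) : ℚ) = uEval ε τ q →
      d ^ 2 = (stabMod ι x 1).index ^ 2 * Nat.card (𝔤 ⧸ IsCayleyPair.centMod 𝔤 x) ^ (ℓ - 1) →
      (d : ℚ) = (q : ℚ) ^ (n.choose 2 * (ℓ - 1)) * vEval n ε q / uEval ε τ q := by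
    intro d x τ hx hcyc hτ hd
    rw [hcent x hx hcyc, ← pow_mul, mul_comm 2, pow_mul, ← mul_pow] at hd
    have hd' : d = (stabMod ι x 1).index * (q ^ n.choose 2) ^ (ℓ - 1) :=
      Nat.pow_left_injective two_ne_zero hd
    have h1 := congrArg (Nat.cast : ℕ → ℚ) (index_stabMod_one_mul_card ι H hH x)
    rw [Nat.cast_mul, hτ, horder] at h1
    rw [eq_div_iff (uEval_ne_zero hε hq τ), ← h1, hd', pow_mul]
    push_cast
    ring
  ext r
  constructor
  · rintro ⟨d, ⟨ρ, hρ⟩, rfl⟩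
    obtain ⟨x, hx, hcyc, hd⟩ := E.exists_finrank_sq hℓ hρ
    rw [Module.finrank_fin_fun] at hd
    obtain ⟨τ, hτ, hc⟩ := htype (x.map (residue R)) ((E.mem_iff _).2 ⟨x, hx, rfl⟩) (hcyc.map _)
    exact ⟨τ, hτ, key d x τ hx hcyc hc hd⟩
  · rintro ⟨τ, hτ, rfl⟩
    obtain ⟨y, hy, hy0, hyc, hc⟩ := hex τ hτ
    obtain ⟨x, hx, rfl⟩ := (E.mem_iff _).1 hy
    have hcyc : IsCyclicMatrix x := hyc.of_map (residue R) residue_surjective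
    obtain ⟨d, hd, hd2⟩ := E.exists_mem_regularDegrees hℓ hπ hx hcyc hy0
    exact ⟨d, hd, key d x τ hx hcyc hc hd2⟩

/-- The degrees for `GL_n`. -/
theorem image_degreesGL {n ℓ : ℕ} (hn : 1 ≤ n) (hℓ : 1 ≤ ℓ) (o : Type*) [CommRing o] [IsDomain o]
    [IsDiscreteValuationRing o] [Finite (ResidueField o)] (h2 : ringChar (ResidueField o) ≠ 2)
    (hq : n < Nat.card (ResidueField o)) :
    (Nat.cast : ℕ → ℚ) '' degreesGL o n ℓ = degreeFormula n ℓ 1 (Nat.card (ResidueField o)) := by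
  have E := isRegularSetting_GL (R := o) (n := n) h2
  have h2' : (2 : ResidueField o) ≠ 0 := Ring.two_ne_zero h2
  refine E.image_regularDegrees hℓ (IsDiscreteValuationRing.exists_irreducible o) (H := ⊤)
    (fun h => ⟨fun _ => ?_, fun _ => trivial⟩) (by omega) (Or.inl rfl) (card_GL_eq_vEval n)
    (fun x _ hx => ?_) (fun x _ hx => ?_) (fun τ hτ => ?_)
  · obtain ⟨y, -, hy⟩ := (E.mem_iff h.val).1 trivial
    obtain ⟨g, hg⟩ := isUnit_of_map_residue (hy ▸ h.isUnit)
    refine ⟨g, Units.ext ?_⟩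
    rw [← hy, ← hg]
    rfl
  · exact index_commutant (hx.map (residue o))
      (card_quot_centMod_mul_card ⊤ ⊤ (fun y => by simpa using E.mem_iff y) x)
  · obtain ⟨τ, hτ, hc⟩ := IsSign.exists_card_conic_eq_uEval h2 (ε := 1) (η := 1)
      ⟨one_ne_zero, Or.inl ⟨rfl, IsSquare.one⟩⟩ (Matrix.charpoly_monic x)
      (by rw [Matrix.charpoly_natDegree_eq_dim, Fintype.card_fin])
    exact ⟨τ, hτ, by rw [card_unitCommutant h2' hx, hc]⟩
  · obtain ⟨x, hx0, hx, hc⟩ := exists_isCyclicMatrix_GL h2 hn hq hτ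
    exact ⟨x, trivial, hx0, hx, hc⟩

/-- The degrees for `GU_n`. The anti-hermitian `x` is written as `δ y` with `y` hermitian, whose
characteristic polynomial is defined over the residue field of `o` and determines the type. -/
theorem image_degreesGU {n ℓ : ℕ} (hn : 1 ≤ n) (hℓ : 1 ≤ ℓ) {o O : Type*} [CommRing o] [IsDomain o]
    [IsDiscreteValuationRing o] [Finite (ResidueField o)]
    [CommRing O] [IsDomain O] [IsDiscreteValuationRing O] [Algebra o O] (ν : O ≃ₐ[o] O)
    (h2 : ringChar (ResidueField o) ≠ 2) (hq : n < Nat.card (ResidueField o))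
    (h : IsUnramifiedQuadratic o O) (hν : ν ≠ AlgEquiv.refl) :
    (Nat.cast : ℕ → ℚ) '' degreesGU ν n ℓ =
      degreeFormula n ℓ (-1) (Nat.card (ResidueField o)) := by
  obtain ⟨δ, η, Q⟩ := h.exists_isQuadratic h2 hν
  have := h.isLocalHom
  have Q' := Q.reduction h
  have hη := Q.not_isSquare h
  have h2' : (2 : ResidueField o) ≠ 0 := Ring.two_ne_zero h2
  have hδ : residue O δ ≠ 0 := fun h0 => one_ne_zero (Q'.eq_zero 0 1 (by rw [h0]; simp)).2
  have : Finite (ResidueField O) := Finite.of_surjective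
    (fun p : ResidueField o × ResidueField o => algebraMap (ResidueField o) (ResidueField O) p.1 +
      algebraMap (ResidueField o) (ResidueField O) p.2 * residue O δ) fun z => by
        obtain ⟨a, b, rfl⟩ := Q'.exists_eq z
        exact ⟨(a, b), rfl⟩
  have E := isRegularSetting_GU (n := n) h Q h2 hq
  refine E.image_regularDegrees hℓ (IsDiscreteValuationRing.exists_irreducible o)
    (H := unitary (residueAut ν) n) (fun g => ⟨fun hg => ?_, ?_⟩) (by omega) (Or.inr rfl)
    (card_unitary_eq_vEval Q' h2 hη n) (fun x hxg hx => ?_) (fun x hxL hx => ?_) (fun τ hτ => ?_)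
  · choose f hf using residue_surjective (R := O)
    set a : Matrix (Fin n) (Fin n) O := g.val.map f with ha
    have hag : a.map (residue O) = g.val := by ext i j; simp [ha, hf]
    obtain ⟨u, hu, hua, -⟩ := exists_unitary_lift h Q h2 hq le_rfl a (by
      rw [← map_one (redMat n O 1), redMat_one_eq_iff, Matrix.map_mul, ← conjTr_map_residue, hag]
      exact (mem_unitary.1 hg).trans ((residue O).mapMatrix.map_one).symm)
    refine ⟨⟨u, hu⟩, Units.ext ?_⟩
    exact (redMat_one_eq_iff.1 hua).trans hag
  · rintro ⟨u, rfl⟩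
    refine mem_unitary.2 ?_
    change conjTr (residueAut ν) (u.1.val.map (residue O)) * u.1.val.map (residue O) = 1
    rw [conjTr_map_residue, ← Matrix.map_mul, mem_unitary.1 u.2]
    exact (residue O).mapMatrix.map_one
  · refine Q'.index_commutant h2' (hx.map (residue O)) ?_
      (card_quot_centMod_mul_card _ (antiHermitianSubgroup (residueAut ν) n)
        (fun y => E.mem_iff y) x)
    exact mem_antiHermitian_residueAut.1 ((E.mem_iff _).2 ⟨x, hxg, rfl⟩)
  · have hxa := mem_antiHermitian_residueAut.1 hxL
    set y := (residue O δ)⁻¹ • x with hy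
    have hyx : residue O δ • y = x := by rw [hy, smul_smul, mul_inv_cancel₀ hδ, one_smul]
    have hyh : conjTr (residueAut ν) y = y := by
      rw [hy, conjTr_smul, hxa, map_inv₀, Q'.map_delta, inv_neg, neg_smul_neg]
    have hyc : IsCyclicMatrix y := by
      have := (isCyclicMatrix_iff_isRegularMatrix.1 hx).affine (inv_ne_zero hδ) 0
      rw [map_zero, add_zero] at this
      exact isCyclicMatrix_iff_isRegularMatrix.2 this
    obtain ⟨f, hf⟩ := Q'.exists_map_eq_charpoly h2' hyh
    obtain ⟨τ, hτ, hc⟩ := (IsQuadratic.isSign hη).exists_card_conic_eq_uEval h2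
      (monic_of_map_eq_charpoly hf) (natDegree_of_map_eq_charpoly hf)
    refine ⟨τ, hτ, ?_⟩
    rw [← hyx, Q'.card_unitCommutant hyh hyc hf, hc]
  · exact Q'.exists_isCyclicMatrix hη h2 hn hq hτ

end Formula

/-! ### The degrees as polynomials -/

section Polynomials

/-- `∏_{1 ≤ d ≤ a} (x ^ d - ε ^ d)`. -/
noncomputable def prodPoly (ε : ℤ) (a : ℕ) : ℤ[X] :=
  ∏ d ∈ Finset.range a, (X ^ (d + 1) - C (ε ^ (d + 1)))

theorem prodPoly_succ (ε : ℤ) (a : ℕ) :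
    prodPoly ε (a + 1) = prodPoly ε a * (X ^ (a + 1) - C (ε ^ (a + 1))) :=
  Finset.prod_range_succ _ _

/-- The integrality of the Gaussian binomial coefficients. -/
theorem prodPoly_mul_dvd (ε : ℤ) (a b : ℕ) : prodPoly ε a * prodPoly ε b ∣ prodPoly ε (a + b) := by
  induction h : a + b generalizing a b with
  | zero =>
    obtain ⟨rfl, rfl⟩ : a = 0 ∧ b = 0 := by omega
    simp [prodPoly]
  | succ m ih =>
    rcases a with _ | a
    · rw [show b = m + 1 by omega]
      simp [prodPoly]
    rcases b with _ | b
    · rw [show a + 1 = m + 1 by omega]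
      simp [prodPoly]
    have e : (X : ℤ[X]) ^ (m + 1) - C (ε ^ (m + 1)) = X ^ (b + 1) * (X ^ (a + 1) - C (ε ^ (a + 1))) +
        C (ε ^ (a + 1)) * (X ^ (b + 1) - C (ε ^ (b + 1))) := by
      have e1 : ε ^ (m + 1) = ε ^ (a + 1) * ε ^ (b + 1) := by rw [← pow_add, h]
      have e2 : (X : ℤ[X]) ^ (m + 1) = X ^ (a + 1) * X ^ (b + 1) := by rw [← pow_add, h]
      rw [e1, e2, C_mul]
      ring
    rw [prodPoly_succ ε m, e, mul_add]
    refine dvd_add ?_ ?_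
    · have := ih a (b + 1) (by omega)
      rw [prodPoly_succ ε a]
      calc _ = prodPoly ε a * prodPoly ε (b + 1) * (X ^ (a + 1) - C (ε ^ (a + 1))) := by ring
        _ ∣ prodPoly ε m * (X ^ (a + 1) - C (ε ^ (a + 1))) := mul_dvd_mul_right this _
        _ ∣ _ := ⟨X ^ (b + 1), by ring⟩
    · have := ih (a + 1) b (by omega)
      rw [prodPoly_succ ε b]
      calc _ = prodPoly ε (a + 1) * prodPoly ε b * (X ^ (b + 1) - C (ε ^ (b + 1))) := by ring
        _ ∣ prodPoly ε m * (X ^ (b + 1) - C (ε ^ (b + 1))) := mul_dvd_mul_right this _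
        _ ∣ _ := ⟨C (ε ^ (a + 1)), by ring⟩

theorem prodPoly_dvd_of_le (ε : ℤ) {a b : ℕ} (h : a ≤ b) : prodPoly ε a ∣ prodPoly ε b := by
  obtain ⟨c, rfl⟩ := Nat.exists_eq_add_of_le h
  exact (dvd_mul_right _ _).trans (prodPoly_mul_dvd ε a c)

/-- Multinomial analogue of `prodPoly_mul_dvd`. -/
theorem prod_pow_dvd_prodPoly (ε : ℤ) {I : Type*} (s : Finset I) (d m : I → ℕ) :
    ∏ i ∈ s, (X ^ (d i + 1) - C (ε ^ (d i + 1))) ^ m i ∣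
      prodPoly ε (∑ i ∈ s, (d i + 1) * m i) := by
  classical
  have h1 : ∀ d m : ℕ, ((X : ℤ[X]) ^ (d + 1) - C (ε ^ (d + 1))) ^ m ∣ prodPoly ε ((d + 1) * m) := by
    intro d m
    induction m with
    | zero => simp
    | succ m ih =>
      rw [pow_succ, mul_add, mul_one]
      refine dvd_trans (mul_dvd_mul ih ?_) (prodPoly_mul_dvd ε _ _)
      rw [prodPoly_succ]
      exact dvd_mul_left _ _
  induction s using Finset.induction_on with
  | empty => simp
  | insert i s hi ih =>
    rw [Finset.prod_insert hi, Finset.sum_insert hi]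
    exact (mul_dvd_mul (h1 _ _) ih).trans (prodPoly_mul_dvd ε _ _)

variable {n : ℕ}

/-- The polynomial `v_ε`. -/
noncomputable def vPoly (n : ℕ) (ε : ℤ) : ℤ[X] := X ^ n.choose 2 * prodPoly ε n

/-- The number `∑ d τ_{d,e}`, the degree of the separable part of a polynomial of type `τ`. -/
def sepDegree (τ : Matrix (Fin n) (Fin n) ℕ) : ℕ :=
  ∑ i : Fin n × Fin n, ((i.1 : ℕ) + 1) * τ i.1 i.2

/-- The polynomial `u_ε^τ`. -/
noncomputable def uPoly (ε : ℤ) (τ : Matrix (Fin n) (Fin n) ℕ) : ℤ[X] :=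
  X ^ (n - sepDegree τ) *
    ∏ i : Fin n × Fin n, (X ^ ((i.1 : ℕ) + 1) - C (ε ^ ((i.1 : ℕ) + 1))) ^ τ i.1 i.2

theorem sepDegree_le {τ : Matrix (Fin n) (Fin n) ℕ} (hτ : IsType τ) : sepDegree τ ≤ n := by
  refine le_trans ?_ hτ.le
  rw [sepDegree, Fintype.sum_prod_type]
  refine Finset.sum_le_sum fun d _ => Finset.sum_le_sum fun e _ => ?_
  exact Nat.mul_le_mul_right _ (Nat.le_mul_of_pos_right _ (Nat.succ_pos _))

/-- The power of `x` in `u_ε^τ` is at most that in `v_ε`. -/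
theorem sub_sepDegree_le {τ : Matrix (Fin n) (Fin n) ℕ} (hτ : IsType τ) :
    n - sepDegree τ ≤ n.choose 2 := by
  rcases Nat.eq_zero_or_pos n with h0 | hn
  · omega
  have h1 : 1 ≤ sepDegree τ := by
    by_contra h
    have h2 : sepDegree τ = 0 := by omega
    rw [sepDegree, Finset.sum_eq_zero_iff] at h2
    have h3 : ∀ d e, τ d e = 0 := fun d e => by
      have := h2 (d, e) (Finset.mem_univ _)
      simpa using this
    have h4 : ∑ d : Fin n, ∑ e : Fin n, ((d : ℕ) + 1) * ((e : ℕ) + 1) * τ d e = 0 :=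
      Finset.sum_eq_zero fun d _ => Finset.sum_eq_zero fun e _ => by rw [h3, mul_zero]
    have h5 := h4.symm.trans hτ
    omega
  have h2 : n - 1 ≤ n.choose 2 := by
    obtain ⟨m, rfl⟩ : ∃ m, n = m + 1 := ⟨n - 1, by omega⟩
    rw [Nat.choose_succ_succ' m 1, Nat.choose_one_right]
    omega
  omega

theorem uPoly_dvd_vPoly (ε : ℤ) {τ : Matrix (Fin n) (Fin n) ℕ} (hτ : IsType τ) :
    uPoly ε τ ∣ vPoly n ε :=
  mul_dvd_mul (pow_dvd_pow _ (sub_sepDegree_le hτ))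
    ((prod_pow_dvd_prodPoly ε _ _ _).trans (prodPoly_dvd_of_le ε (sepDegree_le hτ)))

theorem monic_factor (ε : ℤ) (d : ℕ) : ((X : ℤ[X]) ^ (d + 1) - C (ε ^ (d + 1))).Monic :=
  monic_X_pow_sub_C _ (Nat.succ_ne_zero d)

theorem monic_uPoly (ε : ℤ) (τ : Matrix (Fin n) (Fin n) ℕ) : (uPoly ε τ).Monic :=
  (monic_X_pow _).mul (monic_prod_of_monic _ _ fun _ _ => (monic_factor ε _).pow _)

theorem eval_vPoly (n : ℕ) (ε : ℤ) {x : ℤ} (hx : x ≠ 0) :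
    (((vPoly n ε).eval x : ℤ) : ℚ) = vEval n ε x := by
  have hx' : (x : ℚ) ≠ 0 := Int.cast_ne_zero.2 hx
  rw [vPoly]
  induction n with
  | zero => simp [prodPoly, vEval]
  | succ n ih =>
    rw [vEval_succ n ε hx', ← ih, prodPoly_succ, Nat.choose_succ_succ' n 1, Nat.choose_one_right]
    simp
    ring

theorem eval_uPoly (ε : ℤ) {τ : Matrix (Fin n) (Fin n) ℕ} (hτ : IsType τ) {x : ℤ} (hx : x ≠ 0) :
    (((uPoly ε τ).eval x : ℤ) : ℚ) = uEval ε τ x := by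
  have hx' : (x : ℚ) ≠ 0 := Int.cast_ne_zero.2 hx
  have h1 : (x : ℚ) ^ n = x ^ (n - sepDegree τ) * x ^ sepDegree τ := by
    rw [← pow_add, Nat.sub_add_cancel (sepDegree_le hτ)]
  rw [uPoly, uEval, h1, sepDegree, ← Finset.prod_pow_eq_pow_sum, ← Fintype.prod_prod_type', mul_assoc,
    ← Finset.prod_mul_distrib]
  simp only [eval_mul, eval_pow, eval_X, eval_prod, eval_sub, eval_C, Int.cast_mul, Int.cast_pow,
    Int.cast_prod, Int.cast_sub]
  congr 1
  refine Finset.prod_congr rfl fun i _ => ?_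
  rw [pow_mul, ← mul_pow]
  congr 1
  field_simp

theorem exists_degreePoly (ℓ : ℕ) (ε : ℤ) {τ : Matrix (Fin n) (Fin n) ℕ} (hτ : IsType τ) :
    ∃ F : ℤ[X], X ^ (n.choose 2 * (ℓ - 1)) * vPoly n ε = uPoly ε τ * F := by
  obtain ⟨F, hF⟩ := uPoly_dvd_vPoly ε hτ
  exact ⟨X ^ (n.choose 2 * (ℓ - 1)) * F, by rw [hF]; ring⟩

/-- The polynomials whose values are the degrees of regular characters. -/
def formulaPolynomials (n ℓ : ℕ) (ε : ℤ) : Set ℤ[X] :=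
  {F | ∃ τ : Matrix (Fin n) (Fin n) ℕ, IsType τ ∧
    X ^ (n.choose 2 * (ℓ - 1)) * vPoly n ε = uPoly ε τ * F}

theorem mem_degreeFormula_iff {n ℓ : ℕ} {ε : ℤ} (hε : ε = 1 ∨ ε = -1) {q : ℕ} (hq : 1 < q) {r : ℚ} :
    r ∈ degreeFormula n ℓ ε q ↔ ∃ F ∈ formulaPolynomials n ℓ ε, ((F.eval (q : ℤ) : ℤ) : ℚ) = r := by
  have key : ∀ (τ : Matrix (Fin n) (Fin n) ℕ) (F : ℤ[X]), IsType τ →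
      X ^ (n.choose 2 * (ℓ - 1)) * vPoly n ε = uPoly ε τ * F →
      ((F.eval (q : ℤ) : ℤ) : ℚ) = (q : ℚ) ^ (n.choose 2 * (ℓ - 1)) * vEval n ε q / uEval ε τ q := by
    intro τ F hτ hF
    have hq0 : (q : ℤ) ≠ 0 := by positivity
    have h1 := congrArg (fun p => ((p.eval (q : ℤ) : ℤ) : ℚ)) hF
    simp only [eval_mul, Int.cast_mul, eval_vPoly n ε hq0, eval_uPoly ε hτ hq0] at h1
    rw [eq_div_iff (uEval_ne_zero hε hq τ)]
    push_cast at h1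
    rw [mul_comm, ← h1]
    simp
  constructor
  · rintro ⟨τ, hτ, rfl⟩
    obtain ⟨F, hF⟩ := exists_degreePoly ℓ ε hτ
    exact ⟨F, ⟨τ, hτ, hF⟩, key τ F hτ hF⟩
  · rintro ⟨F, ⟨τ, hτ, hF⟩, rfl⟩
    exact ⟨τ, hτ, key τ F hτ hF⟩

theorem finite_formulaPolynomials (n ℓ : ℕ) (ε : ℤ) : (formulaPolynomials n ℓ ε).Finite := by
  have hfin : {τ : Matrix (Fin n) (Fin n) ℕ | IsType τ}.Finite := by
    have h1 : {t : Fin n → Fin n → ℕ | IsType (Matrix.of t)}.Finite := by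
      refine (Set.finite_Icc (0 : Fin n → Fin n → ℕ) fun _ _ => n).subset fun t ht =>
        ⟨fun _ _ => Nat.zero_le _, fun d e => ?_⟩
      have h3 : ∑ d : Fin n, ∑ e : Fin n, ((d : ℕ) + 1) * ((e : ℕ) + 1) * t d e = n := ht
      calc t d e ≤ ((d : ℕ) + 1) * ((e : ℕ) + 1) * t d e :=
            Nat.le_mul_of_pos_left _ (by positivity)
        _ ≤ ∑ e : Fin n, ((d : ℕ) + 1) * ((e : ℕ) + 1) * t d e :=
            Finset.single_le_sum (f := fun e : Fin n => ((d : ℕ) + 1) * ((e : ℕ) + 1) * t d e)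
              (fun _ _ => Nat.zero_le _) (Finset.mem_univ e)
        _ ≤ ∑ d : Fin n, ∑ e : Fin n, ((d : ℕ) + 1) * ((e : ℕ) + 1) * t d e :=
            Finset.single_le_sum (f := fun d : Fin n => ∑ e : Fin n,
              ((d : ℕ) + 1) * ((e : ℕ) + 1) * t d e) (fun _ _ => Nat.zero_le _) (Finset.mem_univ d)
        _ = n := h3
    exact h1.preimage Matrix.of.symm.injective.injOn
  refine (hfin.biUnion (t := fun τ => {F | X ^ (n.choose 2 * (ℓ - 1)) * vPoly n ε = uPoly ε τ * F})
    fun τ _ => Set.Subsingleton.finite fun F hF G hG => ?_).subset ?_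
  · exact (monic_uPoly ε τ).isRegular.left (hF.symm.trans hG)
  · rintro F ⟨τ, hτ, hF⟩
    exact Set.mem_biUnion (show τ ∈ _ from hτ) hF

/-- A polynomial with values among those of finitely many polynomials is one of them. -/
theorem mem_of_infinite_eval {S : Set ℤ[X]} (hS : S.Finite) {f : ℤ[X]} {T : Set ℤ} (hT : T.Infinite)
    (h : ∀ x ∈ T, ∃ F ∈ S, F.eval x = f.eval x) : f ∈ S := by
  choose! F hFS hF using h
  obtain ⟨G, hG, hinf⟩ : ∃ G ∈ S, {x ∈ T | F x = G}.Infinite := by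
    by_contra! hcon
    refine hT ((hS.biUnion fun G hG => hcon G hG).subset fun x hx => ?_)
    exact Set.mem_biUnion (hFS x hx) ⟨hx, rfl⟩
  have : G = f := eq_of_infinite_eval_eq _ _ (hinf.mono fun x hx => by
    have := hF x hx.1
    rwa [hx.2] at this)
  exact this ▸ hG

end Polynomials

section Ennola

theorem ennola_ennola (f : ℤ[X]) : ennola (ennola f) = f := by
  have hd : (ennola f).natDegree = f.natDegree := by
    rw [ennola, natDegree_C_mul (pow_ne_zero _ (by norm_num)), natDegree_comp, natDegree_neg,
      natDegree_X, mul_one]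
  rw [ennola, hd, ennola, mul_comp, C_comp, comp_assoc, neg_comp, X_comp, neg_neg, comp_X,
    ← mul_assoc, ← C_mul, ← mul_pow]
  norm_num

theorem ennola_one : ennola 1 = 1 := by simp [ennola]

theorem ennola_mul (f g : ℤ[X]) : ennola (f * g) = ennola f * ennola g := by
  rcases eq_or_ne f 0 with rfl | hf
  · simp [ennola]
  rcases eq_or_ne g 0 with rfl | hg
  · simp [ennola]
  rw [ennola, ennola, ennola, natDegree_mul hf hg, pow_add, C_mul, mul_comp]
  ring

/-- Ennola duality is multiplicative. -/
noncomputable def ennolaHom : ℤ[X] →* ℤ[X] where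
  toFun := ennola
  map_one' := ennola_one
  map_mul' := ennola_mul

theorem ennola_X_pow (m : ℕ) : ennola (X ^ m) = X ^ m := by
  rw [ennola, natDegree_X_pow, X_pow_comp, neg_pow (X : ℤ[X]), ← mul_assoc, C_pow, C_neg, C_1, ← mul_pow]
  norm_num

theorem ennola_factor (d : ℕ) :
    ennola (X ^ (d + 1) - C (1 ^ (d + 1))) = X ^ (d + 1) - C ((-1) ^ (d + 1)) := by
  rw [ennola, natDegree_X_pow_sub_C, sub_comp, X_pow_comp, C_comp, neg_pow (X : ℤ[X]), mul_sub, ← mul_assoc,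
    C_pow, C_neg, C_1, ← mul_pow]
  simp

theorem ennola_prodPoly (a : ℕ) : ennola (prodPoly 1 a) = prodPoly (-1) a := by
  change ennolaHom _ = _
  rw [prodPoly, map_prod]
  exact Finset.prod_congr rfl fun d _ => ennola_factor d

/-- The substitution `x ↦ -x` exchanges the two signs, up to a sign which makes polynomials monic. -/
theorem ennola_vPoly (n : ℕ) : ennola (vPoly n 1) = vPoly n (-1) := by
  rw [vPoly, ennola_mul, ennola_X_pow, ennola_prodPoly, vPoly]

theorem ennola_uPoly {n : ℕ} (τ : Matrix (Fin n) (Fin n) ℕ) : ennola (uPoly 1 τ) = uPoly (-1) τ := by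
  rw [uPoly, ennola_mul, ennola_X_pow, uPoly]
  congr 1
  change ennolaHom _ = _
  rw [map_prod]
  refine Finset.prod_congr rfl fun i _ => ?_
  rw [map_pow]
  exact congrArg (· ^ _) (ennola_factor _)

theorem mem_formulaPolynomials_iff_ennola {n ℓ : ℕ} {f : ℤ[X]} :
    f ∈ formulaPolynomials n ℓ 1 ↔ ennola f ∈ formulaPolynomials n ℓ (-1) := by
  refine exists_congr fun τ => and_congr_right fun _ => ?_
  have h1 : X ^ (n.choose 2 * (ℓ - 1)) * vPoly n (-1) =
      ennola (X ^ (n.choose 2 * (ℓ - 1)) * vPoly n 1) := by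
    rw [ennola_mul, ennola_X_pow, ennola_vPoly]
  rw [h1, ← ennola_uPoly, ← ennola_mul]
  exact ⟨fun h => by rw [h], fun h => by
    have := congrArg ennola h
    rwa [ennola_ennola, ennola_ennola] at this⟩

end Ennola

/-! ### Unramified extensions of power series rings -/

section PowerSeriesRings

theorem isAdicComplete_powerSeries (k : Type*) [Field k] :
    IsAdicComplete (maximalIdeal (PowerSeries k)) (PowerSeries k) := by
  rw [PowerSeries.maximalIdeal_eq_span_X]
  infer_instance

variable {k K : Type*} [Field k] [Field K] [Algebra k K] {σ : K →+* K} {δ : K} {η : k}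

theorem algebraMap_powerSeries (a : PowerSeries k) :
    algebraMap (PowerSeries k) (PowerSeries K) a = PowerSeries.map (algebraMap k K) a := rfl

/-- A quadratic extension of fields gives an unramified one of power series rings. -/
theorem IsQuadratic.isUnramifiedQuadratic_powerSeries (Q : IsQuadratic σ δ η) :
    IsUnramifiedQuadratic (PowerSeries k) (PowerSeries K) := by
  let F : (PowerSeries k × PowerSeries k) →ₗ[PowerSeries k] PowerSeries K :=
    (LinearMap.toSpanSingleton (PowerSeries k) (PowerSeries K) 1).coprod
      (LinearMap.toSpanSingleton (PowerSeries k) (PowerSeries K) (PowerSeries.C δ))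
  have hF : ∀ p m, PowerSeries.coeff m (F p) = algebraMap k K (PowerSeries.coeff m p.1) +
      algebraMap k K (PowerSeries.coeff m p.2) * δ := by
    intro p m
    have : F p = p.1 • (1 : PowerSeries K) + p.2 • (PowerSeries.C δ : PowerSeries K) := rfl
    rw [this, Algebra.smul_def, Algebra.smul_def, mul_one, map_add, PowerSeries.coeff_mul_C,
      algebraMap_powerSeries, algebraMap_powerSeries, PowerSeries.coeff_map, PowerSeries.coeff_map]
  have hbij : Function.Bijective F := by
    constructor
    · intro p p' h
      have h1 : ∀ m, PowerSeries.coeff m p.1 = PowerSeries.coeff m p'.1 ∧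
          PowerSeries.coeff m p.2 = PowerSeries.coeff m p'.2 := fun m => by
        rw [← Q.ext_iff, ← hF, ← hF, h]
      exact Prod.ext (PowerSeries.ext fun m => (h1 m).1) (PowerSeries.ext fun m => (h1 m).2)
    · intro z
      choose a b hab using fun m => Q.exists_eq (PowerSeries.coeff m z)
      refine ⟨(PowerSeries.mk a, PowerSeries.mk b), PowerSeries.ext fun m => ?_⟩
      rw [hF, hab, PowerSeries.coeff_mk, PowerSeries.coeff_mk]
  let e := LinearEquiv.ofBijective F hbij
  refine ⟨Module.Finite.equiv e, ?_, ?_⟩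
  · rw [← e.finrank_eq, Module.finrank_prod, Module.finrank_self]
  · rw [PowerSeries.maximalIdeal_eq_span_X, PowerSeries.maximalIdeal_eq_span_X, Ideal.map_span,
      Set.image_singleton, algebraMap_powerSeries, PowerSeries.map_X]

/-- The conjugation of a quadratic extension, applied to the coefficients of power series. -/
noncomputable def IsQuadratic.powerSeriesConj (Q : IsQuadratic σ δ η) :
    PowerSeries K ≃ₐ[PowerSeries k] PowerSeries K :=
  { PowerSeries.map σ with
    invFun := PowerSeries.map σ
    left_inv := fun _ => PowerSeries.ext fun _ => Q.involutive _
    right_inv := fun _ => PowerSeries.ext fun _ => Q.involutive _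
    commutes' := fun _ => PowerSeries.ext fun _ => Q.map_algebraMap _ }

theorem IsQuadratic.powerSeriesConj_ne_refl (Q : IsQuadratic σ δ η) (h2 : (2 : k) ≠ 0) :
    Q.powerSeriesConj ≠ AlgEquiv.refl := by
  intro h
  have h1 : PowerSeries.map σ (PowerSeries.C δ) = PowerSeries.C δ :=
    congrArg (fun ν : PowerSeries K ≃ₐ[PowerSeries k] PowerSeries K => ν (PowerSeries.C δ)) h
  have h3 : σ δ = δ := by
    have := congrArg (PowerSeries.coeff 0) h1
    simpa using this
  rw [Q.map_delta] at h3
  have h4 := (Q.eq_zero 0 2 (by rw [map_zero, map_ofNat]; linear_combination -h3)).2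
  exact h2 h4

theorem ringChar_ne_two {R : Type*} [CommRing R] (h : (2 : R) ≠ 0) : ringChar R ≠ 2 := by
  intro h1
  have h3 := ringChar.Nat.cast_ringChar (R := R)
  rw [h1, Nat.cast_ofNat] at h3
  exact h h3

theorem two_ne_zero_zmod (p : ℕ) [Fact p.Prime] (hp : p ≠ 2) : (2 : ULift.{u} (ZMod p)) ≠ 0 := by
  intro h
  have h3 : ((2 : ℕ) : ZMod p) = 0 := congrArg ULift.down h
  rw [ZMod.natCast_eq_zero_iff] at h3
  exact hp ((Nat.prime_dvd_prime_iff_eq Fact.out Nat.prime_two).1 h3)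

/-- The fields with `p` elements in two universes, and a quadratic extension of the first in the
universe of the second. -/
theorem exists_quadratic_zmod (p : ℕ) [Fact p.Prime] (hp : p ≠ 2) :
    ∃ (K : Type v) (_ : Field K) (_ : Algebra (ULift.{u} (ZMod p)) K) (σ : K →+* K) (δ : K)
      (η : ULift.{u} (ZMod p)), IsQuadratic σ δ η := by
  have h2 := ringChar_ne_two (two_ne_zero_zmod.{v} p hp)
  obtain ⟨η, hη⟩ := FiniteField.exists_nonsquare h2
  have : Fact (∀ r : ULift.{v} (ZMod p), r ^ 2 ≠ η + 0 * r) :=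
    ⟨fun r hr => hη ⟨r, by rw [← pow_two, hr, zero_mul, add_zero]⟩⟩
  let φ : ULift.{u} (ZMod p) ≃+* ULift.{v} (ZMod p) := ULift.ringEquiv.trans ULift.ringEquiv.symm
  let f : ULift.{u} (ZMod p) →+* QuadraticAlgebra (ULift.{v} (ZMod p)) η 0 :=
    (algebraMap (ULift.{v} (ZMod p)) _).comp (φ : ULift.{u} (ZMod p) →+* ULift.{v} (ZMod p))
  have hf : ∀ a, f a = ⟨φ a, 0⟩ := fun _ => rfl
  let δ : QuadraticAlgebra (ULift.{v} (ZMod p)) η 0 := ⟨0, 1⟩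
  have hfδ : ∀ a b, f a + f b * δ = ⟨φ a, φ b⟩ := fun a b => by
    rw [hf, hf]
    ext <;> simp [δ]
  let alg : Algebra (ULift.{u} (ZMod p)) (QuadraticAlgebra (ULift.{v} (ZMod p)) η 0) := f.toAlgebra
  refine ⟨QuadraticAlgebra (ULift.{v} (ZMod p)) η 0, inferInstance, alg, starRingEnd _, δ,
    φ.symm η, ?_⟩
  refine @IsQuadratic.mk _ _ _ _ alg _ _ _ (fun a => ?_) ?_ ?_ (fun z => ?_) (fun a b h => ?_)
  · change star (f a) = f a
    rw [hf]
    ext <;> simp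
  · change star δ = -δ
    ext <;> simp [δ]
  · change δ * δ = f (φ.symm η)
    rw [hf]
    ext <;> simp [δ]
  · exact ⟨φ.symm z.re, φ.symm z.im, by
      change z = f _ + f _ * δ
      rw [hfδ]
      ext <;> simp⟩
  · change f a + f b * δ = 0 at h
    rw [hfδ] at h
    exact ⟨φ.injective ((congrArg QuadraticAlgebra.re h).trans (map_zero φ).symm),
      φ.injective ((congrArg QuadraticAlgebra.im h).trans (map_zero φ).symm)⟩

theorem card_residueField_powerSeries (p : ℕ) [Fact p.Prime] :
    Nat.card (ResidueField (PowerSeries (ULift.{u} (ZMod p)))) = p := by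
  rw [Nat.card_congr (PowerSeries.residueFieldOfPowerSeries (k := ULift.{u} (ZMod p))).toEquiv,
    Nat.card_congr Equiv.ulift, Nat.card_zmod]

theorem ringChar_residueField_powerSeries (p : ℕ) [Fact p.Prime] (hp : p ≠ 2) :
    ringChar (ResidueField (PowerSeries (ULift.{u} (ZMod p)))) ≠ 2 := by
  refine ringChar_ne_two fun h => two_ne_zero_zmod.{u} p hp ?_
  rw [← map_ofNat (PowerSeries.residueFieldOfPowerSeries (k := ULift.{u} (ZMod p))), h, map_zero]

end PowerSeriesRings

/-! ### Degree polynomials -/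

section DegreePolynomials

theorem infinite_prime_cast (n : ℕ) :
    {x : ℤ | ∃ p : ℕ, p.Prime ∧ 2 < p ∧ n < p ∧ (p : ℤ) = x}.Infinite := by
  have h1 : {p : ℕ | p.Prime ∧ 2 < p ∧ n < p}.Infinite := by
    refine Set.infinite_of_not_bddAbove fun ⟨b, hb⟩ => ?_
    obtain ⟨p, hp, hprime⟩ := Nat.exists_infinite_primes (b + n + 3)
    have := hb (show p ∈ {p : ℕ | p.Prime ∧ 2 < p ∧ n < p} from ⟨hprime, by omega, by omega⟩)
    omega
  refine (h1.image (Nat.cast_injective (R := ℤ)).injOn).mono ?_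
  rintro _ ⟨p, ⟨h1, h2, h3⟩, rfl⟩
  exact ⟨p, h1, h2, h3, rfl⟩

theorem exists_mem_iff_of_image_eq {D : Set ℕ} {n ℓ q : ℕ} {ε : ℤ} (hε : ε = 1 ∨ ε = -1) (hq : 1 < q)
    (hD : (Nat.cast : ℕ → ℚ) '' D = degreeFormula n ℓ ε q) (r : ℤ) :
    (∃ d ∈ D, (d : ℤ) = r) ↔ ∃ F ∈ formulaPolynomials n ℓ ε, F.eval (q : ℤ) = r := by
  have h1 : (∃ d ∈ D, (d : ℤ) = r) ↔ (r : ℚ) ∈ (Nat.cast : ℕ → ℚ) '' D := by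
    refine exists_congr fun d => and_congr_right fun _ => ?_
    exact ⟨fun h => by rw [← h, Int.cast_natCast], fun h => by exact_mod_cast h⟩
  rw [h1, hD, mem_degreeFormula_iff hε hq]
  simp only [Int.cast_inj]

/-- A degree polynomial agrees with one of finitely many polynomials at infinitely many primes, the
residue cardinalities of power series rings over prime fields. -/
theorem degreePolynomialsGL_eq {n ℓ : ℕ} (hn : 1 ≤ n) (hℓ : 1 ≤ ℓ) :
    degreePolynomialsGL.{u} n ℓ = formulaPolynomials n ℓ 1 := by
  ext f
  constructor
  · intro hf
    refine mem_of_infinite_eval (finite_formulaPolynomials n ℓ 1) (infinite_prime_cast n) ?_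
    rintro _ ⟨p, hp, hp2, hpn, rfl⟩
    have : Fact p.Prime := ⟨hp⟩
    have hcard := card_residueField_powerSeries.{u} p
    have hchar := ringChar_residueField_powerSeries.{u} p (by omega)
    have := isAdicComplete_powerSeries (ULift.{u} (ZMod p))
    have hfin : Finite (ResidueField (PowerSeries (ULift.{u} (ZMod p)))) :=
      Nat.finite_of_card_ne_zero (by omega)
    have h1 := hf (PowerSeries (ULift.{u} (ZMod p))) hchar (by omega)
    have h2 := image_degreesGL hn hℓ (PowerSeries (ULift.{u} (ZMod p))) hchar (by omega)
    rw [hcard] at h1 h2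
    exact (exists_mem_iff_of_image_eq (Or.inl rfl) (by omega) h2 _).1 h1
  · intro hf o _ _ _ _ _ hchar hq
    exact (exists_mem_iff_of_image_eq (Or.inl rfl) (by omega)
      (image_degreesGL hn hℓ o hchar hq) _).2 ⟨f, hf, rfl⟩

theorem degreePolynomialsGU_eq {n ℓ : ℕ} (hn : 1 ≤ n) (hℓ : 1 ≤ ℓ) :
    degreePolynomialsGU.{u, v} n ℓ = formulaPolynomials n ℓ (-1) := by
  ext f
  constructor
  · intro hf
    refine mem_of_infinite_eval (finite_formulaPolynomials n ℓ (-1)) (infinite_prime_cast n) ?_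
    rintro _ ⟨p, hp, hp2, hpn, rfl⟩
    have : Fact p.Prime := ⟨hp⟩
    have hcard := card_residueField_powerSeries.{u} p
    have hchar := ringChar_residueField_powerSeries.{u} p (by omega)
    have := isAdicComplete_powerSeries (ULift.{u} (ZMod p))
    have hfin : Finite (ResidueField (PowerSeries (ULift.{u} (ZMod p)))) :=
      Nat.finite_of_card_ne_zero (by omega)
    obtain ⟨K, _, _, σ, δ, η, Q⟩ := exists_quadratic_zmod.{u, v} p (by omega)
    have h2 := two_ne_zero_zmod.{u} p (by omega)
    have hO := Q.isUnramifiedQuadratic_powerSeries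
    have hν := Q.powerSeriesConj_ne_refl h2
    have h1 := hf (PowerSeries (ULift.{u} (ZMod p))) (PowerSeries K) Q.powerSeriesConj hchar
      (by omega) hO hν
    have h3 := image_degreesGU hn hℓ Q.powerSeriesConj hchar (by omega) hO hν
    rw [hcard] at h1 h3
    exact (exists_mem_iff_of_image_eq (Or.inr rfl) (by omega) h3 _).1 h1
  · intro hf o _ _ _ _ _ O _ _ _ _ ν hchar hq hO hν
    exact (exists_mem_iff_of_image_eq (Or.inr rfl) (by omega)
      (image_degreesGU hn hℓ ν hchar hq hO hν) _).2 ⟨f, hf, rfl⟩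

end DegreePolynomials

end RegChar

theorem theoremB (n ℓ : ℕ) (hn : 1 ≤ n) (hℓ : 1 ≤ ℓ) :
    -- the degrees for `GL_n`
    (∀ (o : Type u) [CommRing o] [IsDomain o] [IsDiscreteValuationRing o]
      [IsAdicComplete (maximalIdeal o) o] [Finite (ResidueField o)],
      ringChar (ResidueField o) ≠ 2 → n < Nat.card (ResidueField o) →
        (Nat.cast : ℕ → ℚ) '' RegChar.degreesGL o n ℓ =
            RegChar.degreeFormula n ℓ 1 (Nat.card (ResidueField o)) ∧
          -- every degree is the value of a degree polynomial
          ∀ d ∈ RegChar.degreesGL o n ℓ, ∃ f ∈ RegChar.degreePolynomialsGL.{u} n ℓ,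
            (d : ℤ) = f.eval (Nat.card (ResidueField o) : ℤ)) ∧
    -- the degrees for `GU_n`
    (∀ (o : Type u) [CommRing o] [IsDomain o] [IsDiscreteValuationRing o]
      [IsAdicComplete (maximalIdeal o) o] [Finite (ResidueField o)]
      (O : Type v) [CommRing O] [IsDomain O] [IsDiscreteValuationRing O] [Algebra o O]
      (ν : O ≃ₐ[o] O),
      ringChar (ResidueField o) ≠ 2 → n < Nat.card (ResidueField o) →
      RegChar.IsUnramifiedQuadratic o O → ν ≠ AlgEquiv.refl →
        (Nat.cast : ℕ → ℚ) '' RegChar.degreesGU ν n ℓ =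
            RegChar.degreeFormula n ℓ (-1) (Nat.card (ResidueField o)) ∧
          -- every degree is the value of a degree polynomial
          ∀ d ∈ RegChar.degreesGU ν n ℓ, ∃ f ∈ RegChar.degreePolynomialsGU.{u, v} n ℓ,
            (d : ℤ) = f.eval (Nat.card (ResidueField o) : ℤ)) ∧
    -- Ennola duality
    (∀ f : ℤ[X], f ∈ RegChar.degreePolynomialsGL.{u} n ℓ ↔
      RegChar.ennola f ∈ RegChar.degreePolynomialsGU.{u, v} n ℓ) := by
  refine ⟨?_, ?_, fun f => ?_⟩
  · intro o _ _ _ _ _ hchar hq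
    have h := RegChar.image_degreesGL hn hℓ o hchar hq
    refine ⟨h, fun d hd => ?_⟩
    obtain ⟨F, hF, hFd⟩ := (RegChar.exists_mem_iff_of_image_eq (Or.inl rfl) (by omega) h d).1
      ⟨d, hd, rfl⟩
    exact ⟨F, RegChar.degreePolynomialsGL_eq hn hℓ ▸ hF, hFd.symm⟩
  · intro o _ _ _ _ _ O _ _ _ _ ν hchar hq hO hν
    have h := RegChar.image_degreesGU hn hℓ ν hchar hq hO hν
    refine ⟨h, fun d hd => ?_⟩
    obtain ⟨F, hF, hFd⟩ := (RegChar.exists_mem_iff_of_image_eq (Or.inr rfl) (by omega) h d).1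
      ⟨d, hd, rfl⟩
    exact ⟨F, RegChar.degreePolynomialsGU_eq hn hℓ ▸ hF, hFd.symm⟩
  · rw [RegChar.degreePolynomialsGL_eq hn hℓ, RegChar.degreePolynomialsGU_eq hn hℓ]
    exact RegChar.mem_formulaPolynomials_iff_ennola
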